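/- Let $p$ be a prime and $n\ge 1$. For a commutative ring $R$ let $W_n(R)$ be the ring of $p$-typical Witt vectors of length $n$, let $\operatorname{Res},F\colon W_{n+1}(R)\to W_n(R)$ be the restriction and the Frobenius, and let $\mathcal W_n(R)\subseteq W_n(R)\times W_n(R)$ be the image of $(\operatorname{Res},F)\colon W_{n+1}(R)\to W_n(R)\times W_n(R)$; the two projections $\mathcal W_n(R)\to W_n(R)$ are again denoted by $\operatorname{Res}$ and $F$. Let $I_{n+1}=V(W_n(R))\subseteq W_{n+1}(R)$, a $\mathcal W_n(R)$-module by $\xi\cdot V\eta=V(F(\xi)\eta)$, and let $\kappa\colon I_{n+1}\to\mathcal W_n(R)$ be induced by $(\operatorname{Res},F)$; the cokernel of $\kappa$ is $R$. A *truncated display of level $n$ over $R$* is a tuple $(P,Q,\iota,\epsilon,F,\dot F)$ of $\mathcal W_n(R)$-modules $P,Q$, $\mathcal W_n(R)$-linear maps $\iota\colon Q\to P$ and $\epsilon\colon I_{n+1}\otimes_{\mathcal W_n(R)}P\to Q$, and $F$-linear maps $F\colon P\to W_n(R)\otimes_{\operatorname{Res},\mathcal W_n(R)}P$ and $\dot F\colon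 Q\to W_n(R)\otimes_{\operatorname{Res},\mathcal W_n(R)}P$ such that: $P$ is finitely generated projective; $\iota\circ\epsilon$ and $\epsilon\circ(\mathrm{id}\otimes\iota)$ are the multiplication maps via $\kappa$; the cokernels of $\iota$ and $\epsilon$ are finitely generated projective $R$-modules; $\dot F(\epsilon(V\eta\otimes x))=\eta F(x)$; $\dot F(Q)$ generates $W_n(R)\otimes_{\mathcal W_n(R)}P$ as a $W_n(R)$-module; and the map $Q/\operatorname{Im}\epsilon\to P/\kappa(I_{n+1})P$ induced by $\iota$ is injective. Homomorphisms are pairs of linear maps on $P$ and $Q$ compatible with $\iota,\epsilon,F,\dot F$. For a ring homomorphism $\varphi\colon R\to S$, the base change $\mathcal P_S$ is the target of the universal homomorphism $\mathcal P\to\mathcal P_S$ over $\varphi$; its first module is $P_S=\mathcal W_n(S)\otimes_{\mathcal W_n(R)}P$. Let $R\to S$ be a faithfully flat homomorphism of commutative rings in which $p$ is nilpotent, and let $p_1,p_2\colon S\to S\otimes_RS$ be $s\mapsto s\otimes 1$ and $s\mapsto 1\otimes s$. A *descent datum* relative to $S/R$ on a truncated display over $S$ (respectively a *$\mathcal W_n$-descent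 datum* on a $\mathcal W_n(S)$-module) is an isomorphism $\nabla$ over $S\otimes_RS$ (respectively over $\mathcal W_n(S\otimes_RS)$) from its base change along $p_1$ to its base change along $p_2$ that satisfies the cocycle condition $\nabla_{13}=\nabla_{23}\circ\nabla_{12}$ over $S\otimes_RS\otimes_RS$ (respectively over $\mathcal W_n(S\otimes_RS\otimes_RS)$). Then: 1. The Čech complex $$0\to\mathcal W_n(R)\to\mathcal W_n(S)\to\mathcal W_n(S\otimes_RS)\to\mathcal W_n(S\otimes_RS\otimes_RS)\to\cdots$$ is exact; its differentials are the alternating sums of the maps induced by inserting $1$ as a tensor factor. 2. Let $P$ be a finitely generated projective $\mathcal W_n(S)$-module with a $\mathcal W_n$-descent datum $\nabla$. For $k\ge0$ let $C^k=\mathcal W_n(S^{\otimes_R(k+1)})\otimes_{\mathcal W_n(S)}P$, the $\mathcal W_n(S)$-module structure of the first factor being via the last factor of $S^{\otimes_R(k+1)}$. Let $d=\sum_{i=0}^{k+1}(-1)^i\partial_i\colon C^k\to C^{k+1}$, where $\partial_i$ for $0\le i\le k$ is induced by inserting $1$ in position $i$, and $\partial_{k+1}$ inserts $1$ in the last position and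 then applies the base change of $\nabla$ to the last two positions. Then the complex $C^0=P\to C^1\to C^2\to\cdots$ is exact at $C^k$ for all $k\ge1$. If $P_0=\{x\in P\mid\nabla(1\otimes x)=1\otimes x\}$ is the kernel of its first arrow, then $P_0$ is a finitely generated projective $\mathcal W_n(R)$-module, and the canonical map $\mathcal W_n(S)\otimes_{\mathcal W_n(R)}P_0\to P$ is bijective. 3. Base change induces an equivalence from the category of truncated displays of level $n$ over $R$ to the category of truncated displays of level $n$ over $S$ endowed with a descent datum relative to $S/R$ (morphisms being the homomorphisms compatible with the descent data). -/

import Mathlib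

/-! ### Truncated Witt vectors -/

universe u v w

namespace TruncDisp

open TensorProduct CategoryTheory

noncomputable section

section Witt

variable (p : ℕ) [Fact p.Prime] (n : ℕ)

/-- The ring `W_n(R)` of truncated `p`-typical Witt vectors. -/
def W (R : Type u) : Type u := TruncatedWittVector p n R

instance (R : Type u) [CommRing R] : CommRing (W p n R) :=
  inferInstanceAs (CommRing (TruncatedWittVector p n R))

variable {R S T : Type u} [CommRing R] [CommRing S] [CommRing T]

/-- The truncation `W(R) → W_n(R)`. -/
def W.trunc (R : Type u) [CommRing R] : WittVector p R →+* W p n R := WittVector.truncate n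

theorem W.exists_trunc (x : W p n R) : ∃ y : WittVector p R, W.trunc p n R y = x :=
  WittVector.truncate_surjective p n R x

theorem W.trunc_eq_iff (x y : WittVector p R) :
    W.trunc p n R x = W.trunc p n R y ↔ ∀ i < n, x.coeff i = y.coeff i := by
  constructor
  · intro h i hi
    have h' := congrArg (TruncatedWittVector.coeff (p := p) (⟨i, hi⟩ : Fin n)) h
    exact ((WittVector.coeff_truncate x ⟨i, hi⟩).symm.trans h').trans
      (WittVector.coeff_truncate y ⟨i, hi⟩)
  · intro h
    refine TruncatedWittVector.ext fun i => ?_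
    exact ((WittVector.coeff_truncate x i).trans (h i i.2)).trans
      (WittVector.coeff_truncate y i).symm

theorem W.trunc_eq_zero (x : WittVector p R) :
    W.trunc p n R x = 0 ↔ ∀ i < n, x.coeff i = 0 :=
  WittVector.mem_ker_truncate n x

/-- A lift of a truncated Witt vector to `W(R)`. -/
def W.out (x : W p n R) : WittVector p R := TruncatedWittVector.out x

@[simp] theorem W.trunc_out (x : W p n R) : W.trunc p n R (W.out p n x) = x :=
  TruncatedWittVector.truncateFun_out x

/-- A ring homomorphism out of `W_n(R)` from one out of `W(R)`. -/
def W.lift (f : WittVector p R →+* S) (hf : ∀ x, W.trunc p n R x = 0 → f x = 0) :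
    W p n R →+* S :=
  RingHom.liftOfRightInverse (W.trunc p n R) (W.out p n) (W.trunc_out p n) ⟨f, hf⟩

theorem W.lift_trunc (f : WittVector p R →+* S) (hf : ∀ x, W.trunc p n R x = 0 → f x = 0)
    (x : WittVector p R) : W.lift p n f hf (W.trunc p n R x) = f x :=
  RingHom.liftOfRightInverse_comp_apply _ _ _ _ _

/-- The functoriality of `W_n`. -/
def W.map (φ : R →+* S) : W p n R →+* W p n S :=
  W.lift p n ((W.trunc p n _).comp (WittVector.map φ)) fun x hx => by
    rw [W.trunc_eq_zero] at hx
    rw [RingHom.comp_apply, W.trunc_eq_zero]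
    intro i hi
    rw [WittVector.map_coeff, hx i hi, map_zero]

@[simp] theorem W.map_trunc (φ : R →+* S) (x : WittVector p R) :
    W.map p n φ (W.trunc p n R x) = W.trunc p n S (WittVector.map φ x) :=
  W.lift_trunc ..

/-- The Frobenius `F : W_{n+1}(R) → W_n(R)`. -/
def W.frob (R : Type u) [CommRing R] : W p (n + 1) R →+* W p n R :=
  W.lift p (n + 1) ((W.trunc p n _).comp WittVector.frobenius) fun x hx => by
    rw [W.trunc_eq_zero] at hx
    rw [RingHom.comp_apply, WittVector.eq_iterate_verschiebung hx, Function.iterate_succ_apply',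
      WittVector.frobenius_verschiebung, map_mul,
      (W.trunc_eq_zero p n _).2 fun i hi => WittVector.iterate_verschiebung_coeff_eq_zero _ hi,
      zero_mul]

@[simp] theorem W.frob_trunc (x : WittVector p R) :
    W.frob p n R (W.trunc p (n + 1) R x) =
      W.trunc p n R (WittVector.frobenius x) :=
  W.lift_trunc ..

/-- The restriction `Res : W_{n+1}(R) → W_n(R)`. -/
def W.res (R : Type u) [CommRing R] : W p (n + 1) R →+* W p n R :=
  W.lift p (n + 1) (W.trunc p n R) fun x hx =>
    (W.trunc_eq_zero p n x).2 fun i hi => (W.trunc_eq_zero p (n + 1) x).1 hx i (by omega)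

@[simp] theorem W.res_trunc (x : WittVector p R) :
    W.res p n R (W.trunc p (n + 1) R x) = W.trunc p n R x :=
  W.lift_trunc ..

theorem W.trunc_verschiebung_congr {x y : WittVector p R}
    (h : W.trunc p n R x = W.trunc p n R y) :
    W.trunc p (n + 1) R (WittVector.verschiebung x) =
      W.trunc p (n + 1) R (WittVector.verschiebung y) := by
  rw [W.trunc_eq_iff] at h ⊢
  intro i hi
  cases i with
  | zero => simp
  | succ i => simpa using h i (by omega)

/-- The Verschiebung `V : W_n(R) → W_{n+1}(R)`. -/
def W.ver (R : Type u) [CommRing R] : W p n R →+ W p (n + 1) R where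
  toFun x := W.trunc p (n + 1) R (WittVector.verschiebung (W.out p n x))
  map_zero' := by
    rw [W.trunc_verschiebung_congr p n (y := 0) (by rw [W.trunc_out, map_zero])]
    simp
  map_add' x y := by
    rw [← map_add, ← map_add]
    exact W.trunc_verschiebung_congr p n
      (by rw [map_add, W.trunc_out, W.trunc_out, W.trunc_out])

@[simp] theorem W.ver_trunc (x : WittVector p R) :
    W.ver p n R (W.trunc p n R x) =
      W.trunc p (n + 1) R (WittVector.verschiebung x) :=
  W.trunc_verschiebung_congr p n (W.trunc_out p n _)

theorem W.ver_injective : Function.Injective (W.ver p n R) := by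
  intro x y h
  obtain ⟨x, rfl⟩ := W.exists_trunc p n x
  obtain ⟨y, rfl⟩ := W.exists_trunc p n y
  rw [W.ver_trunc, W.ver_trunc, W.trunc_eq_iff] at h
  rw [W.trunc_eq_iff]
  intro i hi
  simpa using h (i + 1) (by omega)

theorem W.mul_ver (x : W p (n + 1) R) (y : W p n R) :
    x * W.ver p n R y = W.ver p n R (W.frob p n R x * y) := by
  obtain ⟨x, rfl⟩ := W.exists_trunc p _ x
  obtain ⟨y, rfl⟩ := W.exists_trunc p n y
  rw [W.ver_trunc, W.frob_trunc, ← map_mul, ← map_mul, W.ver_trunc, mul_comm x,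
    mul_comm _ y, WittVector.verschiebung_mul_frobenius]

theorem W.frob_ver (y : W p n R) : W.frob p n R (W.ver p n R y) = p * y := by
  obtain ⟨y, rfl⟩ := W.exists_trunc p n y
  rw [W.ver_trunc, W.frob_trunc, WittVector.frobenius_verschiebung, map_mul, mul_comm,
    map_natCast]

theorem W.map_ver (φ : R →+* S) (y : W p n R) :
    W.map p (n + 1) φ (W.ver p n R y) = W.ver p n S (W.map p n φ y) := by
  obtain ⟨y, rfl⟩ := W.exists_trunc p n y
  simp [WittVector.map_verschiebung]

theorem W.map_frob (φ : R →+* S) (x : W p (n + 1) R) :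
    W.map p n φ (W.frob p n R x) = W.frob p n S (W.map p (n + 1) φ x) := by
  obtain ⟨x, rfl⟩ := W.exists_trunc p _ x
  simp only [W.frob_trunc, W.map_trunc]
  congr 1
  exact (WittVector.frobenius_isPoly p).map φ x

theorem W.map_res (φ : R →+* S) (x : W p (n + 1) R) :
    W.map p n φ (W.res p n R x) = W.res p n S (W.map p (n + 1) φ x) := by
  obtain ⟨x, rfl⟩ := W.exists_trunc p _ x
  simp

theorem W.map_id (x : W p n R) : W.map p n (RingHom.id R) x = x := by
  obtain ⟨x, rfl⟩ := W.exists_trunc p _ x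
  rw [W.map_trunc]
  congr 1

theorem W.map_comp (φ : R →+* S) (ψ : S →+* T) (x : W p n R) :
    W.map p n (ψ.comp φ) x = W.map p n ψ (W.map p n φ x) := by
  obtain ⟨x, rfl⟩ := W.exists_trunc p _ x
  simp only [W.map_trunc]
  congr 1

/-- The zeroth Witt component `w_0 : W_n(R) → R`, for `n ≥ 1`. -/
def W.w0 [NeZero n] (R : Type u) [CommRing R] : W p n R →+* R :=
  W.lift p n WittVector.constantCoeff fun x hx =>
    (W.trunc_eq_zero p n x).1 hx 0 (Nat.pos_of_neZero n)

@[simp] theorem W.w0_trunc [NeZero n] (x : WittVector p R) :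
    W.w0 p n R (W.trunc p n R x) = x.coeff 0 :=
  W.lift_trunc ..

/-! ### The ring `𝒲_n(R)` and the module `I_{n+1}` -/

/-- The ring `𝒲_n(R)`: the image of `(Res, F) : W_{n+1}(R) → W_n(R) × W_n(R)`. -/
def CalW (R : Type u) [CommRing R] : Type u :=
  ((W.res p n R).prod (W.frob p n R)).range

instance (R : Type u) [CommRing R] : CommRing (CalW p n R) :=
  inferInstanceAs (CommRing ((W.res p n R).prod (W.frob p n R)).range)

namespace CalW

/-- The surjection `W_{n+1}(R) → 𝒲_n(R)`. -/
def mk (R : Type u) [CommRing R] : W p (n + 1) R →+* CalW p n R :=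
  ((W.res p n R).prod (W.frob p n R)).rangeRestrict

theorem mk_surjective : Function.Surjective (mk p n R) :=
  RingHom.rangeRestrict_surjective _

/-- The projection `Res : 𝒲_n(R) → W_n(R)`. -/
def res (R : Type u) [CommRing R] : CalW p n R →+* W p n R :=
  (RingHom.fst _ _).comp ((W.res p n R).prod (W.frob p n R)).range.subtype

/-- The projection `F : 𝒲_n(R) → W_n(R)`. -/
def frob (R : Type u) [CommRing R] : CalW p n R →+* W p n R :=
  (RingHom.snd _ _).comp ((W.res p n R).prod (W.frob p n R)).range.subtype

@[simp] theorem res_mk (x : W p (n + 1) R) : res p n R (mk p n R x) = W.res p n R x := rfl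

@[simp] theorem frob_mk (x : W p (n + 1) R) : frob p n R (mk p n R x) = W.frob p n R x := rfl

variable {p n} in
theorem ext {x y : CalW p n R} (h₁ : res p n R x = res p n R y)
    (h₂ : frob p n R x = frob p n R y) : x = y :=
  Subtype.ext (Prod.ext h₁ h₂)

/-- The functoriality of `𝒲_n`. -/
def map (φ : R →+* S) : CalW p n R →+* CalW p n S :=
  (((W.map p n φ).prodMap (W.map p n φ)).comp
      ((W.res p n R).prod (W.frob p n R)).range.subtype).codRestrict
    ((W.res p n S).prod (W.frob p n S)).range (by
      rintro ⟨_, x, rfl⟩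
      exact ⟨W.map p (n + 1) φ x, Prod.ext (W.map_res p n φ x).symm (W.map_frob p n φ x).symm⟩)

@[simp] theorem res_map (φ : R →+* S) (x : CalW p n R) :
    res p n S (map p n φ x) = W.map p n φ (res p n R x) := rfl

@[simp] theorem frob_map (φ : R →+* S) (x : CalW p n R) :
    frob p n S (map p n φ x) = W.map p n φ (frob p n R x) := rfl

theorem frob_map' (φ : R →+* S) (x : CalW p n R) :
    (W.map p n φ).comp (frob p n R) x = frob p n S (map p n φ x) := rfl

theorem map_mk (φ : R →+* S) (x : W p (n + 1) R) :
    map p n φ (mk p n R x) = mk p n S (W.map p (n + 1) φ x) :=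
  ext (by simp [W.map_res]) (by simp [W.map_frob])

theorem map_id (x : CalW p n R) : map p n (RingHom.id R) x = x :=
  ext (by simp [W.map_id]) (by simp [W.map_id])

theorem map_comp (φ : R →+* S) (ψ : S →+* T) (x : CalW p n R) :
    map p n (ψ.comp φ) x = map p n ψ (map p n φ x) :=
  ext (by simp [W.map_comp]) (by simp [W.map_comp])

/-- The composition of `Res` and `w_0 : W_n(R) → R`; through it, `R` is the cokernel of
`κ : I_{n+1} → 𝒲_n(R)`. -/
def w0 [NeZero n] (R : Type u) [CommRing R] : CalW p n R →+* R :=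
  (W.w0 p n R).comp (res p n R)

theorem w0_map [NeZero n] (φ : R →+* S) (x : CalW p n R) :
    w0 p n S (map p n φ x) = φ (w0 p n R x) := by
  change W.w0 p n S (W.map p n φ (res p n R x)) = φ (W.w0 p n R (res p n R x))
  obtain ⟨y, hy⟩ := W.exists_trunc p n (res p n R x)
  rw [← hy]
  simp

theorem w0_surjective [NeZero n] : Function.Surjective (w0 p n R) := by
  intro r
  refine ⟨mk p n R (W.trunc p (n + 1) R (WittVector.teichmuller p r)), ?_⟩
  simp [w0]

end CalW

/-- The `𝒲_n(R)`-module `I_{n+1} = V(W_n(R)) ⊆ W_{n+1}(R)`, with `ξ • V(η) = V(F(ξ) η)`.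
As `V` is injective, an element is represented by `η ∈ W_n(R)`, standing for `V(η)`; so the
identity `I_{n+1} → W_n(R)` on representatives is `V⁻¹`. -/
def VIdeal (R : Type u) [CommRing R] : Type u := W p n R

instance (R : Type u) [CommRing R] : AddCommGroup (VIdeal p n R) :=
  inferInstanceAs (AddCommGroup (W p n R))

instance (R : Type u) [CommRing R] : Module (CalW p n R) (VIdeal p n R) :=
  Module.compHom (W p n R) (CalW.frob p n R)

namespace VIdeal

/-- The map `V⁻¹ : I_{n+1} → W_n(R)`. -/
def verInv (R : Type u) [CommRing R] : VIdeal p n R ≃+ W p n R := AddEquiv.refl _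

/-- The inclusion `I_{n+1} ⊆ W_{n+1}(R)`. -/
def incl (R : Type u) [CommRing R] : VIdeal p n R →+ W p (n + 1) R :=
  (W.ver p n R).comp (verInv p n R).toAddMonoidHom

theorem incl_apply (a : VIdeal p n R) : incl p n R a = W.ver p n R (verInv p n R a) := rfl

theorem incl_injective : Function.Injective (incl p n R) :=
  (W.ver_injective p n).comp (verInv p n R).injective

@[simp] theorem verInv_smul (x : CalW p n R) (a : VIdeal p n R) :
    verInv p n R (x • a) = CalW.frob p n R x * verInv p n R a := rfl

theorem incl_smul (x : W p (n + 1) R) (a : VIdeal p n R) :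
    incl p n R (CalW.mk p n R x • a) = x * incl p n R a := by
  rw [incl_apply, incl_apply, W.mul_ver, verInv_smul, CalW.frob_mk]

/-- The map `κ : I_{n+1} → 𝒲_n(R)` induced by `(Res, F)`. -/
def kappa (R : Type u) [CommRing R] : VIdeal p n R →ₗ[CalW p n R] CalW p n R where
  toFun a := CalW.mk p n R (incl p n R a)
  map_add' a b := by simp
  map_smul' x a := by
    obtain ⟨x, rfl⟩ := CalW.mk_surjective p n x
    rw [incl_smul, map_mul]
    rfl

theorem kappa_apply (a : VIdeal p n R) : kappa p n R a = CalW.mk p n R (incl p n R a) := rfl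

@[simp] theorem frob_kappa (a : VIdeal p n R) :
    CalW.frob p n R (kappa p n R a) = p * verInv p n R a := by
  rw [kappa_apply, CalW.frob_mk, incl_apply, W.frob_ver]

/-- The ideal `κ(I_{n+1})` of `𝒲_n(R)`. -/
def kappaIdeal (R : Type u) [CommRing R] : Ideal (CalW p n R) :=
  LinearMap.range (kappa p n R)

theorem kappa_smul_comm (a b : VIdeal p n R) : kappa p n R a • b = kappa p n R b • a := by
  apply (verInv p n R).injective
  simp only [verInv_smul, frob_kappa]
  ring

/-- The functoriality of `I_{n+1}`. -/
def map (φ : R →+* S) : VIdeal p n R →ₛₗ[CalW.map p n φ] VIdeal p n S where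
  toFun a := (verInv p n S).symm (W.map p n φ (verInv p n R a))
  map_add' a b := by simp
  map_smul' x a := by
    apply (verInv p n S).injective
    simp

@[simp] theorem verInv_map (φ : R →+* S) (a : VIdeal p n R) :
    verInv p n S (map p n φ a) = W.map p n φ (verInv p n R a) := rfl

theorem kappa_map (φ : R →+* S) (a : VIdeal p n R) :
    kappa p n S (map p n φ a) = CalW.map p n φ (kappa p n R a) := by
  rw [kappa_apply, kappa_apply, CalW.map_mk, incl_apply, incl_apply, W.map_ver, verInv_map]

theorem map_id (a : VIdeal p n R) : map p n (RingHom.id R) a = a :=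
  (verInv p n R).injective (by simp [W.map_id])

theorem map_comp (φ : R →+* S) (ψ : S →+* T) (a : VIdeal p n R) :
    map p n (ψ.comp φ) a = map p n ψ (map p n φ a) :=
  (verInv p n T).injective (by simp [W.map_comp])

theorem w0_eq_zero_iff [NeZero n] (x : CalW p n R) :
    CalW.w0 p n R x = 0 ↔ ∃ a, kappa p n R a = x := by
  constructor
  · intro h
    obtain ⟨x, rfl⟩ := CalW.mk_surjective p n x
    obtain ⟨x, rfl⟩ := W.exists_trunc p _ x
    have h0 : x.coeff 0 = 0 := by simpa [CalW.w0] using h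
    refine ⟨(verInv p n R).symm (W.trunc p n R (x.shift 1)), ?_⟩
    rw [kappa_apply, incl_apply, AddEquiv.apply_symm_apply, W.ver_trunc]
    congr 2
    ext i
    cases i with
    | zero => simp [h0]
    | succ i => simp [WittVector.shift_coeff, add_comm]
  · rintro ⟨a, rfl⟩
    obtain ⟨y, hy⟩ := W.exists_trunc p n (verInv p n R a)
    rw [kappa_apply, incl_apply, ← hy, W.ver_trunc]
    simp [CalW.w0]

end VIdeal

end Witt

/-! ### Extension of scalars along a ring homomorphism -/

section BC

variable {A : Type*} {B : Type*} {C : Type*} [CommRing A] [CommRing B] [CommRing C]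

/-- The composition of semilinear maps, as a map linear over a given `γ = τ ∘ σ`. -/
def semiComp {σ : A →+* B} {τ : B →+* C} {γ : A →+* C} {M N K : Type*} [AddCommGroup M]
    [Module A M] [AddCommGroup N] [Module B N] [AddCommGroup K] [Module C K] (g : N →ₛₗ[τ] K)
    (f : M →ₛₗ[σ] N) (h : ∀ a, γ a = τ (σ a)) : M →ₛₗ[γ] K where
  toFun x := g (f x)
  map_add' x y := by simp
  map_smul' a x := by rw [LinearMap.map_smulₛₗ, LinearMap.map_smulₛₗ, h]

@[simp] theorem semiComp_apply {σ : A →+* B} {τ : B →+* C} {γ : A →+* C} {M N K : Type*}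
    [AddCommGroup M] [Module A M] [AddCommGroup N] [Module B N] [AddCommGroup K] [Module C K]
    (g : N →ₛₗ[τ] K) (f : M →ₛₗ[σ] N) (h : ∀ a, γ a = τ (σ a)) (x : M) :
    semiComp g f h x = g (f x) := rfl

/-- The module `B ⊗_{σ, A} M` for a ring homomorphism `σ : A → B`. -/
def BC (σ : A →+* B) (M : Type*) [AddCommGroup M] [Module A M] : Type _ :=
  letI := σ.toAlgebra
  B ⊗[A] M

namespace BC

variable (σ : A →+* B) (M : Type*) [AddCommGroup M] [Module A M]

instance : AddCommGroup (BC σ M) :=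
  letI := σ.toAlgebra
  (TensorProduct.addCommGroup : AddCommGroup (B ⊗[A] M))

instance : Module B (BC σ M) :=
  letI := σ.toAlgebra
  (TensorProduct.leftModule : Module B (B ⊗[A] M))

instance [Module.Finite A M] : Module.Finite B (BC σ M) := by
  let := σ.toAlgebra
  exact (inferInstance : Module.Finite B (B ⊗[A] M))

instance [Module.Projective A M] : Module.Projective B (BC σ M) := by
  let := σ.toAlgebra
  exact (inferInstance : Module.Projective B (B ⊗[A] M))

variable {M}

/-- The map `x ↦ 1 ⊗ x`. -/
def of : M →ₛₗ[σ] BC σ M where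
  toFun x :=
    letI := σ.toAlgebra
    (1 : B) ⊗ₜ[A] x
  map_add' x y :=
    letI := σ.toAlgebra
    TensorProduct.tmul_add (1 : B) x y
  map_smul' a x := by
    let := σ.toAlgebra
    change (1 : B) ⊗ₜ[A] (a • x) = (σ a * 1) ⊗ₜ[A] x
    rw [← TensorProduct.smul_tmul]
    rfl

theorem span_of : Submodule.span B (Set.range (of σ : M → BC σ M)) = ⊤ := by
  let := σ.toAlgebra
  rw [eq_top_iff]
  rintro x -
  change B ⊗[A] M at x
  induction x using TensorProduct.induction_on with
  | zero => exact Submodule.zero_mem _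
  | tmul b m =>
    have : (b ⊗ₜ[A] m : B ⊗[A] M) = b • (of σ m : BC σ M) := by
      change _ = (b * 1) ⊗ₜ[A] m
      rw [mul_one]
    rw [this]
    exact Submodule.smul_mem _ _ (Submodule.subset_span ⟨m, rfl⟩)
  | add x y hx hy => exact Submodule.add_mem _ hx hy

@[elab_as_elim]
theorem induction {motive : BC σ M → Prop} (x : BC σ M) (zero : motive 0)
    (of : ∀ m, motive (of σ m)) (add : ∀ x y, motive x → motive y → motive (x + y))
    (smul : ∀ (b : B) x, motive x → motive (b • x)) : motive x := by
  have hx : x ∈ Submodule.span B (Set.range (BC.of σ : M → BC σ M)) := by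
    rw [span_of]; trivial
  induction hx using Submodule.span_induction with
  | mem x h => obtain ⟨m, rfl⟩ := h; exact of m
  | zero => exact zero
  | add x y _ _ hx hy => exact add x y hx hy
  | smul b x _ hx => exact smul b x hx

variable {σ} {N : Type*} [AddCommGroup N] [Module C N]

/-- The universal property of `B ⊗_{σ, A} M`: a map `f : M → N` that is linear over
`γ = β ∘ σ` extends uniquely to a map `B ⊗_{σ, A} M → N` that is linear over `β : B → C`. -/
def lift (β : B →+* C) {γ : A →+* C} (hγ : ∀ a, γ a = β (σ a)) (f : M →ₛₗ[γ] N) :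
    BC σ M →ₛₗ[β] N :=
  letI := σ.toAlgebra
  let g : B ⊗[A] M →+ N := TensorProduct.liftAddHom
    { toFun b :=
        { toFun x := β b • f x
          map_zero' := by simp
          map_add' x y := by simp }
      map_zero' := by ext; simp
      map_add' b c := by ext; simp [add_smul] } (by
        intro a b x
        change β (σ a * b) • f x = β b • f (a • x)
        rw [LinearMap.map_smulₛₗ, hγ, map_mul, mul_comm, mul_smul])
  { toFun := g
    map_add' := g.map_add
    map_smul' := by
      intro b x
      induction x using TensorProduct.induction_on with
      | zero => exact (map_zero g).trans (by rw [map_zero, smul_zero])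
      | tmul c m =>
        change β (b * c) • f m = β b • (β c • f m)
        rw [map_mul, mul_smul]
      | add x y hx hy =>
        rw [map_add, smul_add, ← hx, ← hy]
        exact (congrArg g (smul_add b (x : BC σ M) y)).trans (map_add g _ _) }

@[simp] theorem lift_of (β : B →+* C) {γ : A →+* C} (hγ : ∀ a, γ a = β (σ a)) (f : M →ₛₗ[γ] N)
    (x : M) : lift β hγ f (of σ x) = f x := by
  change β 1 • f x = f x
  rw [map_one, one_smul]

/-- Two semilinear maps on `B ⊗_{σ, A} M` agree if they agree on all `1 ⊗ x`. -/
theorem ext_of {β : B →+* C} {f g : BC σ M →ₛₗ[β] N} (h : ∀ x, f (of σ x) = g (of σ x)) :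
    f = g := by
  ext x
  induction x using induction with
  | zero => rw [map_zero, map_zero]
  | of m => exact h m
  | add x y hx hy => rw [map_add, map_add, hx, hy]
  | smul b x hx => rw [LinearMap.map_smulₛₗ, LinearMap.map_smulₛₗ, hx]

variable {D : Type*} [CommRing D] {M' : Type*} [AddCommGroup M'] [Module C M']

/-- For a commutative square `β ∘ σ = τ ∘ α` of rings, the map
`B ⊗_{σ, A} M → D ⊗_{τ, C} M'` induced by `β` and an `α`-linear map `M → M'`. -/
def map (β : B →+* D) {τ : C →+* D} {α : A →+* C} (h : ∀ a, τ (α a) = β (σ a))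
    (f : M →ₛₗ[α] M') : BC σ M →ₛₗ[β] BC τ M' :=
  lift β (γ := τ.comp α) h (semiComp (of τ) f fun _ => rfl)

@[simp] theorem map_of (β : B →+* D) {τ : C →+* D} {α : A →+* C}
    (h : ∀ a, τ (α a) = β (σ a)) (f : M →ₛₗ[α] M') (x : M) :
    map β h f (of σ x) = of τ (f x) := by
  rw [map, lift_of, semiComp_apply]

/-- The canonical map `B ⊗_{σ, A} M → C ⊗_{γ, A} M` over `β : B → C`, where `β ∘ σ = γ`. -/
def trans (β : B →+* C) {γ : A →+* C} (h : ∀ a, γ a = β (σ a)) : BC σ M →ₛₗ[β] BC γ M :=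
  lift β h (of γ)

@[simp] theorem trans_of (β : B →+* C) {γ : A →+* C} (h : ∀ a, γ a = β (σ a)) (x : M) :
    trans β h (of σ x) = of γ x :=
  lift_of ..

/-- If `σ` is surjective and its kernel annihilates `M`, then `M → B ⊗_{σ, A} M` is
injective. -/
theorem of_injective (hσ : Function.Surjective σ) (h : ∀ a, σ a = 0 → ∀ x : M, a • x = 0) :
    Function.Injective (of σ : M → BC σ M) := by
  let := σ.toAlgebra
  have key : ∀ a a' : A, σ a = σ a' → ∀ x : M, a • x = a' • x := fun a a' haa x => by
    rw [← sub_eq_zero, ← sub_smul]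
    exact h _ (by rw [map_sub, haa, sub_self]) x
  have hs := Function.surjInv_eq hσ
  let g : B ⊗[A] M →+ M := TensorProduct.liftAddHom
    { toFun b :=
        { toFun x := Function.surjInv hσ b • x
          map_zero' := by simp
          map_add' x y := by simp }
      map_zero' := by
        ext x
        exact h _ (hs 0) x
      map_add' b c := by
        ext x
        change Function.surjInv hσ (b + c) • x =
          Function.surjInv hσ b • x + Function.surjInv hσ c • x
        rw [← add_smul]
        exact key _ _ (by rw [map_add, hs, hs, hs]) x } (by
        intro a b x
        change Function.surjInv hσ (σ a * b) • x = Function.surjInv hσ b • a • x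
        rw [← mul_smul]
        refine key _ _ ?_ x
        rw [map_mul, hs, hs, mul_comm])
  have hg : ∀ x : M, g (of σ x) = x := fun x => by
    change Function.surjInv hσ 1 • x = x
    rw [key _ 1 (by rw [hs, map_one]), one_smul]
  intro x y hxy
  rw [← hg x, ← hg y, hxy]

theorem of_surjective (hσ : Function.Surjective σ) :
    Function.Surjective (of σ : M → BC σ M) := by
  intro z
  induction z using induction with
  | zero => exact ⟨0, map_zero _⟩
  | of m => exact ⟨m, rfl⟩
  | add x y hx hy =>
    obtain ⟨x, rfl⟩ := hx
    obtain ⟨y, rfl⟩ := hy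
    exact ⟨x + y, map_add _ _ _⟩
  | smul b x hx =>
    obtain ⟨x, rfl⟩ := hx
    obtain ⟨a, rfl⟩ := hσ b
    exact ⟨a • x, LinearMap.map_smulₛₗ _ _ _⟩

end BC

end BC

/-! ### Truncated displays -/

section Display

variable (p : ℕ) [Fact p.Prime] (n : ℕ)

/-- The data `(P, Q, ι, ε, F, Ḟ)` of a truncated display of level `n` over `R`, subject to the
compatibilities between the maps: `ι ∘ ε` and `ε ∘ (id ⊗ ι)` are the multiplication maps via
`κ`, and `Ḟ ∘ ε` is the map `V(η) ⊗ x ↦ η F(x)`. The conditions on the modules are in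
`Predisplay.IsTruncatedDisplay`. Here `BC (CalW.res p n R) P` is `W_n(R) ⊗_{𝒲_n(R)} P`, the
tensor product being taken with respect to `Res`. -/
structure Predisplay (R : Type u) [CommRing R] where
  /-- The module `P`. -/
  P : Type u
  /-- The module `Q`. -/
  Q : Type u
  [addCommGroupP : AddCommGroup P]
  [addCommGroupQ : AddCommGroup Q]
  [moduleP : Module (CalW p n R) P]
  [moduleQ : Module (CalW p n R) Q]
  /-- The map `ι : Q → P`. -/
  iota : Q →ₗ[CalW p n R] P
  /-- The map `ε : I_{n+1} ⊗ P → Q`. -/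
  eps : VIdeal p n R ⊗[CalW p n R] P →ₗ[CalW p n R] Q
  /-- The `F`-linear map `F : P → W_n(R) ⊗ P`. -/
  F : P →ₛₗ[CalW.frob p n R] BC (CalW.res p n R) P
  /-- The `F`-linear map `Ḟ : Q → W_n(R) ⊗ P`. -/
  Fdot : Q →ₛₗ[CalW.frob p n R] BC (CalW.res p n R) P
  iota_eps : ∀ (a : VIdeal p n R) (x : P), iota (eps (a ⊗ₜ x)) = VIdeal.kappa p n R a • x
  eps_iota : ∀ (a : VIdeal p n R) (y : Q), eps (a ⊗ₜ iota y) = VIdeal.kappa p n R a • y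
  Fdot_eps : ∀ (a : VIdeal p n R) (x : P), Fdot (eps (a ⊗ₜ x)) = VIdeal.verInv p n R a • F x

attribute [instance] Predisplay.addCommGroupP Predisplay.addCommGroupQ Predisplay.moduleP
  Predisplay.moduleQ

variable {p n}
variable {R S T U : Type u} [CommRing R] [CommRing S] [CommRing T] [CommRing U]

/-- The conditions on the modules in the definition of a truncated display of level `n`: `P` and
the cokernels of `ι` and `ε` are finitely generated projective, `Ḟ(Q)` generates `W_n(R) ⊗ P`,
and `Q / Im ε → P / κ(I_{n+1}) P` is injective. The cokernels of `ι` and `ε` are annihilated by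
the kernel of the surjection `w_0 : 𝒲_n(R) → R`; as `R`-modules they are their extension of
scalars along `w_0`. -/
structure Predisplay.IsTruncatedDisplay [NeZero n] (D : Predisplay p n R) : Prop where
  finite : Module.Finite (CalW p n R) D.P
  projective : Module.Projective (CalW p n R) D.P
  finite_coker_iota : Module.Finite R (BC (CalW.w0 p n R) (D.P ⧸ LinearMap.range D.iota))
  projective_coker_iota :
    Module.Projective R (BC (CalW.w0 p n R) (D.P ⧸ LinearMap.range D.iota))
  finite_coker_eps : Module.Finite R (BC (CalW.w0 p n R) (D.Q ⧸ LinearMap.range D.eps))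
  projective_coker_eps :
    Module.Projective R (BC (CalW.w0 p n R) (D.Q ⧸ LinearMap.range D.eps))
  span_Fdot : Submodule.span (W p n R) (Set.range D.Fdot) = ⊤
  /-- The map `Q / Im ε → P / κ(I_{n+1}) P` induced by `ι` is injective. -/
  mem_range_eps : ∀ y : D.Q,
    D.iota y ∈ VIdeal.kappaIdeal p n R • (⊤ : Submodule (CalW p n R) D.P) →
      y ∈ LinearMap.range D.eps

/-- The map `W_n(R) ⊗ M → W_n(S) ⊗ N` induced by `φ : R → S` and a map `M → N` over
`𝒲_n(φ)`. -/
def wMap (φ : R →+* S) {M N : Type*} [AddCommGroup M] [Module (CalW p n R) M] [AddCommGroup N]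
    [Module (CalW p n S) N] (f : M →ₛₗ[CalW.map p n φ] N) :
    BC (CalW.res p n R) M →ₛₗ[W.map p n φ] BC (CalW.res p n S) N :=
  BC.map (W.map p n φ) (CalW.res_map p n φ) f

@[simp] theorem wMap_of (φ : R →+* S) {M N : Type*} [AddCommGroup M] [Module (CalW p n R) M]
    [AddCommGroup N] [Module (CalW p n S) N] (f : M →ₛₗ[CalW.map p n φ] N) (x : M) :
    wMap φ f (BC.of _ x) = BC.of _ (f x) :=
  BC.map_of ..

theorem wMap_comp {φ : R →+* S} {ψ : S →+* T} {χ : R →+* T} (hχ : ψ.comp φ = χ)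
    {M N K : Type*} [AddCommGroup M] [Module (CalW p n R) M] [AddCommGroup N]
    [Module (CalW p n S) N] [AddCommGroup K] [Module (CalW p n T) K]
    (f : M →ₛₗ[CalW.map p n φ] N) (g : N →ₛₗ[CalW.map p n ψ] K) (k : M →ₛₗ[CalW.map p n χ] K)
    (h : ∀ x, k x = g (f x)) (z : BC (CalW.res p n R) M) :
    wMap ψ g (wMap φ f z) = wMap χ k z := by
  have : semiComp (γ := W.map p n χ) (wMap ψ g) (wMap φ f)
      (fun a => by rw [← hχ, W.map_comp]) = wMap χ k :=
    BC.ext_of fun x => by simp [h]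
  rw [← this, semiComp_apply]

theorem wMap_id {M : Type*} [AddCommGroup M] [Module (CalW p n R) M]
    (k : M →ₛₗ[CalW.map p n (RingHom.id R)] M) (h : ∀ x, k x = x)
    (z : BC (CalW.res p n R) M) : wMap (RingHom.id R) k z = z := by
  induction z using BC.induction with
  | zero => rw [map_zero]
  | of m => rw [wMap_of, h]
  | add x y hx hy => rw [map_add, hx, hy]
  | smul b x hx => rw [LinearMap.map_smulₛₗ, hx, W.map_id]

namespace Predisplay

/-- A homomorphism `D → E` over a ring homomorphism `φ : R → S`: maps `P → P'` and `Q → Q'`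
that are linear over `𝒲_n(φ)` and compatible with `ι`, `ε`, `F` and `Ḟ`. -/
@[ext]
structure HomOver (φ : R →+* S) (D : Predisplay p n R) (E : Predisplay p n S) where
  /-- The map `P → P'`. -/
  mapP : D.P →ₛₗ[CalW.map p n φ] E.P
  /-- The map `Q → Q'`. -/
  mapQ : D.Q →ₛₗ[CalW.map p n φ] E.Q
  iota_comm : ∀ y : D.Q, E.iota (mapQ y) = mapP (D.iota y)
  eps_comm : ∀ (a : VIdeal p n R) (x : D.P),
    mapQ (D.eps (a ⊗ₜ x)) = E.eps (VIdeal.map p n φ a ⊗ₜ mapP x)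
  F_comm : ∀ x : D.P, E.F (mapP x) = wMap φ mapP (D.F x)
  Fdot_comm : ∀ y : D.Q, E.Fdot (mapQ y) = wMap φ mapP (D.Fdot y)

namespace HomOver

/-- The identity, as a homomorphism over the identity of `R`. -/
def id (D : Predisplay p n R) : HomOver (RingHom.id R) D D where
  mapP :=
    { toFun x := x
      map_add' _ _ := rfl
      map_smul' r x := by rw [CalW.map_id] }
  mapQ :=
    { toFun y := y
      map_add' _ _ := rfl
      map_smul' r y := by rw [CalW.map_id] }
  iota_comm y := rfl
  eps_comm a x := by rw [VIdeal.map_id]; rfl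
  F_comm x := by rw [wMap_id _ (fun _ => rfl)]; rfl
  Fdot_comm x := by rw [wMap_id _ (fun _ => rfl)]; rfl

/-- The composition of a homomorphism over `φ` and a homomorphism over `ψ`, as a homomorphism
over `χ = ψ ∘ φ`. -/
def comp {φ : R →+* S} {ψ : S →+* T} {χ : R →+* T} (hχ : ψ.comp φ = χ) {D : Predisplay p n R}
    {E : Predisplay p n S} {G : Predisplay p n T} (f : HomOver φ D E) (g : HomOver ψ E G) :
    HomOver χ D G where
  mapP := semiComp g.mapP f.mapP (fun a => by rw [← hχ, CalW.map_comp])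
  mapQ := semiComp g.mapQ f.mapQ (fun a => by rw [← hχ, CalW.map_comp])
  iota_comm y := by rw [semiComp_apply, semiComp_apply, g.iota_comm, f.iota_comm]
  eps_comm a x := by
    rw [semiComp_apply, semiComp_apply, f.eps_comm, g.eps_comm, ← hχ, VIdeal.map_comp]
  F_comm x := by
    rw [semiComp_apply, g.F_comm, f.F_comm, wMap_comp hχ]
    exact fun _ => rfl
  Fdot_comm x := by
    rw [semiComp_apply, g.Fdot_comm, f.Fdot_comm, wMap_comp hχ]
    exact fun _ => rfl

@[simp] theorem comp_mapP {φ : R →+* S} {ψ : S →+* T} {χ : R →+* T} (hχ : ψ.comp φ = χ)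
    {D : Predisplay p n R} {E : Predisplay p n S} {G : Predisplay p n T} (f : HomOver φ D E)
    (g : HomOver ψ E G) (x : D.P) : (comp hχ f g).mapP x = g.mapP (f.mapP x) := rfl

@[simp] theorem comp_mapQ {φ : R →+* S} {ψ : S →+* T} {χ : R →+* T} (hχ : ψ.comp φ = χ)
    {D : Predisplay p n R} {E : Predisplay p n S} {G : Predisplay p n T} (f : HomOver φ D E)
    (g : HomOver ψ E G) (y : D.Q) : (comp hχ f g).mapQ y = g.mapQ (f.mapQ y) := rfl

end HomOver

/-- The category of predisplays over `R`; morphisms are homomorphisms over the identity of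
`R`. -/
instance : Category (Predisplay p n R) where
  Hom D E := HomOver (RingHom.id R) D E
  id D := HomOver.id D
  comp f g := HomOver.comp (RingHom.id_comp _) f g

theorem hom_ext {D E : Predisplay p n R} {f g : D ⟶ E} (hP : ∀ x, f.mapP x = g.mapP x)
    (hQ : ∀ y, f.mapQ y = g.mapQ y) : f = g :=
  HomOver.ext (LinearMap.ext hP) (LinearMap.ext hQ)

@[simp] theorem id_mapP (D : Predisplay p n R) (x : D.P) : HomOver.mapP (𝟙 D) x = x := rfl
@[simp] theorem id_mapQ (D : Predisplay p n R) (y : D.Q) : HomOver.mapQ (𝟙 D) y = y := rfl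
@[simp] theorem comp_mapP {D E G : Predisplay p n R} (f : D ⟶ E) (g : E ⟶ G) (x : D.P) :
    HomOver.mapP (f ≫ g) x = g.mapP (f.mapP x) := rfl
@[simp] theorem comp_mapQ {D E G : Predisplay p n R} (f : D ⟶ E) (g : E ⟶ G) (y : D.Q) :
    HomOver.mapQ (f ≫ g) y = g.mapQ (f.mapQ y) := rfl

/-! ### Base change -/

section BaseChange

variable (φ : R →+* S) (D : Predisplay p n R)

/-- The module `P_S = 𝒲_n(S) ⊗_{𝒲_n(R)} P`. -/
abbrev bcP : Type u := BC (CalW.map p n φ) D.P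

/-- The relations defining `Q_S`: for `a ∈ I_{n+1}(R)`, `x ∈ P`, the element `1 ⊗ ε(a ⊗ x)` is
identified with `φ(a) ⊗ (1 ⊗ x)`, and for `b ∈ I_{n+1}(S)`, `y ∈ Q`, the element
`κ(b) ⊗ y` is identified with `b ⊗ (1 ⊗ ι(y))`. -/
def bcRel : Submodule (CalW p n S)
    (BC (CalW.map p n φ) D.Q × (VIdeal p n S ⊗[CalW p n S] D.bcP φ)) :=
  Submodule.span _
    ({z | ∃ (a : VIdeal p n R) (x : D.P),
        z = (BC.of _ (D.eps (a ⊗ₜ x)), -(VIdeal.map p n φ a ⊗ₜ BC.of _ x))} ∪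
      {z | ∃ (b : VIdeal p n S) (y : D.Q),
        z = (VIdeal.kappa p n S b • BC.of _ y, -(b ⊗ₜ BC.of _ (D.iota y)))})

/-- The module `Q_S`: the universal `𝒲_n(S)`-module with maps from `𝒲_n(S) ⊗_{𝒲_n(R)} Q` and
`I_{n+1}(S) ⊗_{𝒲_n(S)} P_S` that are compatible with `ε` and `ι`. For a normal decomposition
`P = T ⊕ L`, `Q = I_{n+1}(R) ⊗ T ⊕ L` it is `I_{n+1}(S) ⊗ T_S ⊕ L_S`. -/
abbrev bcQ : Type u :=
  (BC (CalW.map p n φ) D.Q × (VIdeal p n S ⊗[CalW p n S] D.bcP φ)) ⧸ D.bcRel φ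

/-- The map `Q → Q_S`. -/
def bcQOf : D.Q →ₛₗ[CalW.map p n φ] D.bcQ φ :=
  ((D.bcRel φ).mkQ ∘ₗ LinearMap.inl _ _ _) ∘ₛₗ BC.of (CalW.map p n φ)

theorem bcQOf_apply (y : D.Q) : D.bcQOf φ y = (D.bcRel φ).mkQ (BC.of _ y, 0) := rfl

/-- The map `ε_S : I_{n+1}(S) ⊗ P_S → Q_S`. -/
def bcEps : VIdeal p n S ⊗[CalW p n S] D.bcP φ →ₗ[CalW p n S] D.bcQ φ :=
  (D.bcRel φ).mkQ ∘ₗ LinearMap.inr _ _ _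

theorem bcRel_le_iff {C : Type*} [CommRing C] {N : Type*} [AddCommGroup N] [Module C N]
    {τ : CalW p n S →+* C}
    (f : BC (CalW.map p n φ) D.Q × (VIdeal p n S ⊗[CalW p n S] D.bcP φ) →ₛₗ[τ] N)
    (h₁ : ∀ (a : VIdeal p n R) (x : D.P), f (BC.of _ (D.eps (a ⊗ₜ x)), 0) =
      f (0, VIdeal.map p n φ a ⊗ₜ BC.of _ x))
    (h₂ : ∀ (b : VIdeal p n S) (y : D.Q), τ (VIdeal.kappa p n S b) • f (BC.of _ y, 0) =
      f (0, b ⊗ₜ BC.of _ (D.iota y))) : D.bcRel φ ≤ LinearMap.ker f := by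
  rw [bcRel, Submodule.span_le]
  have key : ∀ u v, f (u, -v) = f (u, 0) - f (0, v) := fun u v => by
    rw [← map_sub]; simp
  rintro _ (⟨a, x, rfl⟩ | ⟨b, y, rfl⟩)
  · rw [SetLike.mem_coe, LinearMap.mem_ker, key, h₁, sub_self]
  · rw [SetLike.mem_coe, LinearMap.mem_ker, key, ← h₂, ← LinearMap.map_smulₛₗ, Prod.smul_mk,
      smul_zero, sub_self]

theorem bcQOf_eps (a : VIdeal p n R) (x : D.P) :
    D.bcQOf φ (D.eps (a ⊗ₜ x)) = D.bcEps φ (VIdeal.map p n φ a ⊗ₜ BC.of _ x) := by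
  rw [← sub_eq_zero, bcQOf_apply, bcEps, LinearMap.comp_apply, ← map_sub]
  refine (Submodule.Quotient.mk_eq_zero _).2 (Submodule.subset_span (Or.inl ⟨a, x, ?_⟩))
  simp

theorem bcEps_of_iota (b : VIdeal p n S) (y : D.Q) :
    D.bcEps φ (b ⊗ₜ BC.of _ (D.iota y)) = VIdeal.kappa p n S b • D.bcQOf φ y := by
  symm
  rw [← sub_eq_zero, bcQOf_apply, bcEps, LinearMap.comp_apply, ← map_smul, ← map_sub]
  refine (Submodule.Quotient.mk_eq_zero _).2 (Submodule.subset_span (Or.inr ⟨b, y, ?_⟩))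
  simp

/-- A property of the elements of `Q_S` that holds on the images of `Q` and of `ε_S` and is
stable under addition and scalar multiplication holds on `Q_S`. -/
theorem bcQ_induction {motive : D.bcQ φ → Prop} (z : D.bcQ φ)
    (of : ∀ y, motive (D.bcQOf φ y)) (eps : ∀ w, motive (D.bcEps φ w))
    (add : ∀ x y, motive x → motive y → motive (x + y))
    (smul : ∀ (b : CalW p n S) x, motive x → motive (b • x)) : motive z := by
  obtain ⟨⟨u, w⟩, rfl⟩ := Submodule.mkQ_surjective _ z
  have hz : (D.bcRel φ).mkQ (u, w) =
      ((D.bcRel φ).mkQ ∘ₗ LinearMap.inl _ _ _) u + D.bcEps φ w := by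
    rw [bcEps, LinearMap.comp_apply, LinearMap.comp_apply, ← map_add]; simp
  rw [hz]
  refine add _ _ ?_ (eps w)
  clear hz
  induction u using BC.induction with
  | zero =>
    have h := eps 0
    rw [map_zero] at h ⊢
    exact h
  | of y => exact of y
  | add x y hx hy =>
    rw [map_add]
    exact add _ _ hx hy
  | smul b x hx =>
    rw [map_smul]
    exact smul b _ hx

/-- The map `ι_S : Q_S → P_S`. -/
def bcIota : D.bcQ φ →ₗ[CalW p n S] D.bcP φ :=
  (D.bcRel φ).liftQ
    ((BC.lift (σ := CalW.map p n φ) (RingHom.id _) (fun _ => rfl)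
        (BC.of (CalW.map p n φ) ∘ₛₗ D.iota)).coprod
      (TensorProduct.lift ((LinearMap.lsmul (CalW p n S) (D.bcP φ)).comp
        (VIdeal.kappa p n S)))) (D.bcRel_le_iff φ _
      (fun a x => by
        simp only [LinearMap.coprod_apply, map_zero, add_zero, zero_add, BC.lift_of,
          TensorProduct.lift.tmul, LinearMap.comp_apply, D.iota_eps, LinearMap.map_smulₛₗ,
          VIdeal.kappa_map, LinearMap.lsmul_apply])
      (fun b y => by
        simp only [LinearMap.coprod_apply, map_zero, add_zero, zero_add, BC.lift_of,
          TensorProduct.lift.tmul, LinearMap.comp_apply, RingHom.id_apply,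
          LinearMap.lsmul_apply]))

theorem bcIota_of (y : D.Q) : D.bcIota φ (D.bcQOf φ y) = BC.of _ (D.iota y) := by
  rw [bcIota, bcQOf_apply, Submodule.mkQ_apply, Submodule.liftQ_apply]
  simp only [LinearMap.coprod_apply, map_zero, add_zero, BC.lift_of, LinearMap.comp_apply]

theorem bcIota_eps (b : VIdeal p n S) (z : D.bcP φ) :
    D.bcIota φ (D.bcEps φ (b ⊗ₜ z)) = VIdeal.kappa p n S b • z := by
  rw [bcIota, bcEps, LinearMap.comp_apply, Submodule.mkQ_apply, Submodule.liftQ_apply]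
  simp

/-- The map `W_n(R) ⊗ P → W_n(S) ⊗ P_S`. -/
def bcW : BC (CalW.res p n R) D.P →ₛₗ[W.map p n φ] BC (CalW.res p n S) (D.bcP φ) :=
  wMap φ (BC.of (CalW.map p n φ))

/-- The map `F_S : P_S → W_n(S) ⊗ P_S`. -/
def bcF : D.bcP φ →ₛₗ[CalW.frob p n S] BC (CalW.res p n S) (D.bcP φ) :=
  BC.lift (CalW.frob p n S) (CalW.frob_map' p n φ)
    (semiComp (D.bcW φ) D.F fun _ => RingHom.comp_apply _ _ _)

theorem bcF_of (x : D.P) : D.bcF φ (BC.of _ x) = D.bcW φ (D.F x) := by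
  rw [bcF, BC.lift_of, semiComp_apply]

/-- The map `I_{n+1}(S) ⊗ P_S → W_n(S) ⊗ P_S`, `V(η) ⊗ z ↦ η F_S(z)`. -/
def bcFtilde : VIdeal p n S ⊗[CalW p n S] D.bcP φ →ₛₗ[CalW.frob p n S]
    BC (CalW.res p n S) (D.bcP φ) :=
  TensorProduct.lift (LinearMap.mk₂'ₛₗ (CalW.frob p n S) (CalW.frob p n S)
    (fun b z => VIdeal.verInv p n S b • D.bcF φ z)
    (fun a b z => by rw [map_add, add_smul])
    (fun r b z => by rw [VIdeal.verInv_smul, mul_smul])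
    (fun b z w => by rw [map_add, smul_add])
    (fun r b z => by rw [LinearMap.map_smulₛₗ, smul_comm]))

theorem bcFtilde_tmul (b : VIdeal p n S) (z : D.bcP φ) :
    D.bcFtilde φ (b ⊗ₜ z) = VIdeal.verInv p n S b • D.bcF φ z := by
  rw [bcFtilde, TensorProduct.lift.tmul, LinearMap.mk₂'ₛₗ_apply]

theorem F_iota (y : D.Q) : D.F (D.iota y) = (p : W p n R) • D.Fdot y := by
  have h := D.Fdot_eps ((VIdeal.verInv p n R).symm 1) (D.iota y)
  rw [AddEquiv.apply_symm_apply, one_smul, D.eps_iota, LinearMap.map_smulₛₗ,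
    VIdeal.frob_kappa, AddEquiv.apply_symm_apply, mul_one] at h
  exact h.symm

/-- The map `Ḟ_S : Q_S → W_n(S) ⊗ P_S`. -/
def bcFdot : D.bcQ φ →ₛₗ[CalW.frob p n S] BC (CalW.res p n S) (D.bcP φ) :=
  (D.bcRel φ).liftQ
    (BC.lift (CalW.frob p n S) (CalW.frob_map' p n φ)
          (semiComp (D.bcW φ) D.Fdot fun _ => RingHom.comp_apply _ _ _) ∘ₛₗ
        LinearMap.fst (CalW p n S) _ _ +
      D.bcFtilde φ ∘ₛₗ LinearMap.snd (CalW p n S) _ _) (D.bcRel_le_iff φ _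
      (fun a x => by
        simp only [LinearMap.add_apply, LinearMap.comp_apply, LinearMap.fst_apply,
          LinearMap.snd_apply, map_zero, add_zero, zero_add, BC.lift_of, bcFtilde_tmul, bcF_of,
          semiComp_apply, D.Fdot_eps, LinearMap.map_smulₛₗ, VIdeal.verInv_map])
      (fun b y => by
        simp only [LinearMap.add_apply, LinearMap.comp_apply, LinearMap.fst_apply,
          LinearMap.snd_apply, map_zero, add_zero, zero_add, BC.lift_of, bcFtilde_tmul, bcF_of,
          VIdeal.frob_kappa, F_iota, semiComp_apply]
        rw [LinearMap.map_smulₛₗ, map_natCast, mul_comm, mul_smul]))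

theorem bcFdot_of (y : D.Q) : D.bcFdot φ (D.bcQOf φ y) = D.bcW φ (D.Fdot y) := by
  rw [bcFdot, bcQOf_apply, Submodule.mkQ_apply, Submodule.liftQ_apply]
  simp only [LinearMap.add_apply, LinearMap.comp_apply, LinearMap.fst_apply,
    LinearMap.snd_apply, map_zero, add_zero, BC.lift_of, semiComp_apply]

theorem bcFdot_eps (b : VIdeal p n S) (z : D.bcP φ) :
    D.bcFdot φ (D.bcEps φ (b ⊗ₜ z)) = VIdeal.verInv p n S b • D.bcF φ z := by
  rw [bcFdot, bcEps, LinearMap.comp_apply, Submodule.mkQ_apply, Submodule.liftQ_apply]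
  simp [bcFtilde_tmul]

theorem bcEps_iota (b : VIdeal p n S) (z : D.bcQ φ) :
    D.bcEps φ (b ⊗ₜ D.bcIota φ z) = VIdeal.kappa p n S b • z := by
  induction z using bcQ_induction with
  | of y => rw [bcIota_of, bcEps_of_iota]
  | eps w =>
    induction w using TensorProduct.induction_on with
    | zero => simp
    | tmul b' z =>
      rw [bcIota_eps, ← map_smul, TensorProduct.tmul_smul, TensorProduct.smul_tmul',
        TensorProduct.smul_tmul', VIdeal.kappa_smul_comm]
    | add x y hx hy => simp only [map_add, TensorProduct.tmul_add, smul_add, hx, hy]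
  | add x y hx hy => rw [map_add, TensorProduct.tmul_add, map_add, hx, hy, smul_add]
  | smul c x hx => rw [map_smul, TensorProduct.tmul_smul, map_smul, hx, smul_comm]

/-- The base change `D_S` of a predisplay along `φ : R → S`. It is characterized by the
universal property that homomorphisms `D_S → E` are the homomorphisms `D → E` over `φ`; see
`toBaseChange` and `desc`. -/
def baseChange : Predisplay p n S where
  P := D.bcP φ
  Q := D.bcQ φ
  iota := D.bcIota φ
  eps := D.bcEps φ
  F := D.bcF φ
  Fdot := D.bcFdot φ
  iota_eps := D.bcIota_eps φ
  eps_iota := D.bcEps_iota φ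
  Fdot_eps := D.bcFdot_eps φ

/-- The canonical homomorphism `D → D_S` over `φ`. -/
def toBaseChange : HomOver φ D (D.baseChange φ) where
  mapP := BC.of (CalW.map p n φ)
  mapQ := D.bcQOf φ
  iota_comm := D.bcIota_of φ
  eps_comm := D.bcQOf_eps φ
  F_comm := D.bcF_of φ
  Fdot_comm := D.bcFdot_of φ

variable {φ D}

theorem baseChange_P_induction {motive : (D.baseChange φ).P → Prop} (z : (D.baseChange φ).P)
    (of : ∀ x, motive ((D.toBaseChange φ).mapP x))
    (add : ∀ x y, motive x → motive y → motive (x + y))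
    (smul : ∀ (b : CalW p n S) x, motive x → motive (b • x)) : motive z :=
  BC.induction (σ := CalW.map p n φ) (motive := motive) z
    (by have h := of 0; rwa [map_zero] at h) of add smul

theorem baseChange_Q_induction {motive : (D.baseChange φ).Q → Prop} (z : (D.baseChange φ).Q)
    (of : ∀ y, motive ((D.toBaseChange φ).mapQ y))
    (eps : ∀ b x, motive ((D.baseChange φ).eps (b ⊗ₜ x)))
    (add : ∀ x y, motive x → motive y → motive (x + y))
    (smul : ∀ (b : CalW p n S) x, motive x → motive (b • x)) : motive z := by
  refine bcQ_induction (φ := φ) (D := D) (motive := motive) z of (fun w => ?_) add smul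
  change motive ((D.baseChange φ).eps w)
  induction w using TensorProduct.induction_on with
  | zero =>
    have h := of 0
    rw [map_zero] at h
    exact (map_zero (D.baseChange φ).eps).symm ▸ h
  | tmul b x => exact eps b x
  | add x y hx hy => exact (map_add (D.baseChange φ).eps x y).symm ▸ add _ _ hx hy

/-- Two homomorphisms out of `D_S` over `ψ : S → T` that agree on `D` are equal. -/
theorem baseChange_ext {ψ : S →+* T} {E : Predisplay p n T}
    {f g : HomOver ψ (D.baseChange φ) E}
    (hP : ∀ x, f.mapP ((D.toBaseChange φ).mapP x) = g.mapP ((D.toBaseChange φ).mapP x))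
    (hQ : ∀ y, f.mapQ ((D.toBaseChange φ).mapQ y) = g.mapQ ((D.toBaseChange φ).mapQ y)) :
    f = g := by
  have hP' : ∀ x, f.mapP x = g.mapP x := fun x => by
    induction x using baseChange_P_induction with
    | of x => exact hP x
    | add x y hx hy => rw [map_add, map_add, hx, hy]
    | smul c x hx => rw [LinearMap.map_smulₛₗ, LinearMap.map_smulₛₗ, hx]
  refine HomOver.ext (LinearMap.ext hP') (LinearMap.ext fun z => ?_)
  induction z using baseChange_Q_induction with
  | of y => exact hQ y
  | eps b x => rw [f.eps_comm, g.eps_comm, hP']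
  | add x y hx hy => rw [map_add, map_add, hx, hy]
  | smul c x hx => rw [LinearMap.map_smulₛₗ, LinearMap.map_smulₛₗ, hx]

theorem calWMap_comp' {φ : R →+* S} {ψ : S →+* T} {χ : R →+* T} (hχ : ψ.comp φ = χ)
    (r : CalW p n R) : CalW.map p n χ r = CalW.map p n ψ (CalW.map p n φ r) := by
  rw [← hχ, CalW.map_comp]

theorem vIdealMap_comp' {φ : R →+* S} {ψ : S →+* T} {χ : R →+* T} (hχ : ψ.comp φ = χ)
    (a : VIdeal p n R) : VIdeal.map p n χ a = VIdeal.map p n ψ (VIdeal.map p n φ a) := by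
  rw [← hχ, VIdeal.map_comp]

variable (φ) in
/-- The map `P_S → P'` over `ψ` induced by a homomorphism over `χ = ψ ∘ φ`. -/
def descP {ψ : S →+* T} {χ : R →+* T} (hχ : ψ.comp φ = χ) {E : Predisplay p n T}
    (f : HomOver χ D E) : D.bcP φ →ₛₗ[CalW.map p n ψ] E.P :=
  BC.lift (CalW.map p n ψ) (calWMap_comp' hχ) f.mapP

theorem descP_of {ψ : S →+* T} {χ : R →+* T} (hχ : ψ.comp φ = χ) {E : Predisplay p n T}
    (f : HomOver χ D E) (x : D.P) : descP φ hχ f (BC.of _ x) = f.mapP x :=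
  BC.lift_of ..

variable (φ) in
/-- The map `Q_S → Q'` over `ψ` induced by a homomorphism over `χ = ψ ∘ φ`. -/
def descQ {ψ : S →+* T} {χ : R →+* T} (hχ : ψ.comp φ = χ) {E : Predisplay p n T}
    (f : HomOver χ D E) : D.bcQ φ →ₛₗ[CalW.map p n ψ] E.Q :=
  (D.bcRel φ).liftQ
    (BC.lift (CalW.map p n ψ) (calWMap_comp' hχ) f.mapQ ∘ₛₗ LinearMap.fst (CalW p n S) _ _ +
      (E.eps ∘ₛₗ TensorProduct.map (VIdeal.map p n ψ) (descP φ hχ f)) ∘ₛₗ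
        LinearMap.snd (CalW p n S) _ _) (D.bcRel_le_iff φ _
      (fun a x => by
        simp only [LinearMap.add_apply, LinearMap.comp_apply, LinearMap.fst_apply,
          LinearMap.snd_apply, map_zero, add_zero, zero_add, BC.lift_of,
          TensorProduct.map_tmul, descP_of, f.eps_comm, vIdealMap_comp' hχ])
      (fun b y => by
        simp only [LinearMap.add_apply, LinearMap.comp_apply, LinearMap.fst_apply,
          LinearMap.snd_apply, map_zero, add_zero, zero_add, BC.lift_of,
          TensorProduct.map_tmul, descP_of, ← f.iota_comm, E.eps_iota, VIdeal.kappa_map]))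

theorem descQ_of {ψ : S →+* T} {χ : R →+* T} (hχ : ψ.comp φ = χ) {E : Predisplay p n T}
    (f : HomOver χ D E) (y : D.Q) : descQ φ hχ f (D.bcQOf φ y) = f.mapQ y := by
  simp only [descQ, bcQOf_apply, Submodule.mkQ_apply, Submodule.liftQ_apply, LinearMap.add_apply,
    LinearMap.comp_apply, LinearMap.fst_apply, LinearMap.snd_apply, map_zero, add_zero,
    BC.lift_of]

theorem descQ_eps {ψ : S →+* T} {χ : R →+* T} (hχ : ψ.comp φ = χ) {E : Predisplay p n T}
    (f : HomOver χ D E) (b : VIdeal p n S) (z : D.bcP φ) :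
    descQ φ hχ f (D.bcEps φ (b ⊗ₜ z)) = E.eps (VIdeal.map p n ψ b ⊗ₜ descP φ hχ f z) := by
  simp only [descQ, bcEps, Submodule.mkQ_apply, Submodule.liftQ_apply, LinearMap.add_apply,
    LinearMap.comp_apply, LinearMap.fst_apply, LinearMap.snd_apply, map_zero, zero_add,
    LinearMap.inr_apply, TensorProduct.map_tmul]

theorem wMap_descP {ψ : S →+* T} {χ : R →+* T} (hχ : ψ.comp φ = χ) {E : Predisplay p n T}
    (f : HomOver χ D E) (z : BC (CalW.res p n R) D.P) :
    wMap ψ (descP φ hχ f) (D.bcW φ z) = wMap χ f.mapP z :=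
  wMap_comp hχ _ _ _ (fun x => (descP_of hχ f x).symm) z

theorem F_descP {ψ : S →+* T} {χ : R →+* T} (hχ : ψ.comp φ = χ) {E : Predisplay p n T}
    (f : HomOver χ D E) (z : D.bcP φ) :
    E.F (descP φ hχ f z) = wMap ψ (descP φ hχ f) (D.bcF φ z) := by
  induction z using BC.induction with
  | zero => simp only [map_zero]
  | of x => rw [descP_of, f.F_comm, bcF_of, wMap_descP]
  | add x y hx hy => simp only [map_add, hx, hy]
  | smul c x hx => simp only [LinearMap.map_smulₛₗ, hx, CalW.frob_map]

variable (φ) in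
/-- The universal property of base change: a homomorphism `D → E` over `χ = ψ ∘ φ` factors
uniquely over a homomorphism `D_S → E` over `ψ`. -/
def desc {ψ : S →+* T} {χ : R →+* T} (hχ : ψ.comp φ = χ) {E : Predisplay p n T}
    (f : HomOver χ D E) : HomOver ψ (D.baseChange φ) E where
  mapP := descP φ hχ f
  mapQ := descQ φ hχ f
  iota_comm := fun (z : D.bcQ φ) => by
    change E.iota (descQ φ hχ f z) = descP φ hχ f (D.bcIota φ z)
    induction z using bcQ_induction with
    | of y => rw [bcIota_of, descQ_of, descP_of, f.iota_comm]
    | eps w =>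
      induction w using TensorProduct.induction_on with
      | zero => simp only [map_zero]
      | tmul b z =>
        rw [descQ_eps, E.iota_eps, bcIota_eps, LinearMap.map_smulₛₗ, VIdeal.kappa_map]
      | add x y hx hy => simp only [map_add, hx, hy]
    | add x y hx hy => simp only [map_add, hx, hy]
    | smul c x hx => simp only [LinearMap.map_smulₛₗ, hx, RingHom.id_apply]
  eps_comm := descQ_eps hχ f
  F_comm := F_descP hχ f
  Fdot_comm := fun (z : D.bcQ φ) => by
    change E.Fdot (descQ φ hχ f z) = wMap ψ (descP φ hχ f) (D.bcFdot φ z)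
    induction z using bcQ_induction with
    | of y => rw [bcFdot_of, descQ_of, f.Fdot_comm, wMap_descP]
    | eps w =>
      induction w using TensorProduct.induction_on with
      | zero => simp only [map_zero]
      | tmul b z =>
        rw [descQ_eps, E.Fdot_eps, bcFdot_eps, LinearMap.map_smulₛₗ, VIdeal.verInv_map, F_descP]
      | add x y hx hy => simp only [map_add, hx, hy]
    | add x y hx hy => simp only [map_add, hx, hy]
    | smul c x hx => simp only [LinearMap.map_smulₛₗ, hx, CalW.frob_map]

@[simp] theorem desc_mapP {ψ : S →+* T} {χ : R →+* T} (hχ : ψ.comp φ = χ)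
    {E : Predisplay p n T} (f : HomOver χ D E) (x : D.P) :
    (desc φ hχ f).mapP ((D.toBaseChange φ).mapP x) = f.mapP x :=
  descP_of hχ f x

@[simp] theorem desc_mapQ {ψ : S →+* T} {χ : R →+* T} (hχ : ψ.comp φ = χ)
    {E : Predisplay p n T} (f : HomOver χ D E) (y : D.Q) :
    (desc φ hχ f).mapQ ((D.toBaseChange φ).mapQ y) = f.mapQ y :=
  descQ_of hχ f y

end BaseChange

end Predisplay

end Display

/-! ### The base change of a truncated display is a truncated display -/

namespace Predisplay

section Preservation

variable {p : ℕ} [Fact p.Prime] {n : ℕ} [NeZero n] {R S : Type u} [CommRing R] [CommRing S]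

theorem w0_kappa (a : VIdeal p n R) : CalW.w0 p n R (VIdeal.kappa p n R a) = 0 :=
  (VIdeal.w0_eq_zero_iff p n _).2 ⟨a, rfl⟩

theorem w0_comp (φ : R →+* S) (r : CalW p n R) :
    (φ.comp (CalW.w0 p n R)) r = CalW.w0 p n S (CalW.map p n φ r) := by
  rw [RingHom.comp_apply, CalW.w0_map]

variable (φ : R →+* S) (D : Predisplay p n R)

/-- `P / ι(Q)`, as an `R`-module. -/
abbrev cokerIota : Type u := BC (CalW.w0 p n R) (D.P ⧸ LinearMap.range D.iota)

/-- `Q / Im ε`, as an `R`-module. -/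
abbrev cokerEps : Type u := BC (CalW.w0 p n R) (D.Q ⧸ LinearMap.range D.eps)

/-- The map `P → P / ι(Q)`. -/
def toCokerIota : D.P →ₛₗ[CalW.w0 p n R] D.cokerIota :=
  BC.of (CalW.w0 p n R) ∘ₛₗ (LinearMap.range D.iota).mkQ

/-- The map `Q → Q / Im ε`. -/
def toCokerEps : D.Q →ₛₗ[CalW.w0 p n R] D.cokerEps :=
  BC.of (CalW.w0 p n R) ∘ₛₗ (LinearMap.range D.eps).mkQ

theorem toCokerIota_surjective : Function.Surjective D.toCokerIota :=
  (BC.of_surjective (CalW.w0_surjective p n)).comp (Submodule.mkQ_surjective _)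

theorem toCokerEps_surjective : Function.Surjective D.toCokerEps :=
  (BC.of_surjective (CalW.w0_surjective p n)).comp (Submodule.mkQ_surjective _)

@[simp] theorem toCokerIota_iota (y : D.Q) : D.toCokerIota (D.iota y) = 0 := by
  have h : (Submodule.Quotient.mk (D.iota y) : D.P ⧸ LinearMap.range D.iota) = 0 :=
    (Submodule.Quotient.mk_eq_zero _).2 ⟨y, rfl⟩
  rw [toCokerIota, LinearMap.comp_apply, Submodule.mkQ_apply, h, map_zero]

@[simp] theorem toCokerEps_eps (z : VIdeal p n R ⊗[CalW p n R] D.P) :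
    D.toCokerEps (D.eps z) = 0 := by
  have h : (Submodule.Quotient.mk (D.eps z) : D.Q ⧸ LinearMap.range D.eps) = 0 :=
    (Submodule.Quotient.mk_eq_zero _).2 ⟨z, rfl⟩
  rw [toCokerEps, LinearMap.comp_apply, Submodule.mkQ_apply, h, map_zero]

theorem toCokerEps_eq_zero (y : D.Q) (h : D.toCokerEps y = 0) : y ∈ LinearMap.range D.eps := by
  rw [← Submodule.Quotient.mk_eq_zero]
  refine BC.of_injective (CalW.w0_surjective p n) ?_ (h.trans (map_zero _).symm)
  intro a ha x
  obtain ⟨b, rfl⟩ := (VIdeal.w0_eq_zero_iff p n a).1 ha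
  obtain ⟨x, rfl⟩ := Submodule.mkQ_surjective _ x
  rw [← map_smul, Submodule.mkQ_apply, Submodule.Quotient.mk_eq_zero, ← D.eps_iota]
  exact ⟨_, rfl⟩

variable {φ D}

variable {C : Type*} [CommRing C] {N : Type*} [AddCommGroup N] [Module C N]

/-- Maps out of `P / ι(Q)`. -/
def cokerIotaLift {τ : R →+* C} {γ : CalW p n R →+* C} (hγ : ∀ a, γ a = τ (CalW.w0 p n R a))
    (f : D.P →ₛₗ[γ] N) (hf : ∀ y, f (D.iota y) = 0) : D.cokerIota →ₛₗ[τ] N :=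
  BC.lift τ hγ ((LinearMap.range D.iota).liftQ f (by rintro _ ⟨y, rfl⟩; exact hf y))

theorem cokerIotaLift_apply {τ : R →+* C} {γ : CalW p n R →+* C}
    (hγ : ∀ a, γ a = τ (CalW.w0 p n R a)) (f : D.P →ₛₗ[γ] N) (hf : ∀ y, f (D.iota y) = 0)
    (x : D.P) : cokerIotaLift hγ f hf (D.toCokerIota x) = f x := by
  rw [cokerIotaLift, toCokerIota, LinearMap.comp_apply, BC.lift_of, Submodule.mkQ_apply,
    Submodule.liftQ_apply]

/-- Maps out of `Q / Im ε`. -/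
def cokerEpsLift {τ : R →+* C} {γ : CalW p n R →+* C} (hγ : ∀ a, γ a = τ (CalW.w0 p n R a))
    (f : D.Q →ₛₗ[γ] N) (hf : ∀ z, f (D.eps z) = 0) : D.cokerEps →ₛₗ[τ] N :=
  BC.lift τ hγ ((LinearMap.range D.eps).liftQ f (by rintro _ ⟨y, rfl⟩; exact hf y))

theorem cokerEpsLift_apply {τ : R →+* C} {γ : CalW p n R →+* C}
    (hγ : ∀ a, γ a = τ (CalW.w0 p n R a)) (f : D.Q →ₛₗ[γ] N) (hf : ∀ z, f (D.eps z) = 0)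
    (y : D.Q) : cokerEpsLift hγ f hf (D.toCokerEps y) = f y := by
  rw [cokerEpsLift, toCokerEps, LinearMap.comp_apply, BC.lift_of, Submodule.mkQ_apply,
    Submodule.liftQ_apply]

variable (φ D)

/-- The map `P / ι(Q) → P_S / ι_S(Q_S)`. -/
def cokerIotaMap : D.cokerIota →ₛₗ[φ] (D.baseChange φ).cokerIota :=
  cokerIotaLift (γ := φ.comp (CalW.w0 p n R)) (fun _ => RingHom.comp_apply _ _ _)
    (semiComp (D.baseChange φ).toCokerIota (D.toBaseChange φ).mapP (w0_comp φ)) (fun y => by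
      rw [semiComp_apply, ← (D.toBaseChange φ).iota_comm, toCokerIota_iota])

theorem cokerIotaMap_apply (x : D.P) : D.cokerIotaMap φ (D.toCokerIota x) =
    (D.baseChange φ).toCokerIota ((D.toBaseChange φ).mapP x) := by
  rw [cokerIotaMap, cokerIotaLift_apply, semiComp_apply]

/-- The map `Q / Im ε → Q_S / Im ε_S`. -/
def cokerEpsMap : D.cokerEps →ₛₗ[φ] (D.baseChange φ).cokerEps :=
  cokerEpsLift (γ := φ.comp (CalW.w0 p n R)) (fun _ => RingHom.comp_apply _ _ _)
    (semiComp (D.baseChange φ).toCokerEps (D.toBaseChange φ).mapQ (w0_comp φ)) (fun z => by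
      rw [semiComp_apply]
      induction z using TensorProduct.induction_on with
      | zero => simp only [map_zero]
      | tmul a x => rw [(D.toBaseChange φ).eps_comm, toCokerEps_eps]
      | add x y hx hy => simp only [map_add, hx, hy, add_zero])

theorem cokerEpsMap_apply (y : D.Q) : D.cokerEpsMap φ (D.toCokerEps y) =
    (D.baseChange φ).toCokerEps ((D.toBaseChange φ).mapQ y) := by
  rw [cokerEpsMap, cokerEpsLift_apply, semiComp_apply]

/-- The map `P_S → S ⊗_R P / ι(Q)`. -/
def bcPToCoker : (D.baseChange φ).P →ₛₗ[CalW.w0 p n S] BC φ D.cokerIota :=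
  BC.lift (σ := CalW.map p n φ) (M := D.P) (CalW.w0 p n S) (w0_comp φ)
    (semiComp (BC.of φ) D.toCokerIota fun _ => RingHom.comp_apply _ _ _)

theorem bcPToCoker_of (x : D.P) :
    D.bcPToCoker φ ((D.toBaseChange φ).mapP x) = BC.of φ (D.toCokerIota x) :=
  (BC.lift_of ..).trans (semiComp_apply ..)

theorem bcPToCoker_iota (z : (D.baseChange φ).Q) :
    D.bcPToCoker φ ((D.baseChange φ).iota z) = 0 := by
  induction z using baseChange_Q_induction with
  | of y => rw [(D.toBaseChange φ).iota_comm, bcPToCoker_of, toCokerIota_iota, map_zero]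
  | eps b x => rw [(D.baseChange φ).iota_eps, LinearMap.map_smulₛₗ, w0_kappa, zero_smul]
  | add x y hx hy => rw [map_add, map_add, hx, hy, add_zero]
  | smul c x hx => rw [map_smul, LinearMap.map_smulₛₗ, hx, smul_zero]

/-- The map `Q_S → S ⊗_R Q / Im ε`. -/
def bcQToCoker : (D.baseChange φ).Q →ₛₗ[CalW.w0 p n S] BC φ D.cokerEps :=
  (D.bcRel φ).liftQ
    (BC.lift (σ := CalW.map p n φ) (M := D.Q) (CalW.w0 p n S) (w0_comp φ)
      (semiComp (BC.of φ) D.toCokerEps fun _ => RingHom.comp_apply _ _ _) ∘ₛₗ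
        LinearMap.fst (CalW p n S) _ _) (D.bcRel_le_iff φ _
      (fun a x => by
        simp only [LinearMap.comp_apply, LinearMap.fst_apply, BC.lift_of, semiComp_apply,
          toCokerEps_eps, map_zero])
      (fun b y => by
        simp only [LinearMap.comp_apply, LinearMap.fst_apply, w0_kappa, zero_smul, map_zero]))

theorem bcQToCoker_of (y : D.Q) :
    D.bcQToCoker φ ((D.toBaseChange φ).mapQ y) = BC.of φ (D.toCokerEps y) := by
  change (D.bcRel φ).liftQ _ _ (D.bcQOf φ y) = _
  rw [bcQOf_apply, Submodule.mkQ_apply, Submodule.liftQ_apply, LinearMap.comp_apply,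
    LinearMap.fst_apply, BC.lift_of, semiComp_apply]

theorem bcQToCoker_bcEps (z : VIdeal p n S ⊗[CalW p n S] D.bcP φ) :
    D.bcQToCoker φ (D.bcEps φ z) = 0 := by
  rw [bcQToCoker, bcEps, LinearMap.comp_apply, Submodule.mkQ_apply, LinearMap.inr_apply]
  refine (Submodule.liftQ_apply ..).trans ?_
  rw [LinearMap.comp_apply, LinearMap.fst_apply, map_zero]

theorem bcQToCoker_eps (z : VIdeal p n S ⊗[CalW p n S] (D.baseChange φ).P) :
    D.bcQToCoker φ ((D.baseChange φ).eps z) = 0 :=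
  D.bcQToCoker_bcEps φ z

/-- `S ⊗_R (P / ι(Q)) = P_S / ι_S(Q_S)`. -/
def cokerIotaEquiv : BC φ D.cokerIota ≃ₗ[S] (D.baseChange φ).cokerIota :=
  LinearEquiv.ofLinearMap
    (BC.lift (RingHom.id S) (fun _ => rfl) (D.cokerIotaMap φ))
    (cokerIotaLift (fun _ => rfl) (D.bcPToCoker φ) (D.bcPToCoker_iota φ))
    (LinearMap.ext fun z => by
      obtain ⟨x, rfl⟩ := toCokerIota_surjective _ z
      rw [LinearMap.comp_apply, LinearMap.id_apply, cokerIotaLift_apply]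
      induction x using baseChange_P_induction with
      | of x => rw [bcPToCoker_of, BC.lift_of, cokerIotaMap_apply]
      | add x y hx hy => simp only [map_add, hx, hy]
      | smul c x hx => simp only [LinearMap.map_smulₛₗ, hx, RingHom.id_apply])
    (BC.ext_of fun z => by
      obtain ⟨x, rfl⟩ := toCokerIota_surjective _ z
      rw [LinearMap.comp_apply, LinearMap.id_apply, BC.lift_of, cokerIotaMap_apply,
        cokerIotaLift_apply, bcPToCoker_of])

/-- `S ⊗_R (Q / Im ε) = Q_S / Im ε_S`. -/
def cokerEpsEquiv : BC φ D.cokerEps ≃ₗ[S] (D.baseChange φ).cokerEps :=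
  LinearEquiv.ofLinearMap
    (BC.lift (RingHom.id S) (fun _ => rfl) (D.cokerEpsMap φ))
    (cokerEpsLift (fun _ => rfl) (D.bcQToCoker φ) (D.bcQToCoker_eps φ))
    (LinearMap.ext fun z => by
      obtain ⟨x, rfl⟩ := toCokerEps_surjective _ z
      rw [LinearMap.comp_apply, LinearMap.id_apply, cokerEpsLift_apply]
      induction x using baseChange_Q_induction with
      | of x => rw [bcQToCoker_of, BC.lift_of, cokerEpsMap_apply]
      | eps b x => rw [bcQToCoker_eps, map_zero, toCokerEps_eps]
      | add x y hx hy => simp only [map_add, hx, hy]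
      | smul c x hx => simp only [LinearMap.map_smulₛₗ, hx, RingHom.id_apply])
    (BC.ext_of fun z => by
      obtain ⟨x, rfl⟩ := toCokerEps_surjective _ z
      rw [LinearMap.comp_apply, LinearMap.id_apply, BC.lift_of, cokerEpsMap_apply,
        cokerEpsLift_apply, bcQToCoker_of])

variable {D}

/-- The injection `Q / Im ε → P / κ(I_{n+1}) P` has a retraction. -/
theorem IsTruncatedDisplay.exists_retraction (hD : D.IsTruncatedDisplay) :
    ∃ r : D.P →ₛₗ[CalW.w0 p n R] D.cokerEps, ∀ y, r (D.iota y) = D.toCokerEps y := by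
  have := hD.projective_coker_iota
  let j : D.cokerEps →ₗ[R] BC (CalW.w0 p n R) D.P :=
    cokerEpsLift (fun _ => rfl) (BC.of (CalW.w0 p n R) ∘ₛₗ D.iota) (fun z => by
      induction z using TensorProduct.induction_on with
      | zero => simp only [map_zero]
      | tmul a x =>
        rw [LinearMap.comp_apply, D.iota_eps, LinearMap.map_smulₛₗ, w0_kappa, zero_smul]
      | add x y hx hy => simp only [map_add, hx, hy, add_zero])
  have hj : ∀ y, j (D.toCokerEps y) = BC.of _ (D.iota y) := fun y => by
    rw [cokerEpsLift_apply, LinearMap.comp_apply]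
  let π : BC (CalW.w0 p n R) D.P →ₗ[R] D.cokerIota :=
    BC.lift (RingHom.id R) (fun _ => rfl) D.toCokerIota
  have hπ : ∀ x, π (BC.of _ x) = D.toCokerIota x := fun x => BC.lift_of ..
  have hπs : Function.Surjective π := fun z => by
    obtain ⟨x, rfl⟩ := D.toCokerIota_surjective z
    exact ⟨_, hπ x⟩
  have hker : ∀ z, π z = 0 → z ∈ LinearMap.range j := by
    intro z hz
    let s : D.cokerIota →ₗ[R] (BC (CalW.w0 p n R) D.P ⧸ LinearMap.range j) :=
      cokerIotaLift (fun _ => rfl) ((LinearMap.range j).mkQ ∘ₛₗ BC.of (CalW.w0 p n R))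
        (fun y => by
          rw [LinearMap.comp_apply, Submodule.mkQ_apply, ← hj]
          exact (Submodule.Quotient.mk_eq_zero _).2 ⟨_, rfl⟩)
    obtain ⟨x, rfl⟩ := BC.of_surjective (CalW.w0_surjective p n) z
    have hs : s (π (BC.of _ x)) = (LinearMap.range j).mkQ (BC.of _ x) := by
      rw [hπ, cokerIotaLift_apply, LinearMap.comp_apply]
    rw [hz, map_zero] at hs
    exact (Submodule.Quotient.mk_eq_zero _).1 hs.symm
  have hjinj : Function.Injective j := by
    rw [injective_iff_map_eq_zero]
    intro z hz
    obtain ⟨y, rfl⟩ := D.toCokerEps_surjective z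
    rw [hj] at hz
    have hy : D.iota y ∈ VIdeal.kappaIdeal p n R • (⊤ : Submodule (CalW p n R) D.P) := by
      rw [← Submodule.Quotient.mk_eq_zero]
      refine BC.of_injective (σ := CalW.w0 p n R) (CalW.w0_surjective p n) ?_ ?_
      · intro a ha x
        obtain ⟨b, rfl⟩ := (VIdeal.w0_eq_zero_iff p n a).1 ha
        obtain ⟨x, rfl⟩ := Submodule.mkQ_surjective _ x
        rw [← map_smul, Submodule.mkQ_apply, Submodule.Quotient.mk_eq_zero]
        exact Submodule.smul_mem_smul ⟨b, rfl⟩ trivial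
      · have h := congrArg (BC.lift (RingHom.id R) (γ := CalW.w0 p n R) (fun _ => rfl)
          (BC.of (CalW.w0 p n R) ∘ₛₗ (VIdeal.kappaIdeal p n R •
            (⊤ : Submodule (CalW p n R) D.P)).mkQ)) hz
        rw [BC.lift_of, map_zero, LinearMap.comp_apply, Submodule.mkQ_apply] at h
        rw [h, map_zero]
    obtain ⟨w, rfl⟩ := hD.mem_range_eps y hy
    rw [toCokerEps_eps]
  obtain ⟨s, hs⟩ := Module.projective_lifting_property π LinearMap.id hπs
  have hs' : ∀ z, π (s z) = z := fun z => LinearMap.congr_fun hs z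
  let r : BC (CalW.w0 p n R) D.P →ₗ[R] D.cokerEps :=
    (LinearEquiv.ofInjective j hjinj).symm.toLinearMap ∘ₗ
      LinearMap.codRestrict (LinearMap.range j) (LinearMap.id - s ∘ₗ π) (fun z => hker _ (by
        simp only [LinearMap.sub_apply, LinearMap.id_apply, LinearMap.comp_apply, map_sub, hs',
          sub_self]))
  refine ⟨r ∘ₛₗ BC.of (CalW.w0 p n R), fun y => ?_⟩
  rw [LinearMap.comp_apply, LinearMap.comp_apply, LinearEquiv.coe_coe,
    LinearEquiv.symm_apply_eq]
  refine Subtype.ext ?_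
  rw [LinearMap.codRestrict_apply, LinearEquiv.ofInjective_apply, hj, LinearMap.sub_apply,
    LinearMap.comp_apply, hπ, toCokerIota_iota, map_zero, sub_zero, LinearMap.id_apply]

/-- Base change preserves truncated displays. -/
theorem IsTruncatedDisplay.baseChange (hD : D.IsTruncatedDisplay) :
    (D.baseChange φ).IsTruncatedDisplay where
  finite := by
    have := hD.finite
    exact (inferInstance : Module.Finite (CalW p n S) (D.bcP φ))
  projective := by
    have := hD.projective
    exact (inferInstance : Module.Projective (CalW p n S) (D.bcP φ))
  finite_coker_iota := by
    have := hD.finite_coker_iota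
    exact Module.Finite.equiv (D.cokerIotaEquiv φ)
  projective_coker_iota := by
    have := hD.projective_coker_iota
    exact Module.Projective.of_equiv (D.cokerIotaEquiv φ)
  finite_coker_eps := by
    have := hD.finite_coker_eps
    exact Module.Finite.equiv (D.cokerEpsEquiv φ)
  projective_coker_eps := by
    have := hD.projective_coker_eps
    exact Module.Projective.of_equiv (D.cokerEpsEquiv φ)
  span_Fdot := by
    rw [eq_top_iff]
    rintro z -
    induction z using BC.induction with
    | zero => exact Submodule.zero_mem _
    | of x =>
      induction x using baseChange_P_induction with
      | of x =>
        have key : ∀ w : BC (CalW.res p n R) D.P, wMap φ (D.toBaseChange φ).mapP w ∈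
            Submodule.span (W p n S) (Set.range (D.baseChange φ).Fdot) := by
          intro w
          have hw : w ∈ Submodule.span (W p n R) (Set.range D.Fdot) := by
            rw [hD.span_Fdot]; trivial
          induction hw using Submodule.span_induction with
          | mem w h =>
            obtain ⟨y, rfl⟩ := h
            rw [← (D.toBaseChange φ).Fdot_comm]
            exact Submodule.subset_span ⟨_, rfl⟩
          | zero => rw [map_zero]; exact Submodule.zero_mem _
          | add x y _ _ hx hy => rw [map_add]; exact Submodule.add_mem _ hx hy
          | smul c x _ hx => rw [LinearMap.map_smulₛₗ]; exact Submodule.smul_mem _ _ hx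
        have h := key (BC.of _ x)
        rwa [wMap_of] at h
      | add x y hx hy => rw [map_add]; exact Submodule.add_mem _ hx hy
      | smul c x hx => rw [LinearMap.map_smulₛₗ]; exact Submodule.smul_mem _ _ hx
    | add x y hx hy => exact Submodule.add_mem _ hx hy
    | smul c x hx => exact Submodule.smul_mem _ _ hx
  mem_range_eps := by
    obtain ⟨r, hr⟩ := hD.exists_retraction
    let rS : (D.baseChange φ).P →ₛₗ[CalW.w0 p n S] (D.baseChange φ).cokerEps :=
      BC.lift (σ := CalW.map p n φ) (M := D.P) (CalW.w0 p n S) (w0_comp φ)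
        (semiComp (D.cokerEpsMap φ) r fun _ => RingHom.comp_apply _ _ _)
    have hrS : ∀ x, rS ((D.toBaseChange φ).mapP x) = D.cokerEpsMap φ (r x) := fun x =>
      (BC.lift_of ..).trans (semiComp_apply ..)
    have hrι : ∀ z, rS ((D.baseChange φ).iota z) = (D.baseChange φ).toCokerEps z := fun z => by
      induction z using baseChange_Q_induction with
      | of y => rw [(D.toBaseChange φ).iota_comm, hrS, hr, cokerEpsMap_apply]
      | eps b x =>
        rw [(D.baseChange φ).iota_eps, LinearMap.map_smulₛₗ, w0_kappa, zero_smul,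
          toCokerEps_eps]
      | add x y hx hy => rw [map_add, map_add, map_add, hx, hy]
      | smul c x hx => rw [map_smul, LinearMap.map_smulₛₗ, LinearMap.map_smulₛₗ, hx]
    intro z hz
    refine toCokerEps_eq_zero _ z ?_
    rw [← hrι]
    generalize (D.baseChange φ).iota z = x at hz
    induction hz using Submodule.smul_induction_on' with
    | smul a ha x _ =>
      obtain ⟨b, rfl⟩ := ha
      rw [LinearMap.map_smulₛₗ, w0_kappa, zero_smul]
    | add x _ y _ hx hy => rw [map_add, hx, hy, add_zero]

end Preservation

end Predisplay

/-! ### Descent data for truncated displays -/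

section DisplayDescent

namespace Predisplay

variable {p : ℕ} [Fact p.Prime] {n : ℕ}

section

variable {R S T U : Type u} [CommRing R] [CommRing S] [CommRing T] [CommRing U]

/-- The homomorphism `D_S → E_S` induced by `f : D → E`. -/
def baseChangeMap (φ : R →+* S) {D E : Predisplay p n R} (f : D ⟶ E) :
    D.baseChange φ ⟶ E.baseChange φ :=
  desc φ (RingHom.id_comp φ) (HomOver.comp (RingHom.comp_id φ) f (E.toBaseChange φ))

@[simp] theorem baseChangeMap_mapP (φ : R →+* S) {D E : Predisplay p n R} (f : D ⟶ E)
    (x : D.P) : HomOver.mapP (baseChangeMap φ f) ((D.toBaseChange φ).mapP x) =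
      (E.toBaseChange φ).mapP (f.mapP x) := by
  rw [baseChangeMap, desc_mapP, HomOver.comp_mapP]

@[simp] theorem baseChangeMap_mapQ (φ : R →+* S) {D E : Predisplay p n R} (f : D ⟶ E)
    (y : D.Q) : HomOver.mapQ (baseChangeMap φ f) ((D.toBaseChange φ).mapQ y) =
      (E.toBaseChange φ).mapQ (f.mapQ y) := by
  rw [baseChangeMap, desc_mapQ, HomOver.comp_mapQ]

theorem baseChangeMap_id (φ : R →+* S) (D : Predisplay p n R) :
    baseChangeMap φ (𝟙 D) = 𝟙 (D.baseChange φ) := by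
  refine baseChange_ext (fun x => ?_) (fun y => ?_)
  · rw [baseChangeMap_mapP, id_mapP, id_mapP]
  · rw [baseChangeMap_mapQ, id_mapQ, id_mapQ]

theorem baseChangeMap_comp (φ : R →+* S) {D E G : Predisplay p n R} (f : D ⟶ E) (g : E ⟶ G) :
    baseChangeMap φ (f ≫ g) = baseChangeMap φ f ≫ baseChangeMap φ g := by
  refine baseChange_ext (fun x => ?_) (fun y => ?_)
  · rw [comp_mapP, baseChangeMap_mapP, baseChangeMap_mapP, baseChangeMap_mapP, comp_mapP]
  · rw [comp_mapQ, baseChangeMap_mapQ, baseChangeMap_mapQ, baseChangeMap_mapQ, comp_mapQ]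

/-- The canonical homomorphism `D_S → D_T` over `q : S → T`, where `q ∘ φ = χ`. -/
def baseChangeTrans {φ : R →+* S} {q : S →+* T} {χ : R →+* T} (hq : q.comp φ = χ)
    (D : Predisplay p n R) : HomOver q (D.baseChange φ) (D.baseChange χ) :=
  desc φ hq (D.toBaseChange χ)

@[simp] theorem baseChangeTrans_mapP {φ : R →+* S} {q : S →+* T} {χ : R →+* T}
    (hq : q.comp φ = χ) (D : Predisplay p n R) (x : D.P) :
    (baseChangeTrans hq D).mapP ((D.toBaseChange φ).mapP x) = (D.toBaseChange χ).mapP x := by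
  rw [baseChangeTrans, desc_mapP]

@[simp] theorem baseChangeTrans_mapQ {φ : R →+* S} {q : S →+* T} {χ : R →+* T}
    (hq : q.comp φ = χ) (D : Predisplay p n R) (y : D.Q) :
    (baseChangeTrans hq D).mapQ ((D.toBaseChange φ).mapQ y) = (D.toBaseChange χ).mapQ y := by
  rw [baseChangeTrans, desc_mapQ]

/-- The base change along `q : T → U` of a homomorphism `α` between the base changes of `D`
along `φ₁, φ₂ : S → T`, as a homomorphism between the base changes of `D` along `q ∘ φ₁` and
`q ∘ φ₂`. -/
def pull {φ₁ φ₂ : S →+* T} {D : Predisplay p n S} (α : D.baseChange φ₁ ⟶ D.baseChange φ₂)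
    (q : T →+* U) {χ₁ χ₂ : S →+* U} (h₁ : q.comp φ₁ = χ₁) (h₂ : q.comp φ₂ = χ₂) :
    D.baseChange χ₁ ⟶ D.baseChange χ₂ :=
  desc χ₁ (RingHom.id_comp χ₁)
    (HomOver.comp h₁ (D.toBaseChange φ₁) (HomOver.comp (RingHom.comp_id q) α
      (baseChangeTrans h₂ D)))

theorem pull_mapP {φ₁ φ₂ : S →+* T} {D : Predisplay p n S}
    (α : D.baseChange φ₁ ⟶ D.baseChange φ₂) (q : T →+* U) {χ₁ χ₂ : S →+* U}
    (h₁ : q.comp φ₁ = χ₁) (h₂ : q.comp φ₂ = χ₂) (x : D.P) :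
    HomOver.mapP (pull α q h₁ h₂) ((D.toBaseChange χ₁).mapP x) =
      (baseChangeTrans h₂ D).mapP (α.mapP ((D.toBaseChange φ₁).mapP x)) := by
  rw [pull, desc_mapP, HomOver.comp_mapP, HomOver.comp_mapP]

theorem pull_mapQ {φ₁ φ₂ : S →+* T} {D : Predisplay p n S}
    (α : D.baseChange φ₁ ⟶ D.baseChange φ₂) (q : T →+* U) {χ₁ χ₂ : S →+* U}
    (h₁ : q.comp φ₁ = χ₁) (h₂ : q.comp φ₂ = χ₂) (y : D.Q) :
    HomOver.mapQ (pull α q h₁ h₂) ((D.toBaseChange χ₁).mapQ y) =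
      (baseChangeTrans h₂ D).mapQ (α.mapQ ((D.toBaseChange φ₁).mapQ y)) := by
  rw [pull, desc_mapQ, HomOver.comp_mapQ, HomOver.comp_mapQ]

/-- For `φ₁ ∘ φ = χ = φ₂ ∘ φ`, the canonical homomorphism `(D_φ)_{φ₁} → (D_φ)_{φ₂}`, compatible
with the canonical homomorphisms from `D`. -/
def canonicalHom {φ : R →+* S} {φ₁ φ₂ : S →+* T} {χ : R →+* T} (h₁ : φ₁.comp φ = χ)
    (h₂ : φ₂.comp φ = χ) (D : Predisplay p n R) :
    (D.baseChange φ).baseChange φ₁ ⟶ (D.baseChange φ).baseChange φ₂ :=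
  desc φ₁ (RingHom.id_comp φ₁) (desc φ h₁
    (HomOver.comp h₂ (D.toBaseChange φ) ((D.baseChange φ).toBaseChange φ₂)))

theorem canonicalHom_mapP {φ : R →+* S} {φ₁ φ₂ : S →+* T} {χ : R →+* T} (h₁ : φ₁.comp φ = χ)
    (h₂ : φ₂.comp φ = χ) (D : Predisplay p n R) (x : D.P) :
    HomOver.mapP (canonicalHom h₁ h₂ D)
        (((D.baseChange φ).toBaseChange φ₁).mapP ((D.toBaseChange φ).mapP x)) =
      ((D.baseChange φ).toBaseChange φ₂).mapP ((D.toBaseChange φ).mapP x) := by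
  rw [canonicalHom, desc_mapP, desc_mapP, HomOver.comp_mapP]

theorem canonicalHom_mapQ {φ : R →+* S} {φ₁ φ₂ : S →+* T} {χ : R →+* T} (h₁ : φ₁.comp φ = χ)
    (h₂ : φ₂.comp φ = χ) (D : Predisplay p n R) (y : D.Q) :
    HomOver.mapQ (canonicalHom h₁ h₂ D)
        (((D.baseChange φ).toBaseChange φ₁).mapQ ((D.toBaseChange φ).mapQ y)) =
      ((D.baseChange φ).toBaseChange φ₂).mapQ ((D.toBaseChange φ).mapQ y) := by
  rw [canonicalHom, desc_mapQ, desc_mapQ, HomOver.comp_mapQ]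

/-- Two homomorphisms out of `(D_φ)_{φ₁}` over `ψ` that agree on `D` are equal. -/
theorem baseChange_baseChange_ext {φ : R →+* S} {φ₁ : S →+* T} {ψ : T →+* U}
    {D : Predisplay p n R} {E : Predisplay p n U}
    {f g : HomOver ψ ((D.baseChange φ).baseChange φ₁) E}
    (hP : ∀ x, f.mapP (((D.baseChange φ).toBaseChange φ₁).mapP ((D.toBaseChange φ).mapP x)) =
      g.mapP (((D.baseChange φ).toBaseChange φ₁).mapP ((D.toBaseChange φ).mapP x)))
    (hQ : ∀ y, f.mapQ (((D.baseChange φ).toBaseChange φ₁).mapQ ((D.toBaseChange φ).mapQ y)) =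
      g.mapQ (((D.baseChange φ).toBaseChange φ₁).mapQ ((D.toBaseChange φ).mapQ y))) : f = g := by
  have key : HomOver.comp (χ := ψ.comp φ₁) rfl ((D.baseChange φ).toBaseChange φ₁) f =
      HomOver.comp rfl ((D.baseChange φ).toBaseChange φ₁) g := by
    refine baseChange_ext (fun x => ?_) (fun y => ?_)
    · rw [HomOver.comp_mapP, HomOver.comp_mapP]; exact hP x
    · rw [HomOver.comp_mapQ, HomOver.comp_mapQ]; exact hQ y
  refine baseChange_ext (fun x => ?_) (fun y => ?_)
  · have h := LinearMap.congr_fun (congrArg HomOver.mapP key) x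
    rwa [HomOver.comp_mapP, HomOver.comp_mapP] at h
  · have h := LinearMap.congr_fun (congrArg HomOver.mapQ key) y
    rwa [HomOver.comp_mapQ, HomOver.comp_mapQ] at h

theorem canonicalHom_comp {φ : R →+* S} {φ₁ φ₂ φ₃ : S →+* T} {χ : R →+* T}
    (h₁ : φ₁.comp φ = χ) (h₂ : φ₂.comp φ = χ) (h₃ : φ₃.comp φ = χ) (D : Predisplay p n R) :
    canonicalHom h₁ h₂ D ≫ canonicalHom h₂ h₃ D = canonicalHom h₁ h₃ D := by
  refine baseChange_baseChange_ext (fun x => ?_) (fun y => ?_)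
  · rw [comp_mapP, canonicalHom_mapP, canonicalHom_mapP, canonicalHom_mapP]
  · rw [comp_mapQ, canonicalHom_mapQ, canonicalHom_mapQ, canonicalHom_mapQ]

theorem canonicalHom_self {φ : R →+* S} {φ₁ : S →+* T} {χ : R →+* T}
    (h₁ : φ₁.comp φ = χ) (D : Predisplay p n R) :
    canonicalHom h₁ h₁ D = 𝟙 ((D.baseChange φ).baseChange φ₁) := by
  refine baseChange_baseChange_ext (fun x => ?_) (fun y => ?_)
  · rw [canonicalHom_mapP, id_mapP]
  · rw [canonicalHom_mapQ, id_mapQ]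

/-- The canonical isomorphism `(D_φ)_{φ₁} ≅ (D_φ)_{φ₂}` for `φ₁ ∘ φ = χ = φ₂ ∘ φ`. -/
def canonicalIso {φ : R →+* S} {φ₁ φ₂ : S →+* T} {χ : R →+* T} (h₁ : φ₁.comp φ = χ)
    (h₂ : φ₂.comp φ = χ) (D : Predisplay p n R) :
    (D.baseChange φ).baseChange φ₁ ≅ (D.baseChange φ).baseChange φ₂ where
  hom := canonicalHom h₁ h₂ D
  inv := canonicalHom h₂ h₁ D
  hom_inv_id := by rw [canonicalHom_comp, canonicalHom_self]
  inv_hom_id := by rw [canonicalHom_comp, canonicalHom_self]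

theorem canonicalHom_naturality {φ : R →+* S} {φ₁ φ₂ : S →+* T} {χ : R →+* T}
    (h₁ : φ₁.comp φ = χ) (h₂ : φ₂.comp φ = χ) {D E : Predisplay p n R} (f : D ⟶ E) :
    baseChangeMap φ₁ (baseChangeMap φ f) ≫ canonicalHom h₁ h₂ E =
      canonicalHom h₁ h₂ D ≫ baseChangeMap φ₂ (baseChangeMap φ f) := by
  refine baseChange_baseChange_ext (fun x => ?_) (fun y => ?_)
  · rw [comp_mapP, comp_mapP, baseChangeMap_mapP, baseChangeMap_mapP, canonicalHom_mapP,
      canonicalHom_mapP, baseChangeMap_mapP, baseChangeMap_mapP]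
  · rw [comp_mapQ, comp_mapQ, baseChangeMap_mapQ, baseChangeMap_mapQ, canonicalHom_mapQ,
      canonicalHom_mapQ, baseChangeMap_mapQ, baseChangeMap_mapQ]

theorem pull_canonicalHom {φ : R →+* S} {φ₁ φ₂ : S →+* T} {χ : R →+* T}
    (h₁ : φ₁.comp φ = χ) (h₂ : φ₂.comp φ = χ) (D : Predisplay p n R) (q : T →+* U)
    {χ₁ χ₂ : S →+* U} (hq₁ : q.comp φ₁ = χ₁) (hq₂ : q.comp φ₂ = χ₂) {χ' : R →+* U}
    (h₁' : χ₁.comp φ = χ') (h₂' : χ₂.comp φ = χ') :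
    pull (canonicalHom h₁ h₂ D) q hq₁ hq₂ = canonicalHom h₁' h₂' D := by
  refine baseChange_baseChange_ext (fun x => ?_) (fun y => ?_)
  · rw [pull_mapP, canonicalHom_mapP, canonicalHom_mapP, baseChangeTrans_mapP]
  · rw [pull_mapQ, canonicalHom_mapQ, canonicalHom_mapQ, baseChangeTrans_mapQ]

end


end Predisplay

section Coprojections

variable (R S : Type u) [CommRing R] [CommRing S] [Algebra R S]

/-- The homomorphism `p₁ : S → S ⊗_R S`, `s ↦ s ⊗ 1`. -/
def p₁ : S →ₐ[R] S ⊗[R] S := Algebra.TensorProduct.includeLeft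

/-- The homomorphism `p₂ : S → S ⊗_R S`, `s ↦ 1 ⊗ s`. -/
def p₂ : S →ₐ[R] S ⊗[R] S := Algebra.TensorProduct.includeRight

/-- The homomorphism `S → S ⊗_R S ⊗_R S`, `s ↦ s ⊗ 1 ⊗ 1`. -/
def q₁ : S →ₐ[R] S ⊗[R] (S ⊗[R] S) := Algebra.TensorProduct.includeLeft

/-- The homomorphism `S → S ⊗_R S ⊗_R S`, `s ↦ 1 ⊗ s ⊗ 1`. -/
def q₂ : S →ₐ[R] S ⊗[R] (S ⊗[R] S) := Algebra.TensorProduct.includeRight.comp (p₁ R S)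

/-- The homomorphism `S → S ⊗_R S ⊗_R S`, `s ↦ 1 ⊗ 1 ⊗ s`. -/
def q₃ : S →ₐ[R] S ⊗[R] (S ⊗[R] S) := Algebra.TensorProduct.includeRight.comp (p₂ R S)

variable {R S} {T : Type u} [CommRing T] [Algebra R T]

/-- The homomorphism `S ⊗_R S → T`, `s ⊗ s' ↦ f(s) g(s')`. -/
def pairMap (f g : S →ₐ[R] T) : S ⊗[R] S →ₐ[R] T := Algebra.TensorProduct.productMap f g

theorem pairMap_comp_p₁ (f g : S →ₐ[R] T) :
    (pairMap f g : S ⊗[R] S →+* T).comp (p₁ R S : S →+* S ⊗[R] S) = (f : S →+* T) :=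
  RingHom.ext fun s => Algebra.TensorProduct.productMap_left_apply f g s

theorem pairMap_comp_p₂ (f g : S →ₐ[R] T) :
    (pairMap f g : S ⊗[R] S →+* T).comp (p₂ R S : S →+* S ⊗[R] S) = (g : S →+* T) :=
  RingHom.ext fun s => Algebra.TensorProduct.productMap_right_apply f g s

theorem algHom_comp_algebraMap (f : S →ₐ[R] T) :
    (f : S →+* T).comp (algebraMap R S) = algebraMap R T :=
  f.comp_algebraMap

end Coprojections

variable (p : ℕ) [Fact p.Prime] (n : ℕ) (R S : Type u) [CommRing R] [CommRing S] [Algebra R S]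

variable {p n R S} in
/-- For an isomorphism `α : (p₁)_* D → (p₂)_* D` over `S ⊗_R S` and `f, g : S → T`, the
homomorphism `f_* D → g_* D` over `T` obtained from `α` by base change along
`S ⊗_R S → T`, `s ⊗ s' ↦ f(s) g(s')`. -/
def Predisplay.pullPair {D : Predisplay p n S}
    (α : D.baseChange (p₁ R S : S →+* S ⊗[R] S) ⟶ D.baseChange (p₂ R S : S →+* S ⊗[R] S))
    {T : Type u} [CommRing T] [Algebra R T] (f g : S →ₐ[R] T) :
    D.baseChange (f : S →+* T) ⟶ D.baseChange (g : S →+* T) :=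
  Predisplay.pull α (pairMap f g : S ⊗[R] S →+* T) (pairMap_comp_p₁ f g) (pairMap_comp_p₂ f g)

/-- A predisplay over `S` with a descent datum relative to `S / R`. -/
structure DescentDatum where
  /-- The predisplay over `S`. -/
  obj : Predisplay p n S
  /-- The isomorphism over `S ⊗_R S`. -/
  iso : obj.baseChange (p₁ R S : S →+* S ⊗[R] S) ≅ obj.baseChange (p₂ R S : S →+* S ⊗[R] S)
  cocycle : Predisplay.pullPair iso.hom (q₁ R S) (q₃ R S) =
    Predisplay.pullPair iso.hom (q₁ R S) (q₂ R S) ≫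
      Predisplay.pullPair iso.hom (q₂ R S) (q₃ R S)

namespace DescentDatum

variable {p n R S}

/-- A homomorphism of predisplays over `S` that is compatible with the descent data. -/
@[ext]
structure Hom (D E : DescentDatum p n R S) where
  /-- The homomorphism of predisplays. -/
  hom : D.obj ⟶ E.obj
  comm : Predisplay.baseChangeMap (p₁ R S : S →+* S ⊗[R] S) hom ≫ E.iso.hom =
    D.iso.hom ≫ Predisplay.baseChangeMap (p₂ R S : S →+* S ⊗[R] S) hom

instance : Category (DescentDatum p n R S) where
  Hom := Hom
  id D :=
    { hom := 𝟙 D.obj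
      comm := by
        rw [Predisplay.baseChangeMap_id, Predisplay.baseChangeMap_id, Category.id_comp,
          Category.comp_id] }
  comp f g :=
    { hom := f.hom ≫ g.hom
      comm := by
        rw [Predisplay.baseChangeMap_comp, Predisplay.baseChangeMap_comp, Category.assoc, g.comm,
          ← Category.assoc, f.comm, Category.assoc] }
  id_comp f := Hom.ext (Category.id_comp f.hom)
  comp_id f := Hom.ext (Category.comp_id f.hom)
  assoc f g h := Hom.ext (Category.assoc f.hom g.hom h.hom)

/-- The base change of a predisplay from `R` to `S` with its canonical descent datum. -/
def ofBaseChange (D : Predisplay p n R) : DescentDatum p n R S where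
  obj := D.baseChange (algebraMap R S)
  iso := Predisplay.canonicalIso (algHom_comp_algebraMap (p₁ R S))
    (algHom_comp_algebraMap (p₂ R S)) D
  cocycle := by
    have h : ∀ f g : S →ₐ[R] S ⊗[R] (S ⊗[R] S),
        Predisplay.pullPair (Predisplay.canonicalIso (algHom_comp_algebraMap (p₁ R S))
          (algHom_comp_algebraMap (p₂ R S)) D).hom f g =
        Predisplay.canonicalHom (algHom_comp_algebraMap f) (algHom_comp_algebraMap g) D :=
      fun f g => Predisplay.pull_canonicalHom _ _ _ _ _ _ _ _
    rw [h, h, h, Predisplay.canonicalHom_comp]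

variable (p n R S)

/-- The base change functor from predisplays over `R` to predisplays over `S` with a descent
datum. -/
def baseChangeFunctor : Predisplay p n R ⥤ DescentDatum p n R S where
  obj D := ofBaseChange D
  map f :=
    { hom := Predisplay.baseChangeMap (algebraMap R S) f
      comm := Predisplay.canonicalHom_naturality _ _ f }
  map_id D := Hom.ext (Predisplay.baseChangeMap_id _ D)
  map_comp f g := Hom.ext (Predisplay.baseChangeMap_comp _ f g)

end DescentDatum

variable [NeZero n]

/-- The category `𝒟_n(R)` of truncated displays of level `n` over `R`. -/
abbrev TruncatedDisplay : Type (u + 1) :=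
  ObjectProperty.FullSubcategory
    (fun D : Predisplay p n R => D.IsTruncatedDisplay)

/-- The category of truncated displays of level `n` over `S` with a descent datum relative to
`S / R`. -/
abbrev TruncatedDisplayWithDescentDatum : Type (u + 1) :=
  ObjectProperty.FullSubcategory
    (fun D : DescentDatum p n R S => D.obj.IsTruncatedDisplay)

/-- The base change functor from truncated displays over `R` to truncated displays over `S` with
a descent datum. -/
def TruncatedDisplay.baseChangeFunctor :
    TruncatedDisplay p n R ⥤ TruncatedDisplayWithDescentDatum p n R S :=
  ObjectProperty.lift _ (ObjectProperty.ι _ ⋙ DescentDatum.baseChangeFunctor p n R S)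
    (fun D => D.property.baseChange (algebraMap R S))

end DisplayDescent

/-! ### The Čech complex and descent for modules -/

section ModuleDescent

section Cech

variable (R S : Type u) [CommRing R] [CommRing S] [Algebra R S]

/-- The `k`-fold tensor product `S ⊗_R ⋯ ⊗_R S`. -/
abbrev TensorPower (k : ℕ) : Type u := ⨂[R] (_ : Fin k), S

/-- The homomorphism `s ↦ 1 ⊗ ⋯ ⊗ s ⊗ ⋯ ⊗ 1`, with `s` in position `i`. -/
def slot {k : ℕ} (i : Fin k) : S →ₐ[R] TensorPower R S k :=
  PiTensorProduct.singleAlgHom (A := fun _ : Fin k => S) i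

/-- The multilinear map underlying `coface`. -/
def cofaceAux {k : ℕ} (i : Fin (k + 1)) :
    MultilinearMap R (fun _ : Fin k => S) (TensorPower R S (k + 1)) :=
  (MultilinearMap.mkPiAlgebra R (Fin k) (TensorPower R S (k + 1))).compLinearMap
    fun j => (slot R S (i.succAbove j)).toLinearMap

theorem cofaceAux_apply {k : ℕ} (i : Fin (k + 1)) (s : Fin k → S) :
    cofaceAux R S i s = ∏ j, slot R S (i.succAbove j) (s j) := by
  rw [cofaceAux, MultilinearMap.compLinearMap_apply, MultilinearMap.mkPiAlgebra_apply]
  rfl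

/-- The homomorphism `s_0 ⊗ ⋯ ⊗ s_{k-1} ↦ s_0 ⊗ ⋯ ⊗ 1 ⊗ ⋯ ⊗ s_{k-1}`, with `1` inserted in
position `i`. -/
def coface {k : ℕ} (i : Fin (k + 1)) : TensorPower R S k →ₐ[R] TensorPower R S (k + 1) :=
  PiTensorProduct.liftAlgHom (cofaceAux R S i)
    (by simp only [cofaceAux_apply, Pi.one_apply, map_one, Finset.prod_const_one])
    (fun x y => by
      simp only [cofaceAux_apply, Pi.mul_apply, map_mul, Finset.prod_mul_distrib])

theorem coface_slot {k : ℕ} (i : Fin (k + 1)) (j : Fin k) :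
    (coface R S i : TensorPower R S k →+* TensorPower R S (k + 1)).comp
      (slot R S j : S →+* TensorPower R S k) =
        (slot R S (i.succAbove j) : S →+* TensorPower R S (k + 1)) := by
  refine RingHom.ext fun s => ?_
  change coface R S i (slot R S j s) = slot R S (i.succAbove j) s
  rw [coface, slot, PiTensorProduct.singleAlgHom_apply, PiTensorProduct.liftAlgHom_apply,
    PiTensorProduct.lift.tprod, cofaceAux_apply, Finset.prod_eq_single j]
  · rw [MonoidHom.mulSingle_apply, Pi.mulSingle_eq_same]
  · intro l _ hl
    rw [MonoidHom.mulSingle_apply, Pi.mulSingle_eq_of_ne hl, map_one]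
  · simp

variable (p : ℕ) [Fact p.Prime] (n : ℕ)

/-- The differential `∑ (-1)^i 𝒲_n(δ_i)` of the Čech complex of `𝒲_n`, where `δ_i` inserts `1`
in position `i`. -/
def cechD (k : ℕ) : CalW p n (TensorPower R S k) →+ CalW p n (TensorPower R S (k + 1)) :=
  ∑ i : Fin (k + 1), (-1 : ℤ) ^ (i : ℕ) •
    (CalW.map p n (coface R S i : TensorPower R S k →+* TensorPower R S (k + 1))).toAddMonoidHom

end Cech

variable {p : ℕ} [Fact p.Prime] {n : ℕ} {R S : Type u} [CommRing R] [CommRing S] [Algebra R S]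
variable {P : Type u} [AddCommGroup P] [Module (CalW p n S) P]

/-- For a map `∇ : 𝒲_n(S ⊗_R S) ⊗_{p₁} P → 𝒲_n(S ⊗_R S) ⊗_{p₂} P` and `f, g : S → T`, the map
`𝒲_n(T) ⊗_f P → 𝒲_n(T) ⊗_g P` obtained from `∇` by base change along
`S ⊗_R S → T`, `s ⊗ s' ↦ f(s) g(s')`. -/
def nablaAlong (nabla : BC (CalW.map p n (p₁ R S : S →+* S ⊗[R] S)) P →ₗ[CalW p n (S ⊗[R] S)]
      BC (CalW.map p n (p₂ R S : S →+* S ⊗[R] S)) P)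
    {T : Type u} [CommRing T] [Algebra R T] (f g : S →ₐ[R] T) :
    BC (CalW.map p n (f : S →+* T)) P →ₗ[CalW p n T] BC (CalW.map p n (g : S →+* T)) P :=
  BC.lift (RingHom.id _) (γ := CalW.map p n (f : S →+* T)) (fun _ => rfl)
    (semiComp
      (BC.trans (CalW.map p n (pairMap f g : S ⊗[R] S →+* T))
        (Predisplay.calWMap_comp' (pairMap_comp_p₂ f g)))
      (nabla ∘ₛₗ BC.of (CalW.map p n (p₁ R S : S →+* S ⊗[R] S)))
      (Predisplay.calWMap_comp' (pairMap_comp_p₁ f g)))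

variable (p n R S P) in
/-- A `𝒲_n`-descent datum relative to `S / R` on a `𝒲_n(S)`-module `P`. -/
structure ModuleDescentDatum where
  /-- The isomorphism over `𝒲_n(S ⊗_R S)`. -/
  nabla : BC (CalW.map p n (p₁ R S : S →+* S ⊗[R] S)) P ≃ₗ[CalW p n (S ⊗[R] S)]
    BC (CalW.map p n (p₂ R S : S →+* S ⊗[R] S)) P
  cocycle : nablaAlong nabla.toLinearMap (q₁ R S) (q₃ R S) =
    nablaAlong nabla.toLinearMap (q₂ R S) (q₃ R S) ∘ₗ
      nablaAlong nabla.toLinearMap (q₁ R S) (q₂ R S)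

namespace ModuleDescentDatum

variable (D : ModuleDescentDatum p n R S P)

/-- The module `𝒲_n(S ⊗_R ⋯ ⊗_R S) ⊗_{𝒲_n(S)} P` with `k + 1` tensor factors, the
`𝒲_n(S)`-module structure of the first factor being via the last tensor factor. -/
abbrev Cochain (_ : ModuleDescentDatum p n R S P) (k : ℕ) : Type u :=
  BC (CalW.map p n (slot R S (Fin.last k) : S →+* TensorPower R S (k + 1))) P

/-- The map induced by inserting `1` in position `i`, where `i` is not the last position. -/
def face (k : ℕ) (i : Fin (k + 1)) : D.Cochain k →+ D.Cochain (k + 1) :=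
  (BC.trans (CalW.map p n (coface R S i.castSucc : TensorPower R S (k + 1) →+* _))
    (Predisplay.calWMap_comp' (by
      rw [coface_slot, Fin.succAbove_castSucc_of_le _ _ (Fin.le_last i), Fin.succ_last]))
    : D.Cochain k →ₛₗ[_] D.Cochain (k + 1)).toAddMonoidHom

/-- The map `w ⊗ x ↦ (w ⊗ 1) ∇(1 ⊗ x)`: first `1` is inserted in the last position, then `∇` is
applied in the last two positions. -/
def lastFace (k : ℕ) : D.Cochain k →+ D.Cochain (k + 1) :=
  (nablaAlong D.nabla.toLinearMap (slot R S (Fin.last k).castSucc)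
    (slot R S (Fin.last (k + 1)))).toAddMonoidHom.comp
  (BC.trans (CalW.map p n (coface R S (Fin.last (k + 1)) : TensorPower R S (k + 1) →+* _))
    (Predisplay.calWMap_comp' (by rw [coface_slot, Fin.succAbove_last]))
    : D.Cochain k →ₛₗ[_]
      BC (CalW.map p n (slot R S (Fin.last k).castSucc : S →+* TensorPower R S (k + 2))) P
    ).toAddMonoidHom

/-- The differential of the complex associated to a descent datum. -/
def d (k : ℕ) : D.Cochain k →+ D.Cochain (k + 1) :=
  ∑ i : Fin (k + 1), (-1 : ℤ) ^ (i : ℕ) • D.face k i + (-1 : ℤ) ^ (k + 1) • D.lastFace k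

/-- The kernel `P_0` of the first arrow, that is, `{x ∈ P | ∇(1 ⊗ x) = 1 ⊗ x}`. -/
def invariants : AddSubgroup P where
  carrier := {x | D.nabla (BC.of _ x) = BC.of _ x}
  zero_mem' := by
    rw [Set.mem_ofPred_eq, map_zero, map_zero, map_zero]
  add_mem' {x y} hx hy := by
    rw [Set.mem_ofPred_eq] at hx hy ⊢
    rw [map_add, map_add, map_add, hx, hy]
  neg_mem' {x} hx := by
    rw [Set.mem_ofPred_eq] at hx ⊢
    rw [map_neg, map_neg, map_neg, hx]

theorem mem_invariants (x : P) : x ∈ D.invariants ↔ D.nabla (BC.of _ x) = BC.of _ x := Iff.rfl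

theorem smul_mem_invariants (r : CalW p n R) {x : P} (hx : x ∈ D.invariants) :
    CalW.map p n (algebraMap R S) r • x ∈ D.invariants := by
  rw [mem_invariants] at hx ⊢
  rw [LinearMap.map_smulₛₗ, LinearMap.map_smulₛₗ, map_smul, hx, ← CalW.map_comp,
    ← CalW.map_comp, algHom_comp_algebraMap, algHom_comp_algebraMap]

/-- The `𝒲_n(R)`-module structure of `P_0`. -/
instance : Module (CalW p n R) D.invariants where
  smul r x := ⟨CalW.map p n (algebraMap R S) r • (x : P), D.smul_mem_invariants r x.2⟩
  one_smul x := Subtype.ext (by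
    change CalW.map p n (algebraMap R S) 1 • (x : P) = x
    rw [map_one, one_smul])
  mul_smul r s x := Subtype.ext (by
    change CalW.map p n (algebraMap R S) (r * s) • (x : P) =
      CalW.map p n (algebraMap R S) r • CalW.map p n (algebraMap R S) s • (x : P)
    rw [map_mul, mul_smul])
  smul_zero r := Subtype.ext (smul_zero (CalW.map p n (algebraMap R S) r))
  smul_add r x y := Subtype.ext (smul_add (CalW.map p n (algebraMap R S) r) (x : P) y)
  add_smul r s x := Subtype.ext (by
    change CalW.map p n (algebraMap R S) (r + s) • (x : P) =
      CalW.map p n (algebraMap R S) r • (x : P) + CalW.map p n (algebraMap R S) s • (x : P)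
    rw [map_add, add_smul])
  zero_smul x := Subtype.ext (by
    change CalW.map p n (algebraMap R S) 0 • (x : P) = 0
    rw [map_zero, zero_smul])

/-- The canonical map `𝒲_n(S) ⊗_{𝒲_n(R)} P_0 → P`. -/
def fromInvariants :
    BC (CalW.map p n (algebraMap R S)) D.invariants →ₗ[CalW p n S] P :=
  BC.lift (RingHom.id _) (γ := CalW.map p n (algebraMap R S)) (fun _ => rfl)
    { toFun x := (x : P)
      map_add' _ _ := rfl
      map_smul' _ _ := rfl }

end ModuleDescentDatum

end ModuleDescent
end
end TruncDisp

namespace TruncDisp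

open TensorProduct CategoryTheory

noncomputable section

/-! ### Base change maps -/

section IsBC

variable {A B C : Type*} [CommRing A] [CommRing B] [CommRing C] {σ : A →+* B} {τ : B →+* C}
  {γ : A →+* C} {M N K : Type*} [AddCommGroup M] [Module A M] [AddCommGroup N] [Module B N]
  [AddCommGroup K] [Module C K]

/-! Everything rests on the Verschiebung filtration. The kernel of W(T) → 𝒲_n(T) consists of the
vectors with x_i = 0 for i < n and p x_n = 0 (`CalW.proj_eq_zero_iff`). Hence 𝒲_n(T) is filtered by
the images of V^m W(T) for 0 ≤ m ≤ n, and the graded pieces are T for m < n, acted on through the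
ghost component w_m, and T/T[p] for m = n, acted on through w_n. The functors T ↦ T and T ↦ T[p]
commute with flat base change.

Let M be a module over the Čech nerve that is flat in every degree and Cartesian for the face
inserting 1 in front. Its tensor product with such a linear functor is a classical Amitsur complex:
S ⊗_R of it is the same complex shifted by one, with the face 0 omitted, and multiplication of the
first two tensor factors contracts it (`altSum_exact`, `altSum_descent`). Dévissage along the
filtration gives exactness in positive degrees for M itself (`CechModule.IsCartesian.exact`). This
covers 𝒲_n, and also the complex of a descent datum, because the cocycle condition turns the base
changes of P into such an M (`ModuleDescentDatum.cech`). Exactness at 𝒲_n(S) is a computation with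
Witt coefficients that uses R ∩ pS = pR (`CalW.exists_of_map_eq`).

For the descent of modules, p nilpotent makes the kernel of w_0 : 𝒲_n → R nilpotent
(`CalW.isNilpotent_ker_w0`). The reduction of P along w_0 descends classically to a finitely
generated projective R-module, and this lifts to a projective 𝒲_n(R)-module P'. The first cohomology
of the first filtration step vanishes, so invariants of the reduction lift to invariants of P. This
gives a map from P' to the invariants; it induces an isomorphism over 𝒲_n(S) by Nakayama, and P' is
then all of the invariants, because tensoring with a flat module preserves the equalizer 𝒲_n(R) →
𝒲_n(S) ⇉ 𝒲_n(S ⊗_R S).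

For displays the difficulty is Q, which need not be flat. It is controlled by normal decompositions
P = T ⊕ L, Q = I ⊗ T ⊕ L. That I ⊗ T ⊕ L → Q is injective follows from Ḟ: it induces a surjection
W_n ⊗_F (T ⊕ L) → W_n ⊗_Res P of projective modules of the same rank, as F(a) ≡ Res(a)^p modulo
nilpotents (`Predisplay.IsNormal.of_surjective`). So Q, like P, is the equalizer of the two maps
from Q_S, and base change is fully faithful.

For effectivity, take the invariants of P and of Q over S. The cokernel of ι descends to R and lifts
to a summand T of the invariants of P. A complement L maps into ι(Q). It lifts to invariants of Q,
because the kernel of ι is the p-torsion of the ring tensored with T, whose Čech complex is acyclic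
in degree 1 (`DescentDatum.exists_invariant_lift`). The resulting normal decomposition over S is
defined over R, so the invariants have a normal decomposition too; this yields the axioms over R and
the isomorphism of their base change with the given display. -/

@[simp] theorem BC.lift_id_of (f : M →ₛₗ[σ] N) (x : M) :
    BC.lift (RingHom.id B) (γ := σ) (fun _ => rfl) f (BC.of σ x) = f x :=
  BC.lift_of ..

/-- The semilinear map `f : M → N` over `σ : A → B` induces an isomorphism
`B ⊗_{σ, A} M ≅ N`. -/
def IsBC (f : M →ₛₗ[σ] N) : Prop :=
  Function.Bijective (BC.lift (RingHom.id B) (γ := σ) (fun _ => rfl) f)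

theorem isBC_of (σ : A →+* B) (M : Type*) [AddCommGroup M] [Module A M] :
    IsBC (BC.of σ : M →ₛₗ[σ] BC σ M) := by
  have : BC.lift (RingHom.id B) (γ := σ) (fun _ => rfl) (BC.of σ : M →ₛₗ[σ] BC σ M) =
      LinearMap.id := BC.ext_of fun x => by simp
  rw [IsBC, this]
  exact Function.bijective_id

namespace IsBC

/-- The isomorphism given by a base change map. -/
def equiv {f : M →ₛₗ[σ] N} (hf : IsBC f) : BC σ M ≃ₗ[B] N :=
  LinearEquiv.ofBijective _ hf

@[simp] theorem equiv_of {f : M →ₛₗ[σ] N} (hf : IsBC f) (x : M) :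
    hf.equiv (BC.of σ x) = f x :=
  BC.lift_id_of f x

@[simp] theorem equiv_symm {f : M →ₛₗ[σ] N} (hf : IsBC f) (x : M) :
    hf.equiv.symm (f x) = BC.of σ x := by
  rw [LinearEquiv.symm_apply_eq, equiv_of]

/-- The extension of a semilinear map along a base change map. -/
def lift {f : M →ₛₗ[σ] N} (hf : IsBC f) (τ : B →+* C) (h : ∀ a, γ a = τ (σ a))
    (g : M →ₛₗ[γ] K) : N →ₛₗ[τ] K :=
  (BC.lift τ h g) ∘ₛₗ hf.equiv.symm.toLinearMap

@[simp] theorem lift_apply {f : M →ₛₗ[σ] N} (hf : IsBC f) (h : ∀ a, γ a = τ (σ a))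
    (g : M →ₛₗ[γ] K) (x : M) : hf.lift τ h g (f x) = g x := by
  rw [lift, LinearMap.comp_apply, LinearEquiv.coe_coe, equiv_symm, BC.lift_of]

theorem induction {f : M →ₛₗ[σ] N} (hf : IsBC f) {motive : N → Prop} (x : N)
    (of : ∀ m, motive (f m)) (add : ∀ x y, motive x → motive y → motive (x + y))
    (smul : ∀ (b : B) x, motive x → motive (b • x)) : motive x := by
  obtain ⟨x, rfl⟩ := hf.equiv.surjective x
  induction x using BC.induction with
  | zero => have := of 0; rwa [map_zero] at this ⊢
  | of m => rw [equiv_of]; exact of m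
  | add x y hx hy => rw [map_add]; exact add _ _ hx hy
  | smul b x hx => rw [map_smul]; exact smul _ _ hx

theorem ext {f : M →ₛₗ[σ] N} (hf : IsBC f) {g h : N →ₛₗ[τ] K} (hgh : ∀ x, g (f x) = h (f x))
    (x : N) : g x = h x := by
  induction x using hf.induction with
  | of m => exact hgh m
  | add x y hx hy => rw [map_add, map_add, hx, hy]
  | smul b x hx => rw [LinearMap.map_smulₛₗ, LinearMap.map_smulₛₗ, hx]

/-- The isomorphism `C ⊗ M ≅ C ⊗ N` for a base change map `M → N`. -/
def trans {f : M →ₛₗ[σ] N} (hf : IsBC f) (τ : B →+* C) (h : ∀ a, γ a = τ (σ a)) :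
    BC γ M ≃ₗ[C] BC τ N :=
  LinearEquiv.ofLinearMap
    (BC.lift (RingHom.id C) (γ := γ) (fun _ => rfl) (semiComp (BC.of τ) f h))
    (BC.lift (RingHom.id C) (γ := τ) (fun _ => rfl) (hf.lift τ h (BC.of γ)))
    (BC.ext_of fun x => by
      refine hf.ext (g := (LinearMap.comp (BC.lift (RingHom.id C) (γ := γ) (fun _ => rfl)
        (semiComp (BC.of τ) f h)) (BC.lift (RingHom.id C) (γ := τ) (fun _ => rfl)
          (hf.lift τ h (BC.of γ)))) ∘ₛₗ BC.of τ) (h := BC.of τ) (fun x => ?_) x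
      simp)
    (BC.ext_of fun x => by simp)

theorem trans_of {f : M →ₛₗ[σ] N} (hf : IsBC f) (h : ∀ a, γ a = τ (σ a)) (x : M) :
    hf.trans τ h (BC.of γ x) = BC.of τ (f x) :=
  BC.lift_id_of _ x

/-- Transitivity of extension of scalars, C ⊗_A M ≅ C ⊗_B N, carries the linear extension of `k` to
that of `g`. Most identifications of base changes below are obtained from this criterion and not
from explicit isomorphisms. -/
theorem iff_comp {f : M →ₛₗ[σ] N} (hf : IsBC f) {g : N →ₛₗ[τ] K} {k : M →ₛₗ[γ] K}
    (h : ∀ a, γ a = τ (σ a)) (hk : ∀ x, k x = g (f x)) : IsBC g ↔ IsBC k := by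
  have : BC.lift (RingHom.id C) (γ := γ) (fun _ => rfl) k =
      BC.lift (RingHom.id C) (γ := τ) (fun _ => rfl) g ∘ₗ (hf.trans τ h).toLinearMap :=
    BC.ext_of fun x => by
      rw [BC.lift_of, LinearMap.comp_apply, LinearEquiv.coe_coe, trans_of, BC.lift_of, hk]
  rw [IsBC, IsBC, this, LinearMap.coe_comp, LinearEquiv.coe_coe]
  exact ((hf.trans τ h).bijective.of_comp_iff _).symm

theorem comp {f : M →ₛₗ[σ] N} (hf : IsBC f) {g : N →ₛₗ[τ] K} (hg : IsBC g) {k : M →ₛₗ[γ] K}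
    (h : ∀ a, γ a = τ (σ a)) (hk : ∀ x, k x = g (f x)) : IsBC k :=
  (hf.iff_comp h hk).1 hg

theorem of_comp {f : M →ₛₗ[σ] N} (hf : IsBC f) {g : N →ₛₗ[τ] K} {k : M →ₛₗ[γ] K} (hk : IsBC k)
    (h : ∀ a, γ a = τ (σ a)) (hkg : ∀ x, k x = g (f x)) : IsBC g :=
  (hf.iff_comp h hkg).2 hk

theorem finite {f : M →ₛₗ[σ] N} (hf : IsBC f) [Module.Finite A M] : Module.Finite B N :=
  Module.Finite.equiv hf.equiv

theorem projective {f : M →ₛₗ[σ] N} (hf : IsBC f) [Module.Projective A M] :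
    Module.Projective B N :=
  Module.Projective.of_equiv hf.equiv

/-- A retract of a base change map is a base change map. -/
theorem retract {f : M →ₛₗ[σ] N} (hf : IsBC f) {M' N' : Type*} [AddCommGroup M'] [Module A M']
    [AddCommGroup N'] [Module B N'] {f' : M' →ₛₗ[σ] N'} (i : M' →ₗ[A] M) (r : M →ₗ[A] M')
    (i' : N' →ₗ[B] N) (r' : N →ₗ[B] N') (hr : ∀ x, r (i x) = x) (hr' : ∀ x, r' (i' x) = x)
    (hi : ∀ x, i' (f' x) = f (i x)) (hrf : ∀ x, r' (f x) = f' (r x)) : IsBC f' := by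
  let I : BC σ M' →ₗ[B] BC σ M := BC.map (RingHom.id B) (α := RingHom.id A) (fun _ => rfl) i
  let Q : BC σ M →ₗ[B] BC σ M' := BC.map (RingHom.id B) (α := RingHom.id A) (fun _ => rfl) r
  let inv : N' →ₗ[B] BC σ M' := Q ∘ₗ hf.equiv.symm.toLinearMap ∘ₗ i'
  have h1 : inv ∘ₗ BC.lift (RingHom.id B) (γ := σ) (fun _ => rfl) f' = LinearMap.id :=
    BC.ext_of fun x => by
      simp only [inv, Q, LinearMap.comp_apply, BC.lift_of, hi, LinearEquiv.coe_coe, equiv_symm,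
        BC.map_of, hr, LinearMap.id_apply]
  have h2 : ∀ z, BC.lift (RingHom.id B) (γ := σ) (fun _ => rfl) f' (Q z) = r' (hf.equiv z) := by
    refine fun z => LinearMap.congr_fun (f := BC.lift (RingHom.id B) (γ := σ) (fun _ => rfl) f' ∘ₗ Q)
      (g := r' ∘ₗ hf.equiv.toLinearMap) (BC.ext_of fun x => ?_) z
    simp only [Q, LinearMap.comp_apply, BC.lift_of, BC.map_of, LinearEquiv.coe_coe, equiv_of, hrf]
  refine ⟨Function.LeftInverse.injective (g := inv) fun x => LinearMap.congr_fun h1 x,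
    Function.RightInverse.surjective (g := inv) fun x => ?_⟩
  simp only [inv, LinearMap.comp_apply, LinearEquiv.coe_coe, h2, LinearEquiv.apply_symm_apply, hr']

/-- A bijective map over an isomorphism of rings is a base change map. -/
theorem of_bijective {f : M →ₛₗ[σ] N} (hσ : Function.Bijective σ) (hf : Function.Bijective f) :
    IsBC f := by
  have hs := BC.of_surjective (σ := σ) (M := M) hσ.2
  refine ⟨?_, fun y => ?_⟩
  · intro x y hxy
    obtain ⟨x, rfl⟩ := hs x
    obtain ⟨y, rfl⟩ := hs y
    rw [BC.lift_of, BC.lift_of] at hxy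
    rw [hf.1 hxy]
  · obtain ⟨x, rfl⟩ := hf.2 y
    exact ⟨BC.of σ x, BC.lift_of ..⟩

theorem bijective {f : M →ₛₗ[σ] N} (hf : IsBC f) (hσ : Function.Bijective σ) :
    Function.Bijective f := by
  have h1 : Function.Bijective (BC.of σ : M → BC σ M) := ⟨BC.of_injective hσ.2 fun a ha x => by
    rw [(injective_iff_map_eq_zero σ).1 hσ.1 a ha, zero_smul], BC.of_surjective hσ.2⟩
  have h2 := Function.Bijective.comp hf h1
  convert h2 using 1
  ext x
  exact (BC.lift_of ..).symm

theorem surjective {f : M →ₛₗ[σ] N} (hf : IsBC f) (hσ : Function.Surjective σ) :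
    Function.Surjective f := fun y => by
  obtain ⟨x, rfl⟩ := hf.2 y
  obtain ⟨x, rfl⟩ := BC.of_surjective hσ x
  exact ⟨x, (BC.lift_of ..).symm⟩

/-- For surjective `σ` the base change is M/(ker σ)M: this quotient is annihilated by ker σ, so it
embeds into its own extension of scalars, and the quotient map of M factors over N. -/
theorem mem_ker_smul {f : M →ₛₗ[σ] N} (hf : IsBC f) (hσ : Function.Surjective σ) {x : M}
    (hx : f x = 0) : x ∈ RingHom.ker σ • (⊤ : Submodule A M) := by
  rw [← Submodule.Quotient.mk_eq_zero]
  refine BC.of_injective (σ := σ) hσ ?_ ?_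
  · intro a ha y
    obtain ⟨y, rfl⟩ := Submodule.mkQ_surjective _ y
    rw [← map_smul, Submodule.mkQ_apply, Submodule.Quotient.mk_eq_zero]
    exact Submodule.smul_mem_smul ha trivial
  · have h := hf.lift_apply (τ := RingHom.id B) (γ := σ) (fun _ => rfl)
      (BC.of σ ∘ₛₗ (RingHom.ker σ • (⊤ : Submodule A M)).mkQ) x
    rw [hx, map_zero] at h
    rw [map_zero]
    exact h.symm

end IsBC

/-- For the structure map of an algebra, base change maps can be tested on the tensor
product. -/
theorem isBC_algebraMap_iff {R S : Type*} [CommRing R] [CommRing S] [Algebra R S] {M N : Type*}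
    [AddCommGroup M] [Module R M] [AddCommGroup N] [Module S N]
    {f : M →ₛₗ[algebraMap R S] N} {g : S ⊗[R] M →ₗ[S] N}
    (hg : ∀ x, g (1 ⊗ₜ x) = f x) : IsBC f ↔ Function.Bijective g := by
  let o : M →ₛₗ[algebraMap R S] S ⊗[R] M :=
    { toFun x := 1 ⊗ₜ x
      map_add' x y := tmul_add _ _ _
      map_smul' r x := by rw [← smul_tmul, Algebra.smul_def, mul_one, smul_tmul', smul_eq_mul,
        mul_one] }
  let e : BC (algebraMap R S) M →ₗ[S] S ⊗[R] M :=
    BC.lift (RingHom.id S) (γ := algebraMap R S) (fun _ => rfl) o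
  let l : S ⊗[R] M →+ BC (algebraMap R S) M := TensorProduct.liftAddHom
    { toFun s :=
        { toFun x := s • BC.of (algebraMap R S) x
          map_zero' := by simp
          map_add' x y := by simp }
      map_zero' := by ext; simp
      map_add' b c := by ext; simp [add_smul] } (by
        intro r s x
        change (r • s) • BC.of (algebraMap R S) x = s • BC.of (algebraMap R S) (r • x)
        rw [LinearMap.map_smulₛₗ, Algebra.smul_def, mul_comm, mul_smul])
  have hl : ∀ s x, l (s ⊗ₜ x) = s • BC.of (algebraMap R S) x := fun s x => rfl
  have he : ∀ x, e (BC.of _ x) = (1 : S) ⊗ₜ[R] x := fun x =>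
    BC.lift_id_of o x
  have hbij : Function.Bijective e := by
    refine ⟨Function.LeftInverse.injective (g := l) fun x => ?_, fun z => ?_⟩
    · have key : ∀ (s : S) z, l (s • z) = s • l z := by
        intro s z
        induction z using TensorProduct.induction_on with
        | zero => simp
        | tmul a b => rw [smul_tmul', hl, hl, smul_eq_mul, mul_smul]
        | add x y hx hy => rw [smul_add, map_add, map_add, smul_add, hx, hy]
      induction x using BC.induction with
      | zero => simp
      | of m => rw [he, hl, one_smul]
      | add x y hx hy => rw [map_add, map_add, hx, hy]
      | smul b x hx => rw [map_smul, key, hx]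
    · induction z using TensorProduct.induction_on with
      | zero => exact ⟨0, map_zero _⟩
      | tmul a b =>
        refine ⟨a • BC.of _ b, ?_⟩
        rw [map_smul, he, smul_tmul', smul_eq_mul, mul_one]
      | add x y hx hy =>
        obtain ⟨x, rfl⟩ := hx
        obtain ⟨y, rfl⟩ := hy
        exact ⟨x + y, map_add _ _ _⟩
  have : BC.lift (RingHom.id S) (γ := algebraMap R S) (fun _ => rfl) f = g ∘ₗ e :=
    BC.ext_of fun x => by
      rw [BC.lift_of, LinearMap.comp_apply, he, hg]
  rw [IsBC, this, LinearMap.coe_comp]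
  exact hbij.of_comp_iff g

end IsBC

end
end TruncDisp

namespace TruncDisp

open TensorProduct CategoryTheory

noncomputable section

/-! ### Projective modules and nilpotent ideals -/

section Nilpotent

variable {A B : Type*} [CommRing A] [CommRing B] {π : A →+* B}
  {M N M' N' : Type*} [AddCommGroup M] [Module A M] [AddCommGroup N] [Module A N]
  [AddCommGroup M'] [Module B M'] [AddCommGroup N'] [Module B N']

/-- Nakayama's lemma for a nilpotent ideal. -/
theorem eq_top_of_sup_smul_eq_top {J : Ideal A} (hJ : IsNilpotent J) {U : Submodule A M}
    (h : ⊤ ≤ U ⊔ J • (⊤ : Submodule A M)) : U = ⊤ := by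
  obtain ⟨k, hk⟩ := hJ
  have key : ∀ k : ℕ, ⊤ ≤ U ⊔ J ^ k • (⊤ : Submodule A M) := by
    intro k
    induction k with
    | zero => simp
    | succ k ih =>
      refine ih.trans (sup_le le_sup_left ((Submodule.smul_mono le_rfl h).trans ?_))
      rw [Submodule.smul_sup, ← mul_smul, ← pow_succ]
      exact sup_le_sup_right Submodule.smul_le_right _
  have := key k
  rw [hk, Submodule.zero_eq_bot, Submodule.bot_smul, sup_bot_eq] at this
  exact top_le_iff.1 this

/-- Every y in N is f(x) plus an element of (ker π)N, so Nakayama applies to the range of `f`. -/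
theorem surjective_of_surjective_mod (hπ : Function.Surjective π)
    (hker : IsNilpotent (RingHom.ker π)) {m : M →ₛₗ[π] M'} {q : N →ₛₗ[π] N'}
    (hm : Function.Surjective m) (hq : IsBC q) {f : M →ₗ[A] N} {f' : M' →ₗ[B] N'}
    (h : ∀ x, f' (m x) = q (f x)) (hf' : Function.Surjective f') : Function.Surjective f := by
  rw [← LinearMap.range_eq_top]
  refine eq_top_of_sup_smul_eq_top hker fun y _ => ?_
  obtain ⟨x', hx'⟩ := hf' (q y)
  obtain ⟨x, rfl⟩ := hm x'
  have : q (y - f x) = 0 := by rw [map_sub, ← h, hx', sub_self]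
  have := hq.mem_ker_smul hπ this
  rw [show y = f x + (y - f x) by abel]
  exact Submodule.add_mem_sup ⟨x, rfl⟩ this

/-- A section `s` of `f` makes ker f the image of the projector `r` = id − s f. Put J = ker π. As
`f'` is injective, ker f dies in M', so it lies in JM; applying `r` places it in J ker f. Iterate
until the power of J vanishes. Only N has to be projective. -/
theorem bijective_of_bijective_mod (hπ : Function.Surjective π)
    (hker : IsNilpotent (RingHom.ker π)) {m : M →ₛₗ[π] M'} {q : N →ₛₗ[π] N'}
    (hm : IsBC m) (hq : IsBC q) [Module.Projective A N] {f : M →ₗ[A] N} {f' : M' →ₗ[B] N'}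
    (h : ∀ x, f' (m x) = q (f x)) (hf' : Function.Bijective f') : Function.Bijective f := by
  have hs := surjective_of_surjective_mod hπ hker (hm.surjective hπ) hq h hf'.2
  obtain ⟨s, hs'⟩ := Module.projective_lifting_property f LinearMap.id hs
  have hs' : ∀ y, f (s y) = y := fun y => LinearMap.congr_fun hs' y
  let r : M →ₗ[A] M := LinearMap.id - s ∘ₗ f
  have hr : ∀ x, f x = 0 → r x = x := fun x hx => by simp [r, hx]
  have hfr : ∀ x, f (r x) = 0 := fun x => by simp [r, hs']
  have key : LinearMap.range r ≤ RingHom.ker π • LinearMap.range r := by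
    rintro _ ⟨x, rfl⟩
    have h0 : m (r x) = 0 := hf'.1 (by rw [h, hfr, map_zero, map_zero])
    have := Submodule.mem_map_of_mem (f := r) (hm.mem_ker_smul hπ h0)
    rwa [Submodule.map_smul'', Submodule.map_top, hr _ (hfr x)] at this
  refine ⟨(injective_iff_map_eq_zero f).2 fun x hx => ?_, hs⟩
  obtain ⟨k, hk⟩ := hker
  have hpow : ∀ k : ℕ, LinearMap.range r ≤ RingHom.ker π ^ k • LinearMap.range r := by
    intro k
    induction k with
    | zero => simp
    | succ k ih =>
      rw [pow_succ, mul_smul]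
      exact ih.trans (Submodule.smul_mono le_rfl key)
  have := hpow k
  rw [hk, Submodule.zero_eq_bot, Submodule.bot_smul] at this
  have := this ⟨x, rfl⟩
  rwa [hr x hx] at this

/-- The entries of X^k lie in J^k. This makes the kernel on matrix rings nil, as is needed for
lifting idempotent matrices. -/
theorem isNilpotent_matrix_of_mem {ι : Type*} [Fintype ι] [DecidableEq ι] {J : Ideal A}
    (hJ : IsNilpotent J) {X : Matrix ι ι A} (hX : ∀ i j, X i j ∈ J) : IsNilpotent X := by
  obtain ⟨k, hk⟩ := hJ
  have key : ∀ k : ℕ, ∀ i j, (X ^ k) i j ∈ J ^ k := by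
    intro k
    induction k with
    | zero => simp
    | succ k ih =>
      intro i j
      rw [pow_succ, pow_succ, Matrix.mul_apply]
      exact Ideal.sum_mem _ fun l _ => Ideal.mul_mem_mul (ih i l) (hX l j)
  refine ⟨k, Matrix.ext fun i j => ?_⟩
  have := key k i j
  rwa [hk] at this

/-- The coordinatewise map `A^ι → B^ι`. -/
def piMap (π : A →+* B) (ι : Type*) : (ι → A) →ₛₗ[π] (ι → B) where
  toFun x i := π (x i)
  map_add' x y := by ext; simp
  map_smul' a x := by ext; simp

theorem isBC_piMap (π : A →+* B) (ι : Type*) [Fintype ι] [DecidableEq ι] :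
    IsBC (piMap π ι) := by
  let e : BC π (ι → A) →ₗ[B] (ι → B) := BC.lift (RingHom.id B) (fun _ => rfl) (piMap π ι)
  let g : (ι → B) →ₗ[B] BC π (ι → A) :=
    Fintype.linearCombination B fun i => BC.of π (Pi.single i 1)
  refine ⟨Function.LeftInverse.injective (g := g) fun x => ?_,
    Function.RightInverse.surjective (g := g) fun x => ?_⟩
  · change (g ∘ₗ e) x = LinearMap.id (R := B) x
    congr 1
    refine BC.ext_of fun x => ?_
    rw [LinearMap.comp_apply, BC.lift_id_of, LinearMap.id_apply, Fintype.linearCombination_apply]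
    conv_rhs => rw [pi_eq_sum_univ' x, map_sum]
    refine Finset.sum_congr rfl fun i _ => ?_
    rw [LinearMap.map_smulₛₗ]
    rfl
  · change e (g x) = x
    rw [Fintype.linearCombination_apply, map_sum]
    conv_rhs => rw [pi_eq_sum_univ' x]
    refine Finset.sum_congr rfl fun i _ => ?_
    rw [map_smul, BC.lift_id_of]
    congr 1
    ext j
    simp [piMap, Pi.single_apply, eq_comm]

/-- Finitely generated projective modules lift along surjections with nilpotent kernel. -/
theorem exists_lift_projective {A B : Type u} [CommRing A] [CommRing B] {π : A →+* B}
    (hπ : Function.Surjective π) (hker : IsNilpotent (RingHom.ker π)) (M' : Type u)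
    [AddCommGroup M'] [Module B M'] [Module.Finite B M'] [Module.Projective B M'] :
    ∃ (M : Type u) (_ : AddCommGroup M) (_ : Module A M) (_ : Module.Finite A M)
      (_ : Module.Projective A M) (m : M →ₛₗ[π] M'), IsBC m := by
  obtain ⟨k, q, hq⟩ := Module.Finite.exists_fin' B M'
  obtain ⟨s, hs⟩ := Module.projective_lifting_property q LinearMap.id hq
  have hs : ∀ y, q (s y) = y := fun y => LinearMap.congr_fun hs y
  -- M' is the image of the idempotent matrix of s q. Idempotents lift along surjections with nil
  -- kernel, and the image of the lifted matrix is the required module; `IsBC.retract` compares the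
  -- two images as summands of free modules.
  have hidem : IsIdempotentElem (LinearMap.toMatrix' (s ∘ₗ q)) := by
    rw [IsIdempotentElem, ← LinearMap.toMatrix'_comp]
    congr 1
    refine LinearMap.ext fun x => ?_
    simp only [LinearMap.comp_apply, hs]
  have hmap : Function.Surjective (π.mapMatrix (m := Fin k)) := fun X =>
    ⟨Matrix.of fun i j => Function.surjInv hπ (X i j), Matrix.ext fun i j =>
      Function.surjInv_eq hπ (X i j)⟩
  obtain ⟨e, he, heq⟩ := exists_isIdempotentElem_eq_of_ker_isNilpotent (π.mapMatrix (m := Fin k))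
    (fun X hX => isNilpotent_matrix_of_mem hker fun i j => congrFun (congrFun hX i) j) _
    (hmap _) hidem
  let E : (Fin k → A) →ₗ[A] (Fin k → A) := Matrix.toLin' e
  have hE : ∀ x, E (E x) = E x := fun x => by
    rw [← LinearMap.comp_apply, ← Matrix.toLin'_mul, he.eq]
  have hEs : ∀ x, s (q (piMap π _ x)) = piMap π _ (E x) := fun x => by
    have : s (q (piMap π _ x)) = Matrix.toLin' (π.mapMatrix e) (piMap π _ x) := by
      rw [heq, Matrix.toLin'_toMatrix', LinearMap.comp_apply]
    rw [this]
    ext i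
    simp [piMap, E, Matrix.mulVec, dotProduct]
  have hr : ∀ x : LinearMap.range E, E.rangeRestrict ((LinearMap.range E).subtype x) = x := by
    rintro ⟨_, x, rfl⟩
    exact Subtype.ext (hE x)
  refine ⟨LinearMap.range E, inferInstance, inferInstance, inferInstance,
    Module.Projective.of_split (LinearMap.range E).subtype E.rangeRestrict (LinearMap.ext hr),
    q.comp (piMap π (Fin k)) ∘ₛₗ (LinearMap.range E).subtype, ?_⟩
  refine (isBC_piMap π (Fin k)).retract (LinearMap.range E).subtype E.rangeRestrict s q hr hs ?_ ?_
  · rintro ⟨_, x, rfl⟩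
    change s (q (piMap π _ (E x))) = piMap π _ (E x)
    rw [hEs, hE]
  · intro x
    change q (piMap π _ x) = q (piMap π _ (E x))
    rw [← hEs, hs]

end Nilpotent

/-! ### Faithfully flat descent of finitely generated projective modules -/

section Descent

variable {R S : Type u} [CommRing R] [CommRing S] [Algebra R S] [Module.FaithfullyFlat R S]
  {M : Type u} [AddCommGroup M] [Module R M]

/-- `g` splits, so K is a direct summand of F and in particular a quotient of it. -/
theorem finite_of_exact_of_projective {S K F M : Type*} [CommRing S] [AddCommGroup K]
    [Module S K] [AddCommGroup F] [Module S F] [AddCommGroup M] [Module S M] [Module.Finite S F]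
    [Module.Projective S M] {i : K →ₗ[S] F} {g : F →ₗ[S] M} (hi : Function.Injective i)
    (hex : Function.Exact i g) (hg : Function.Surjective g) : Module.Finite S K := by
  obtain ⟨s, hs⟩ := Module.projective_lifting_property g LinearMap.id hg
  have hs : ∀ y, g (s y) = y := fun y => LinearMap.congr_fun hs y
  have hmem : ∀ x, (LinearMap.id - s ∘ₗ g : F →ₗ[S] F) x ∈ LinearMap.range i := fun x => (hex _).1 (by
    rw [LinearMap.sub_apply, map_sub, LinearMap.comp_apply, hs, LinearMap.id_apply, sub_self])
  let r := (LinearEquiv.ofInjective _ hi).symm.toLinearMap ∘ₗ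
    LinearMap.codRestrict (LinearMap.range i) (LinearMap.id - s ∘ₗ g) hmem
  refine Module.Finite.of_surjective r fun x => ⟨i x, ?_⟩
  rw [LinearMap.comp_apply, LinearEquiv.coe_coe, LinearEquiv.symm_apply_eq]
  refine Subtype.ext ?_
  rw [LinearMap.codRestrict_apply, LinearEquiv.ofInjective_apply, LinearMap.sub_apply,
    LinearMap.comp_apply, hex.apply_apply_eq_zero, map_zero, sub_zero, LinearMap.id_apply]

/-- Finite generation descends along a faithfully flat map. It is used for M and then for the kernel
of a presentation of M, which is finitely generated over S because S ⊗ M is projective. -/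
theorem finitePresentation_of_faithfullyFlat [Module.Finite S (S ⊗[R] M)]
    [Module.Projective S (S ⊗[R] M)] : Module.FinitePresentation R M := by
  have := Module.Finite.of_finite_tensorProduct_of_faithfullyFlat (R := R) (M := M) S
  obtain ⟨k, q, hq⟩ := Module.Finite.exists_fin' R M
  have hex : Function.Exact (AlgebraTensorModule.lTensor S S (LinearMap.ker q).subtype)
      (AlgebraTensorModule.lTensor S S q) :=
    lTensor_exact S (f := (LinearMap.ker q).subtype) (g := q)
      (LinearMap.exact_subtype_ker_map q) hq
  have hsurj : Function.Surjective (AlgebraTensorModule.lTensor S S q) :=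
    LinearMap.lTensor_surjective S hq
  have hinj : Function.Injective (AlgebraTensorModule.lTensor S S (LinearMap.ker q).subtype) :=
    Module.Flat.lTensor_preserves_injective_linearMap (M := S) (LinearMap.ker q).subtype
      (Submodule.injective_subtype _)
  have : Module.Finite S (S ⊗[R] LinearMap.ker q) := finite_of_exact_of_projective hinj hex hsurj
  have := Module.Finite.of_finite_tensorProduct_of_faithfullyFlat (R := R) (M := LinearMap.ker q) S
  exact Module.finitePresentation_of_surjective q hq (Module.Finite.iff_fg.1 this)

/-- Flatness descends as well, and flat modules of finite presentation are projective. -/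
theorem projective_of_faithfullyFlat [Module.Finite S (S ⊗[R] M)]
    [Module.Projective S (S ⊗[R] M)] : Module.Projective R M := by
  have := finitePresentation_of_faithfullyFlat (R := R) (S := S) (M := M)
  have := Module.Flat.of_flat_tensorProduct R M S
  exact Module.Flat.projective_of_finitePresentation

end Descent

end
end TruncDisp

namespace TruncDisp

open TensorProduct CategoryTheory

noncomputable section

/-! ### Tensor powers of an algebra -/

section TensorPower

variable {R S : Type u} [CommRing R] [CommRing S] [Algebra R S]

namespace TensorPower

theorem algHom_ext {k : ℕ} {T : Type*} [CommRing T] [Algebra R T]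
    {f g : TensorPower R S k →ₐ[R] T} (h : ∀ i s, f (slot R S i s) = g (slot R S i s)) : f = g :=
  PiTensorProduct.algHom_ext fun i => AlgHom.ext (h i)

/-- The multilinear map underlying `desc`. -/
def descAux {k : ℕ} {T : Type*} [CommRing T] [Algebra R T] (g : Fin k → S →ₐ[R] T) :
    MultilinearMap R (fun _ : Fin k => S) T :=
  (MultilinearMap.mkPiAlgebra R (Fin k) T).compLinearMap fun j => (g j).toLinearMap

theorem descAux_apply {k : ℕ} {T : Type*} [CommRing T] [Algebra R T] (g : Fin k → S →ₐ[R] T)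
    (s : Fin k → S) : descAux g s = ∏ j, g j (s j) := by
  rw [descAux, MultilinearMap.compLinearMap_apply, MultilinearMap.mkPiAlgebra_apply]
  rfl

/-- The homomorphism `s_0 ⊗ ⋯ ⊗ s_{k-1} ↦ g_0(s_0) ⋯ g_{k-1}(s_{k-1})`. -/
def desc {k : ℕ} {T : Type*} [CommRing T] [Algebra R T] (g : Fin k → S →ₐ[R] T) :
    TensorPower R S k →ₐ[R] T :=
  PiTensorProduct.liftAlgHom (descAux g)
    (by simp only [descAux_apply, Pi.one_apply, map_one, Finset.prod_const_one])
    (fun x y => by simp only [descAux_apply, Pi.mul_apply, map_mul, Finset.prod_mul_distrib])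

@[simp] theorem desc_slot {k : ℕ} {T : Type*} [CommRing T] [Algebra R T]
    (g : Fin k → S →ₐ[R] T) (i : Fin k) (s : S) : desc g (slot R S i s) = g i s := by
  rw [desc, slot, PiTensorProduct.singleAlgHom_apply, PiTensorProduct.liftAlgHom_apply,
    PiTensorProduct.lift.tprod, descAux_apply, Finset.prod_eq_single i]
  · rw [MonoidHom.mulSingle_apply, Pi.mulSingle_eq_same]
  · intro l _ hl
    rw [MonoidHom.mulSingle_apply, Pi.mulSingle_eq_of_ne hl, map_one]
  · simp

@[simp] theorem coface_slot_apply {k : ℕ} (i : Fin (k + 1)) (j : Fin k) (s : S) :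
    coface R S i (slot R S j s) = slot R S (i.succAbove j) s :=
  RingHom.congr_fun (coface_slot R S i j) s

variable (R S) in
/-- The homomorphism `s_0 ⊗ s_1 ⊗ ⋯ ↦ s_0 s_1 ⊗ ⋯`. -/
def merge (k : ℕ) : TensorPower R S (k + 2) →ₐ[R] TensorPower R S (k + 1) :=
  desc fun i => slot R S ((0 : Fin (k + 1)).predAbove i)

@[simp] theorem merge_slot (k : ℕ) (i : Fin (k + 2)) (s : S) :
    merge R S k (slot R S i s) = slot R S ((0 : Fin (k + 1)).predAbove i) s :=
  desc_slot ..

theorem coface_coface {k : ℕ} {i j : Fin (k + 1)} (h : i ≤ j) (x : TensorPower R S k) :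
    coface R S j.succ (coface R S i x) = coface R S i.castSucc (coface R S j x) := by
  refine AlgHom.congr_fun (φ₁ := (coface R S j.succ).comp (coface R S i))
    (φ₂ := (coface R S i.castSucc).comp (coface R S j)) (algHom_ext fun l s => ?_) x
  simp only [AlgHom.comp_apply, coface_slot_apply]
  congr 1
  simp only [Fin.succAbove, Fin.lt_def, Fin.le_def] at h ⊢
  split_ifs <;> simp_all <;> omega

/-- This and `merge_coface_succ_succ` are the only degeneracy relations that are needed: they make
multiplication of the first two factors a contraction of the complex from which the face 0 has been
removed. -/
theorem merge_coface_one (k : ℕ) (x : TensorPower R S (k + 1)) :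
    merge R S k (coface R S 1 x) = x := by
  refine AlgHom.congr_fun (φ₁ := (merge R S k).comp (coface R S 1))
    (φ₂ := AlgHom.id R _) (algHom_ext fun l s => ?_) x
  simp only [AlgHom.comp_apply, coface_slot_apply, merge_slot, AlgHom.id_apply]
  congr 1
  cases l using Fin.cases with
  | zero => simp [Fin.succAbove]
  | succ l =>
    have : (1 : Fin (k + 2)).succAbove l.succ = l.succ.succ := by
      apply Fin.succAbove_of_le_castSucc
      simp [Fin.le_def]
    rw [this]
    simp

theorem merge_coface_succ_succ (k : ℕ) (i : Fin (k + 1)) (x : TensorPower R S (k + 2)) :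
    merge R S (k + 1) (coface R S i.succ.succ x) = coface R S i.succ (merge R S k x) := by
  refine AlgHom.congr_fun (φ₁ := (merge R S (k + 1)).comp (coface R S i.succ.succ))
    (φ₂ := (coface R S i.succ).comp (merge R S k)) (algHom_ext fun l s => ?_) x
  simp only [AlgHom.comp_apply, coface_slot_apply, merge_slot]
  congr 1
  cases l using Fin.cases with
  | zero => simp
  | succ l => simp [Fin.succ_succAbove_succ]

variable (R S) in
/-- The homomorphism `s_0 ⊗ ⋯ ⊗ s_k ↦ s_0 ⊗ (s_1 ⊗ ⋯ ⊗ s_k)`. -/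
def uncons (k : ℕ) : TensorPower R S (k + 1) →ₐ[R] S ⊗[R] TensorPower R S k :=
  desc (Fin.cases Algebra.TensorProduct.includeLeft
    fun i => Algebra.TensorProduct.includeRight.comp (slot R S i))

theorem uncons_slot_zero (k : ℕ) (s : S) : uncons R S k (slot R S 0 s) = s ⊗ₜ 1 := by
  rw [uncons, desc_slot]
  rfl

theorem uncons_slot_succ (k : ℕ) (i : Fin k) (s : S) :
    uncons R S k (slot R S i.succ s) = 1 ⊗ₜ slot R S i s := by
  rw [uncons, desc_slot]
  rfl

theorem uncons_coface_zero (k : ℕ) (x : TensorPower R S k) :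
    uncons R S k (coface R S 0 x) = 1 ⊗ₜ x := by
  refine AlgHom.congr_fun (φ₁ := (uncons R S k).comp (coface R S 0))
    (φ₂ := Algebra.TensorProduct.includeRight) (algHom_ext fun i s => ?_) x
  rw [AlgHom.comp_apply, coface_slot_apply, Fin.succAbove_zero, uncons_slot_succ]
  rfl

/-- The isomorphism `S ⊗_R S^{⊗ k} ≅ S^{⊗ (k + 1)}`. -/
theorem cons_bijective (k : ℕ) : Function.Bijective
    (Algebra.TensorProduct.productMap (slot R S (0 : Fin (k + 1))) (coface R S 0)) := by
  refine Function.bijective_iff_has_inverse.2 ⟨uncons R S k, fun x => ?_, fun x => ?_⟩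
  · induction x using TensorProduct.induction_on with
    | zero => rw [map_zero, map_zero]
    | tmul s x =>
      rw [Algebra.TensorProduct.productMap_apply_tmul, map_mul, uncons_slot_zero,
        uncons_coface_zero, Algebra.TensorProduct.tmul_mul_tmul, one_mul, mul_one]
    | add x y hx hy => rw [map_add, map_add, hx, hy]
  · refine AlgHom.congr_fun (φ₁ := (Algebra.TensorProduct.productMap (slot R S (0 : Fin (k + 1)))
      (coface R S 0)).comp (uncons R S k)) (φ₂ := AlgHom.id R _) (algHom_ext fun i s => ?_) x
    cases i using Fin.cases with
    | zero =>
      rw [AlgHom.comp_apply, uncons_slot_zero, Algebra.TensorProduct.productMap_apply_tmul,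
        map_one, mul_one]
      rfl
    | succ i =>
      rw [AlgHom.comp_apply, uncons_slot_succ, Algebra.TensorProduct.productMap_apply_tmul,
        map_one, one_mul, coface_slot_apply, Fin.succAbove_zero]
      rfl

theorem slot_zero_bijective : Function.Bijective (slot R S (0 : Fin 1)) := by
  refine Function.bijective_iff_has_inverse.2 ⟨desc fun _ => AlgHom.id R S, fun s => by simp,
    fun x => ?_⟩
  refine AlgHom.congr_fun (φ₁ := (slot R S (0 : Fin 1)).comp (desc fun _ => AlgHom.id R S))
    (φ₂ := AlgHom.id R _) (algHom_ext fun i s => ?_) x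
  fin_cases i
  simp

/-- Compares the two models of S ⊗_R S: descent data use the binary tensor product, the Čech complex
the indexed one. -/
theorem pairMap_slot_bijective :
    Function.Bijective (pairMap (slot R S (0 : Fin 2)) (slot R S (1 : Fin 2))) := by
  refine Function.bijective_iff_has_inverse.2
    ⟨desc ![p₁ R S, p₂ R S], fun x => ?_, fun x => ?_⟩
  · refine AlgHom.congr_fun (φ₁ := (desc ![p₁ R S, p₂ R S]).comp
      (pairMap (slot R S (0 : Fin 2)) (slot R S (1 : Fin 2)))) (φ₂ := AlgHom.id R _) ?_ x
    ext s
    · simp [pairMap, p₁]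
    · simp [pairMap, p₂]
  · refine AlgHom.congr_fun (φ₁ := (pairMap (slot R S (0 : Fin 2)) (slot R S (1 : Fin 2))).comp
      (desc ![p₁ R S, p₂ R S])) (φ₂ := AlgHom.id R _) (algHom_ext fun i s => ?_) x
    fin_cases i
    · simp [pairMap, p₁]
    · simp [pairMap, p₂]

end TensorPower

/-- The tensor product with an algebra as a base change. -/
theorem isBC_bijective_tensor {T T' : Type u} [CommRing T] [CommRing T'] [Algebra R T]
    [Algebra R T'] {f : S →ₐ[R] T'} {j : T →ₐ[R] T'}
    (hj : Function.Bijective (Algebra.TensorProduct.productMap f j)) {C C' : Type u}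
    [AddCommGroup C] [Module T C] [AddCommGroup C'] [Module T' C'] [Module R C]
    [IsScalarTower R T C] {g : C →ₛₗ[(j : T →+* T')] C'} (hg : IsBC g)
    (m : S ⊗[R] C →+ C') (hm : ∀ s x, m (s ⊗ₜ x) = f s • g x) : Function.Bijective m := by
  let : Algebra T T' := (j : T →+* T').toAlgebra
  have hT : IsScalarTower R T T' := IsScalarTower.of_algebraMap_eq fun r => (j.commutes r).symm
  let e₀ : T ⊗[R] S →ₐ[T] T' :=
    Algebra.TensorProduct.lift (Algebra.ofId T T') f fun _ _ => Commute.all _ _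
  have he₀ : ∀ t s, e₀ (t ⊗ₜ s) = j t * f s := fun t s => Algebra.TensorProduct.lift_tmul ..
  have hb₀ : Function.Bijective e₀ := by
    have : (e₀ : T ⊗[R] S → T') = Algebra.TensorProduct.productMap f j ∘
        Algebra.TensorProduct.comm R T S := by
      ext z
      induction z using TensorProduct.induction_on with
      | zero => simp
      | tmul t s => rw [he₀]; simp [mul_comm]
      | add x y hx hy => rw [map_add, hx, hy]; simp
    rw [this]
    exact hj.comp (Algebra.TensorProduct.comm R T S).bijective
  let e₁ : C ⊗[T] (T ⊗[R] S) ≃ₗ[T] C ⊗[R] S := AlgebraTensorModule.cancelBaseChange R T T C S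
  let e₂ : C ⊗[T] (T ⊗[R] S) →ₗ[T] C ⊗[T] T' := LinearMap.lTensor C e₀.toLinearMap
  have hb₂ : Function.Bijective e₂ :=
    (LinearEquiv.lTensor C (LinearEquiv.ofBijective e₀.toLinearMap hb₀)).bijective
  let c : T' ⊗[T] C →+ C' := hg.equiv.toLinearMap.toAddMonoidHom
  have hcb : Function.Bijective c := hg.equiv.bijective
  have hc : ∀ t x, c (t ⊗ₜ x) = t • g x := fun t x => by
    have h3 : (t ⊗ₜ x : T' ⊗[T] C) = (t • BC.of (j : T →+* T') x : BC (j : T →+* T') C) := by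
      change _ = (t * 1) ⊗ₜ[T] x
      rw [mul_one]
    change hg.equiv _ = _
    rw [h3, map_smul, hg.equiv_of]
  -- The map is S ⊗_R C ≅ C ⊗_T (T ⊗_R S) ≅ C ⊗_T T' ≅ C'; the middle step is the hypothesis on
  -- rings, the last one the hypothesis on `g`.
  have key : (m : S ⊗[R] C → C') = c ∘ TensorProduct.comm T C T' ∘ e₂ ∘ e₁.symm ∘
      TensorProduct.comm R S C := by
    ext z
    simp only [Function.comp_apply]
    induction z using TensorProduct.induction_on with
    | zero => simp only [map_zero]
    | tmul s x =>
      have h1 : e₁.symm (x ⊗ₜ s) = x ⊗ₜ (1 ⊗ₜ s) :=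
        AlgebraTensorModule.cancelBaseChange_symm_tmul ..
      have h2 : e₂ (x ⊗ₜ (1 ⊗ₜ s)) = x ⊗ₜ f s := by
        refine (LinearMap.lTensor_tmul ..).trans ?_
        rw [AlgHom.toLinearMap_apply, he₀, map_one, one_mul]
      rw [hm, TensorProduct.comm_tmul, h1, h2, TensorProduct.comm_tmul, hc]
    | add x y hx hy => simp only [map_add, hx, hy]
  rw [key]
  exact hcb.comp ((TensorProduct.comm T C T').bijective.comp (hb₂.comp (e₁.symm.bijective.comp
    (TensorProduct.comm R S C).bijective)))

end TensorPower

end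
end TruncDisp

namespace TruncDisp

open TensorProduct CategoryTheory

noncomputable section

/-! ### Alternating sums of face maps -/

section Alternating

variable {C : ℕ → Type*} [∀ k, AddCommGroup (C k)] (f : ∀ k, Fin (k + 2) → C k →+ C (k + 1))

/-- The alternating sum of the face maps. -/
def altSum (k : ℕ) : C k →+ C (k + 1) := ∑ i : Fin (k + 2), (-1 : ℤ) ^ (i : ℕ) • f k i

theorem altSum_apply (k : ℕ) (x : C k) :
    altSum f k x = ∑ i : Fin (k + 2), (-1 : ℤ) ^ (i : ℕ) • f k i x := by
  simp [altSum]

theorem altSum_zero_apply (x : C 0) : altSum f 0 x = f 0 0 x - f 0 1 x := by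
  rw [altSum_apply, Fin.sum_univ_two]
  simp [sub_eq_add_neg]

variable {f}

/-- The cosimplicial identity matches the pair (i, j) of outer and inner face indices, i ≤ j, with
the pair (j + 1, i). The two composites agree and carry opposite signs. -/
theorem altSum_altSum
    (hf : ∀ k (i j : Fin (k + 2)), i ≤ j → ∀ x,
      f (k + 1) j.succ (f k i x) = f (k + 1) i.castSucc (f k j x)) (k : ℕ) (x : C k) :
    altSum f (k + 1) (altSum f k x) = 0 := by
  simp only [altSum_apply, map_sum, map_zsmul, Finset.smul_sum, smul_smul]
  rw [Finset.sum_comm, ← Finset.sum_product']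
  let P := Fin (k + 3) × Fin (k + 2)
  let S : Finset P := {ij : P | (ij.1 : ℕ) ≤ (ij.2 : ℕ)}
  rw [Finset.univ_product_univ, ← Finset.sum_add_sum_compl S, ← eq_neg_iff_add_eq_zero,
    ← Finset.sum_neg_distrib]
  let φ : ∀ ij : P, ij ∈ S → P := fun ij hij =>
    (ij.2.succ, Fin.castLT ij.1 (lt_of_le_of_lt (Finset.mem_filter.mp hij).right ij.2.is_lt))
  apply Finset.sum_bij φ
  · intro ij hij
    simp_rw [S, φ, Finset.compl_filter, Finset.mem_filter_univ, Fin.val_succ,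
      Fin.val_castLT] at hij ⊢
    lia
  · rintro ⟨i, j⟩ hij ⟨i', j'⟩ hij' h
    have h1 := Fin.succ_inj.1 (Prod.ext_iff.1 h).1
    have h2 := congrArg Fin.val (Prod.ext_iff.1 h).2
    exact Prod.ext (Fin.ext h2) h1
  · rintro ⟨i', j'⟩ hij'
    simp_rw [S, Finset.compl_filter, Finset.mem_filter_univ, not_le] at hij'
    refine ⟨(Fin.castSucc j', i'.pred <| ?_), ?_, ?_⟩
    · rintro rfl
      simp only [Fin.val_zero, not_lt_zero] at hij'
    · simpa [S] using! Nat.le_sub_one_of_lt hij'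
    · simp only [φ, Fin.castLT_castSucc, Fin.succ_pred]
  · rintro ⟨i, j⟩ hij
    have hij : (i : ℕ) ≤ j := by simpa [S] using hij
    simp only [φ, Fin.val_succ, Fin.val_castLT]
    rw [← neg_smul, hf k _ _ (Fin.le_def.2 (by simpa using hij))]
    congr 1
    rw [pow_succ]
    ring

variable {R S : Type*} [CommRing R] [CommRing S] [Algebra R S] [∀ k, Module R (C k)]
  {μ : ∀ k, S ⊗[R] C k →+ C (k + 1)} {σ : ∀ k, C (k + 1) →+ C k}

/-- The alternating sum of the face maps as a linear map. -/
def altSumLin (hR : ∀ k i (r : R) x, f k i (r • x) = r • f k i x) (k : ℕ) : C k →ₗ[R] C (k + 1) where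
  toFun := altSum f k
  map_add' := map_add _
  map_smul' r x := by
    simp only [altSum_apply, hR, Finset.smul_sum, RingHom.id_apply]
    refine Finset.sum_congr rfl fun i _ => smul_comm _ _ _

/-- `μ` transforms S ⊗_R C into C shifted by one degree; the differential becomes the alternating
sum of all faces but the face 0. -/
theorem mu_lTensor_altSum (hR : ∀ k i (r : R) x, f k i (r • x) = r • f k i x)
    (hfμ : ∀ k i s x, f (k + 1) i.succ (μ k (s ⊗ₜ x)) = μ (k + 1) (s ⊗ₜ f k i x)) (k : ℕ)
    (z : S ⊗[R] C k) : μ (k + 1) ((altSumLin hR k).lTensor S z) =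
      ∑ i : Fin (k + 2), (-1 : ℤ) ^ (i : ℕ) • f (k + 1) i.succ (μ k z) := by
  induction z using TensorProduct.induction_on with
  | zero => simp
  | tmul s x =>
    rw [LinearMap.lTensor_tmul]
    change μ (k + 1) (s ⊗ₜ altSum f k x) = _
    rw [altSum_apply, tmul_sum, map_sum]
    refine Finset.sum_congr rfl fun i _ => ?_
    rw [hfμ]
    exact (((μ (k + 1)).comp (TensorProduct.mk R S (C (k + 1)) s).toAddMonoidHom).map_zsmul _ _)
  | add x y hx hy => simp only [map_add, hx, hy, smul_add, Finset.sum_add_distrib]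

variable [Module.FaithfullyFlat R S]

/-- A complex of alternating sums is exact if its base change under a faithfully flat map is
its own shift and has an extra degeneracy. -/
theorem altSum_exact
    (hf : ∀ k (i j : Fin (k + 2)), i ≤ j → ∀ x,
      f (k + 1) j.succ (f k i x) = f (k + 1) i.castSucc (f k j x))
    (hR : ∀ k i (r : R) x, f k i (r • x) = r • f k i x)
    (hμ : ∀ k, Function.Bijective (μ k))
    (hfμ : ∀ k i s x, f (k + 1) i.succ (μ k (s ⊗ₜ x)) = μ (k + 1) (s ⊗ₜ f k i x))
    (h1 : ∀ k x, σ k (f k 1 x) = x)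
    (h2 : ∀ k (i : Fin (k + 1)) x, σ (k + 1) (f (k + 1) i.succ.succ x) = f k i.succ (σ k x))
    (k : ℕ) : Function.Exact (altSum f k) (altSum f (k + 1)) := by
  change Function.Exact (altSumLin hR k) (altSumLin hR (k + 1))
  refine Module.FaithfullyFlat.lTensor_reflects_exact R S _ _ fun z => ⟨fun hz => ?_, ?_⟩
  · have h := mu_lTensor_altSum hR hfμ (k + 1) z
    rw [hz, map_zero, Fin.sum_univ_succ] at h
    have h' := congrArg (σ (k + 2)) h
    rw [map_zero, map_add, map_sum] at h'
    simp only [map_zsmul, h2] at h'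
    have h1' : σ (k + 2) (f (k + 1 + 1) (Fin.succ 0) (μ (k + 1) z)) = μ (k + 1) z := h1 (k + 2) _
    rw [Fin.val_zero, pow_zero, one_smul, h1'] at h'
    obtain ⟨w, hw⟩ := (hμ k).2 (σ (k + 1) (μ (k + 1) z))
    refine ⟨w, (hμ (k + 1)).1 ?_⟩
    rw [mu_lTensor_altSum hR hfμ, hw]
    rw [eq_comm, add_eq_zero_iff_eq_neg, ← Finset.sum_neg_distrib] at h'
    refine Eq.trans (Finset.sum_congr rfl fun i _ => ?_) h'.symm
    rw [← neg_smul, Fin.val_succ, pow_succ, mul_neg, mul_one, neg_neg]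
  · rintro ⟨y, rfl⟩
    rw [← LinearMap.comp_apply, ← LinearMap.lTensor_comp]
    have : altSumLin hR (k + 1) ∘ₗ altSumLin hR k = 0 :=
      LinearMap.ext fun x => altSum_altSum hf k x
    rw [this, LinearMap.lTensor_zero, LinearMap.zero_apply]

/-- Descent for the zeroth cohomology of such a complex. -/
theorem altSum_descent
    (hf : ∀ k (i j : Fin (k + 2)), i ≤ j → ∀ x,
      f (k + 1) j.succ (f k i x) = f (k + 1) i.castSucc (f k j x))
    (hR : ∀ k i (r : R) x, f k i (r • x) = r • f k i x)
    (hμ : ∀ k, Function.Bijective (μ k))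
    (hfμ : ∀ k i s x, f (k + 1) i.succ (μ k (s ⊗ₜ x)) = μ (k + 1) (s ⊗ₜ f k i x))
    (h1 : ∀ k x, σ k (f k 1 x) = x)
    (h2 : ∀ k (i : Fin (k + 1)) x, σ (k + 1) (f (k + 1) i.succ.succ x) = f k i.succ (σ k x)) :
    Function.Bijective fun z : S ⊗[R] LinearMap.ker (altSumLin hR 0) =>
      σ 0 (μ 0 ((LinearMap.ker (altSumLin hR 0)).subtype.lTensor S z)) := by
  have hex := Module.Flat.lTensor_exact S (LinearMap.exact_subtype_ker_map (altSumLin hR 0))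
  have hE : ∀ z, μ 1 ((altSumLin hR 0).lTensor S z) = f 1 1 (μ 0 z) - f 1 2 (μ 0 z) := fun z => by
    rw [mu_lTensor_altSum hR hfμ, Fin.sum_univ_two]
    simp [sub_eq_add_neg]
  constructor
  · intro z z' hzz
    rw [← sub_eq_zero, ← map_sub, ← map_sub, ← map_sub] at hzz
    rw [← sub_eq_zero]
    generalize z - z' = w at hzz
    have h0 : (altSumLin hR 0).lTensor S ((LinearMap.ker (altSumLin hR 0)).subtype.lTensor S w)
      = 0 := hex.apply_apply_eq_zero w
    set y := (LinearMap.ker (altSumLin hR 0)).subtype.lTensor S w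
    -- The cocycle condition says f₁(μ y) = f₂(μ y). The degeneracy turns this into μ y = f₁(σ(μ
    -- y)), and σ(μ y) = 0 by assumption.
    have h3 := hE y
    rw [h0, map_zero, eq_comm, sub_eq_zero] at h3
    have h4 := h2 0 0 (μ 0 y)
    rw [hzz, map_zero] at h4
    have h5 : μ 0 y = 0 := by
      rw [← h1 1 (μ 0 y), h3]
      exact h4
    have h6 : y = 0 := (hμ 0).1 (h5.trans (map_zero _).symm)
    exact Module.Flat.lTensor_preserves_injective_linearMap (M := S) _
      (Submodule.injective_subtype _) (h6.trans (map_zero _).symm)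
  · intro x
    -- The preimage of x is read off from f₁ x: this is a cocycle of the shifted complex because f₂
    -- f₁ = f₁ f₁, and σ f₁ = id.
    obtain ⟨z, hz⟩ := (hμ 0).2 (f 0 1 x)
    have h0 : (altSumLin hR 0).lTensor S z = 0 := by
      refine (hμ 1).1 ?_
      rw [hE, hz, map_zero, sub_eq_zero]
      exact (hf 0 1 1 le_rfl x).symm
    obtain ⟨w, rfl⟩ := (hex z).1 h0
    exact ⟨w, (congrArg (σ 0) hz).trans (h1 0 x)⟩

end Alternating

end
end TruncDisp

namespace TruncDisp

open TensorProduct CategoryTheory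

noncomputable section

/-! ### Short exact sequences of complexes -/

section Devissage

variable {C D E : ℕ → Type*} [∀ k, AddCommGroup (C k)] [∀ k, AddCommGroup (D k)]
  [∀ k, AddCommGroup (E k)] {dC : ∀ k, C k →+ C (k + 1)} {dD : ∀ k, D k →+ D (k + 1)}
  {dE : ∀ k, E k →+ E (k + 1)} {i : ∀ k, C k →+ D k} {q : ∀ k, D k →+ E k}

/-- A short exact sequence of sequences of maps. -/
structure ShortExact (dC : ∀ k, C k →+ C (k + 1)) (dD : ∀ k, D k →+ D (k + 1))
    (dE : ∀ k, E k →+ E (k + 1)) (i : ∀ k, C k →+ D k) (q : ∀ k, D k →+ E k) : Prop where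
  inj k : Function.Injective (i k)
  exact k : Function.Exact (i k) (q k)
  surj k : Function.Surjective (q k)
  i_comm k x : i (k + 1) (dC k x) = dD k (i k x)
  q_comm k x : q (k + 1) (dD k x) = dE k (q k x)

namespace ShortExact

variable (h : ShortExact dC dD dE i q)
include h

/-- A piece of the long exact cohomology sequence: H^{k+1} of the middle term sits between H^{k+1}
of the two outer terms. -/
theorem exact_mid (hD : ∀ k x, dD (k + 1) (dD k x) = 0) {k : ℕ}
    (hC : Function.Exact (dC k) (dC (k + 1)))
    (hE : Function.Exact (dE k) (dE (k + 1))) : Function.Exact (dD k) (dD (k + 1)) := by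
  refine fun x => ⟨fun hx => ?_, fun ⟨y, hy⟩ => hy ▸ hD k y⟩
  obtain ⟨e, he⟩ := (hE (q _ x)).1 (by rw [← h.q_comm, hx, map_zero])
  obtain ⟨y, rfl⟩ := h.surj _ e
  obtain ⟨c, hc⟩ := (h.exact _ (x - dD k y)).1 (by rw [map_sub, h.q_comm, he, sub_self])
  obtain ⟨c', rfl⟩ := (hC c).1 (h.inj _ (by
    rw [h.i_comm, hc, map_sub, hx, hD, sub_zero, map_zero]))
  exact ⟨i _ c' + y, by rw [map_add, ← h.i_comm, hc, sub_add_cancel]⟩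

/-- The obstruction to lifting the cocycle e is its connecting class in H^{k+1}(C), which vanishes.
-/
theorem exists_cocycle_lift (hD : ∀ k x, dD (k + 1) (dD k x) = 0) {k : ℕ}
    (hC : Function.Exact (dC k) (dC (k + 1))) {e : E k}
    (he : dE k e = 0) : ∃ x, dD k x = 0 ∧ q k x = e := by
  obtain ⟨x, rfl⟩ := h.surj _ e
  obtain ⟨c, hc⟩ := (h.exact _ (dD k x)).1 (by rw [h.q_comm, he])
  obtain ⟨c', rfl⟩ := (hC c).1 (h.inj _ (by rw [h.i_comm, hc, hD, map_zero]))
  exact ⟨x - i _ c', by rw [map_sub, ← h.i_comm, hc, sub_self],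
    by rw [map_sub, h.exact _ |>.apply_apply_eq_zero, sub_zero]⟩

/-- H^{k+1}(E) sits between H^{k+1}(D) and H^{k+2}(C). This serves for T/T[p], whose sequence begins
with T[p]. -/
theorem exact_right (hD : ∀ k x, dD (k + 1) (dD k x) = 0) {k : ℕ}
    (hC : Function.Exact (dC (k + 1)) (dC (k + 2)))
    (hDk : Function.Exact (dD k) (dD (k + 1))) : Function.Exact (dE k) (dE (k + 1)) := by
  refine fun e => ⟨fun he => ?_, ?_⟩
  · obtain ⟨x, hx, rfl⟩ := h.exists_cocycle_lift hD hC he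
    obtain ⟨y, rfl⟩ := (hDk x).1 hx
    exact ⟨q _ y, (h.q_comm _ _).symm⟩
  · rintro ⟨e, rfl⟩
    obtain ⟨y, rfl⟩ := h.surj _ e
    rw [← h.q_comm, ← h.q_comm, hD, map_zero]

end ShortExact

end Devissage

/-! ### Base change of tensor products -/

section Tensor

variable {A A' T T' : Type*} [CommRing A] [CommRing A'] [CommRing T] [CommRing T']
  {α : A →+* A'} {τ : T →+* T'} {w : A →+* T} {w' : A' →+* T'}
  {G G' M M' : Type*} [AddCommGroup G] [AddCommGroup G'] [AddCommGroup M] [AddCommGroup M']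
  [Module A G] [Module T G] [Module A' G'] [Module T' G'] [Module A M] [Module A' M']
  [SMulCommClass A T G] [SMulCommClass A' T' G']

theorem isBC_toSemilinearMap (τ : T →+* T') : IsBC τ.toSemilinearMap := by
  let l := BC.lift (RingHom.id T') (γ := τ) (fun _ => rfl) τ.toSemilinearMap
  have hl : ∀ x, l (BC.of τ x) = τ x := fun x => BC.lift_id_of τ.toSemilinearMap x
  have h1 : ∀ z : BC τ T, l z • BC.of τ (1 : T) = z := by
    intro z
    induction z using BC.induction with
    | zero => rw [map_zero, zero_smul]
    | of x => rw [hl, ← LinearMap.map_smulₛₗ, smul_eq_mul, mul_one]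
    | add x y hx hy => rw [map_add, add_smul, hx, hy]
    | smul b x hx => rw [map_smul, smul_eq_mul, mul_smul, hx]
  refine ⟨Function.LeftInverse.injective (g := fun b : T' => b • BC.of τ (1 : T)) h1,
    fun b => ⟨b • BC.of τ (1 : T), ?_⟩⟩
  change l _ = b
  rw [map_smul, hl, map_one, smul_eq_mul, mul_one]

/-- Here T' ⊗_T (G ⊗_A M) = G' ⊗_A M = G' ⊗_{A'} M', provided A and A' act on G and G' through T and
T'. For this reason the linear coefficient functors record the homomorphism through which 𝒲_n acts.
-/
theorem isBC_tensor (hw : ∀ a, w' (α a) = τ (w a)) (hG : ∀ a (x : G), a • x = w a • x)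
    (hG' : ∀ a (x : G'), a • x = w' a • x) {g : G →ₛₗ[τ] G'} (hg : IsBC g) {f : M →ₛₗ[α] M'}
    (hf : IsBC f) (h : G ⊗[A] M →ₛₗ[τ] G' ⊗[A'] M') (hh : ∀ x y, h (x ⊗ₜ y) = g x ⊗ₜ f y) :
    IsBC h := by
  let X := BC τ (G ⊗[A] M)
  let : Module A' X := Module.compHom X w'
  have hX : ∀ a (x : X), a • x = w' a • x := fun _ _ => rfl
  let : SMulCommClass T' A' X := ⟨fun t a x => by rw [hX, hX, smul_comm]⟩
  let m (y : M) : G →ₗ[T] G ⊗[A] M :=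
    { toFun x := x ⊗ₜ y
      map_add' _ _ := add_tmul ..
      map_smul' _ _ := rfl }
  -- The inverse has to send g(x) ⊗ f(y) to 1 ⊗ (x ⊗ y). For fixed y this extends T'-linearly in x;
  -- the result is then extended A'-linearly in y.
  let ψ₀ : M →ₛₗ[α] (G' →ₗ[T'] X) :=
    { toFun y := hg.lift (RingHom.id T') (γ := τ) (fun _ => rfl) (BC.of τ ∘ₛₗ m y)
      map_add' y z := LinearMap.ext fun x => by
        refine hg.ext (τ := RingHom.id T') (h := _ + _) (fun x => ?_) x
        rw [LinearMap.add_apply, IsBC.lift_apply, IsBC.lift_apply, IsBC.lift_apply]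
        change BC.of τ (x ⊗ₜ (y + z)) = BC.of τ (x ⊗ₜ y) + BC.of τ (x ⊗ₜ z)
        rw [tmul_add, map_add]
      map_smul' a y := LinearMap.ext fun x => by
        refine hg.ext (τ := RingHom.id T') (h := _ • _) (fun x => ?_) x
        rw [LinearMap.smul_apply, IsBC.lift_apply, IsBC.lift_apply]
        change BC.of τ (x ⊗ₜ (a • y)) = α a • BC.of τ (x ⊗ₜ y)
        rw [hX, hw, ← LinearMap.map_smulₛₗ, ← smul_tmul, hG]
        rfl }
  let ψ₁ : M' →ₗ[A'] (G' →ₗ[T'] X) := hf.lift (RingHom.id A') (γ := α) (fun _ => rfl) ψ₀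
  have hψ₁ : ∀ x y, ψ₁ (f y) (g x) = BC.of τ (x ⊗ₜ y) := fun x y => by
    have : ψ₁ (f y) = ψ₀ y := IsBC.lift_apply ..
    rw [this]
    exact IsBC.lift_apply ..
  let ψ : M' ⊗[A'] G' →+ X := TensorProduct.liftAddHom
    { toFun y := (ψ₁ y).toAddMonoidHom
      map_zero' := by rw [map_zero]; rfl
      map_add' y z := by rw [map_add]; rfl } fun a y x => by
        change ψ₁ (a • y) x = ψ₁ y (a • x)
        rw [map_smul, LinearMap.smul_apply, hX, hG', map_smul]
  have hψ : ∀ y x, ψ (y ⊗ₜ x) = ψ₁ y x := fun y x => rfl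
  let c := TensorProduct.comm A' G' M'
  have hs : ∀ (t : T') z, ψ (c (t • z)) = t • ψ (c z) := by
    intro t z
    induction z using TensorProduct.induction_on with
    | zero => rw [smul_zero, map_zero, map_zero, smul_zero]
    | tmul x y =>
      rw [smul_tmul', TensorProduct.comm_tmul, TensorProduct.comm_tmul, hψ, hψ, map_smul]
    | add x y hx hy => rw [smul_add, map_add, map_add, map_add, map_add, hx, hy, smul_add]
  have hl : ∀ z : X, ψ (c (BC.lift (RingHom.id T') (γ := τ) (fun _ => rfl) h z)) = z := by
    intro z
    induction z using BC.induction with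
    | zero => simp only [map_zero]
    | of z =>
      rw [BC.lift_id_of]
      induction z using TensorProduct.induction_on with
      | zero => simp only [map_zero]
      | tmul x y => rw [hh, TensorProduct.comm_tmul, hψ, hψ₁]
      | add x y hx hy => rw [map_add, map_add, map_add, hx, hy, map_add]
    | add x y hx hy => rw [map_add, map_add, map_add, hx, hy]
    | smul t x hx => rw [map_smul, hs, hx]
  refine ⟨Function.LeftInverse.injective (g := fun z => ψ (c z)) hl, ?_⟩
  rw [← LinearMap.range_eq_top, eq_top_iff]
  rintro z -
  induction z using TensorProduct.induction_on with
  | zero => exact zero_mem _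
  | add x y hx hy => exact add_mem hx hy
  | tmul x y =>
    induction y using hf.induction with
    | add y z hy hz => rw [tmul_add]; exact add_mem hy hz
    | smul a y hy =>
      rw [← smul_tmul, hG', ← smul_tmul']
      exact Submodule.smul_mem _ _ hy
    | of y =>
      induction x using hg.induction with
      | add x z hx hz => rw [add_tmul]; exact add_mem hx hz
      | smul t x hx =>
        rw [← smul_tmul']
        exact Submodule.smul_mem _ _ hx
      | of x => exact ⟨BC.of τ (x ⊗ₜ y), by rw [BC.lift_id_of, hh]⟩

end Tensor

end
end TruncDisp

namespace TruncDisp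


open TensorProduct CategoryTheory

noncomputable section

/-! ### Cosimplicial modules over the Čech nerve and coefficients -/

section Coefficients

/-- A module over `𝒲_n(T)` that is functorial in the ring `T`. -/
structure Coeff (p : ℕ) [Fact p.Prime] (n : ℕ) where
  /-- The underlying type. -/
  obj (T : Type u) [CommRing T] : Type u
  [group (T : Type u) [CommRing T] : AddCommGroup (obj T)]
  [module (T : Type u) [CommRing T] : Module (CalW p n T) (obj T)]
  /-- The functoriality. -/
  map {T T' : Type u} [CommRing T] [CommRing T'] (φ : T →+* T') :
    obj T →ₛₗ[CalW.map p n φ] obj T'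
  map_comp {T T' T'' : Type u} [CommRing T] [CommRing T'] [CommRing T''] (φ : T →+* T')
    (ψ : T' →+* T'') (x : obj T) : map (ψ.comp φ) x = map ψ (map φ x)
  map_id {T : Type u} [CommRing T] (x : obj T) : map (RingHom.id T) x = x

attribute [instance] Coeff.group Coeff.module

theorem Coeff.map_map_eq {p : ℕ} [Fact p.Prime] {n : ℕ} (G : Coeff.{u} p n) {T T₁ T₂ T' : Type u}
    [CommRing T] [CommRing T₁] [CommRing T₂] [CommRing T'] {φ : T →+* T₁} {ψ : T₁ →+* T'}
    {φ' : T →+* T₂} {ψ' : T₂ →+* T'} (h : ∀ t, ψ (φ t) = ψ' (φ' t)) (x : G.obj T) :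
    G.map ψ (G.map φ x) = G.map ψ' (G.map φ' x) := by
  have h' : ψ.comp φ = ψ'.comp φ' := RingHom.ext h
  rw [← G.map_comp, ← G.map_comp, h']

theorem Coeff.map_map_id {p : ℕ} [Fact p.Prime] {n : ℕ} (G : Coeff.{u} p n) {T T₁ : Type u}
    [CommRing T] [CommRing T₁] {φ : T →+* T₁} {ψ : T₁ →+* T} (h : ∀ t, ψ (φ t) = t) (x : G.obj T) :
    G.map ψ (G.map φ x) = x := by
  have h' : ψ.comp φ = RingHom.id T := RingHom.ext h
  rw [← G.map_comp, h', G.map_id]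

/-- A coefficient functor whose values are `T`-modules. -/
structure LinCoeff (p : ℕ) [Fact p.Prime] (n : ℕ) extends Coeff.{u} p n where
  [lin (T : Type u) [CommRing T] : Module T (obj T)]
  /-- The homomorphism through which `𝒲_n(T)` acts. -/
  w (T : Type u) [CommRing T] : CalW p n T →+* T
  w_map {T T' : Type u} [CommRing T] [CommRing T'] (φ : T →+* T') (a : CalW p n T) :
    w T' (CalW.map p n φ a) = φ (w T a)
  smul_eq {T : Type u} [CommRing T] (a : CalW p n T) (x : obj T) : a • x = w T a • x
  map_lin {T T' : Type u} [CommRing T] [CommRing T'] (φ : T →+* T') (t : T) (x : obj T) :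
    map φ (t • x) = φ t • map φ x

attribute [instance] LinCoeff.lin

variable {p : ℕ} [Fact p.Prime] {n : ℕ}

instance (G : LinCoeff.{u} p n) (T : Type u) [CommRing T] :
    SMulCommClass (CalW p n T) T (G.obj T) :=
  ⟨fun a t x => by rw [G.smul_eq, G.smul_eq, smul_comm]⟩

/-- The functoriality of a linear coefficient functor as a semilinear map. -/
def LinCoeff.mapLin (G : LinCoeff.{u} p n) {T T' : Type u} [CommRing T] [CommRing T']
    (φ : T →+* T') : G.obj T →ₛₗ[φ] G.obj T' where
  toFun := G.map φ
  map_add' := map_add _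
  map_smul' := G.map_lin φ

/-- A natural transformation of coefficient functors. -/
structure Coeff.Hom (G H : Coeff.{u} p n) where
  /-- The underlying maps. -/
  app (T : Type u) [CommRing T] : G.obj T →ₗ[CalW p n T] H.obj T
  naturality {T T' : Type u} [CommRing T] [CommRing T'] (φ : T →+* T') (x : G.obj T) :
    app T' (G.map φ x) = H.map φ (app T x)

variable (p n) (R S : Type u) [CommRing R] [CommRing S] [Algebra R S]

/-- `coface` as a ring homomorphism. -/
abbrev cofaceHom {k : ℕ} (i : Fin (k + 1)) : TensorPower R S k →+* TensorPower R S (k + 1) :=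
  coface R S i

/-- `TensorPower.merge` as a ring homomorphism. -/
abbrev mergeHom (k : ℕ) : TensorPower R S (k + 2) →+* TensorPower R S (k + 1) :=
  TensorPower.merge R S k

variable {R S} in
theorem cofaceHom_cofaceHom {k : ℕ} {i j : Fin (k + 1)} (h : i ≤ j) (x : TensorPower R S k) :
    cofaceHom R S j.succ (cofaceHom R S i x) = cofaceHom R S i.castSucc (cofaceHom R S j x) :=
  TensorPower.coface_coface h x

variable {R S} in
theorem mergeHom_cofaceHom_one (k : ℕ) (x : TensorPower R S (k + 1)) :
    mergeHom R S k (cofaceHom R S 1 x) = x :=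
  TensorPower.merge_coface_one k x

variable {R S} in
theorem mergeHom_cofaceHom_succ_succ (k : ℕ) (i : Fin (k + 1)) (x : TensorPower R S (k + 2)) :
    mergeHom R S (k + 1) (cofaceHom R S i.succ.succ x) = cofaceHom R S i.succ (mergeHom R S k x) :=
  TensorPower.merge_coface_succ_succ k i x

/-- A cosimplicial module over the rings `𝒲_n(S ⊗_R ⋯ ⊗_R S)`, with the single degeneracy that
multiplies the first two tensor factors. -/
structure CechModule where
  /-- The underlying types. -/
  obj : ℕ → Type u
  [group (k : ℕ) : AddCommGroup (obj k)]
  [module (k : ℕ) : Module (CalW p n (TensorPower R S (k + 1))) (obj k)]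
  /-- The face maps. -/
  face k (i : Fin (k + 2)) :
    obj k →ₛₗ[CalW.map p n (cofaceHom R S i)] obj (k + 1)
  face_face k (i j : Fin (k + 2)) : i ≤ j → ∀ x,
    face (k + 1) j.succ (face k i x) = face (k + 1) i.castSucc (face k j x)
  /-- The degeneracy. -/
  merge k : obj (k + 1) →ₛₗ[CalW.map p n (mergeHom R S k)] obj k
  merge_face_one k x : merge k (face k 1 x) = x
  merge_face_succ_succ k (i : Fin (k + 1)) x :
    merge (k + 1) (face (k + 1) i.succ.succ x) = face k i.succ (merge k x)

attribute [instance] CechModule.group CechModule.module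

variable {p n R S}

namespace CechModule

/-- The face maps as additive maps. -/
def faceAdd (M : CechModule p n R S) (k : ℕ) (i : Fin (k + 2)) : M.obj k →+ M.obj (k + 1) :=
  (M.face k i).toAddMonoidHom

/-- The differential. -/
def d (M : CechModule p n R S) : ∀ k, M.obj k →+ M.obj (k + 1) := altSum M.faceAdd

theorem d_d (M : CechModule p n R S) (k : ℕ) (x : M.obj k) : M.d (k + 1) (M.d k x) = 0 :=
  altSum_altSum M.face_face k x

/-- The tensor product of a coefficient functor and a cosimplicial module. -/
def tensor (G : Coeff.{u} p n) (M : CechModule p n R S) : CechModule p n R S where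
  obj k := G.obj (TensorPower R S (k + 1)) ⊗[CalW p n (TensorPower R S (k + 1))] M.obj k
  face k i := TensorProduct.map (G.map _) (M.face k i)
  face_face k i j h x := by
    induction x using TensorProduct.induction_on with
    | zero => simp only [map_zero]
    | add x y hx hy => simp only [map_add, hx, hy]
    | tmul x y =>
      simp only [TensorProduct.map_tmul]
      rw [M.face_face k i j h, G.map_map_eq (cofaceHom_cofaceHom h)]
  merge k := TensorProduct.map (G.map _) (M.merge k)
  merge_face_one k x := by
    induction x using TensorProduct.induction_on with
    | zero => simp only [map_zero]
    | add x y hx hy => simp only [map_add, hx, hy]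
    | tmul x y =>
      simp only [TensorProduct.map_tmul]
      rw [M.merge_face_one, G.map_map_id (mergeHom_cofaceHom_one k)]
  merge_face_succ_succ k i x := by
    induction x using TensorProduct.induction_on with
    | zero => simp only [map_zero]
    | add x y hx hy => simp only [map_add, hx, hy]
    | tmul x y =>
      simp only [TensorProduct.map_tmul]
      rw [M.merge_face_succ_succ, G.map_map_eq (mergeHom_cofaceHom_succ_succ k i)]

/-- The pure tensor `x ⊗ y`. -/
def tmul (G : Coeff.{u} p n) (M : CechModule p n R S) (k : ℕ)
    (x : G.obj (TensorPower R S (k + 1))) (y : M.obj k) : (M.tensor G).obj k := x ⊗ₜ y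

@[elab_as_elim]
theorem tensor_induction {G : Coeff.{u} p n} {M : CechModule p n R S} {k : ℕ}
    {motive : (M.tensor G).obj k → Prop} (x : (M.tensor G).obj k) (zero : motive 0)
    (tmul : ∀ x y, motive (M.tmul G k x y))
    (add : ∀ x y, motive x → motive y → motive (x + y)) : motive x :=
  TensorProduct.induction_on (motive := motive) x zero tmul add

/-- The map of tensor products induced by a map of coefficient functors. -/
def tensorMap {G H : Coeff.{u} p n} (f : G.Hom H) (M : CechModule p n R S) (k : ℕ) :
    (M.tensor G).obj k →+ (M.tensor H).obj k :=
  (LinearMap.rTensor (M.obj k) (f.app (TensorPower R S (k + 1)))).toAddMonoidHom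

theorem tensorMap_tmul {G H : Coeff.{u} p n} (f : G.Hom H) (M : CechModule p n R S) (k : ℕ)
    (x : G.obj (TensorPower R S (k + 1))) (y : M.obj k) :
    M.tensorMap f k (M.tmul G k x y) = M.tmul H k (f.app (TensorPower R S (k + 1)) x) y := rfl

theorem face_tensor_tmul (G : Coeff.{u} p n) (M : CechModule p n R S) (k : ℕ) (i : Fin (k + 2))
    (x : G.obj (TensorPower R S (k + 1))) (y : M.obj k) :
    (M.tensor G).face k i (M.tmul G k x y) =
      M.tmul G (k + 1) (G.map (cofaceHom R S i) x) (M.face k i y) := rfl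

theorem tensorMap_d {G H : Coeff.{u} p n} (f : G.Hom H) (M : CechModule p n R S) (k : ℕ)
    (x : (M.tensor G).obj k) :
    M.tensorMap f (k + 1) ((M.tensor G).d k x) = (M.tensor H).d k (M.tensorMap f k x) := by
  simp only [d, altSum_apply, map_sum, map_zsmul]
  refine Finset.sum_congr rfl fun i _ => ?_
  congr 1
  change M.tensorMap f (k + 1) ((M.tensor G).face k i x) =
    (M.tensor H).face k i (M.tensorMap f k x)
  induction x using tensor_induction with
  | zero => simp only [map_zero]
  | add x y hx hy => simp only [map_add, hx, hy]
  | tmul x y =>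
    rw [face_tensor_tmul, tensorMap_tmul, tensorMap_tmul, face_tensor_tmul, f.naturality]

/-- A cosimplicial module is Cartesian and flat. -/
structure IsCartesian (M : CechModule p n R S) : Prop where
  flat k : Module.Flat (CalW p n (TensorPower R S (k + 1))) (M.obj k)
  isBC k : IsBC (M.face k 0)

/-- A short exact sequence of coefficient functors. -/
structure _root_.TruncDisp.Coeff.ShortExact {G H K : Coeff.{u} p n} (f : G.Hom H) (g : H.Hom K) :
    Prop where
  inj (T : Type u) [CommRing T] : Function.Injective (f.app T)
  exact (T : Type u) [CommRing T] : Function.Exact (f.app T) (g.app T)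
  surj (T : Type u) [CommRing T] : Function.Surjective (g.app T)

/-- Flatness of M in each degree is used only for injectivity; the remaining exactness is right
exactness of the tensor product. -/
theorem IsCartesian.shortExact {M : CechModule p n R S} (hM : M.IsCartesian)
    {G H K : Coeff.{u} p n} {f : G.Hom H} {g : H.Hom K} (h : Coeff.ShortExact f g) :
    ShortExact (M.tensor G).d (M.tensor H).d (M.tensor K).d (M.tensorMap f) (M.tensorMap g) where
  inj k := by
    have := hM.flat k
    exact Module.Flat.rTensor_preserves_injective_linearMap (M := M.obj k) _ (h.inj _)
  exact k := rTensor_exact (M.obj k) (h.exact _) (h.surj _)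
  surj k := LinearMap.rTensor_surjective (M.obj k) (h.surj _)
  i_comm k x := M.tensorMap_d f k x
  q_comm k x := M.tensorMap_d g k x

/-! #### Linear coefficients -/

section Lin

variable (G : LinCoeff.{u} p n) (M : CechModule p n R S)

instance (k : ℕ) : Module (TensorPower R S (k + 1)) ((M.tensor G.toCoeff).obj k) :=
  inferInstanceAs (Module (TensorPower R S (k + 1))
    (G.obj (TensorPower R S (k + 1)) ⊗[CalW p n (TensorPower R S (k + 1))] M.obj k))

instance (k : ℕ) : Module R ((M.tensor G.toCoeff).obj k) :=
  Module.compHom _ (algebraMap R (TensorPower R S (k + 1)))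

instance (k : ℕ) : IsScalarTower R (TensorPower R S (k + 1)) ((M.tensor G.toCoeff).obj k) :=
  ⟨fun r t x => by
    rw [Algebra.smul_def, mul_smul]
    rfl⟩

theorem face_tensor_smul (k : ℕ) (i : Fin (k + 2)) (t : TensorPower R S (k + 1))
    (x : (M.tensor G.toCoeff).obj k) : (M.tensor G.toCoeff).face k i (t • x) =
      coface R S i t • (M.tensor G.toCoeff).face k i x := by
  induction x using tensor_induction with
  | zero => rw [smul_zero, map_zero, smul_zero]
  | add x y hx hy => rw [smul_add, map_add, map_add, hx, hy, smul_add]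
  | tmul x y =>
    change (M.tensor G.toCoeff).face k i (M.tmul G.toCoeff k (t • x) y) = _
    rw [face_tensor_tmul, G.map_lin]
    rfl

theorem faceAdd_tensor_smul (k : ℕ) (i : Fin (k + 2)) (r : R)
    (x : (M.tensor G.toCoeff).obj k) : (M.tensor G.toCoeff).faceAdd k i (r • x) =
      r • (M.tensor G.toCoeff).faceAdd k i x := by
  refine (M.face_tensor_smul G k i (algebraMap R _ r) x).trans ?_
  rw [AlgHom.commutes]
  rfl

/-- The face maps as semilinear maps over the tensor powers. -/
def faceLin (k : ℕ) (i : Fin (k + 2)) :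
    (M.tensor G.toCoeff).obj k →ₛₗ[(cofaceHom R S i)]
      (M.tensor G.toCoeff).obj (k + 1) where
  toFun := (M.tensor G.toCoeff).face k i
  map_add' := map_add _
  map_smul' := M.face_tensor_smul G k i

/-- The map `s ⊗ x ↦ (s ⊗ 1) (1 ⊗ x)`. -/
def mu (k : ℕ) :
    S ⊗[R] (M.tensor G.toCoeff).obj k →+ (M.tensor G.toCoeff).obj (k + 1) :=
  TensorProduct.liftAddHom
    { toFun s :=
        { toFun x := slot R S (0 : Fin (k + 2)) s • (M.tensor G.toCoeff).face k 0 x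
          map_zero' := by rw [map_zero, smul_zero]
          map_add' x y := by rw [map_add, smul_add] }
      map_zero' := by
        ext x
        change slot R S (0 : Fin (k + 2)) 0 • (M.tensor G.toCoeff).face k 0 x = 0
        rw [map_zero, zero_smul]
      map_add' s t := by
        ext x
        change slot R S (0 : Fin (k + 2)) (s + t) • (M.tensor G.toCoeff).face k 0 x = _
        rw [map_add, add_smul]
        rfl } fun r s x => by
    change slot R S (0 : Fin (k + 2)) (r • s) • (M.tensor G.toCoeff).faceAdd k 0 x =
      slot R S (0 : Fin (k + 2)) s • (M.tensor G.toCoeff).faceAdd k 0 (r • x)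
    rw [faceAdd_tensor_smul, map_smul, Algebra.smul_def, mul_comm, mul_smul]
    rfl

theorem mu_tmul (k : ℕ) (s : S) (x : (M.tensor G.toCoeff).obj k) :
    M.mu G k (s ⊗ₜ x) = slot R S (0 : Fin (k + 2)) s • (M.tensor G.toCoeff).face k 0 x := rfl

theorem face_mu (k : ℕ) (i : Fin (k + 2)) (s : S) (x : (M.tensor G.toCoeff).obj k) :
    (M.tensor G.toCoeff).faceAdd (k + 1) i.succ (M.mu G k (s ⊗ₜ x)) =
      M.mu G (k + 1) (s ⊗ₜ (M.tensor G.toCoeff).faceAdd k i x) := by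
  rw [mu_tmul, mu_tmul]
  refine (M.face_tensor_smul G (k + 1) i.succ _ _).trans ?_
  rw [(M.tensor G.toCoeff).face_face k 0 i (Fin.zero_le _), TensorPower.coface_slot_apply,
    Fin.succ_succAbove_zero]
  rfl

variable {G M}

/-- The face 0 of G ⊗ M is a tensor product of base change maps, hence itself a base change along
the coface 0, and this coface is T → S ⊗_R T up to isomorphism. -/
theorem IsCartesian.mu_bijective (hM : M.IsCartesian)
    (hG : ∀ k, IsBC (G.mapLin (cofaceHom R S (0 : Fin (k + 2)))))
    (k : ℕ) : Function.Bijective (M.mu G k) := by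
  have h : IsBC (M.faceLin G k 0) :=
    isBC_tensor (α := CalW.map p n (cofaceHom R S (0 : Fin (k + 2))))
      (w := G.w _) (w' := G.w _) (fun a => G.w_map _ a) G.smul_eq G.smul_eq (hG k) (hM.isBC k)
      (M.faceLin G k 0) fun x y => rfl
  exact isBC_bijective_tensor (TensorPower.cons_bijective (k + 1)) h _ fun s x => rfl

variable [Module.FaithfullyFlat R S]

theorem IsCartesian.exact_lin (hM : M.IsCartesian)
    (hG : ∀ k, IsBC (G.mapLin (cofaceHom R S (0 : Fin (k + 2)))))
    (k : ℕ) : Function.Exact ((M.tensor G.toCoeff).d k) ((M.tensor G.toCoeff).d (k + 1)) :=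
  altSum_exact (σ := fun k => ((M.tensor G.toCoeff).merge k).toAddMonoidHom)
    (M.tensor G.toCoeff).face_face (M.faceAdd_tensor_smul G)
    (hM.mu_bijective hG) (M.face_mu G) (M.tensor G.toCoeff).merge_face_one
    (M.tensor G.toCoeff).merge_face_succ_succ k

variable (G M) in
/-- The kernel of the first differential. -/
abbrev Z : Submodule R ((M.tensor G.toCoeff).obj 0) :=
  LinearMap.ker (altSumLin (M.faceAdd_tensor_smul G) 0)

theorem IsCartesian.descent_lin (hM : M.IsCartesian)
    (hG : ∀ k, IsBC (G.mapLin (cofaceHom R S (0 : Fin (k + 2))))) :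
    Function.Bijective fun z : S ⊗[R] M.Z G =>
      (M.tensor G.toCoeff).merge 0 (M.mu G 0 ((M.Z G).subtype.lTensor S z)) :=
  altSum_descent (σ := fun k => ((M.tensor G.toCoeff).merge k).toAddMonoidHom)
    (M.tensor G.toCoeff).face_face (M.faceAdd_tensor_smul G)
    (hM.mu_bijective hG) (M.face_mu G) (M.tensor G.toCoeff).merge_face_one
    (M.tensor G.toCoeff).merge_face_succ_succ

end Lin

end CechModule

end Coefficients

end
end TruncDisp

namespace TruncDisp


open TensorProduct CategoryTheory

noncomputable section

/-! ### The Verschiebung filtration of `𝒲_n` -/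

section Filtration

variable {p : ℕ} [Fact p.Prime] {T : Type u} [CommRing T]

open WittVector

theorem iterate_verschiebung_add (m : ℕ) (x y : WittVector p T) :
    verschiebung^[m] (x + y) = verschiebung^[m] x + verschiebung^[m] y :=
  iterate_map_add ..

theorem coeff_iterate_verschiebung (m : ℕ) (x : WittVector p T) :
    (verschiebung^[m] x).coeff m = x.coeff 0 := by
  simpa using iterate_verschiebung_coeff x m 0

/-- This follows from w_k ∘ F = w_{k+1}. Combined with y V^m(x) = V^m(F^m(y) x), it identifies the
action on the m-th graded piece with the m-th ghost component. -/
theorem constantCoeff_iterate_frobenius (m : ℕ) (x : WittVector p T) :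
    (frobenius^[m] x).coeff 0 = ghostComponent m x := by
  have h : ∀ k, ghostComponent k (frobenius^[m] x) = ghostComponent (k + m) x := by
    intro k
    induction m generalizing k with
    | zero => rfl
    | succ m ih => rw [Function.iterate_succ_apply', ghostComponent_frobenius, ih]; congr 2; ring
  have := h 0
  rwa [zero_add, ghostComponent_apply, wittPolynomial_zero, MvPolynomial.aeval_X] at this

theorem mul_iterate_verschiebung (m : ℕ) (x y : WittVector p T) :
    y * verschiebung^[m] x = verschiebung^[m] (frobenius^[m] y * x) := by
  rw [mul_comm, iterate_verschiebung_mul_left, mul_comm]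

theorem ghostComponent_map {T' : Type u} [CommRing T'] (φ : T →+* T') (m : ℕ)
    (x : WittVector p T) : ghostComponent m (WittVector.map φ x) = φ (ghostComponent m x) := by
  simp only [ghostComponent_apply, aeval_wittPolynomial, map_sum, map_mul, map_pow, map_natCast,
    WittVector.map_coeff]

theorem map_iterate_verschiebung {T' : Type u} [CommRing T'] (φ : T →+* T') (m : ℕ)
    (x : WittVector p T) : WittVector.map φ (verschiebung^[m] x) =
      verschiebung^[m] (WittVector.map φ x) := by
  induction m with
  | zero => rfl
  | succ m ih => rw [Function.iterate_succ_apply', Function.iterate_succ_apply', ← ih,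
      WittVector.map_verschiebung]

theorem exists_iterate_verschiebung (m : ℕ) (x : WittVector p T) (h : ∀ i < m, x.coeff i = 0) :
    ∃ y, x = verschiebung^[m] y :=
  ⟨_, eq_iterate_verschiebung h⟩

variable (p) (n : ℕ)

/-- The projection `W(T) → 𝒲_n(T)`. -/
def CalW.proj (T : Type u) [CommRing T] : WittVector p T →+* CalW p n T :=
  (CalW.mk p n T).comp (W.trunc p (n + 1) T)

theorem CalW.proj_surjective : Function.Surjective (CalW.proj p n T) := fun a => by
  obtain ⟨a, rfl⟩ := CalW.mk_surjective p n a
  obtain ⟨a, rfl⟩ := W.exists_trunc p _ a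
  exact ⟨a, rfl⟩

variable {p n}

theorem CalW.res_proj (x : WittVector p T) : res p n T (proj p n T x) = W.trunc p n T x := by
  simp [proj]

theorem CalW.frob_proj (x : WittVector p T) :
    frob p n T (proj p n T x) = W.trunc p n T (frobenius x) := by
  simp [proj]

theorem CalW.map_proj {T' : Type u} [CommRing T'] (φ : T →+* T') (x : WittVector p T) :
    map p n φ (proj p n T x) = proj p n T' (WittVector.map φ x) := by
  simp [proj, map_mk]

/-- From FV = p, and the integer p can be moved through V^m since F fixes it. -/
theorem frobenius_iterate_verschiebung_succ (m : ℕ) (x : WittVector p T) :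
    frobenius (verschiebung^[m + 1] x) = verschiebung^[m] (x * (p : WittVector p T)) := by
  rw [Function.iterate_succ_apply', frobenius_verschiebung, iterate_verschiebung_mul_left]
  have h : frobenius^[m] (p : WittVector p T) = p := by
    induction m with
    | zero => rfl
    | succ m ih => rw [Function.iterate_succ_apply', ih, map_natCast]
  rw [h]

/-- Vanishing of Res means x = V^n(y). Then F(x) = V^{n−1}(p y), of which the truncation to length n
sees only the coefficient n − 1, equal to p y_0 = p x_n. -/
theorem CalW.proj_eq_zero_iff [NeZero n] (x : WittVector p T) :
    proj p n T x = 0 ↔ (∀ i < n, x.coeff i = 0) ∧ p * x.coeff n = 0 := by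
  obtain ⟨m, rfl⟩ : ∃ m, n = m + 1 := ⟨n - 1, (Nat.succ_pred_eq_of_ne_zero (NeZero.ne n)).symm⟩
  have key : ∀ y : WittVector p T, frobenius (verschiebung^[m + 1] y) =
      verschiebung^[m] (y * (p : WittVector p T)) := frobenius_iterate_verschiebung_succ m
  have hc : ∀ y : WittVector p T, (y * (p : WittVector p T)).coeff 0 = p * (verschiebung^[m + 1] y).coeff (m + 1) :=
    fun y => by
    rw [coeff_iterate_verschiebung, ← constantCoeff_apply, map_mul, map_natCast, mul_comm]
    rfl
  constructor
  · intro h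
    have h1 : W.trunc p (m + 1) T x = 0 := by rw [← res_proj, h, map_zero]
    rw [W.trunc_eq_zero] at h1
    refine ⟨h1, ?_⟩
    obtain ⟨y, rfl⟩ := exists_iterate_verschiebung _ _ h1
    have h2 : W.trunc p (m + 1) T (frobenius (verschiebung^[m + 1] y)) = 0 := by
      rw [← frob_proj, h, map_zero]
    rw [key, W.trunc_eq_zero] at h2
    rw [← hc, ← h2 m (Nat.lt_succ_self m), coeff_iterate_verschiebung]
  · rintro ⟨h1, h2⟩
    refine CalW.ext ?_ ?_
    · rw [res_proj, map_zero, W.trunc_eq_zero]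
      exact h1
    · obtain ⟨y, rfl⟩ := exists_iterate_verschiebung _ _ h1
      rw [frob_proj, map_zero, W.trunc_eq_zero, key]
      intro i hi
      rcases Nat.lt_succ_iff_lt_or_eq.1 hi with hi | rfl
      · exact iterate_verschiebung_coeff_eq_zero _ hi
      · rw [coeff_iterate_verschiebung, hc, h2]

/-- The ring homomorphism `𝒲_n(T) → T` given by the `m`-th ghost component, `m ≤ n`. -/
def CalW.ghost [NeZero n] (m : Fin (n + 1)) (T : Type u) [CommRing T] : CalW p n T →+* T :=
  RingHom.liftOfSurjective (CalW.proj p n T) (CalW.proj_surjective p n)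
    ⟨ghostComponent m, fun x hx => by
      rw [RingHom.mem_ker, CalW.proj_eq_zero_iff] at hx
      rw [RingHom.mem_ker, ghostComponent_apply, aeval_wittPolynomial]
      refine Finset.sum_eq_zero fun i hi => ?_
      rw [Finset.mem_range] at hi
      have hm := m.2
      by_cases hin : i < n
      · rw [hx.1 i hin, zero_pow, mul_zero]
        exact pow_ne_zero _ (Fact.out : p.Prime).ne_zero
      · obtain rfl : i = n := by omega
        -- The only surviving index is i = n, and it occurs only for m = n. The term is then p^n
        -- x_n, and since n ≥ 1 it contains the factor p x_n = 0.
        have hmi : (m : ℕ) - i = 0 := by omega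
        obtain ⟨j, rfl⟩ := Nat.exists_eq_succ_of_ne_zero (NeZero.ne i)
        rw [hmi, pow_zero, pow_one, pow_succ, mul_assoc, hx.2, mul_zero]⟩

theorem CalW.ghost_proj [NeZero n] (m : Fin (n + 1)) (x : WittVector p T) :
    ghost m T (proj p n T x) = ghostComponent m x :=
  RingHom.liftOfRightInverse_comp_apply _ _ _ _ _

theorem CalW.ghost_map [NeZero n] (m : Fin (n + 1)) {T' : Type u} [CommRing T'] (φ : T →+* T')
    (a : CalW p n T) : ghost m T' (map p n φ a) = φ (ghost m T a) := by
  obtain ⟨x, rfl⟩ := proj_surjective p n a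
  rw [map_proj, ghost_proj, ghost_proj, ghostComponent_map]

theorem CalW.ghost_zero [NeZero n] (a : CalW p n T) : ghost 0 T a = w0 p n T a := by
  obtain ⟨x, rfl⟩ := proj_surjective p n a
  rw [ghost_proj, ← constantCoeff_iterate_frobenius]
  simp [w0, proj]

variable (p n) in
/-- The ideal of `𝒲_n(T)` of the elements represented by Witt vectors whose first `m`
coefficients vanish. -/
def CalW.fil (m : ℕ) (T : Type u) [CommRing T] : Ideal (CalW p n T) :=
  (RingHom.ker (WittVector.truncate m : WittVector p T →+* _)).map (proj p n T)

theorem CalW.mem_fil (m : ℕ) (a : CalW p n T) :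
    a ∈ fil p n m T ↔ ∃ y, a = proj p n T (verschiebung^[m] y) := by
  rw [fil, Ideal.mem_map_iff_of_surjective _ (proj_surjective p n)]
  constructor
  · rintro ⟨x, hx, rfl⟩
    rw [WittVector.mem_ker_truncate] at hx
    obtain ⟨y, rfl⟩ := exists_iterate_verschiebung _ _ hx
    exact ⟨y, rfl⟩
  · rintro ⟨y, rfl⟩
    refine ⟨_, ?_, rfl⟩
    rw [WittVector.mem_ker_truncate]
    exact fun i hi => iterate_verschiebung_coeff_eq_zero _ hi

theorem CalW.map_mem_fil (m : ℕ) {T' : Type u} [CommRing T'] (φ : T →+* T') {a : CalW p n T}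
    (ha : a ∈ fil p n m T) : map p n φ a ∈ fil p n m T' := by
  rw [mem_fil] at ha ⊢
  obtain ⟨y, rfl⟩ := ha
  exact ⟨WittVector.map φ y, by rw [map_proj, map_iterate_verschiebung]⟩

theorem CalW.fil_succ_le (m : ℕ) : fil p n (m + 1) T ≤ fil p n m T := fun a ha => by
  rw [mem_fil] at ha ⊢
  obtain ⟨y, rfl⟩ := ha
  exact ⟨verschiebung y, rfl⟩

/-- The `m`-th coefficient of an element of `𝒲_n(T)`. -/
def CalW.coeff (m : ℕ) (a : CalW p n T) : T := (W.out p n (res p n T a)).coeff m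

/-- For m < n the coefficient is visible in Res. The coefficient n is determined only modulo
p-torsion, so the last graded piece needs separate treatment. -/
theorem CalW.coeff_proj {m : ℕ} (hm : m < n) (x : WittVector p T) :
    coeff m (proj p n T x) = x.coeff m := by
  rw [coeff, res_proj]
  exact (W.trunc_eq_iff p n _ _).1 (W.trunc_out p n _) m hm

end Filtration

end
end TruncDisp

namespace TruncDisp


open TensorProduct CategoryTheory

noncomputable section

/-! ### The graded pieces of the Verschiebung filtration as coefficient functors -/

section Graded

open WittVector

variable (p : ℕ) [Fact p.Prime] (n : ℕ)

namespace Coeff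

/-- The coefficient functor `T ↦ 𝒲_n(T)`. -/
abbrev one : Coeff.{u} p n where
  obj T _ := CalW p n T
  map φ := { toFun := CalW.map p n φ, map_add' := map_add _, map_smul' := map_mul _ }
  map_comp φ ψ x := CalW.map_comp p n φ ψ x
  map_id x := CalW.map_id p n x

/-- The coefficient functor given by the filtration of `𝒲_n(T)`. -/
abbrev fil (m : ℕ) : Coeff.{u} p n where
  obj T _ := CalW.fil p n m T
  map φ :=
    { toFun x := ⟨CalW.map p n φ x, CalW.map_mem_fil m φ x.2⟩
      map_add' x y := Subtype.ext (map_add _ _ _)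
      map_smul' a x := Subtype.ext (map_mul _ _ _) }
  map_comp φ ψ x := Subtype.ext (CalW.map_comp p n φ ψ x.1)
  map_id x := Subtype.ext (CalW.map_id p n x.1)

variable {p n} in
theorem fil_cases {m : ℕ} {T : Type u} [CommRing T] (x : (fil p n m).obj T) :
    ∃ y : WittVector p T, ∃ h, x = ⟨CalW.proj p n T (verschiebung^[m] y), h⟩ := by
  obtain ⟨y, hy⟩ := (CalW.mem_fil m _).1 x.2
  exact ⟨y, (CalW.mem_fil m _).2 ⟨y, rfl⟩, Subtype.ext hy⟩

end Coeff

variable [NeZero n]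

namespace LinCoeff

/-- The ring `T` as a `𝒲_n(T)`-module via the `m`-th ghost component. -/
def Gr (p : ℕ) [Fact p.Prime] (n : ℕ) (_ : Fin (n + 1)) (T : Type u) [CommRing T] : Type u := T

instance (m : Fin (n + 1)) (T : Type u) [CommRing T] : AddCommGroup (Gr p n m T) :=
  inferInstanceAs (AddCommGroup T)

instance (m : Fin (n + 1)) (T : Type u) [CommRing T] : Module T (Gr p n m T) :=
  inferInstanceAs (Module T T)

instance (m : Fin (n + 1)) (T : Type u) [CommRing T] : Module (CalW p n T) (Gr p n m T) :=
  Module.compHom T (CalW.ghost m T)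

/-- The coefficient functor `T ↦ T`, where `𝒲_n(T)` acts via the `m`-th ghost component. -/
def gr (m : Fin (n + 1)) : LinCoeff.{u} p n where
  obj T _ := Gr p n m T
  map φ :=
    { toFun := φ
      map_add' := map_add φ
      map_smul' a x := (map_mul φ (CalW.ghost m _ a) x).trans
        (congrArg (· * φ x) (CalW.ghost_map m φ a).symm) }
  map_comp φ ψ x := rfl
  map_id x := rfl
  w T _ := CalW.ghost m T
  w_map φ a := CalW.ghost_map m φ a
  smul_eq a x := rfl
  map_lin φ t x := map_mul φ t x

/-- The `p`-torsion of a ring. -/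
def pTorsion (T : Type u) [CommRing T] : Submodule T T := LinearMap.ker (LinearMap.lsmul T T (p : T))

variable {p} in
theorem mem_pTorsion {T : Type u} [CommRing T] (t : T) : t ∈ pTorsion p T ↔ p * t = 0 := Iff.rfl

/-- The `p`-torsion of `T` as a `𝒲_n(T)`-module via the last ghost component. -/
def Tor (_ : ℕ) (T : Type u) [CommRing T] : Type u := pTorsion p T

instance (T : Type u) [CommRing T] : AddCommGroup (Tor p n T) :=
  inferInstanceAs (AddCommGroup (pTorsion p T))

instance (T : Type u) [CommRing T] : Module T (Tor p n T) :=
  inferInstanceAs (Module T (pTorsion p T))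

instance (T : Type u) [CommRing T] : Module (CalW p n T) (Tor p n T) :=
  Module.compHom (pTorsion p T) (CalW.ghost (Fin.last n) T)

/-- The coefficient functor `T ↦ T[p]`, where `𝒲_n(T)` acts via the last ghost component. -/
def tor : LinCoeff.{u} p n where
  obj T _ := Tor p n T
  map φ :=
    { toFun x := ⟨φ x.1, by
        rw [mem_pTorsion, ← map_natCast φ, ← map_mul, (mem_pTorsion _).1 x.2, map_zero]⟩
      map_add' x y := Subtype.ext (map_add φ _ _)
      map_smul' a x := by
        refine Subtype.ext ?_
        change φ (CalW.ghost _ _ a * x.1) = CalW.ghost _ _ (CalW.map p n φ a) * φ x.1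
        rw [map_mul, CalW.ghost_map] }
  map_comp φ ψ x := rfl
  map_id x := rfl
  w T _ := CalW.ghost (Fin.last n) T
  w_map φ a := CalW.ghost_map _ φ a
  smul_eq a x := rfl
  map_lin φ t x := Subtype.ext (map_mul φ _ _)

theorem isBC_gr (m : Fin (n + 1)) {T T' : Type u} [CommRing T] [CommRing T'] (φ : T →+* T') :
    IsBC ((gr p n m).mapLin φ) :=
  isBC_toSemilinearMap φ

/-- T[p] is the kernel of multiplication by p, and flat base change preserves kernels. -/
theorem isBC_tor {T T' : Type u} [CommRing T] [CommRing T'] (φ : T →+* T') (hφ : φ.Flat) :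
    IsBC ((tor p n).mapLin φ) := by
  let := φ.toAlgebra
  have : Module.Flat T T' := hφ
  have hex : Function.Exact ((pTorsion p T).subtype.lTensor T')
      ((LinearMap.lsmul T T (p : T)).lTensor T') :=
    Module.Flat.lTensor_exact T' (LinearMap.exact_subtype_ker_map _)
  have hinj := Module.Flat.lTensor_preserves_injective_linearMap (M := T') (pTorsion p T).subtype
    (Submodule.injective_subtype _)
  let e : T' ⊗[T] T ≃ₗ[T] T' := TensorProduct.rid T T'
  let g : T' ⊗[T] pTorsion p T →ₗ[T'] pTorsion p T' := BC.lift (RingHom.id T') (γ := φ)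
    (fun _ => rfl) ((tor p n).mapLin φ)
  have hg : ∀ z, (g z : T') = e ((pTorsion p T).subtype.lTensor T' z) := by
    intro z
    induction z using TensorProduct.induction_on with
    | zero => simp only [map_zero]; rfl
    | add x y hx hy => simp only [map_add, ← hx, ← hy]; rfl
    | tmul t x =>
      have h : (t ⊗ₜ x : T' ⊗[T] pTorsion p T) =
          (t • BC.of φ x : BC φ (pTorsion p T)) := by
        change _ = (t * 1) ⊗ₜ[T] x
        rw [mul_one]
      have h' : g (t ⊗ₜ x) = t • (tor p n).mapLin φ x := by
        rw [h]
        refine (map_smul _ _ _).trans ?_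
        congr 1
        exact BC.lift_id_of ..
      rw [h', LinearMap.lTensor_tmul]
      change t * φ x = φ x * t
      rw [mul_comm]
  have hp : ∀ z, e ((LinearMap.lsmul T T (p : T)).lTensor T' z) = p * e z := by
    intro z
    induction z using TensorProduct.induction_on with
    | zero => simp only [map_zero, mul_zero]
    | add x y hx hy => simp only [map_add, hx, hy, mul_add]
    | tmul t x =>
      rw [LinearMap.lTensor_tmul]
      change φ (p * x) * t = p * (φ x * t)
      rw [map_mul, map_natCast, mul_assoc]
  change Function.Bijective g
  constructor
  · intro x y hxy
    have := congrArg Subtype.val hxy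
    rw [hg, hg] at this
    exact hinj (e.injective this)
  · intro y
    obtain ⟨z, hz⟩ := e.surjective y
    obtain ⟨w, hw⟩ := (hex z).1 (e.injective (by
      rw [hp, hz, map_zero]
      exact (mem_pTorsion _).1 y.2))
    exact ⟨w, Subtype.ext (by rw [hg, hw, hz])⟩

end LinCoeff

namespace Coeff

open LinCoeff

variable {n}

/-- The inclusion of a step of the filtration. -/
def filSucc (m : ℕ) : Hom (fil.{u} p n (m + 1)) (fil p n m) where
  app T _ := Submodule.inclusion (CalW.fil_succ_le m)
  naturality φ x := rfl

/-- The inclusion of the first step of the filtration. -/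
def filOne : Hom (fil.{u} p n 1) (one p n) where
  app T _ := (CalW.fil p n 1 T).subtype
  naturality φ x := rfl

/-- The homomorphism `w_0`. -/
def oneGr : Hom (one.{u} p n) (gr p n 0).toCoeff where
  app T _ :=
    { toFun a := CalW.w0 p n T a
      map_add' := map_add _
      map_smul' a b := by
        change CalW.w0 p n T (a * b) = CalW.ghost 0 T a * CalW.w0 p n T b
        rw [map_mul, CalW.ghost_zero] }
  naturality φ a := CalW.w0_map p n φ a

theorem coeff_proj_mul {T : Type u} [CommRing T] {m : ℕ} (hm : m < n) (a : CalW p n T)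
    (x : WittVector p T) : CalW.coeff m (a * CalW.proj p n T (verschiebung^[m] x)) =
      CalW.ghost ⟨m, hm.trans n.lt_succ_self⟩ T a * x.coeff 0 := by
  obtain ⟨y, rfl⟩ := CalW.proj_surjective p n a
  rw [← map_mul, CalW.coeff_proj hm, mul_iterate_verschiebung, coeff_iterate_verschiebung,
    CalW.ghost_proj, ← constantCoeff_iterate_frobenius]
  rw [mul_coeff_zero]

/-- The `m`-th coefficient. -/
def filGr (m : ℕ) (hm : m < n) :
    Hom (fil.{u} p n m) (gr p n ⟨m, hm.trans n.lt_succ_self⟩).toCoeff where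
  app T _ :=
    { toFun a := (CalW.coeff m a.1 : T)
      map_add' a b := by
        obtain ⟨x, _, rfl⟩ := fil_cases a
        obtain ⟨y, _, rfl⟩ := fil_cases b
        change CalW.coeff m (CalW.proj p n T _ + CalW.proj p n T _) = _
        rw [← map_add, ← iterate_verschiebung_add, CalW.coeff_proj hm, CalW.coeff_proj hm,
          CalW.coeff_proj hm]
        simp only [coeff_iterate_verschiebung]
        exact add_coeff_zero _ _
      map_smul' a b := by
        obtain ⟨x, _, rfl⟩ := fil_cases b
        change CalW.coeff m (a * CalW.proj p n T (verschiebung^[m] x)) = CalW.ghost _ T a * id (CalW.coeff m (CalW.proj p n T _))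
        rw [coeff_proj_mul p hm, id, CalW.coeff_proj hm, coeff_iterate_verschiebung] }
  naturality {T T'} _ _ φ a := by
    obtain ⟨x, _, rfl⟩ := fil_cases a
    change CalW.coeff m (CalW.map p n φ (CalW.proj p n T _)) =
      φ (CalW.coeff m (CalW.proj p n T _))
    rw [CalW.map_proj, CalW.coeff_proj hm, CalW.coeff_proj hm, WittVector.map_coeff]

-- In length n + 1, V^n(x) depends only on x_0. This makes t ↦ V^n[t] additive although the
-- Teichmüller map is not.
variable (n) in
theorem proj_iterate_verschiebung_eq {T : Type u} [CommRing T] {x y : WittVector p T}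
    (h : x.coeff 0 = y.coeff 0) : CalW.proj p n T (verschiebung^[n] x) =
      CalW.proj p n T (verschiebung^[n] y) := by
  refine congrArg (CalW.mk p n T) ((W.trunc_eq_iff p _ _ _).2 fun i hi => ?_)
  rcases Nat.lt_succ_iff_lt_or_eq.1 hi with hi | rfl
  · rw [iterate_verschiebung_coeff_eq_zero _ hi, iterate_verschiebung_coeff_eq_zero _ hi]
  · rw [coeff_iterate_verschiebung, coeff_iterate_verschiebung, h]

variable (n) in
/-- The map `t ↦ V^n([t])`. -/
def grFil : Hom (gr.{u} p n (Fin.last n)).toCoeff (fil p n n) where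
  app T _ :=
    { toFun (t : T) := ⟨CalW.proj p n T (verschiebung^[n] (teichmuller p t)),
        (CalW.mem_fil n _).2 ⟨_, rfl⟩⟩
      map_add' (s t : T) := Subtype.ext (by
        change _ = CalW.proj p n T _ + CalW.proj p n T _
        rw [← map_add, ← iterate_verschiebung_add]
        refine proj_iterate_verschiebung_eq p n ?_
        rw [add_coeff_zero, teichmuller_coeff_zero, teichmuller_coeff_zero]
        exact teichmuller_coeff_zero p (s + t : T))
      map_smul' a (t : T) := Subtype.ext (by
        obtain ⟨y, rfl⟩ := CalW.proj_surjective p n a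
        change CalW.proj p n T (verschiebung^[n] (teichmuller p (CalW.ghost (Fin.last n) T
          (CalW.proj p n T y) * t))) = CalW.proj p n T _ * CalW.proj p n T _
        rw [← map_mul, mul_iterate_verschiebung]
        refine proj_iterate_verschiebung_eq p n ?_
        rw [mul_coeff_zero, teichmuller_coeff_zero, CalW.ghost_proj, teichmuller_coeff_zero,
          constantCoeff_iterate_frobenius]
        rfl) }
  naturality {T T'} _ _ φ (t : T) := Subtype.ext (by
    change CalW.proj p n T' _ = CalW.map p n φ (CalW.proj p n T _)
    rw [CalW.map_proj, map_iterate_verschiebung, map_teichmuller]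
    rfl)

variable (n) in
/-- The inclusion of the `p`-torsion. -/
def torGr : Hom (tor.{u} p n).toCoeff (gr p n (Fin.last n)).toCoeff where
  app T _ :=
    { toFun t := t.1
      map_add' _ _ := rfl
      map_smul' _ _ := rfl }
  naturality _ _ := rfl

/-- V^m(x) has vanishing coefficient m exactly if x_0 = 0, that is, if x is in turn a Verschiebung.
-/
theorem shortExact_filSucc (m : ℕ) (hm : m < n) :
    ShortExact (filSucc.{u} p (n := n) m) (filGr p m hm) where
  inj T _ := Submodule.inclusion_injective (CalW.fil_succ_le m)
  exact T _ a := by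
    obtain ⟨x, h, rfl⟩ := fil_cases a
    change CalW.coeff m (CalW.proj p n T _) = 0 ↔ _
    rw [CalW.coeff_proj hm, coeff_iterate_verschiebung]
    constructor
    · intro h0
      obtain ⟨y, rfl⟩ := exists_iterate_verschiebung 1 x fun i hi => by
        rwa [Nat.lt_one_iff.1 hi]
      exact ⟨⟨CalW.proj p n T (verschiebung^[m + 1] y), (CalW.mem_fil _ _).2 ⟨_, rfl⟩⟩, rfl⟩
    · rintro ⟨b, hb⟩
      obtain ⟨y, hy⟩ := (CalW.mem_fil (m + 1) b.1).1 b.2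
      have hb' : b.1 = CalW.proj p n T (verschiebung^[m] x) := congrArg Subtype.val hb
      have := congrArg (CalW.coeff m) (hy.symm.trans hb')
      rw [CalW.coeff_proj hm, CalW.coeff_proj hm, coeff_iterate_verschiebung,
        iterate_verschiebung_coeff_eq_zero _ (Nat.lt_succ_self m)] at this
      exact this.symm
  surj T _ (t : T) := ⟨⟨CalW.proj p n T (verschiebung^[m] (teichmuller p t)),
    (CalW.mem_fil _ _).2 ⟨_, rfl⟩⟩, by
      change CalW.coeff m (CalW.proj p n T _) = t
      rw [CalW.coeff_proj hm, coeff_iterate_verschiebung, teichmuller_coeff_zero]⟩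

theorem w0_proj {T : Type u} [CommRing T] (x : WittVector p T) :
    CalW.w0 p n T (CalW.proj p n T x) = x.coeff 0 := by
  simp [CalW.w0, CalW.proj]

theorem shortExact_filOne : ShortExact (filOne.{u} p (n := n)) (oneGr p) where
  inj T _ := Submodule.injective_subtype _
  exact T _ (a : CalW p n T) := by
    obtain ⟨x, rfl⟩ := CalW.proj_surjective p n a
    change CalW.w0 p n T _ = 0 ↔ _
    rw [w0_proj]
    constructor
    · intro h0
      obtain ⟨y, rfl⟩ := exists_iterate_verschiebung 1 x fun i hi => by
        rwa [Nat.lt_one_iff.1 hi]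
      exact ⟨⟨_, (CalW.mem_fil _ _).2 ⟨y, rfl⟩⟩, rfl⟩
    · rintro ⟨b, hb⟩
      obtain ⟨y, hy⟩ := (CalW.mem_fil 1 b.1).1 b.2
      have := congrArg (CalW.w0 p n T) (hy.symm.trans hb)
      rw [w0_proj, w0_proj] at this
      rw [← this]
      exact verschiebung_coeff_zero _
  surj T _ := CalW.w0_surjective (R := T) p n

/-- Presents the last filtration step as T/T[p]: every class V^n(x) equals V^n[x_0], and V^n[t]
vanishes in 𝒲_n exactly when p t = 0. -/
theorem shortExact_torGr : ShortExact (torGr.{u} p n) (grFil p n) where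
  inj T _ := Subtype.val_injective
  exact T _ (t : T) := by
    have : (grFil p n).app T t = 0 ↔
        CalW.proj p n T (verschiebung^[n] (teichmuller p t)) = 0 :=
      Subtype.ext_iff
    rw [this, CalW.proj_eq_zero_iff, coeff_iterate_verschiebung, teichmuller_coeff_zero]
    constructor
    · exact fun h => ⟨⟨t, h.2⟩, rfl⟩
    · rintro ⟨s, rfl⟩
      exact ⟨fun i hi => iterate_verschiebung_coeff_eq_zero _ hi, s.2⟩
  surj T _ a := by
    obtain ⟨x, h, rfl⟩ := fil_cases a
    exact ⟨(x.coeff 0 : T), Subtype.ext (proj_iterate_verschiebung_eq p n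
      (teichmuller_coeff_zero _ _))⟩

end Coeff

end Graded

end
end TruncDisp

namespace TruncDisp


open TensorProduct CategoryTheory

noncomputable section

/-! ### Acyclicity of Cartesian flat modules -/

section Acyclic

variable {p : ℕ} [Fact p.Prime] {n : ℕ} {R S : Type u} [CommRing R] [CommRing S] [Algebra R S]

/-- Inserting 1 in front is the base change T → T ⊗_R S of the flat map R → S. -/
theorem TensorPower.coface_zero_flat [Module.Flat R S] (k : ℕ) :
    (cofaceHom R S (0 : Fin (k + 1))).Flat := by
  let := (cofaceHom R S (0 : Fin (k + 1))).toAlgebra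
  have : IsScalarTower R (TensorPower R S k) (TensorPower R S (k + 1)) :=
    IsScalarTower.of_algebraMap_eq fun r => ((coface R S (0 : Fin (k + 1))).commutes r).symm
  let e : TensorPower R S k ⊗[R] S →ₐ[TensorPower R S k] TensorPower R S (k + 1) :=
    Algebra.TensorProduct.lift (Algebra.ofId _ _) (slot R S (0 : Fin (k + 1)))
      fun _ _ => Commute.all _ _
  have he : Function.Bijective e := by
    have : (e : _ → TensorPower R S (k + 1)) =
        Algebra.TensorProduct.productMap (slot R S (0 : Fin (k + 1))) (coface R S 0) ∘
          Algebra.TensorProduct.comm R (TensorPower R S k) S := by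
      ext z
      induction z using TensorProduct.induction_on with
      | zero => simp
      | tmul t s =>
        refine (Algebra.TensorProduct.lift_tmul ..).trans ?_
        refine Eq.trans ?_ (Algebra.TensorProduct.productMap_apply_tmul ..).symm
        exact mul_comm _ _
      | add x y hx hy => rw [map_add, hx, hy]; simp
    rw [this]
    exact (TensorPower.cons_bijective k).comp (Algebra.TensorProduct.comm R _ S).bijective
  exact Module.Flat.of_linearEquiv (LinearEquiv.ofBijective e.toLinearMap he).symm

namespace CechModule

variable {M : CechModule p n R S}

variable (M) in
/-- The isomorphism `𝒲_n ⊗ M ≅ M`. -/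
def tensorOne (k : ℕ) : (M.tensor (Coeff.one p n)).obj k ≃+ M.obj k :=
  (TensorProduct.lid (CalW p n (TensorPower R S (k + 1))) (M.obj k)).toAddEquiv

theorem tensorOne_tmul (k : ℕ) (a : CalW p n (TensorPower R S (k + 1))) (x : M.obj k) :
    M.tensorOne k (M.tmul (Coeff.one p n) k a x) = a • x := rfl

theorem tensorOne_d (k : ℕ) (x : (M.tensor (Coeff.one p n)).obj k) :
    M.tensorOne (k + 1) ((M.tensor (Coeff.one p n)).d k x) = M.d k (M.tensorOne k x) := by
  simp only [d, altSum_apply, map_sum, map_zsmul]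
  refine Finset.sum_congr rfl fun i _ => ?_
  congr 1
  change M.tensorOne (k + 1) ((M.tensor _).face k i x) = M.face k i (M.tensorOne k x)
  induction x using tensor_induction with
  | zero => simp only [map_zero]
  | add x y hx hy => simp only [map_add, hx, hy]
  | tmul a x =>
    rw [face_tensor_tmul, tensorOne_tmul, tensorOne_tmul, LinearMap.map_smulₛₗ]
    rfl

variable [NeZero n]

variable (M) in
/-- The map `x ↦ 1 ⊗ x` from `M` to its reduction along `w_0`. -/
def toGr (k : ℕ) : M.obj k →ₛₗ[CalW.w0 p n (TensorPower R S (k + 1))]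
    (M.tensor (LinCoeff.gr p n 0).toCoeff).obj k where
  toFun x := M.tmul (LinCoeff.gr p n 0).toCoeff k (1 : TensorPower R S (k + 1)) x
  map_add' x y := tmul_add _ _ _
  map_smul' a x := by
    refine (smul_tmul _ _ _).symm.trans ?_
    change M.tmul (LinCoeff.gr p n 0).toCoeff k (CalW.ghost 0 _ a * 1 : TensorPower R S (k + 1)) x =
      M.tmul (LinCoeff.gr p n 0).toCoeff k (CalW.w0 p n _ a * 1 : TensorPower R S (k + 1)) x
    rw [CalW.ghost_zero]

theorem tensorMap_oneGr (k : ℕ) (x : (M.tensor (Coeff.one p n)).obj k) :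
    M.tensorMap (Coeff.oneGr p) k x = M.toGr k (M.tensorOne k x) := by
  induction x using tensor_induction with
  | zero => simp only [map_zero]
  | add x y hx hy => simp only [map_add, hx, hy]
  | tmul a x =>
    rw [tensorMap_tmul, tensorOne_tmul, LinearMap.map_smulₛₗ]
    change _ = M.tmul (LinCoeff.gr p n 0).toCoeff k
      (CalW.w0 p n _ a * 1 : TensorPower R S (k + 1)) x
    rw [mul_one]
    rfl

/-- Write M as 𝒲_n ⊗ M. As w_0 is the base change of 𝒲_n along itself, `isBC_tensor` applies with
the identity on the second factor. -/
theorem isBC_toGr (k : ℕ) : IsBC (M.toGr k) := by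
  let A := CalW p n (TensorPower R S (k + 1))
  let w := CalW.w0 p n (TensorPower R S (k + 1))
  let l := (TensorProduct.lid A (M.obj k)).symm
  let h : A ⊗[A] M.obj k →ₛₗ[w] (M.tensor (LinCoeff.gr p n 0).toCoeff).obj k :=
    semiComp (γ := w) (M.toGr k) (TensorProduct.lid A (M.obj k)).toLinearMap fun _ => rfl
  have hh : IsBC h := by
    refine isBC_tensor (α := RingHom.id A) (τ := w) (w := RingHom.id A) (w' := CalW.ghost 0 _)
      (M := M.obj k) (M' := M.obj k) (G := A)
      (G' := (LinCoeff.gr p n 0).obj (TensorPower R S (k + 1))) (fun a => CalW.ghost_zero a)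
      (fun _ _ => rfl) (fun _ _ => rfl) (isBC_toSemilinearMap w) (f := LinearMap.id)
      (IsBC.of_bijective Function.bijective_id Function.bijective_id) h fun a x => ?_
    change M.toGr k (a • x) = _
    rw [LinearMap.map_smulₛₗ]
    change M.tmul (LinCoeff.gr p n 0).toCoeff k (w a * 1 : TensorPower R S (k + 1)) x = _
    rw [mul_one]
    rfl
  refine IsBC.comp (f := l.toLinearMap) (IsBC.of_bijective Function.bijective_id l.bijective) hh
    (fun _ => rfl) fun x => ?_
  exact congrArg (M.toGr k) (l.symm_apply_apply x).symm

namespace IsCartesian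

variable [Module.FaithfullyFlat R S] (hM : M.IsCartesian)
include hM

theorem exact_gr (m : Fin (n + 1)) (k : ℕ) :
    Function.Exact ((M.tensor (LinCoeff.gr p n m).toCoeff).d k)
      ((M.tensor (LinCoeff.gr p n m).toCoeff).d (k + 1)) :=
  hM.exact_lin (fun _ => LinCoeff.isBC_gr p n m _) k

theorem exact_tor (k : ℕ) :
    Function.Exact ((M.tensor (LinCoeff.tor p n).toCoeff).d k)
      ((M.tensor (LinCoeff.tor p n).toCoeff).d (k + 1)) :=
  hM.exact_lin (fun k => LinCoeff.isBC_tor p n _ (TensorPower.coface_zero_flat (k + 1))) k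

/-- Descending induction on m, where j = n − m. The start m = n is the cokernel of T[p] → T, at the
cost of one further degree for T[p]; each later step is an extension by a copy of T. -/
theorem exact_fil {m j : ℕ} (hm : m + j = n) (k : ℕ) :
    Function.Exact ((M.tensor (Coeff.fil p n m)).d k) ((M.tensor (Coeff.fil p n m)).d (k + 1)) := by
  induction j generalizing m k with
  | zero =>
    obtain rfl : m = n := hm
    exact (hM.shortExact (Coeff.shortExact_torGr p)).exact_right (CechModule.d_d _)
      (hM.exact_tor (k + 1)) (hM.exact_gr _ k)
  | succ j ih =>
    exact (hM.shortExact (Coeff.shortExact_filSucc p m (by omega))).exact_mid (CechModule.d_d _)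
      (ih (by omega) k) (hM.exact_gr _ k)

theorem exact_fil_one (k : ℕ) :
    Function.Exact ((M.tensor (Coeff.fil p n 1)).d k) ((M.tensor (Coeff.fil p n 1)).d (k + 1)) :=
  hM.exact_fil (Nat.add_sub_cancel' (Nat.pos_of_neZero n)) k

/-- The complex of a Cartesian flat module is exact in positive degrees. -/
theorem exact (k : ℕ) : Function.Exact (M.d k) (M.d (k + 1)) := by
  have h := (hM.shortExact (Coeff.shortExact_filOne p)).exact_mid (CechModule.d_d _)
    (hM.exact_fil_one k) (hM.exact_gr 0 k)
  refine fun x => ⟨fun hx => ?_, ?_⟩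
  · obtain ⟨x, rfl⟩ := (M.tensorOne _).surjective x
    rw [← tensorOne_d] at hx
    obtain ⟨y, rfl⟩ := (h x).1 ((M.tensorOne _).injective (hx.trans (map_zero _).symm))
    exact ⟨M.tensorOne _ y, (tensorOne_d _ _).symm⟩
  · rintro ⟨y, rfl⟩
    exact M.d_d k y

/-- A cocycle of the reduction lifts. -/
theorem exists_cocycle_lift {z : (M.tensor (LinCoeff.gr p n 0).toCoeff).obj 0}
    (hz : (M.tensor (LinCoeff.gr p n 0).toCoeff).d 0 z = 0) :
    ∃ x, M.d 0 x = 0 ∧ M.toGr 0 x = z := by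
  obtain ⟨x, hx, rfl⟩ := (hM.shortExact (Coeff.shortExact_filOne p)).exists_cocycle_lift
    (CechModule.d_d _) (hM.exact_fil_one 0) hz
  exact ⟨M.tensorOne 0 x, by rw [← tensorOne_d, hx, map_zero], (tensorMap_oneGr _ _).symm⟩

end IsCartesian

end CechModule

end Acyclic

end
end TruncDisp

namespace TruncDisp


open TensorProduct CategoryTheory

noncomputable section

/-! ### Equalizers -/

section Equalizer

/-! ### Equalizers and flat tensor products -/

section Tensor

variable {A B C : Type*} [CommRing A] [CommRing B] [CommRing C] {σ : A →+* B} {α β : B →+* C}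
  {γ : A →+* C} {G G' G'' P N K : Type*} [AddCommGroup G] [AddCommGroup G'] [AddCommGroup G'']
  [AddCommGroup P] [AddCommGroup N] [AddCommGroup K] [Module A G] [Module B G'] [Module C G'']
  [Module A P] [Module B N] [Module C K]

/-- The cancellation G' ⊗_A P = G' ⊗_B (B ⊗_A P). -/
theorem IsBC.tensor_bijective {f : P →ₛₗ[σ] N} (hf : IsBC f) [Module A G']
    (hG : ∀ a (x : G'), a • x = σ a • x) (m : G' ⊗[A] P →+ G' ⊗[B] N)
    (hm : ∀ x y, m (x ⊗ₜ y) = x ⊗ₜ f y) : Function.Bijective m := by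
  have : SMulCommClass A B G' := ⟨fun a b x => by rw [hG, hG, smul_comm]⟩
  let h : G' ⊗[A] P →ₛₗ[RingHom.id B] G' ⊗[B] N :=
    { toFun := m
      map_add' := map_add m
      map_smul' b z := by
        induction z using TensorProduct.induction_on with
        | zero => simp only [smul_zero, map_zero]
        | add x y hx hy => rw [smul_add, map_add, map_add, hx, hy, smul_add]
        | tmul x y => rw [smul_tmul', hm, hm, smul_tmul']; rfl }
  exact (isBC_tensor (w := σ) (w' := RingHom.id B) (τ := RingHom.id B) (α := σ) (fun _ => rfl) hG
    (fun _ _ => rfl) (g := LinearMap.id) (IsBC.of_bijective Function.bijective_id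
      Function.bijective_id) hf h hm).bijective Function.bijective_id

/-- Base change of an equalizer along a flat module. -/
theorem tensor_equalizer (hα : ∀ a, γ a = α (σ a)) (hβ : ∀ a, γ a = β (σ a)) {g : G →ₛₗ[σ] G'}
    {u : G' →ₛₗ[α] G''} {v : G' →ₛₗ[β] G''} (hg : Function.Injective g)
    (huv : ∀ x, u (g x) = v (g x)) (heq : ∀ y, u y = v y → ∃ x, g x = y) [Module.Flat A P]
    {f : P →ₛₗ[σ] N} (hf : IsBC f) {f₁ : N →ₛₗ[α] K} {f₂ : N →ₛₗ[β] K} {k : P →ₛₗ[γ] K}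
    (hk : IsBC k) (h₁ : ∀ x, k x = f₁ (f x)) (h₂ : ∀ x, k x = f₂ (f x)) :
    Function.Injective (TensorProduct.map g f) ∧
      ∀ z, TensorProduct.map u f₁ z = TensorProduct.map v f₂ z →
        ∃ x, TensorProduct.map g f x = z := by
  let : Module A G' := Module.compHom G' σ
  let : Module A G'' := Module.compHom G'' γ
  have hG' : ∀ a (x : G'), a • x = σ a • x := fun _ _ => rfl
  have hG'' : ∀ a (x : G''), a • x = γ a • x := fun _ _ => rfl
  let gl : G →ₗ[A] G' :=
    { toFun := g
      map_add' := map_add g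
      map_smul' a x := g.map_smulₛₗ a x }
  -- `u` and `v` are semilinear over different homomorphisms, but both become A-linear because α and
  -- β agree on A. The equalizer is thus the kernel of an A-linear map, and tensoring with the flat
  -- module P preserves it; `θ'` and `θ''` translate the result.
  let dl : G' →ₗ[A] G'' :=
    { toFun x := u x - v x
      map_add' x y := by rw [map_add, map_add]; abel
      map_smul' a x := by
        rw [hG', LinearMap.map_smulₛₗ, LinearMap.map_smulₛₗ, ← hα, ← hβ, ← smul_sub, hG'']
        rfl }
  have hex : Function.Exact gl dl := fun y =>
    ⟨fun h => heq y (sub_eq_zero.1 h), by rintro ⟨x, rfl⟩; exact sub_eq_zero.2 (huv x)⟩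
  have hinj := Module.Flat.rTensor_preserves_injective_linearMap (M := P) gl hg
  have hex' := Module.Flat.rTensor_exact P hex
  let θ' : G' ⊗[A] P →+ G' ⊗[B] N := TensorProduct.liftAddHom
    { toFun x :=
        { toFun y := x ⊗ₜ f y
          map_zero' := by rw [map_zero, tmul_zero]
          map_add' y z := by rw [map_add, tmul_add] }
      map_zero' := by ext y; exact zero_tmul _ _
      map_add' x x' := by ext y; exact add_tmul _ _ _ } fun a x y => by
        change (a • x) ⊗ₜ f y = x ⊗ₜ f (a • y)
        rw [hG', LinearMap.map_smulₛₗ, smul_tmul]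
  let θ'' : G'' ⊗[A] P →+ G'' ⊗[C] K := TensorProduct.liftAddHom
    { toFun x :=
        { toFun y := x ⊗ₜ k y
          map_zero' := by rw [map_zero, tmul_zero]
          map_add' y z := by rw [map_add, tmul_add] }
      map_zero' := by ext y; exact zero_tmul _ _
      map_add' x x' := by ext y; exact add_tmul _ _ _ } fun a x y => by
        change (a • x) ⊗ₜ k y = x ⊗ₜ k (a • y)
        rw [hG'', LinearMap.map_smulₛₗ, smul_tmul]
  have hb' : Function.Bijective θ' := hf.tensor_bijective hG' θ' fun _ _ => rfl
  have hb'' : Function.Bijective θ'' := hk.tensor_bijective hG'' θ'' fun _ _ => rfl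
  have hc' : ∀ z, TensorProduct.map g f z = θ' (gl.rTensor P z) := by
    intro z
    induction z using TensorProduct.induction_on with
    | zero => simp only [map_zero]
    | add x y hx hy => simp only [map_add, hx, hy]
    | tmul x y => rfl
  have hc'' : ∀ z, TensorProduct.map u f₁ (θ' z) - TensorProduct.map v f₂ (θ' z) =
      θ'' (dl.rTensor P z) := by
    intro z
    induction z using TensorProduct.induction_on with
    | zero => simp only [map_zero, sub_zero]
    | add x y hx hy => rw [map_add, map_add, map_add, map_add, map_add, ← hx, ← hy]; abel
    | tmul x y =>
      change u x ⊗ₜ f₁ (f y) - v x ⊗ₜ f₂ (f y) = (u x - v x) ⊗ₜ k y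
      rw [← h₁, ← h₂, sub_tmul]
  constructor
  · intro x y hxy
    rw [hc', hc'] at hxy
    exact hinj (hb'.1 hxy)
  · intro z hz
    obtain ⟨z, rfl⟩ := hb'.2 z
    rw [← sub_eq_zero, hc''] at hz
    obtain ⟨x, rfl⟩ := (hex' z).1 (hb''.1 (hz.trans (map_zero _).symm))
    exact ⟨x, hc' x⟩

/-- The case in which the coefficients are the rings themselves; elements x correspond to 1 ⊗ x. -/
theorem module_equalizer (hα : ∀ a, γ a = α (σ a)) (hβ : ∀ a, γ a = β (σ a))
    (hσ : Function.Injective σ) (heq : ∀ b, α b = β b → ∃ a, σ a = b) [Module.Flat A P]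
    {f : P →ₛₗ[σ] N} (hf : IsBC f) {f₁ : N →ₛₗ[α] K} {f₂ : N →ₛₗ[β] K} {k : P →ₛₗ[γ] K}
    (hk : IsBC k) (h₁ : ∀ x, k x = f₁ (f x)) (h₂ : ∀ x, k x = f₂ (f x)) :
    Function.Injective f ∧ ∀ z, f₁ z = f₂ z → ∃ x, f x = z := by
  obtain ⟨hi, hs⟩ := tensor_equalizer hα hβ (g := σ.toSemilinearMap) (u := α.toSemilinearMap)
    (v := β.toSemilinearMap) hσ (fun a => (hα a).symm.trans (hβ a)) heq hf hk h₁ h₂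
  have h : ∀ x : P, TensorProduct.map σ.toSemilinearMap f (1 ⊗ₜ x) = 1 ⊗ₜ f x := fun x => by
    rw [TensorProduct.map_tmul]
    congr 1
    exact map_one σ
  constructor
  · intro x y hxy
    have := hi (a₁ := 1 ⊗ₜ x) (a₂ := 1 ⊗ₜ y) (by rw [h, h, hxy])
    simpa using congrArg (TensorProduct.lid A P) this
  · intro z hz
    obtain ⟨x, hx⟩ := hs (1 ⊗ₜ z) (by
      rw [TensorProduct.map_tmul, TensorProduct.map_tmul, hz]
      congr 1
      exact (map_one α).trans (map_one β).symm)
    obtain ⟨x, rfl⟩ := (TensorProduct.lid A P).symm.surjective x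
    rw [TensorProduct.lid_symm_apply, h] at hx
    exact ⟨x, by simpa using congrArg (TensorProduct.lid B N) hx⟩

end Tensor

/-! ### Equalizers of rings and Witt vectors -/

section Witt

variable {p : ℕ} [Fact p.Prime] {n : ℕ} {R S T : Type u} [CommRing R] [CommRing S] [CommRing T]

open WittVector

theorem W.map_injective {φ : R →+* S} (hφ : Function.Injective φ) :
    Function.Injective (W.map p n φ) := by
  intro x y h
  obtain ⟨x, rfl⟩ := W.exists_trunc p n x
  obtain ⟨y, rfl⟩ := W.exists_trunc p n y
  rw [W.map_trunc, W.map_trunc, W.trunc_eq_iff] at h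
  rw [W.trunc_eq_iff]
  exact fun i hi => hφ (h i hi)

theorem CalW.map_injective {φ : R →+* S} (hφ : Function.Injective φ) :
    Function.Injective (CalW.map p n φ) := fun x y h =>
  CalW.ext (W.map_injective hφ (congrArg (CalW.res p n S) h))
    (W.map_injective hφ (congrArg (CalW.frob p n S) h))

/-- As a set, W_n is a product of copies of the ring, functorially, so the coefficients may be
descended one at a time. -/
theorem W.exists_of_map_eq {φ : R →+* S} {f g : S →+* T} (h : ∀ s, f s = g s → ∃ r, φ r = s)
    {x : W p n S} (hx : W.map p n f x = W.map p n g x) : ∃ y, W.map p n φ y = x := by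
  classical
  obtain ⟨x, rfl⟩ := W.exists_trunc p n x
  rw [W.map_trunc, W.map_trunc, W.trunc_eq_iff] at hx
  have h' : ∀ i, ∃ r, i < n → φ r = x.coeff i := fun i => by
    by_cases hi : i < n
    · obtain ⟨r, hr⟩ := h _ (hx i hi)
      exact ⟨r, fun _ => hr⟩
    · exact ⟨0, fun h => absurd h hi⟩
  choose r hr using h'
  refine ⟨W.trunc p n R (WittVector.mk p r), ?_⟩
  rw [W.map_trunc, W.trunc_eq_iff]
  exact fun i hi => hr i hi

/-- Res(a) and F(a) both descend to R, but the pair of descended vectors need not come from one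
vector of length n + 1. The missing last coefficient is known only through its product with p; the
divisibility hypothesis `hp` supplies it. -/
theorem CalW.exists_of_map_eq [NeZero n] {φ : R →+* S} {f g : S →+* T}
    (hφ : Function.Injective φ)
    (h : ∀ s, f s = g s → ∃ r, φ r = s) (hp : ∀ r s, φ r = p * s → ∃ r', r = p * r')
    {a : CalW p n S} (ha : CalW.map p n f a = CalW.map p n g a) :
    ∃ b, CalW.map p n φ b = a := by
  obtain ⟨x, rfl⟩ := CalW.proj_surjective p n a
  have hy : ∃ y, W.map p n φ y = CalW.res p n S (CalW.proj p n S x) :=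
    W.exists_of_map_eq h (congrArg (CalW.res p n T) ha)
  have hz : ∃ z, W.map p n φ z = CalW.frob p n S (CalW.proj p n S x) :=
    W.exists_of_map_eq h (congrArg (CalW.frob p n T) ha)
  obtain ⟨y, hy⟩ := hy
  obtain ⟨z, hz⟩ := hz
  obtain ⟨y, rfl⟩ := W.exists_trunc p n y
  obtain ⟨z, rfl⟩ := W.exists_trunc p n z
  rw [CalW.res_proj, W.map_trunc] at hy
  rw [CalW.frob_proj, W.map_trunc] at hz
  obtain ⟨m, rfl⟩ : ∃ m, n = m + 1 := ⟨n - 1, (Nat.succ_pred_eq_of_ne_zero (NeZero.ne n)).symm⟩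
  obtain ⟨u, hu⟩ : ∃ u, x - WittVector.map φ y = verschiebung^[m + 1] u := by
    refine exists_iterate_verschiebung _ _ ((W.trunc_eq_zero p (m + 1) _).1 ?_)
    rw [map_sub, hy, sub_self]
  have hF : W.trunc p (m + 1) S (WittVector.map φ (z - WittVector.frobenius y)) =
      W.trunc p (m + 1) S (verschiebung^[m] (u * (p : WittVector p S))) := by
    have hc : WittVector.map φ (WittVector.frobenius y) =
        WittVector.frobenius (WittVector.map φ y) := (WittVector.frobenius_isPoly p).map φ y
    rw [map_sub, map_sub, hz, ← map_sub, hc, ← map_sub, hu, frobenius_iterate_verschiebung_succ]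
  -- Here n = m + 1 and x − φ(y) = V^n(u). Comparing the coefficient m of the Frobenius components
  -- gives φ((z − F y)_m) = p u_0, so an element of R becomes divisible by p in S.
  have hm := (W.trunc_eq_iff p _ _ _).1 hF m (Nat.lt_succ_self m)
  have hup : (u * (p : WittVector p S)).coeff 0 = p * u.coeff 0 := by
    rw [← constantCoeff_apply, map_mul, map_natCast, mul_comm]
    rfl
  rw [coeff_iterate_verschiebung, hup, WittVector.map_coeff] at hm
  obtain ⟨r, hr⟩ := hp _ _ hm
  -- With (z − F y)_m = p r, the correction V^n[r] replaces the unknown V^n(u). The error V^n([φ r]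
  -- − u) dies in 𝒲_n, because p(φ(r) − u_0) = 0.
  refine ⟨CalW.proj p (m + 1) R (y + verschiebung^[m + 1] (teichmuller p r)), ?_⟩
  rw [CalW.map_proj, ← sub_eq_zero, ← map_sub, map_add, map_iterate_verschiebung]
  have : WittVector.map φ y + verschiebung^[m + 1] (WittVector.map φ (teichmuller p r)) - x =
      verschiebung^[m + 1] (WittVector.map φ (teichmuller p r) - u) := by
    have h' : verschiebung^[m + 1] (WittVector.map φ (teichmuller p r)) =
        verschiebung^[m + 1] (WittVector.map φ (teichmuller p r) - u) + verschiebung^[m + 1] u := by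
      rw [← iterate_verschiebung_add, sub_add_cancel]
    rw [h', ← hu]
    abel
  rw [this, CalW.proj_eq_zero_iff]
  refine ⟨fun i hi => iterate_verschiebung_coeff_eq_zero _ hi, ?_⟩
  have hsub : ∀ a b : WittVector p S, (a - b).coeff 0 = a.coeff 0 - b.coeff 0 := fun a b =>
    map_sub constantCoeff a b
  rw [coeff_iterate_verschiebung, hsub, mul_sub, WittVector.map_coeff, teichmuller_coeff_zero, ← hm, hr, map_mul, map_natCast, sub_self]

end Witt

/-! ### Elements and divisibility under faithfully flat maps -/

section FaithfullyFlat

variable {R S : Type u} [CommRing R] [CommRing S] [Algebra R S] [Module.FaithfullyFlat R S]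

theorem exists_algebraMap_eq {s : S} (h : p₁ R S s = p₂ R S s) : ∃ r, algebraMap R S r = s := by
  have h1 : s ∈ Set.range (algebraMap R S) := by
    rw [← (Algebra.IsEffective.of_faithfullyFlat R S).eqLocus_includeLeft_includeRight]
    exact h
  exact h1

/-- The contraction of aS to R is aR. Only a = p is needed, for the last Witt coefficient. -/
theorem exists_of_algebraMap_eq_mul (a r : R) (s : S) (h : algebraMap R S r = algebraMap R S a * s) :
    ∃ r', r = a * r' := by
  have h1 : r ∈ ((Ideal.span {a}).map (algebraMap R S)).comap (algebraMap R S) := by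
    rw [Ideal.mem_comap, h]
    exact Ideal.mul_mem_right _ _ (Ideal.mem_map_of_mem _ (Ideal.mem_span_singleton_self a))
  rw [Ideal.comap_map_eq_self_of_faithfullyFlat, Ideal.mem_span_singleton] at h1
  exact h1

end FaithfullyFlat

end Equalizer

end
end TruncDisp

namespace TruncDisp


open TensorProduct CategoryTheory

noncomputable section

/-! ### Acyclicity of the Čech complex -/

section Cech

variable {R S : Type u} [CommRing R] [CommRing S] [Algebra R S]

namespace TensorPower

theorem coface_zero_slot_zero (s : S) :
    cofaceHom R S (0 : Fin 2) (slot R S (0 : Fin 1) s) = slot R S (1 : Fin 2) s :=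
  coface_slot_apply (0 : Fin 2) (0 : Fin 1) s

theorem coface_one_slot_zero (s : S) :
    cofaceHom R S (1 : Fin 2) (slot R S (0 : Fin 1) s) = slot R S (0 : Fin 2) s :=
  coface_slot_apply (1 : Fin 2) (0 : Fin 1) s

variable [Module.FaithfullyFlat R S]

theorem algebraMap_injective : Function.Injective (algebraMap R (TensorPower R S 1)) := by
  have h : ∀ r, algebraMap R (TensorPower R S 1) r = slot R S 0 (algebraMap R S r) :=
    fun r => ((slot R S (0 : Fin 1)).commutes r).symm
  intro a b hab
  rw [h, h] at hab
  exact FaithfulSMul.algebraMap_injective R S (slot_zero_bijective.1 hab)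

theorem exists_algebraMap_eq {t : TensorPower R S 1}
    (h : cofaceHom R S (0 : Fin 2) t = cofaceHom R S (1 : Fin 2) t) :
    ∃ r, algebraMap R _ r = t := by
  obtain ⟨s, rfl⟩ := slot_zero_bijective.2 t
  rw [coface_zero_slot_zero, coface_one_slot_zero] at h
  obtain ⟨r, rfl⟩ := TruncDisp.exists_algebraMap_eq (R := R) (s := s) (by
    refine pairMap_slot_bijective.1 ?_
    have h₁ : ∀ s, pairMap (slot R S (0 : Fin 2)) (slot R S (1 : Fin 2)) (p₁ R S s) =
      slot R S (0 : Fin 2) s := fun s => Algebra.TensorProduct.productMap_left_apply _ _ s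
    have h₂ : ∀ s, pairMap (slot R S (0 : Fin 2)) (slot R S (1 : Fin 2)) (p₂ R S s) =
      slot R S (1 : Fin 2) s := fun s => Algebra.TensorProduct.productMap_right_apply _ _ s
    rw [h₁, h₂, h])
  exact ⟨r, ((slot R S (0 : Fin 1)).commutes r).symm⟩

theorem exists_of_algebraMap_eq_mul (a r : R) (t : TensorPower R S 1)
    (h : algebraMap R (TensorPower R S 1) r = algebraMap R _ a * t) : ∃ r', r = a * r' := by
  obtain ⟨s, rfl⟩ := (slot_zero_bijective (R := R)).2 t
  refine TruncDisp.exists_of_algebraMap_eq_mul (R := R) a r s ((slot_zero_bijective (R := R)).1 ?_)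
  rw [map_mul, AlgHom.commutes, AlgHom.commutes, h]

end TensorPower

variable (p : ℕ) [Fact p.Prime] (n : ℕ) (R S)

/-- The Čech complex of `𝒲_n` as a cosimplicial module. -/
def CechModule.unit : CechModule p n R S where
  obj k := CalW p n (TensorPower R S (k + 1))
  face k i := (CalW.map p n (cofaceHom R S i)).toSemilinearMap
  face_face k i j h x := (Coeff.one p n).map_map_eq (cofaceHom_cofaceHom h) x
  merge k := (CalW.map p n (mergeHom R S k)).toSemilinearMap
  merge_face_one k x := (Coeff.one p n).map_map_id (mergeHom_cofaceHom_one k) x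
  merge_face_succ_succ k i x := (Coeff.one p n).map_map_eq (mergeHom_cofaceHom_succ_succ k i) x

theorem CechModule.isCartesian_unit : (CechModule.unit R S p n).IsCartesian where
  flat k := Module.Flat.self
  isBC k := isBC_toSemilinearMap _

variable [NeZero n] [Module.FaithfullyFlat R S]

omit [NeZero n] in
theorem cech_injective :
    Function.Injective (CalW.map p n (algebraMap R (TensorPower R S 1))) :=
  CalW.map_injective TensorPower.algebraMap_injective

/-- The cosimplicial argument gives exactness in positive degrees only. The start of the complex is
settled by coefficients, where faithful flatness enters both through the equalizer R → S ⇉ S ⊗_R S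
and through R ∩ pS = pR. -/
theorem cech_exact_zero :
    Function.Exact (CalW.map p n (algebraMap R (TensorPower R S 1))) (cechD R S p n 1) := by
  have hd : ∀ x, cechD R S p n 1 x = CalW.map p n (cofaceHom R S 0) x -
      CalW.map p n (cofaceHom R S 1) x := altSum_zero_apply (CechModule.unit R S p n).faceAdd
  intro x
  rw [hd, sub_eq_zero]
  constructor
  · intro h
    refine CalW.exists_of_map_eq TensorPower.algebraMap_injective
      (fun t ht => TensorPower.exists_algebraMap_eq ht) (fun r t h => ?_) h
    obtain ⟨r', hr'⟩ := TensorPower.exists_of_algebraMap_eq_mul (p : R) r t (by rwa [map_natCast])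
    exact ⟨r', hr'⟩
  · rintro ⟨x, rfl⟩
    have h : ∀ i : Fin 2, (cofaceHom R S i).comp (algebraMap R (TensorPower R S 1)) =
        algebraMap R _ := fun i => RingHom.ext fun r => (coface R S i).commutes r
    rw [← CalW.map_comp, ← CalW.map_comp, h, h]

theorem cech_exact (k : ℕ) :
    Function.Exact (cechD R S p n (k + 1)) (cechD R S p n (k + 2)) :=
  (CechModule.isCartesian_unit R S p n).exact k

end Cech

end
end TruncDisp

namespace TruncDisp


open TensorProduct CategoryTheory

noncomputable section

/-! ### The cosimplicial module of a descent datum -/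

section Descent

variable {p : ℕ} [Fact p.Prime] {n : ℕ} {R S : Type u} [CommRing R] [CommRing S] [Algebra R S]
  {P : Type u} [AddCommGroup P] [Module (CalW p n S) P]
  {T T' T'' : Type u} [CommRing T] [CommRing T'] [CommRing T''] [Algebra R T] [Algebra R T']
  [Algebra R T'']

theorem pairMap_algHom_comp_p₂ (f g : S →ₐ[R] T) : (pairMap f g).comp (p₂ R S) = g :=
  AlgHom.ext fun s => Algebra.TensorProduct.productMap_right_apply f g s

section NablaAlong

variable (nabla : BC (CalW.map p n (p₁ R S : S →+* S ⊗[R] S)) P →ₗ[CalW p n (S ⊗[R] S)]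
  BC (CalW.map p n (p₂ R S : S →+* S ⊗[R] S)) P)

/-- The canonical map `𝒲_n(T) ⊗ P → 𝒲_n(T') ⊗ P`. -/
def calWTrans {ℓ : S →ₐ[R] T} {ℓ' : S →ₐ[R] T'} (φ : T →ₐ[R] T') (h : φ.comp ℓ = ℓ') :
    BC (CalW.map p n (ℓ : S →+* T)) P →ₛₗ[CalW.map p n (φ : T →+* T')]
      BC (CalW.map p n (ℓ' : S →+* T')) P :=
  BC.trans (CalW.map p n (φ : T →+* T'))
    (Predisplay.calWMap_comp' (congrArg (fun ψ : S →ₐ[R] T' => (ψ : S →+* T')) h))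

theorem calWTrans_of {ℓ : S →ₐ[R] T} {ℓ' : S →ₐ[R] T'} (φ : T →ₐ[R] T') (h : φ.comp ℓ = ℓ')
    (x : P) : calWTrans φ h (BC.of (CalW.map p n (ℓ : S →+* T)) x) = BC.of _ x :=
  BC.trans_of ..

theorem nablaAlong_of (f g : S →ₐ[R] T) (x : P) : nablaAlong nabla f g (BC.of _ x) =
    calWTrans (ℓ := p₂ R S) (pairMap f g) (pairMap_algHom_comp_p₂ f g) (nabla (BC.of _ x)) :=
  BC.lift_id_of _ x

theorem calWTrans_calWTrans {ℓ : S →ₐ[R] T} {ℓ' : S →ₐ[R] T'} {ℓ'' : S →ₐ[R] T''}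
    (φ : T →ₐ[R] T') (h : φ.comp ℓ = ℓ') (φ' : T' →ₐ[R] T'') (h' : φ'.comp ℓ' = ℓ'')
    {φ'' : T →ₐ[R] T''} (h'' : φ'.comp φ = φ'') (x : BC (CalW.map p n (ℓ : S →+* T)) P) :
    calWTrans φ' h' (calWTrans φ h x) =
      calWTrans φ'' (by rw [← h', ← h, ← h'', AlgHom.comp_assoc]) x := by
  subst h' h h''
  induction x using BC.induction with
  | zero => simp only [map_zero]
  | of x => simp only [calWTrans_of]
  | add x y hx hy => simp only [map_add, hx, hy]
  | smul b x hx =>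
    simp only [LinearMap.map_smulₛₗ, hx]
    congr 1
    exact (CalW.map_comp p n (φ : T →+* T') (φ' : T' →+* T'') b).symm

/-- Both sides are base changes of the one map ∇, along the homomorphism S ⊗_R S → T' with
components q f and q g. -/
theorem nablaAlong_calWTrans {f g : S →ₐ[R] T} {f' g' : S →ₐ[R] T'} (q : T →ₐ[R] T')
    (hf : q.comp f = f') (hg : q.comp g = g') (z : BC (CalW.map p n (f : S →+* T)) P) :
    nablaAlong nabla f' g' (calWTrans q hf z) = calWTrans q hg (nablaAlong nabla f g z) := by
  induction z using BC.induction with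
  | zero => simp only [map_zero]
  | add x y hx hy => simp only [map_add, hx, hy]
  | smul b x hx => simp only [LinearMap.map_smulₛₗ, hx, RingHom.id_apply]
  | of x =>
    rw [calWTrans_of, nablaAlong_of, nablaAlong_of, calWTrans_calWTrans]
    subst hf hg
    refine Algebra.TensorProduct.ext' fun a b => ?_
    simp [pairMap]

/-- The surjectivity of `nablaAlong`. -/
theorem nablaAlong_surjective (hn : Function.Surjective nabla) (f g : S →ₐ[R] T) :
    Function.Surjective (nablaAlong nabla f g) := by
  rw [← LinearMap.range_eq_top, eq_top_iff]
  rintro y -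
  induction y using BC.induction with
  | zero => exact zero_mem _
  | add x y hx hy => exact add_mem hx hy
  | smul b x hx => exact Submodule.smul_mem _ _ hx
  | of y =>
    obtain ⟨z, hz⟩ := hn (BC.of _ y)
    have key : ∀ z, calWTrans (pairMap f g) (pairMap_algHom_comp_p₂ f g) (nabla z) ∈
        LinearMap.range (nablaAlong nabla f g) := by
      intro z
      induction z using BC.induction with
      | zero => simp only [map_zero, zero_mem]
      | of x => rw [← nablaAlong_of]; exact ⟨_, rfl⟩
      | add x y hx hy => simp only [map_add]; exact add_mem hx hy
      | smul b x hx => simp only [LinearMap.map_smulₛₗ]; exact Submodule.smul_mem _ _ hx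
    have := key z
    rwa [hz, calWTrans_of] at this

end NablaAlong

namespace ModuleDescentDatum

variable (D : ModuleDescentDatum p n R S P)

/-- The base change of the descent datum along `s ⊗ s' ↦ f(s) g(s')`. -/
abbrev along (f g : S →ₐ[R] T) :
    BC (CalW.map p n (f : S →+* T)) P →ₗ[CalW p n T] BC (CalW.map p n (g : S →+* T)) P :=
  nablaAlong D.nabla.toLinearMap f g

/-- Any triple (f, g, h) is the image of the universal triple (q₁, q₂, q₃) under S ⊗_R S ⊗_R S → T,
so the identity is a base change of the cocycle condition. -/
theorem along_along (f g h : S →ₐ[R] T) (z : BC (CalW.map p n (f : S →+* T)) P) :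
    D.along g h (D.along f g z) = D.along f h z := by
  induction z using BC.induction with
  | zero => simp only [map_zero]
  | add x y hx hy => simp only [map_add, hx, hy]
  | smul b x hx => simp only [map_smul, hx]
  | of x =>
    let t : S ⊗[R] (S ⊗[R] S) →ₐ[R] T := Algebra.TensorProduct.productMap f (pairMap g h)
    have h₁ : t.comp (q₁ R S) = f := AlgHom.ext fun s =>
      Algebra.TensorProduct.productMap_left_apply f (pairMap g h) s
    have h₂ : t.comp (q₂ R S) = g := AlgHom.ext fun s =>
      (Algebra.TensorProduct.productMap_right_apply f (pairMap g h) _).trans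
        (Algebra.TensorProduct.productMap_left_apply g h s)
    have h₃ : t.comp (q₃ R S) = h := AlgHom.ext fun s =>
      (Algebra.TensorProduct.productMap_right_apply f (pairMap g h) _).trans
        (Algebra.TensorProduct.productMap_right_apply g h s)
    rw [← calWTrans_of t h₁, nablaAlong_calWTrans _ t h₁ h₂, nablaAlong_calWTrans _ t h₂ h₃,
      nablaAlong_calWTrans _ t h₁ h₃, D.cocycle]
    rfl

/-- An idempotent surjective map is the identity. Idempotency is `along_along`, surjectivity comes
from that of ∇. -/
theorem along_self (f : S →ₐ[R] T) (z : BC (CalW.map p n (f : S →+* T)) P) :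
    D.along f f z = z := by
  obtain ⟨z, rfl⟩ := nablaAlong_surjective D.nabla.toLinearMap D.nabla.surjective f f z
  exact D.along_along f f f z

theorem along_bijective (f g : S →ₐ[R] T) : Function.Bijective (D.along f g) :=
  Function.bijective_iff_has_inverse.2 ⟨D.along g f,
    fun z => by rw [along_along, along_self], fun z => by rw [along_along, along_self]⟩

/-- The semilinear map `𝒲_n(T) ⊗_ℓ P → 𝒲_n(T') ⊗_ℓ' P` given by the descent datum. -/
def transport (φ : T →ₐ[R] T') (ℓ : S →ₐ[R] T) (ℓ' : S →ₐ[R] T') :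
    BC (CalW.map p n (ℓ : S →+* T)) P →ₛₗ[CalW.map p n (φ : T →+* T')]
      BC (CalW.map p n (ℓ' : S →+* T')) P :=
  D.along (φ.comp ℓ) ℓ' ∘ₛₗ calWTrans φ rfl

theorem transport_apply (φ : T →ₐ[R] T') {ℓ : S →ₐ[R] T} {ℓ' m : S →ₐ[R] T'} (h : φ.comp ℓ = m)
    (x : BC (CalW.map p n (ℓ : S →+* T)) P) :
    D.transport φ ℓ ℓ' x = D.along m ℓ' (calWTrans φ h x) := by
  subst h
  rfl

theorem transport_eq_calWTrans (φ : T →ₐ[R] T') {ℓ : S →ₐ[R] T} {ℓ' : S →ₐ[R] T'}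
    (h : φ.comp ℓ = ℓ') (x : BC (CalW.map p n (ℓ : S →+* T)) P) :
    D.transport φ ℓ ℓ' x = calWTrans φ h x := by
  rw [D.transport_apply φ h, along_self]

theorem transport_transport {φ : T →ₐ[R] T'} {φ' : T' →ₐ[R] T''} {φ'' : T →ₐ[R] T''}
    (h : φ'.comp φ = φ'') {ℓ : S →ₐ[R] T} {ℓ' : S →ₐ[R] T'} {ℓ'' : S →ₐ[R] T''}
    (x : BC (CalW.map p n (ℓ : S →+* T)) P) :
    D.transport φ' ℓ' ℓ'' (D.transport φ ℓ ℓ' x) = D.transport φ'' ℓ ℓ'' x := by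
  subst h
  rw [D.transport_apply φ' rfl, D.transport_apply φ rfl,
    ← nablaAlong_calWTrans _ φ' (f := φ.comp ℓ) rfl rfl, along_along,
    D.transport_apply (φ'.comp φ) rfl,
    calWTrans_calWTrans φ rfl φ' rfl rfl]
  rfl

theorem transport_id (ℓ : S →ₐ[R] T) (x : BC (CalW.map p n (ℓ : S →+* T)) P) :
    D.transport (AlgHom.id R T) ℓ ℓ x = x := by
  rw [D.transport_eq_calWTrans _ (AlgHom.id_comp ℓ)]
  induction x using BC.induction with
  | zero => simp only [map_zero]
  | of x => rw [calWTrans_of]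
  | add x y hx hy => simp only [map_add, hx, hy]
  | smul b x hx =>
    rw [LinearMap.map_smulₛₗ, hx]
    congr 1
    exact CalW.map_id p n b

theorem isBC_transport (φ : T →ₐ[R] T') (ℓ : S →ₐ[R] T) (ℓ' : S →ₐ[R] T') :
    IsBC (D.transport φ ℓ ℓ') := by
  have h1 : IsBC (calWTrans (p := p) (n := n) (P := P) φ (rfl : φ.comp ℓ = φ.comp ℓ)) :=
    (isBC_of (CalW.map p n (ℓ : S →+* T)) P).of_comp
      (isBC_of (CalW.map p n (φ.comp ℓ : S →ₐ[R] T').toRingHom) P)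
      (fun a => CalW.map_comp p n (ℓ : S →+* T) (φ : T →+* T') a)
      fun x => (calWTrans_of φ rfl x).symm
  exact h1.comp (IsBC.of_bijective Function.bijective_id (D.along_bijective _ _))
    (fun _ => rfl) fun x => rfl

/-- The cosimplicial module of a descent datum. -/
def cech : CechModule p n R S where
  obj k := D.Cochain k
  -- All faces are one construction: extend scalars along the coface, then move to the last slot by
  -- the descent datum. Unless i is the last index, the coface preserves the last slot and the
  -- second step is the identity. The cosimplicial identities reduce to those of the rings, since
  -- transports compose.
  face k i := D.transport (coface R S i) (slot R S (Fin.last k)) (slot R S (Fin.last (k + 1)))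
  face_face k i j h x := by
    have h' : (coface R S j.succ).comp (coface R S i) =
        (coface R S i.castSucc).comp (coface R S j) :=
      AlgHom.ext (TensorPower.coface_coface h)
    rw [D.transport_transport h', D.transport_transport rfl]
  merge k := D.transport (TensorPower.merge R S k) (slot R S (Fin.last (k + 1)))
    (slot R S (Fin.last k))
  merge_face_one k x := by
    have h' : (TensorPower.merge R S k).comp (coface R S 1) = AlgHom.id R _ :=
      AlgHom.ext (TensorPower.merge_coface_one k)
    rw [D.transport_transport h']
    exact D.transport_id _ _
  merge_face_succ_succ k i x := by
    have h' : (TensorPower.merge R S (k + 1)).comp (coface R S i.succ.succ) =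
        (coface R S i.succ).comp (TensorPower.merge R S k) :=
      AlgHom.ext (TensorPower.merge_coface_succ_succ k i)
    rw [D.transport_transport h', D.transport_transport rfl]

theorem isCartesian_cech [Module.Projective (CalW p n S) P] : D.cech.IsCartesian where
  flat k := inferInstanceAs (Module.Flat _ (BC _ P))
  isBC k := D.isBC_transport ..

theorem cech_face_last (k : ℕ) (x : D.Cochain k) :
    D.cech.faceAdd k (Fin.last (k + 1)) x = D.lastFace k x := by
  have h : (coface R S (Fin.last (k + 1))).comp (slot R S (Fin.last k)) =
      slot R S (Fin.last k).castSucc := by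
    ext s
    rw [AlgHom.comp_apply, TensorPower.coface_slot_apply, Fin.succAbove_last]
  refine (D.transport_apply (coface R S (Fin.last (k + 1))) h x).trans ?_
  rfl

theorem cech_d (k : ℕ) : D.cech.d k = D.d k := by
  ext (x : D.Cochain k)
  refine (altSum_apply D.cech.faceAdd k x).trans ((Fin.sum_univ_castSucc _).trans ?_)
  have hd : D.d k x = ∑ i : Fin (k + 1), (-1 : ℤ) ^ (i : ℕ) • D.face k i x +
      (-1 : ℤ) ^ (k + 1) • D.lastFace k x := by
    simp [d]
  refine Eq.trans ?_ hd.symm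
  congr 1
  · refine Finset.sum_congr rfl fun i _ => ?_
    congr 1
    refine D.transport_eq_calWTrans (coface R S i.castSucc) ?_ x
    ext s
    rw [AlgHom.comp_apply, TensorPower.coface_slot_apply, Fin.succAbove_castSucc_of_le _ _
      (Fin.le_last i), Fin.succ_last]
  · exact congrArg (fun y => (-1 : ℤ) ^ (k + 1) • y) (D.cech_face_last k x)

theorem d_exact [NeZero n] [Module.FaithfullyFlat R S] [Module.Projective (CalW p n S) P]
    (k : ℕ) : Function.Exact (D.d k) (D.d (k + 1)) := by
  rw [← cech_d, ← cech_d]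
  exact D.isCartesian_cech.exact k

end ModuleDescentDatum

end Descent

end
end TruncDisp

namespace TruncDisp


open TensorProduct CategoryTheory

noncomputable section

/-! ### Nilpotency of the augmentation ideals -/

section Nilpotent

variable {p : ℕ} [Fact p.Prime] {n : ℕ} {T : Type u} [CommRing T]

/-- I² ⊆ aI gives I^{k+1} ⊆ a^k I. -/
theorem isNilpotent_of_mul_le {A : Type*} [CommRing A] {I : Ideal A} {a : A} (ha : IsNilpotent a)
    (h : ∀ x ∈ I, ∀ y ∈ I, ∃ z ∈ I, x * y = a * z) : IsNilpotent I := by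
  obtain ⟨k, hk⟩ := ha
  have h1 : I * I ≤ Ideal.span {a} * I := Ideal.mul_le.2 fun x hx y hy => by
    obtain ⟨z, hz, hxy⟩ := h x hx y hy
    rw [hxy]
    exact Ideal.mul_mem_mul (Ideal.mem_span_singleton_self a) hz
  have key : ∀ k : ℕ, I ^ (k + 1) ≤ Ideal.span {a} ^ k * I := by
    intro k
    induction k with
    | zero => simp
    | succ k ih =>
      rw [pow_succ I]
      refine (Ideal.mul_mono_left ih).trans ?_
      rw [mul_assoc, pow_succ, mul_assoc]
      exact Ideal.mul_mono_right h1
  refine ⟨k + 1, le_bot_iff.1 ((key k).trans ?_)⟩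
  rw [Ideal.span_singleton_pow, hk]
  simp

/-- Induction on the length. If p^N = 0 in T, then p^N is V(y) in W_{n+1}(T), and p^M V(y) = V(p^M
y) vanishes once p^M = 0 in W_n(T). -/
theorem W.isNilpotent_natCast (hp : IsNilpotent (p : T)) (n : ℕ) :
    IsNilpotent (p : W p n T) := by
  induction n with
  | zero =>
    refine ⟨1, ?_⟩
    obtain ⟨x, hx⟩ := W.exists_trunc p 0 (p : W p 0 T)
    rw [pow_one, ← hx, W.trunc_eq_zero]
    exact fun i hi => absurd hi (Nat.not_lt_zero i)
  | succ n ih =>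
    obtain ⟨N, hN⟩ := hp
    obtain ⟨M, hM⟩ := ih
    have h0 : ((p : WittVector p T) ^ N).coeff 0 = 0 := by
      rw [← WittVector.constantCoeff_apply, map_pow, map_natCast, hN]
    obtain ⟨y, hy⟩ := exists_iterate_verschiebung 1 ((p : WittVector p T) ^ N) (fun i hi => by
      obtain rfl : i = 0 := by omega
      exact h0)
    have h1 : (p : W p (n + 1) T) ^ N = W.ver p n T (W.trunc p n T y) := by
      rw [W.ver_trunc, ← map_natCast (W.trunc p (n + 1) T), ← map_pow, hy]
      rfl
    refine ⟨M + N, ?_⟩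
    rw [pow_add, h1, W.mul_ver, map_pow, map_natCast, hM, zero_mul, map_zero]

theorem CalW.isNilpotent_natCast (hp : IsNilpotent (p : T)) :
    IsNilpotent (p : CalW p n T) := by
  obtain ⟨N, hN⟩ := W.isNilpotent_natCast hp n
  exact ⟨N, CalW.ext (by rw [map_pow, map_natCast, hN, map_zero])
    (by rw [map_pow, map_natCast, hN, map_zero])⟩

/-- The kernel is κ(I_{n+1}), and κ(Vξ) κ(Vη) = p κ(V(ξη)), so its square lies in p times itself. -/
theorem CalW.isNilpotent_ker_w0 [NeZero n] (hp : IsNilpotent (p : T)) :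
    IsNilpotent (RingHom.ker (CalW.w0 p n T)) := by
  refine isNilpotent_of_mul_le (CalW.isNilpotent_natCast (n := n) hp) fun x hx y hy => ?_
  obtain ⟨a, rfl⟩ := (VIdeal.w0_eq_zero_iff p n x).1 hx
  obtain ⟨b, rfl⟩ := (VIdeal.w0_eq_zero_iff p n y).1 hy
  refine ⟨VIdeal.kappa p n T ((VIdeal.verInv p n T).symm
    (VIdeal.verInv p n T a * VIdeal.verInv p n T b)), (VIdeal.w0_eq_zero_iff p n _).2 ⟨_, rfl⟩, ?_⟩
  rw [← smul_eq_mul, ← map_smul, ← smul_eq_mul (p : CalW p n T), ← map_smul]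
  congr 1
  refine (VIdeal.verInv p n T).injective ?_
  rw [VIdeal.verInv_smul, VIdeal.frob_kappa, VIdeal.verInv_smul, map_natCast, mul_assoc,
    AddEquiv.apply_symm_apply]

theorem W.isNilpotent_ker_w0 [NeZero n] (hp : IsNilpotent (p : T)) :
    IsNilpotent (RingHom.ker (W.w0 p n T)) := by
  obtain ⟨k, hk⟩ := CalW.isNilpotent_ker_w0 (n := n) hp
  have hs : Function.Surjective (CalW.res p n T) := fun x => by
    obtain ⟨x, rfl⟩ := W.exists_trunc p n x
    exact ⟨CalW.proj p n T x, CalW.res_proj x⟩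
  have h : RingHom.ker (W.w0 p n T) = (RingHom.ker (CalW.w0 p n T)).map (CalW.res p n T) := by
    rw [CalW.w0, ← RingHom.comap_ker, Ideal.map_comap_of_surjective _ hs]
  exact ⟨k, by rw [h, ← Ideal.map_pow, hk]; exact Ideal.map_bot⟩

end Nilpotent

end
end TruncDisp

namespace TruncDisp


open TensorProduct CategoryTheory

noncomputable section

/-! ### Descent of projective modules over `𝒲_n` -/

/-- The inverse of a bijective semilinear map. -/
def semiInv {A B M N : Type*} [CommRing A] [CommRing B] [AddCommGroup M] [Module A M]
    [AddCommGroup N] [Module B N] {σ : A →+* B} {τ : B →+* A} (h : ∀ b, σ (τ b) = b)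
    (f : M →ₛₗ[σ] N) (hf : Function.Bijective f) : N →ₛₗ[τ] M where
  toFun := (Equiv.ofBijective f hf).symm
  map_add' x y := hf.1 (by
    rw [map_add f]
    simp only [Equiv.ofBijective_apply_symm_apply])
  map_smul' b x := hf.1 (by
    rw [LinearMap.map_smulₛₗ, h]
    simp only [Equiv.ofBijective_apply_symm_apply])

theorem apply_semiInv {A B M N : Type*} [CommRing A] [CommRing B] [AddCommGroup M] [Module A M]
    [AddCommGroup N] [Module B N] {σ : A →+* B} {τ : B →+* A} (h : ∀ b, σ (τ b) = b)
    (f : M →ₛₗ[σ] N) (hf : Function.Bijective f) (x : N) : f (semiInv h f hf x) = x :=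
  Equiv.ofBijective_apply_symm_apply f hf x

theorem semiInv_bijective {A B M N : Type*} [CommRing A] [CommRing B] [AddCommGroup M] [Module A M]
    [AddCommGroup N] [Module B N] {σ : A →+* B} {τ : B →+* A} (h : ∀ b, σ (τ b) = b)
    (f : M →ₛₗ[σ] N) (hf : Function.Bijective f) : Function.Bijective (semiInv h f hf) :=
  (Equiv.ofBijective f hf).symm.bijective

theorem IsBC.exists_factor {A B C M N K : Type*} [CommRing A] [CommRing B] [CommRing C]
    [AddCommGroup M] [Module A M] [AddCommGroup N] [Module B N] [AddCommGroup K] [Module C K]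
    {γ : A →+* C} {γ' : A →+* B} {σ : B →+* C} {τ : C →+* B} (h : ∀ c, σ (τ c) = c)
    (hτ : Function.Bijective τ) (hγ : ∀ a, γ' a = τ (γ a)) {f : M →ₛₗ[γ] K} (hf : IsBC f)
    {o : N →ₛₗ[σ] K} (ho : Function.Bijective o) :
    ∃ g : M →ₛₗ[γ'] N, IsBC g ∧ ∀ x, o (g x) = f x :=
  ⟨semiComp (semiInv h o ho) f hγ,
    hf.comp (IsBC.of_bijective hτ (semiInv_bijective h o ho)) hγ fun _ => rfl,
    fun x => apply_semiInv h o ho (f x)⟩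

/-! ### Finiteness and projectivity along faithfully flat base change maps -/

section FaithfullyFlatBC

variable {R S : Type u} [CommRing R] [CommRing S] [Algebra R S] {M N : Type u} [AddCommGroup M]
  [Module R M] [AddCommGroup N] [Module S N]

/-- The linear extension to the tensor product of a map that is semilinear over the structure map
of an algebra. -/
def algebraMapLift (f : M →ₛₗ[algebraMap R S] N) : S ⊗[R] M →ₗ[S] N :=
  letI : Module R N := Module.compHom N (algebraMap R S)
  haveI : IsScalarTower R S N := ⟨fun r s x => by rw [Algebra.smul_def, mul_smul]; rfl⟩
  AlgebraTensorModule.lift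
    { toFun s :=
        { toFun x := s • f x
          map_add' x y := by rw [map_add, smul_add]
          map_smul' r x := by
            rw [LinearMap.map_smulₛₗ, smul_comm]
            rfl }
      map_add' s t := by
        ext x
        exact add_smul s t (f x)
      map_smul' s t := by
        ext x
        exact mul_smul s t (f x) }

theorem algebraMapLift_tmul (f : M →ₛₗ[algebraMap R S] N) (s : S) (x : M) :
    algebraMapLift f (s ⊗ₜ x) = s • f x := rfl

theorem isBC_iff_algebraMapLift (f : M →ₛₗ[algebraMap R S] N) :
    IsBC f ↔ Function.Bijective (algebraMapLift f) :=
  isBC_algebraMap_iff fun x => by rw [algebraMapLift_tmul, one_smul]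

variable [Module.FaithfullyFlat R S] [Module.Finite S N] [Module.Projective S N]

omit [Module.Projective S N] in
theorem IsBC.finite_of_faithfullyFlat {f : M →ₛₗ[algebraMap R S] N} (hf : IsBC f) :
    Module.Finite R M := by
  have : Module.Finite S (S ⊗[R] M) :=
    Module.Finite.equiv (LinearEquiv.ofBijective _ ((isBC_iff_algebraMapLift f).1 hf)).symm
  exact Module.Finite.of_finite_tensorProduct_of_faithfullyFlat (R := R) (M := M) S

theorem IsBC.projective_of_faithfullyFlat {f : M →ₛₗ[algebraMap R S] N} (hf : IsBC f) :
    Module.Projective R M := by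
  let e := (LinearEquiv.ofBijective _ ((isBC_iff_algebraMapLift f).1 hf)).symm
  have : Module.Finite S (S ⊗[R] M) := Module.Finite.equiv e
  have : Module.Projective S (S ⊗[R] M) := Module.Projective.of_equiv e
  exact TruncDisp.projective_of_faithfullyFlat (R := R) (S := S) (M := M)

end FaithfullyFlatBC

/-! ### Effectivity of descent for finitely generated projective 𝒲_n-modules -/

section EffectiveDescent

variable {p : ℕ} [Fact p.Prime] {n : ℕ} {R S : Type u} [CommRing R] [CommRing S] [Algebra R S]

/-- The first tensor power of `S` is `S`. -/
def TensorPower.equivOne (R S : Type u) [CommRing R] [CommRing S] [Algebra R S] :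
    S ≃ₐ[R] TensorPower R S 1 :=
  AlgEquiv.ofBijective (slot R S (0 : Fin 1)) slot_zero_bijective

theorem isBC_calWTrans {P : Type u} [AddCommGroup P] [Module (CalW p n S) P] {T T' : Type u}
    [CommRing T] [CommRing T'] [Algebra R T] [Algebra R T'] {ℓ : S →ₐ[R] T} {ℓ' : S →ₐ[R] T'}
    (φ : T →ₐ[R] T') (h : φ.comp ℓ = ℓ') :
    IsBC (calWTrans (p := p) (n := n) (P := P) φ h) :=
  (isBC_of (CalW.map p n (ℓ : S →+* T)) P).of_comp
    (isBC_of (CalW.map p n (ℓ' : S →+* T')) P)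
    (Predisplay.calWMap_comp' (congrArg (fun ψ : S →ₐ[R] T' => (ψ : S →+* T')) h))
    fun x => (calWTrans_of φ h x).symm

theorem CalW.map_bijective {T T' : Type u} [CommRing T] [CommRing T'] (e : T ≃+* T') :
    Function.Bijective (CalW.map p n (e : T →+* T')) := by
  refine Function.bijective_iff_has_inverse.2 ⟨CalW.map p n (e.symm : T' →+* T), fun a => ?_,
    fun a => ?_⟩
  · rw [← CalW.map_comp, RingEquiv.symm_comp, CalW.map_id]
  · rw [← CalW.map_comp, RingEquiv.comp_symm, CalW.map_id]

variable [NeZero n] [Module.FaithfullyFlat R S]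

namespace CechModule

variable {M : CechModule p n R S}

namespace IsCartesian

/-- Classical faithfully flat descent for the reduction of M along w_0, which is a finitely
generated projective module over S with a descent datum. -/
theorem exists_lift_gr (hM : M.IsCartesian)
    [Module.Finite (CalW p n (TensorPower R S 1)) (M.obj 0)]
    [Module.Projective (CalW p n (TensorPower R S 1)) (M.obj 0)] :
    ∃ (Z : Type u) (_ : AddCommGroup Z) (_ : Module R Z) (_ : Module.Finite R Z)
      (_ : Module.Projective R Z) (i : Z →ₛₗ[algebraMap R (TensorPower R S 1)]
        (M.tensor (LinCoeff.gr p n 0).toCoeff).obj 0), IsBC i ∧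
      ∀ z, (M.tensor (LinCoeff.gr p n 0).toCoeff).d 0 (i z) = 0 := by
  let N := (M.tensor (LinCoeff.gr p n 0).toCoeff).obj 0
  let e := TensorPower.equivOne R S
  have hf : Module.Finite (TensorPower R S 1) N := (isBC_toGr (M := M) 0).finite
  have hpr : Module.Projective (TensorPower R S 1) N := (isBC_toGr (M := M) 0).projective
  -- The reduction lives over the one-fold tensor power. It is viewed over S to apply faithful
  -- flatness of R → S, and `forth` returns to the tensor power at the end.
  let : Module S N := Module.compHom N (e : S →+* TensorPower R S 1)
  let back : N →ₛₗ[(e.symm : TensorPower R S 1 →+* S)] N :=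
    { toFun := id
      map_add' _ _ := rfl
      map_smul' t x := by
        change t • x = e (e.symm t) • x
        rw [e.apply_symm_apply] }
  have hback : IsBC back := IsBC.of_bijective e.symm.bijective Function.bijective_id
  have : Module.Finite S N := hback.finite
  have : Module.Projective S N := hback.projective
  let forth : N →ₛₗ[(e : S →+* TensorPower R S 1)] N :=
    { toFun := id
      map_add' _ _ := rfl
      map_smul' s x := rfl }
  have hforth : IsBC forth := IsBC.of_bijective e.bijective Function.bijective_id
  let Z := M.Z (LinCoeff.gr p n 0)
  have hzR : ∀ (r : R) (z : N), r • z = algebraMap R S r • z := fun r z => by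
    change algebraMap R (TensorPower R S 1) r • z = e (algebraMap R S r) • z
    rw [e.commutes]
  let i : Z →ₛₗ[algebraMap R S] N :=
    { toFun z := z.1
      map_add' _ _ := rfl
      map_smul' r z := hzR r z.1 }
  have hd : ∀ z : Z, (M.tensor (LinCoeff.gr p n 0).toCoeff).d 0 z.1 = 0 := fun z => z.2
  have hi : IsBC i := by
    rw [isBC_iff_algebraMapLift]
    -- On a cocycle z the faces 0 and 1 agree and the degeneracy inverts the face 1, so the
    -- bijection of `descent_lin` sends s ⊗ z to s z.
    convert hM.descent_lin (G := LinCoeff.gr p n 0) (fun _ => LinCoeff.isBC_gr p n 0 _) using 1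
    ext z
    induction z using TensorProduct.induction_on with
    | zero => simp only [map_zero]
    | add x y hx hy => simp only [map_add, hx, hy]
    | tmul s z =>
      have h0 : (M.tensor (LinCoeff.gr p n 0).toCoeff).face 0 0 z.1 =
          (M.tensor (LinCoeff.gr p n 0).toCoeff).face 0 1 z.1 :=
        sub_eq_zero.1 ((altSum_zero_apply _ _).symm.trans (hd z))
      have hm : ∀ (t : TensorPower R S 2) (y : (M.tensor (LinCoeff.gr p n 0).toCoeff).obj 1),
          (M.tensor (LinCoeff.gr p n 0).toCoeff).merge 0 (t • y) =
            TensorPower.merge R S 0 t • (M.tensor (LinCoeff.gr p n 0).toCoeff).merge 0 y := by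
        intro t y
        induction y using tensor_induction with
        | zero => simp only [smul_zero, map_zero]
        | add x y hx hy => simp only [smul_add, map_add, hx, hy]
        | tmul x y =>
          exact congrArg (fun u => M.tmul (LinCoeff.gr p n 0).toCoeff 0 u (M.merge 0 y))
            ((LinCoeff.gr p n 0).map_lin (mergeHom R S 0) t x)
      rw [LinearMap.lTensor_tmul, mu_tmul]
      refine (algebraMapLift_tmul i s z).trans (Eq.symm ((hm _ _).trans ?_))
      rw [Submodule.subtype_apply, h0, (M.tensor (LinCoeff.gr p n 0).toCoeff).merge_face_one,
        TensorPower.merge_slot]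
      rfl
  refine ⟨Z, inferInstance, inferInstance, hi.finite_of_faithfullyFlat,
    hi.projective_of_faithfullyFlat,
    { toFun z := z.1
      map_add' _ _ := rfl
      map_smul' r z := rfl }, ?_, hd⟩
  exact hi.comp hforth (fun r => (e.commutes r).symm) fun _ => rfl

/-- A finitely generated projective Cartesian module descends. -/
theorem exists_descent (hM : M.IsCartesian)
    [Module.Finite (CalW p n (TensorPower R S 1)) (M.obj 0)]
    [Module.Projective (CalW p n (TensorPower R S 1)) (M.obj 0)] (hp : IsNilpotent (p : R)) :
    ∃ (P : Type u) (_ : AddCommGroup P) (_ : Module (CalW p n R) P)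
      (_ : Module.Finite (CalW p n R) P) (_ : Module.Projective (CalW p n R) P)
      (f : P →ₛₗ[CalW.map p n (algebraMap R (TensorPower R S 1))] M.obj 0), IsBC f ∧
      ∀ x, M.d 0 (f x) = 0 := by
  obtain ⟨Z, _, _, _, _, i, hi, hdi⟩ := hM.exists_lift_gr
  -- This is where p nilpotent is needed over R: the kernel of w_0 is nilpotent, so Z lifts to a
  -- projective module over 𝒲_n(R).
  obtain ⟨P, _, _, _, _, m, hm⟩ := exists_lift_projective (CalW.w0_surjective p n (R := R))
    (CalW.isNilpotent_ker_w0 hp) Z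
  let σ := CalW.map p n (algebraMap R (TensorPower R S 1))
  let : Module (CalW p n R) (M.obj 0) := Module.compHom _ σ
  let : Module (CalW p n R) Z := Module.compHom _ (CalW.w0 p n R)
  let N := (M.tensor (LinCoeff.gr p n 0).toCoeff).obj 0
  let : Module (CalW p n R) N :=
    Module.compHom N ((algebraMap R (TensorPower R S 1)).comp (CalW.w0 p n R))
  have hcf : ∀ j, (cofaceHom R S j).comp (algebraMap R (TensorPower R S 1)) =
      algebraMap R (TensorPower R S 2) := fun j => (coface R S j).comp_algebraMap
  have hface : ∀ (a : CalW p n R) j (x : M.obj 0), M.face 0 j (σ a • x) =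
      CalW.map p n (algebraMap R (TensorPower R S 2)) a • M.face 0 j x := fun a j x => by
    rw [LinearMap.map_smulₛₗ, ← CalW.map_comp]
    exact congrArg (fun φ => CalW.map p n φ a • M.face 0 j x) (hcf j)
  have hd0 : ∀ x : M.obj 0, M.d 0 x = M.face 0 0 x - M.face 0 1 x :=
    fun x => altSum_zero_apply M.faceAdd x
  have hd : ∀ (a : CalW p n R) (x : M.obj 0), M.d 0 (σ a • x) =
      CalW.map p n (algebraMap R (TensorPower R S 2)) a • M.d 0 x := fun a x => by
    rw [hd0, hface, hface, ← smul_sub, ← hd0]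
  have hgr : ∀ x, (M.tensor (LinCoeff.gr p n 0).toCoeff).d 0 (M.toGr 0 x) =
      M.toGr 1 (M.d 0 x) := fun x => by
    obtain ⟨x, rfl⟩ := (M.tensorOne 0).surjective x
    rw [← tensorMap_oneGr, ← tensorMap_d, tensorMap_oneGr, tensorOne_d]
  have hdN : ∀ (r : R) (y : N), (M.tensor (LinCoeff.gr p n 0).toCoeff).d 0
      (algebraMap R (TensorPower R S 1) r • y) =
      r • (M.tensor (LinCoeff.gr p n 0).toCoeff).d 0 y :=
    fun r y => (altSumLin (M.faceAdd_tensor_smul (LinCoeff.gr p n 0)) 0).map_smul r y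
  let ZM : Submodule (CalW p n R) (M.obj 0) :=
    { carrier := {x | M.d 0 x = 0}
      zero_mem' := map_zero (M.d 0)
      add_mem' := fun {x y} (hx : M.d 0 x = 0) (hy : M.d 0 y = 0) => by
        change M.d 0 (x + y) = 0
        rw [map_add, hx, hy, add_zero]
      smul_mem' := fun a x (hx : M.d 0 x = 0) => by
        change M.d 0 (σ a • x) = 0
        rw [hd, hx, smul_zero] }
  let ZN : Submodule (CalW p n R) N :=
    { carrier := {x | (M.tensor (LinCoeff.gr p n 0).toCoeff).d 0 x = 0}
      zero_mem' := map_zero ((M.tensor (LinCoeff.gr p n 0).toCoeff).d 0)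
      add_mem' := fun {x y} (hx : (M.tensor (LinCoeff.gr p n 0).toCoeff).d 0 x = 0)
          (hy : (M.tensor (LinCoeff.gr p n 0).toCoeff).d 0 y = 0) => by
        change (M.tensor (LinCoeff.gr p n 0).toCoeff).d 0 (x + y) = 0
        rw [map_add, hx, hy, add_zero]
      smul_mem' := fun a x (hx : (M.tensor (LinCoeff.gr p n 0).toCoeff).d 0 x = 0) => by
        refine (hdN (CalW.w0 p n R a) x).trans ?_
        rw [hx, smul_zero] }
  let q : ZM →ₗ[CalW p n R] ZN :=
    { toFun x := ⟨M.toGr 0 x.1, (hgr x.1).trans (by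
        rw [show M.d 0 x.1 = 0 from x.2, map_zero])⟩
      map_add' x y := Subtype.ext (map_add (M.toGr 0) x.1 y.1)
      map_smul' a x := Subtype.ext (by
        change M.toGr 0 (σ a • x.1) = algebraMap R (TensorPower R S 1) (CalW.w0 p n R a) •
          M.toGr 0 x.1
        rw [LinearMap.map_smulₛₗ, CalW.w0_map]) }
  -- Cocycles of the reduction lift because H¹ of the first filtration step tensored with M is zero.
  -- As P is projective, the map from P to the cocycles of the reduction therefore lifts to cocycles
  -- of M.
  have hq : Function.Surjective q := fun y => by
    obtain ⟨x, hx, hxy⟩ := hM.exists_cocycle_lift (z := y.1) y.2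
    exact ⟨⟨x, hx⟩, Subtype.ext hxy⟩
  let g : P →ₗ[CalW p n R] ZN :=
    { toFun x := ⟨i (m x), hdi _⟩
      map_add' x y := Subtype.ext ((congrArg i (map_add m x y)).trans (map_add i _ _))
      map_smul' a x := Subtype.ext ((congrArg i (m.map_smulₛₗ a x)).trans (i.map_smulₛₗ _ _)) }
  obtain ⟨f, hf⟩ := Module.projective_lifting_property q g hq
  have hf' : ∀ x, M.toGr 0 (f x).1 = i (m x) := fun x =>
    congrArg Subtype.val (LinearMap.congr_fun hf x)
  let f' : P →ₛₗ[σ] M.obj 0 :=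
    { toFun x := (f x).1
      map_add' x y := by rw [map_add]; rfl
      map_smul' a x := by rw [map_smul]; rfl }
  refine ⟨P, inferInstance, inferInstance, inferInstance, inferInstance, f', ?_, fun x => (f x).2⟩
  let im : P →ₛₗ[(algebraMap R (TensorPower R S 1)).comp (CalW.w0 p n R)] N :=
    semiComp i m fun _ => rfl
  have him : IsBC im := hm.comp hi (fun _ => rfl) fun _ => rfl
  have hw : ∀ a, (algebraMap R (TensorPower R S 1)).comp (CalW.w0 p n R) a =
      CalW.w0 p n (TensorPower R S 1) (σ a) := fun a =>
    (CalW.w0_map p n (algebraMap R (TensorPower R S 1)) a).symm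
  let m' : BC σ P →ₛₗ[CalW.w0 p n (TensorPower R S 1)] N := BC.lift _ hw im
  have hm' : IsBC m' := (isBC_of σ P).of_comp him hw fun x => (BC.lift_of ..).symm
  have hp' : IsNilpotent (p : TensorPower R S 1) := by
    simpa using hp.map (algebraMap R (TensorPower R S 1))
  -- After reduction along w_0 the linear extension of `f'` is the identity, so Nakayama makes it
  -- bijective.
  refine bijective_of_bijective_mod (CalW.w0_surjective p n) (CalW.isNilpotent_ker_w0 hp') hm'
    (isBC_toGr (M := M) 0) (f' := LinearMap.id) (fun x => ?_) Function.bijective_id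
  refine LinearMap.congr_fun (f := m') (g := M.toGr 0 ∘ₛₗ
    BC.lift (RingHom.id _) (γ := σ) (fun _ => rfl) f') (BC.ext_of fun x => ?_) x
  refine (BC.lift_of ..).trans ?_
  rw [LinearMap.comp_apply, BC.lift_of]
  exact (hf' x).symm

end IsCartesian

end CechModule

theorem descent_equalizer {P₀ P K : Type*} [AddCommGroup P₀] [Module (CalW p n R) P₀]
    [Module.Projective (CalW p n R) P₀] [AddCommGroup P] [Module (CalW p n S) P] [AddCommGroup K]
    [Module (CalW p n (S ⊗[R] S)) K] {f : P₀ →ₛₗ[CalW.map p n (algebraMap R S)] P} (hf : IsBC f)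
    {f₁ : P →ₛₗ[CalW.map p n (p₁ R S : S →+* S ⊗[R] S)] K}
    {f₂ : P →ₛₗ[CalW.map p n (p₂ R S : S →+* S ⊗[R] S)] K} (h₁ : IsBC f₁)
    (h : ∀ x, f₁ (f x) = f₂ (f x)) :
    Function.Injective f ∧ ∀ z, f₁ z = f₂ z → ∃ x, f x = z := by
  have hα : ∀ (i : S →ₐ[R] S ⊗[R] S) (a : CalW p n R),
      CalW.map p n (algebraMap R (S ⊗[R] S)) a =
        CalW.map p n (i : S →+* S ⊗[R] S) (CalW.map p n (algebraMap R S) a) := fun i a => by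
    rw [← CalW.map_comp, algHom_comp_algebraMap]
  have hinj := FaithfulSMul.algebraMap_injective R S
  have heq : ∀ b, CalW.map p n (p₁ R S : S →+* S ⊗[R] S) b =
      CalW.map p n (p₂ R S : S →+* S ⊗[R] S) b → ∃ a, CalW.map p n (algebraMap R S) a = b :=
    fun b hb => CalW.exists_of_map_eq hinj (fun s hs => exists_algebraMap_eq hs)
      (fun r s hrs => exists_of_algebraMap_eq_mul (p : R) r s (by rwa [map_natCast])) hb
  let k : P₀ →ₛₗ[CalW.map p n (algebraMap R (S ⊗[R] S))] K := semiComp f₁ f (hα _)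
  have hk : IsBC k := hf.comp h₁ (hα _) fun _ => rfl
  exact module_equalizer (hα _) (hα _) (CalW.map_injective hinj) heq hf hk (fun _ => rfl) h

omit [NeZero n] in
theorem CalW.map_bijective_of_inverse {T T' : Type u} [CommRing T] [CommRing T'] {φ : T →+* T'}
    {ψ : T' →+* T} (h : ∀ x, φ (ψ x) = x) (h' : ∀ x, ψ (φ x) = x) :
    Function.Bijective (CalW.map p n φ) ∧
      ∀ a, CalW.map p n φ (CalW.map p n ψ a) = a := by
  have h1 : φ.comp ψ = RingHom.id T' := RingHom.ext h
  have h2 : ψ.comp φ = RingHom.id T := RingHom.ext h'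
  have h3 : ∀ a, CalW.map p n φ (CalW.map p n ψ a) = a := fun a => by
    rw [← CalW.map_comp, h1, CalW.map_id]
  refine ⟨Function.bijective_iff_has_inverse.2 ⟨CalW.map p n ψ, fun a => ?_, h3⟩, h3⟩
  rw [← CalW.map_comp, h2, CalW.map_id]

omit [Module.FaithfullyFlat R S] in
theorem IsBC.exists_factor_calW {T : Type u} [CommRing T] [Algebra R T] {φ : S →ₐ[R] T}
    {ψ : T →ₐ[R] S} (h : ∀ x, φ (ψ x) = x) (h' : ∀ x, ψ (φ x) = x) {P₀ P N : Type*}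
    [AddCommGroup P₀] [Module (CalW p n R) P₀]
    [AddCommGroup P] [Module (CalW p n S) P] [AddCommGroup N] [Module (CalW p n T) N]
    {f : P₀ →ₛₗ[CalW.map p n (algebraMap R T)] N} (hf : IsBC f)
    {o : P →ₛₗ[CalW.map p n (φ : S →+* T)] N} (ho : IsBC o) :
    ∃ g : P₀ →ₛₗ[CalW.map p n (algebraMap R S)] P, IsBC g ∧ ∀ x, o (g x) = f x := by
  obtain ⟨h1, h2⟩ := CalW.map_bijective_of_inverse (p := p) (n := n) (φ := (φ : S →+* T))
    (ψ := (ψ : T →+* S)) h h'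
  obtain ⟨h3, -⟩ := CalW.map_bijective_of_inverse (p := p) (n := n) (φ := (ψ : T →+* S))
    (ψ := (φ : S →+* T)) h' h
  refine IsBC.exists_factor h2 h3 (fun a => ?_) hf (ho.bijective h1)
  rw [← CalW.map_comp, ψ.comp_algebraMap]

namespace ModuleDescentDatum

variable {P : Type u} [AddCommGroup P] [Module (CalW p n S) P]
  (D : ModuleDescentDatum p n R S P)

omit [NeZero n] [Module.FaithfullyFlat R S] in
-- The differential of 1 ⊗ x is 1 ⊗ x − ∇(1 ⊗ x), formed over the indexed tensor power; the
-- isomorphism with S ⊗_R S carries its vanishing back.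
theorem d_zero_of_eq_zero_iff (x : P) :
    D.d 0 (BC.of _ x : D.Cochain 0) = 0 ↔ x ∈ D.invariants := by
  have hc0 : (coface R S (Fin.castSucc (0 : Fin 1))).comp (slot R S (Fin.last 0)) =
      slot R S (Fin.last 1) := by
    ext s
    rw [AlgHom.comp_apply, TensorPower.coface_slot_apply]
    rfl
  have hc1 : (coface R S (Fin.last 1)).comp (slot R S (Fin.last 0)) =
      slot R S (Fin.last 0).castSucc := by
    ext s
    rw [AlgHom.comp_apply, TensorPower.coface_slot_apply]
    rfl
  have h0 : D.face 0 0 (BC.of _ x) = BC.of _ x :=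
    calWTrans_of (coface R S (Fin.castSucc (0 : Fin 1))) hc0 x
  have h1 : D.lastFace 0 (BC.of _ x) = D.along (slot R S 0) (slot R S 1) (BC.of _ x) :=
    congrArg (D.along (slot R S (0 : Fin 2)) (slot R S 1))
      (calWTrans_of (coface R S (Fin.last 1)) hc1 x)
  have h2 : D.d 0 (BC.of _ x : D.Cochain 0) =
      D.face 0 0 (BC.of _ x) - D.lastFace 0 (BC.of _ x) := by
    simp [d, sub_eq_add_neg]
  have h3 : (BC.of _ x : D.Cochain 1) = calWTrans (pairMap (slot R S (0 : Fin 2)) (slot R S 1))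
      (pairMap_algHom_comp_p₂ _ _) (BC.of _ x) := (calWTrans_of _ _ x).symm
  rw [h2, sub_eq_zero, h0, h1, nablaAlong_of, mem_invariants, h3]
  have hb : Function.Bijective (CalW.map p n
      (pairMap (slot R S (0 : Fin 2)) (slot R S 1) : S ⊗[R] S →+* TensorPower R S 2)) :=
    CalW.map_bijective (RingEquiv.ofBijective
      (pairMap (slot R S (0 : Fin 2)) (slot R S 1) : S ⊗[R] S →+* TensorPower R S 2)
      TensorPower.pairMap_slot_bijective)
  exact ((isBC_calWTrans _ _).bijective hb).1.eq_iff.trans eq_comm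

theorem exists_descent_cochain [Module.Finite (CalW p n S) P]
    [Module.Projective (CalW p n S) P] (hp : IsNilpotent (p : R)) :
    ∃ (P₀ : Type u) (_ : AddCommGroup P₀) (_ : Module (CalW p n R) P₀)
      (_ : Module.Finite (CalW p n R) P₀) (_ : Module.Projective (CalW p n R) P₀)
      (f : P₀ →ₛₗ[CalW.map p n (algebraMap R (TensorPower R S 1))] D.Cochain 0),
      IsBC f ∧ ∀ x, D.d 0 (f x) = 0 := by
  have h1 : Module.Finite (CalW p n (TensorPower R S 1)) (D.Cochain 0) := inferInstance
  have h2 : Module.Projective (CalW p n (TensorPower R S 1)) (D.Cochain 0) := inferInstance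
  rw [← D.cech_d 0]
  exact @CechModule.IsCartesian.exists_descent p _ n R S _ _ _ _ _ D.cech D.isCartesian_cech h1 h2 hp

/-- A finitely generated projective module with a descent datum descends. -/
theorem exists_descent [Module.Finite (CalW p n S) P] [Module.Projective (CalW p n S) P]
    (hp : IsNilpotent (p : R)) :
    ∃ (P₀ : Type u) (_ : AddCommGroup P₀) (_ : Module (CalW p n R) P₀)
      (_ : Module.Finite (CalW p n R) P₀) (_ : Module.Projective (CalW p n R) P₀)
      (f : P₀ →ₛₗ[CalW.map p n (algebraMap R S)] P), IsBC f ∧ ∀ x, f x ∈ D.invariants := by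
  obtain ⟨P₀, _, _, _, _, f, hf, hfd⟩ := D.exists_descent_cochain hp
  obtain ⟨g, hg, hgo⟩ := IsBC.exists_factor_calW (φ := slot R S (Fin.last 0))
    (ψ := (TensorPower.equivOne R S).symm) (TensorPower.equivOne R S).apply_symm_apply
    (TensorPower.equivOne R S).symm_apply_apply hf (isBC_of _ P)
  refine ⟨P₀, inferInstance, inferInstance, inferInstance, inferInstance, g, hg, fun x => ?_⟩
  rw [← d_zero_of_eq_zero_iff, hgo]
  exact hfd x

/-- A projective module is the equalizer of its base changes, so any projective descended module is
identified with the full module of invariants. -/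
theorem exists_of_mem_invariants {P₀ : Type u} [AddCommGroup P₀] [Module (CalW p n R) P₀]
    [Module.Projective (CalW p n R) P₀] {f : P₀ →ₛₗ[CalW.map p n (algebraMap R S)] P}
    (hf : IsBC f) (h : ∀ x, f x ∈ D.invariants) :
    Function.Injective f ∧ ∀ z ∈ D.invariants, ∃ x, f x = z := by
  obtain ⟨hi, hs⟩ := descent_equalizer hf (f₁ := D.nabla.toLinearMap ∘ₛₗ BC.of _)
    (f₂ := BC.of _) ((isBC_of _ P).comp (g := D.nabla.toLinearMap)
      (IsBC.of_bijective Function.bijective_id D.nabla.bijective) (fun _ => rfl) fun _ => rfl) h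
  exact ⟨hi, fun z hz => hs z hz⟩

theorem descent [Module.Finite (CalW p n S) P] [Module.Projective (CalW p n S) P]
    (hp : IsNilpotent (p : R)) : Module.Finite (CalW p n R) D.invariants ∧
      Module.Projective (CalW p n R) D.invariants ∧ Function.Bijective D.fromInvariants := by
  obtain ⟨P₀, _, _, _, _, f, hf, h⟩ := D.exists_descent hp
  obtain ⟨hi, hs⟩ := D.exists_of_mem_invariants hf h
  let g : P₀ →ₗ[CalW p n R] D.invariants :=
    { toFun x := ⟨f x, h x⟩
      map_add' x y := Subtype.ext (map_add f x y)
      map_smul' a x := Subtype.ext (f.map_smulₛₗ a x) }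
  have hg : Function.Bijective g := ⟨fun x y hxy => hi (congrArg Subtype.val hxy), fun z => by
    obtain ⟨x, hx⟩ := hs z.1 z.2
    exact ⟨x, Subtype.ext hx⟩⟩
  let e := LinearEquiv.ofBijective g hg
  refine ⟨Module.Finite.equiv e, Module.Projective.of_equiv e, ?_⟩
  exact IsBC.of_comp (f := e.toLinearMap)
    (IsBC.of_bijective Function.bijective_id e.bijective) hf (fun _ => rfl) fun _ => rfl

end ModuleDescentDatum

end EffectiveDescent

end
end TruncDisp

namespace TruncDisp


open TensorProduct CategoryTheory

noncomputable section

/-! ### Further semilinear algebra -/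

section Semilinear

variable {A B C : Type*} [CommRing A] [CommRing B] [CommRing C] {σ : A →+* B}
  {M M' N N' K : Type*} [AddCommGroup M] [Module A M] [AddCommGroup M'] [Module A M']
  [AddCommGroup N] [Module B N] [AddCommGroup N'] [Module B N'] [AddCommGroup K] [Module B K]

/-- Semilinear maps out of a projective module lift along surjections. -/
theorem exists_lift_semilinear [Module.Projective A M] (f : M →ₛₗ[σ] N) {g : M' →ₛₗ[σ] N}
    (h : ∀ x, ∃ y, g y = f x) : ∃ t : M →ₗ[A] M', ∀ x, g (t x) = f x := by
  let : Module A N := Module.compHom N σ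
  let g' : M' →ₗ[A] N :=
    { toFun := g
      map_add' := map_add g
      map_smul' a x := g.map_smulₛₗ a x }
  let f' : M →ₗ[A] N :=
    { toFun := f
      map_add' := map_add f
      map_smul' a x := f.map_smulₛₗ a x }
  have hf : ∀ x, f' x ∈ LinearMap.range g' := fun x => by
    obtain ⟨y, hy⟩ := h x
    exact ⟨y, hy⟩
  obtain ⟨t, ht⟩ := Module.projective_lifting_property g'.rangeRestrict
    (f'.codRestrict _ hf) g'.surjective_rangeRestrict
  exact ⟨t, fun x => congrArg Subtype.val (LinearMap.congr_fun ht x)⟩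

/-- Semilinear maps out of a projective module lift along linear maps. -/
theorem exists_lift_semilinear' [Module.Projective A M] (f : M →ₛₗ[σ] N) {g : K →ₗ[B] N}
    (h : ∀ x, ∃ y, g y = f x) : ∃ t : M →ₛₗ[σ] K, ∀ x, g (t x) = f x := by
  let : Module A K := Module.compHom K σ
  let g' : K →ₛₗ[σ] N :=
    { toFun := g
      map_add' := map_add g
      map_smul' a x := g.map_smul (σ a) x }
  obtain ⟨t, ht⟩ := exists_lift_semilinear f (g := g') h
  exact ⟨{ toFun := t, map_add' := map_add t, map_smul' := fun a x => t.map_smul a x }, ht⟩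

/-- Factoring a semilinear map through an injective one. -/
theorem exists_linear_factor {o : M' →ₛₗ[σ] N} (ho : Function.Injective o) (g : M →ₛₗ[σ] N)
    (h : ∀ x, ∃ y, o y = g x) : ∃ f : M →ₗ[A] M', ∀ x, o (f x) = g x := by
  choose f hf using h
  exact ⟨{ toFun := f
           map_add' x y := ho (by rw [map_add o, hf, hf, hf, map_add])
           map_smul' a x := ho (by
            rw [LinearMap.map_smulₛₗ o, hf, hf, LinearMap.map_smulₛₗ]
            rfl) }, hf⟩

/-- The product of two semilinear maps. -/
def semiProd (f : M →ₛₗ[σ] N) (g : M' →ₛₗ[σ] N') : M × M' →ₛₗ[σ] N × N' where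
  toFun x := (f x.1, g x.2)
  map_add' x y := by simp
  map_smul' a x := by simp

@[simp] theorem semiProd_apply (f : M →ₛₗ[σ] N) (g : M' →ₛₗ[σ] N') (x : M × M') :
    semiProd f g x = (f x.1, g x.2) := rfl

theorem IsBC.prod {f : M →ₛₗ[σ] N} (hf : IsBC f) {g : M' →ₛₗ[σ] N'} (hg : IsBC g) :
    IsBC (semiProd f g) := by
  let inv : N × N' →ₗ[B] BC σ (M × M') :=
    (hf.lift (RingHom.id B) (γ := σ) (fun _ => rfl)
      (BC.of σ ∘ₛₗ LinearMap.inl A M M')).coprod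
    (hg.lift (RingHom.id B) (γ := σ) (fun _ => rfl) (BC.of σ ∘ₛₗ LinearMap.inr A M M'))
  let e := BC.lift (RingHom.id B) (γ := σ) (fun _ => rfl) (semiProd f g)
  have h1 : ∀ z, inv (e z) = z := by
    refine LinearMap.congr_fun (f := inv ∘ₗ e) (g := LinearMap.id) (BC.ext_of fun x => ?_)
    rw [LinearMap.comp_apply, BC.lift_of, LinearMap.id_apply, semiProd_apply,
      LinearMap.coprod_apply, IsBC.lift_apply, IsBC.lift_apply, LinearMap.comp_apply,
      LinearMap.comp_apply, ← map_add]
    simp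
  have h2 : ∀ y, e (inv (y, 0)) = (y, 0) := by
    refine hf.ext (g := e ∘ₗ inv ∘ₗ LinearMap.inl B N N') (h := LinearMap.inl B N N') fun x => ?_
    change e (inv (f x, 0)) = (f x, 0)
    rw [LinearMap.coprod_apply, map_zero, add_zero, IsBC.lift_apply, LinearMap.comp_apply,
      BC.lift_of]
    simp
  have h3 : ∀ y, e (inv (0, y)) = (0, y) := by
    refine hg.ext (g := e ∘ₗ inv ∘ₗ LinearMap.inr B N N') (h := LinearMap.inr B N N') fun x => ?_
    change e (inv (0, g x)) = (0, g x)
    rw [LinearMap.coprod_apply, map_zero, zero_add, IsBC.lift_apply, LinearMap.comp_apply,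
      BC.lift_of]
    simp
  refine Function.bijective_iff_has_inverse.2 ⟨inv, h1, fun y => ?_⟩
  have : y = (y.1, 0) + (0, y.2) := by simp
  rw [this, map_add]
  change e _ = _
  rw [map_add, h2, h3]

/-- A bijection stays bijective under base change. -/
theorem bijective_of_isBC {m : M →ₛₗ[σ] N} (hm : IsBC m) {q : M' →ₛₗ[σ] N'} (hq : IsBC q)
    {f : M →ₗ[A] M'} {f' : N →ₗ[B] N'} (h : ∀ x, f' (m x) = q (f x))
    (hf : Function.Bijective f) : Function.Bijective f' := by
  have h1 : IsBC f := IsBC.of_bijective Function.bijective_id hf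
  have h2 : IsBC (semiComp (γ := σ) q f fun _ => rfl) := h1.comp hq (fun _ => rfl) fun _ => rfl
  exact (hm.of_comp (g := f') h2 (fun _ => rfl) fun x => (h x).symm).bijective
    Function.bijective_id

/-- A base change map of a flat module along an injective homomorphism is injective. -/
theorem IsBC.injective_of_flat {f : M →ₛₗ[σ] N} (hf : IsBC f) (hσ : Function.Injective σ)
    [Module.Flat A M] : Function.Injective f := by
  have h : Function.Injective (BC.of σ : M → BC σ M) := by
    let := σ.toAlgebra
    have h1 := Module.Flat.rTensor_preserves_injective_linearMap (M := M)
      (Algebra.linearMap A B) hσ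
    have h2 : (BC.of σ : M → BC σ M) =
        (Algebra.linearMap A B).rTensor M ∘ (TensorProduct.lid A M).symm := by
      ext x
      change (1 : B) ⊗ₜ[A] x = (Algebra.linearMap A B).rTensor M ((1 : A) ⊗ₜ x)
      rw [LinearMap.rTensor_tmul, Algebra.linearMap_apply, map_one]
    rw [h2]
    exact h1.comp (TensorProduct.lid A M).symm.injective
  intro x y hxy
  rw [← hf.equiv_of, ← hf.equiv_of] at hxy
  exact h (hf.equiv.injective hxy)

/-- Surjective maps between finitely generated projective modules of equal rank, where the ranks
are given by extension of scalars along two homomorphisms that agree up to a Frobenius. -/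
theorem bijective_of_surjective_of_pow {σ τ : A →+* B} {q : ℕ}
    (h : ∀ a, IsNilpotent (σ a - τ a ^ q)) (hq : q ≠ 0) [Module.Finite A M]
    [Module.Projective A M] {Ψ : BC σ M →ₗ[B] BC τ M} (hΨ : Function.Surjective Ψ) :
    Function.Bijective Ψ := by
  -- At a maximal ideal m the two ranks are the ranks of M at the preimages of m under σ and τ.
  -- These preimages coincide, since σ(a) and τ(a)^q differ by a nilpotent element.
  refine Module.bijective_of_surjective_of_rankAtStalk_eq hΨ fun m hm => ?_
  have hp : m.IsPrime := inferInstance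
  have h1 : Module.rankAtStalk (R := B) (BC σ M) ⟨m, hp⟩ =
      Module.rankAtStalk M (PrimeSpectrum.comap σ ⟨m, hp⟩) := by
    let := σ.toAlgebra
    exact Module.rankAtStalk_baseChange ..
  have h2 : Module.rankAtStalk (R := B) (BC τ M) ⟨m, hp⟩ =
      Module.rankAtStalk M (PrimeSpectrum.comap τ ⟨m, hp⟩) := by
    let := τ.toAlgebra
    exact Module.rankAtStalk_baseChange ..
  rw [h1, h2]
  congr 1
  refine PrimeSpectrum.ext (Ideal.ext fun a => ?_)
  change σ a ∈ m ↔ τ a ∈ m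
  have h3 : σ a - τ a ^ q ∈ m := by
    obtain ⟨k, hk⟩ := h a
    exact hp.mem_of_pow_mem k (by rw [hk]; exact m.zero_mem)
  rw [← hp.pow_mem_iff_mem (I := m) (r := τ a) q (Nat.pos_of_ne_zero hq),
    ← sub_add_cancel (σ a) (τ a ^ q)]
  exact ⟨fun h4 => (m.add_mem_iff_right h3).1 h4, fun h4 => (m.add_mem_iff_right h3).2 h4⟩

end Semilinear

/-! ### Frobenius modulo nilpotents and the kernel of κ -/

section Witt

variable {p : ℕ} [Fact p.Prime] {n : ℕ} {T : Type u} [CommRing T]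

open WittVector

/-- Under w_0 the difference becomes w_1(x) − x_0^p = p x_1, which is nilpotent, and the kernel of
w_0 on W_n is nilpotent. -/
theorem CalW.isNilpotent_frob_sub_pow [NeZero n] (hp : IsNilpotent (p : T)) (a : CalW p n T) :
    IsNilpotent (CalW.frob p n T a - CalW.res p n T a ^ p) := by
  obtain ⟨x, rfl⟩ := CalW.proj_surjective p n a
  obtain ⟨N, hN⟩ := hp
  obtain ⟨K, hK⟩ := W.isNilpotent_ker_w0 (n := n) ⟨N, hN⟩
  have h1 : W.w0 p n T (CalW.frob p n T (CalW.proj p n T x) -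
      CalW.res p n T (CalW.proj p n T x) ^ p) = p * x.coeff 1 := by
    rw [map_sub, map_pow, CalW.frob_proj, CalW.res_proj, W.w0_trunc, W.w0_trunc]
    have h2 : (frobenius x).coeff 0 = ghostComponent 1 x := constantCoeff_iterate_frobenius 1 x
    rw [h2, ghostComponent_apply, aeval_wittPolynomial, Finset.sum_range_succ,
      Finset.sum_range_one]
    simp
  have h2 : (CalW.frob p n T (CalW.proj p n T x) -
      CalW.res p n T (CalW.proj p n T x) ^ p) ^ N ∈ RingHom.ker (W.w0 p n T) := by
    rw [RingHom.mem_ker, map_pow, h1, mul_pow, hN, zero_mul]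
  have h3 := Ideal.pow_mem_pow h2 K
  rw [hK, ← pow_mul] at h3
  exact ⟨_, h3⟩

variable (p n)

/-- The isomorphism `I_{n+1} ⊗ M ≅ W_n ⊗_F M`. -/
def VIdeal.tensorEquiv (M : Type*) [AddCommGroup M] [Module (CalW p n T) M] :
    VIdeal p n T ⊗[CalW p n T] M ≃+ BC (CalW.frob p n T) M :=
  letI := (CalW.frob p n T).toAlgebra
  (AddEquiv.refl (W p n T ⊗[CalW p n T] M) :)

theorem VIdeal.tensorEquiv_tmul (M : Type*) [AddCommGroup M] [Module (CalW p n T) M]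
    (a : VIdeal p n T) (x : M) :
    VIdeal.tensorEquiv p n M (a ⊗ₜ x) = VIdeal.verInv p n T a • BC.of _ x := by
  let := (CalW.frob p n T).toAlgebra
  change a ⊗ₜ x = (VIdeal.verInv p n T a * 1) ⊗ₜ[CalW p n T] x
  rw [mul_one]
  rfl

/-- The coefficient functor `I_{n+1}`. -/
def Coeff.vIdeal : Coeff.{u} p n where
  obj T _ := VIdeal p n T
  map φ := VIdeal.map p n φ
  map_comp φ ψ x := VIdeal.map_comp p n φ ψ x
  map_id x := VIdeal.map_id p n x

theorem W.trunc_iterate_verschiebung_eq [NeZero n] {x y : WittVector p T}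
    (h : x.coeff 0 = y.coeff 0) : W.trunc p n T (verschiebung^[n - 1] x) =
      W.trunc p n T (verschiebung^[n - 1] y) := by
  rw [W.trunc_eq_iff]
  intro i hi
  rcases Nat.lt_or_ge i (n - 1) with hi' | hi'
  · rw [iterate_verschiebung_coeff_eq_zero _ hi', iterate_verschiebung_coeff_eq_zero _ hi']
  · obtain rfl : i = n - 1 := by omega
    rw [coeff_iterate_verschiebung, coeff_iterate_verschiebung, h]

/-- The map `t ↦ V(V^{n-1}([t]))` from the `p`-torsion to `I_{n+1}`. -/
def Coeff.torVIdeal [NeZero n] : Coeff.Hom (LinCoeff.tor.{u} p n).toCoeff (Coeff.vIdeal p n) where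
  app T _ :=
    { toFun t := (VIdeal.verInv p n T).symm
        (W.trunc p n T (verschiebung^[n - 1] (teichmuller p t.1)))
      map_add' s t := by
        refine Eq.trans ?_ (map_add (VIdeal.verInv p n T).symm _ _)
        refine congrArg (VIdeal.verInv p n T).symm ?_
        rw [← map_add, ← iterate_verschiebung_add]
        refine W.trunc_iterate_verschiebung_eq p n ?_
        rw [add_coeff_zero, teichmuller_coeff_zero, teichmuller_coeff_zero,
          teichmuller_coeff_zero]
        rfl
      map_smul' a t := by
        obtain ⟨y, rfl⟩ := CalW.proj_surjective p n a
        refine (VIdeal.verInv p n T).injective ?_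
        refine Eq.trans ?_ (VIdeal.verInv_smul ..).symm
        rw [AddEquiv.apply_symm_apply, AddEquiv.apply_symm_apply, RingHom.id_apply,
          CalW.frob_proj, ← map_mul, mul_iterate_verschiebung]
        refine W.trunc_iterate_verschiebung_eq p n ?_
        have h : frobenius^[n - 1] (frobenius y) = frobenius^[n] y := by
          rw [← Function.iterate_succ_apply, Nat.succ_eq_add_one,
            Nat.sub_add_cancel (Nat.pos_of_neZero n)]
        rw [h, mul_coeff_zero, teichmuller_coeff_zero, teichmuller_coeff_zero,
          constantCoeff_iterate_frobenius]
        change CalW.ghost (Fin.last n) T (CalW.proj p n T y) * t.1 = _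
        rw [CalW.ghost_proj]
        rfl }
  naturality {T T'} _ _ φ t := by
    refine (VIdeal.verInv p n T').injective ?_
    refine Eq.trans ?_ (VIdeal.verInv_map ..).symm
    refine (AddEquiv.apply_symm_apply _ _).trans (Eq.trans ?_
      (congrArg (W.map p n φ) (AddEquiv.apply_symm_apply _ _)).symm)
    rw [W.map_trunc, map_iterate_verschiebung, map_teichmuller]
    rfl

theorem VIdeal.kappa_eq [NeZero n] (x : WittVector p T) :
    VIdeal.kappa p n T ((VIdeal.verInv p n T).symm (W.trunc p n T x)) =
      CalW.proj p n T (verschiebung x) := by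
  rw [kappa_apply, incl_apply, AddEquiv.apply_symm_apply, W.ver_trunc]
  rfl

theorem Coeff.torVIdeal_injective [NeZero n] :
    Function.Injective ((Coeff.torVIdeal.{u} p n).app T) := by
  intro s t h
  have h1 := (VIdeal.verInv p n T).symm.injective h
  have h2 := (W.trunc_eq_iff p n _ _).1 h1 (n - 1) (Nat.sub_lt (Nat.pos_of_neZero n) one_pos)
  rw [coeff_iterate_verschiebung, coeff_iterate_verschiebung, teichmuller_coeff_zero,
    teichmuller_coeff_zero] at h2
  exact Subtype.ext h2

/-- κ(Vx) is the class of V(x) in 𝒲_n, so it vanishes exactly when x = V^{n−1}(y) with p y_0 = 0.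
Thus ker κ is the p-torsion of the ring, and it measures the failure of ι to be injective. -/
theorem Coeff.torVIdeal_exact [NeZero n] :
    Function.Exact ((Coeff.torVIdeal.{u} p n).app T) (VIdeal.kappa p n T) := by
  have hn := Nat.sub_add_cancel (Nat.pos_of_neZero n)
  have hV : ∀ y : WittVector p T, verschiebung (verschiebung^[n - 1] y) = verschiebung^[n] y :=
    fun y => by rw [← Function.iterate_succ_apply' (f := verschiebung), Nat.succ_eq_add_one, hn]
  intro a
  constructor
  · intro h
    obtain ⟨a, rfl⟩ := (VIdeal.verInv p n T).symm.surjective a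
    obtain ⟨x, rfl⟩ := W.exists_trunc p n a
    rw [VIdeal.kappa_eq, CalW.proj_eq_zero_iff] at h
    obtain ⟨y, rfl⟩ := exists_iterate_verschiebung (n - 1) x fun i hi => by
      have := h.1 (i + 1) (by omega)
      rwa [verschiebung_coeff_succ] at this
    rw [hV, coeff_iterate_verschiebung] at h
    refine ⟨⟨y.coeff 0, h.2⟩, congrArg (VIdeal.verInv p n T).symm
      (W.trunc_iterate_verschiebung_eq p n ?_)⟩
    exact teichmuller_coeff_zero p _
  · rintro ⟨t, rfl⟩
    refine (VIdeal.kappa_eq p n _).trans ?_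
    rw [hV, CalW.proj_eq_zero_iff, coeff_iterate_verschiebung, teichmuller_coeff_zero]
    exact ⟨fun i hi => iterate_verschiebung_coeff_eq_zero _ hi, t.2⟩

end Witt

end
end TruncDisp

namespace TruncDisp


open TensorProduct CategoryTheory

noncomputable section

/-! ### Normal decompositions -/

section Normal

variable {p : ℕ} [Fact p.Prime] {n : ℕ} {R S : Type u} [CommRing R] [CommRing S]

namespace Predisplay

variable {D : Predisplay p n R} {T L : Type u} [AddCommGroup T] [Module (CalW p n R) T]
  [AddCommGroup L] [Module (CalW p n R) L]

/-- The map `T ⊕ L → P`. -/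
def decP (t : T →ₗ[CalW p n R] D.P) (l : L →ₗ[CalW p n R] D.Q) : T × L →ₗ[CalW p n R] D.P :=
  t.coprod (D.iota ∘ₗ l)

/-- The map `I_{n+1} ⊗ T ⊕ L → Q`. -/
def decQ (t : T →ₗ[CalW p n R] D.P) (l : L →ₗ[CalW p n R] D.Q) :
    (VIdeal p n R ⊗[CalW p n R] T) × L →ₗ[CalW p n R] D.Q :=
  (D.eps ∘ₗ t.lTensor (VIdeal p n R)).coprod l

theorem decP_apply (t : T →ₗ[CalW p n R] D.P) (l : L →ₗ[CalW p n R] D.Q) (x : T) (y : L) :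
    decP t l (x, y) = t x + D.iota (l y) := rfl

theorem decQ_apply (t : T →ₗ[CalW p n R] D.P) (l : L →ₗ[CalW p n R] D.Q)
    (w : VIdeal p n R ⊗[CalW p n R] T) (y : L) :
    decQ t l (w, y) = D.eps (t.lTensor (VIdeal p n R) w) + l y := rfl

/-- `P = T ⊕ L` and `Q = I_{n+1} ⊗ T ⊕ L`. -/
structure IsNormal (t : T →ₗ[CalW p n R] D.P) (l : L →ₗ[CalW p n R] D.Q) : Prop where
  bijective_decP : Function.Bijective (decP t l)
  bijective_decQ : Function.Bijective (decQ t l)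

/-- As P is spanned by T and ι(L), and ε(a ⊗ ι(y)) = κ(a) y, the image of ε is already contained in
ε(I ⊗ T) + L. -/
theorem decQ_surjective {t : T →ₗ[CalW p n R] D.P} {l : L →ₗ[CalW p n R] D.Q}
    (hP : Function.Surjective (decP t l)) (hQ : ∀ y, ∃ w x, y = D.eps w + l x) :
    Function.Surjective (decQ t l) := by
  rw [← LinearMap.range_eq_top]
  have h1 : ∀ x, l x ∈ LinearMap.range (decQ t l) := fun x =>
    ⟨(0, x), by rw [decQ_apply, map_zero, map_zero, zero_add]⟩
  have h2 : ∀ w, D.eps w ∈ LinearMap.range (decQ t l) := by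
    intro w
    induction w using TensorProduct.induction_on with
    | zero => rw [map_zero]; exact zero_mem _
    | add x y hx hy => rw [map_add]; exact add_mem hx hy
    | tmul a z =>
      obtain ⟨⟨x, y⟩, rfl⟩ := hP z
      rw [decP_apply, tmul_add, map_add, D.eps_iota]
      refine add_mem ⟨(a ⊗ₜ x, 0), ?_⟩ (Submodule.smul_mem _ _ (h1 y))
      rw [decQ_apply, map_zero, add_zero, LinearMap.lTensor_tmul]
  refine eq_top_iff.2 fun y _ => ?_
  obtain ⟨w, x, rfl⟩ := hQ y
  exact add_mem (h2 w) (h1 x)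

/-- The linear extension `W_n ⊗_F (T ⊕ L) → W_n ⊗ P` of `(x, y) ↦ F(x) + Ḟ(y)`. -/
def decF (t : T →ₗ[CalW p n R] D.P) (l : L →ₗ[CalW p n R] D.Q) :
    BC (CalW.frob p n R) (T × L) →ₗ[W p n R] BC (CalW.res p n R) D.P :=
  BC.lift (RingHom.id _) (γ := CalW.frob p n R) (fun _ => rfl)
    (D.F ∘ₛₗ (t ∘ₗ LinearMap.fst (CalW p n R) T L) +
      D.Fdot ∘ₛₗ (l ∘ₗ LinearMap.snd (CalW p n R) T L))

theorem decF_of (t : T →ₗ[CalW p n R] D.P) (l : L →ₗ[CalW p n R] D.Q) (x : T × L) :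
    decF t l (BC.of _ x) = D.F (t x.1) + D.Fdot (l x.2) :=
  BC.lift_id_of _ x

/-- The map `I_{n+1} ⊗ T ⊕ L → W_n ⊗_F (T ⊕ L)`. -/
def decV (T L : Type u) [AddCommGroup T] [Module (CalW p n R) T] [AddCommGroup L]
    [Module (CalW p n R) L] :
    (VIdeal p n R ⊗[CalW p n R] T) × L →+ BC (CalW.frob p n R) (T × L) :=
  AddMonoidHom.coprod
    ((BC.map (RingHom.id _) (τ := CalW.frob p n R) (α := RingHom.id _) (fun _ => rfl)
      (LinearMap.inl (CalW p n R) T L) :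
        BC (CalW.frob p n R) T →ₗ[W p n R] _).toAddMonoidHom.comp
      (VIdeal.tensorEquiv p n T).toAddMonoidHom)
    (BC.of (CalW.frob p n R) ∘ₛₗ LinearMap.inr (CalW p n R) T L).toAddMonoidHom

theorem decV_apply (w : VIdeal p n R ⊗[CalW p n R] T) (y : L) :
    decV T L (w, y) = BC.map (RingHom.id _) (τ := CalW.frob p n R) (α := RingHom.id _)
      (fun _ => rfl) (LinearMap.inl (CalW p n R) T L) (VIdeal.tensorEquiv p n T w) +
        BC.of _ (0, y) := rfl

/-- On I ⊗ T ⊕ L the map Ḟ factors over the linear map `decF`. The first map `decV` identifies I ⊗ T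
with W_n ⊗_F T by V⁻¹, so injectivity of `decF` gives information on the kernel of `decQ`. -/
theorem Fdot_decQ (t : T →ₗ[CalW p n R] D.P) (l : L →ₗ[CalW p n R] D.Q)
    (z : (VIdeal p n R ⊗[CalW p n R] T) × L) :
    D.Fdot (decQ t l z) = decF t l (decV T L z) := by
  obtain ⟨w, y⟩ := z
  rw [decQ_apply, decV_apply, map_add, map_add, decF_of]
  simp only [map_zero, zero_add]
  congr 1
  induction w using TensorProduct.induction_on with
  | zero => simp only [map_zero]
  | add x y hx hy => simp only [map_add, hx, hy]
  | tmul a x =>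
    rw [LinearMap.lTensor_tmul, D.Fdot_eps, VIdeal.tensorEquiv_tmul, map_smul, BC.map_of, map_smul,
      decF_of]
    simp

theorem decF_surjective {t : T →ₗ[CalW p n R] D.P} {l : L →ₗ[CalW p n R] D.Q}
    (h : Submodule.span (W p n R) (Set.range D.Fdot) = ⊤)
    (hQ : Function.Surjective (decQ t l)) : Function.Surjective (decF t l) := by
  rw [← LinearMap.range_eq_top, eq_top_iff, ← h, Submodule.span_le]
  rintro _ ⟨y, rfl⟩
  obtain ⟨z, rfl⟩ := hQ y
  exact ⟨_, (Fdot_decQ t l z).symm⟩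

variable [NeZero n]

/-- Only the injectivity of I ⊗ T ⊕ L → Q is at stake, and it is a consequence of Ḟ(Q) generating
W_n ⊗ P. This reduces every later construction of normal decompositions to a statement on P and a
surjectivity statement on Q. -/
theorem IsNormal.of_surjective (hp : IsNilpotent (p : R)) (hD : D.IsTruncatedDisplay)
    {t : T →ₗ[CalW p n R] D.P} {l : L →ₗ[CalW p n R] D.Q} (hP : Function.Bijective (decP t l))
    (hQ : ∀ y, ∃ w x, y = D.eps w + l x) : IsNormal t l := by
  have := hD.finite
  have := hD.projective
  have hs := decQ_surjective hP.2 hQ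
  refine ⟨hP, ?_, hs⟩
  -- After T ⊕ L ≅ P this is a surjection W_n ⊗_F P → W_n ⊗_Res P. The two sides have the same rank
  -- because F and the p-th power of Res agree modulo nilpotents.
  have hF : Function.Injective (decF t l) := by
    let e : BC (CalW.frob p n R) (T × L) ≃ₗ[W p n R] BC (CalW.frob p n R) D.P :=
      (IsBC.of_bijective (f := decP t l) Function.bijective_id hP).trans (CalW.frob p n R)
        (fun _ => rfl)
    have h1 : Function.Surjective (decF t l ∘ₗ e.symm.toLinearMap) :=
      (decF_surjective hD.span_Fdot hs).comp e.symm.surjective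
    have h2 := (bijective_of_surjective_of_pow (CalW.isNilpotent_frob_sub_pow hp)
      (Fact.out : p.Prime).ne_zero h1).1
    intro x y hxy
    refine e.injective (h2 ?_)
    simpa using hxy
  rw [injective_iff_map_eq_zero]
  rintro ⟨w, y⟩ h
  -- For (w, y) in the kernel, `decV` vanishes, and its component in W_n ⊗_F T ≅ I ⊗ T shows w = 0.
  -- Then ι(l(y)) = 0, and the decomposition of P gives y = 0.
  have h1 := Fdot_decQ t l (w, y)
  rw [h, map_zero, eq_comm, ← map_zero (decF t l)] at h1
  have h2 := hF h1
  rw [decV_apply] at h2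
  have h3 := congrArg (BC.map (RingHom.id _) (τ := CalW.frob p n R) (α := RingHom.id _)
      (fun _ => rfl) (LinearMap.fst (CalW p n R) T L)) h2
  have h4 : ∀ z, BC.map (RingHom.id _) (τ := CalW.frob p n R) (α := RingHom.id _)
      (fun _ => rfl) (LinearMap.fst (CalW p n R) T L) (BC.map (RingHom.id _)
        (τ := CalW.frob p n R) (α := RingHom.id _) (fun _ => rfl)
        (LinearMap.inl (CalW p n R) T L) z) = z := fun z =>
    LinearMap.congr_fun (f := (BC.map (RingHom.id _) (τ := CalW.frob p n R) (α := RingHom.id _)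
      (fun _ => rfl) (LinearMap.fst (CalW p n R) T L)).comp (BC.map (RingHom.id _)
        (τ := CalW.frob p n R) (α := RingHom.id _) (fun _ => rfl)
        (LinearMap.inl (CalW p n R) T L))) (g := LinearMap.id)
      (BC.ext_of fun x => by simp) z
  rw [map_add, h4, BC.map_of, map_zero] at h3
  have h5 : VIdeal.tensorEquiv p n T w = 0 := by simpa using h3
  obtain rfl : w = 0 := (VIdeal.tensorEquiv p n T).injective (h5.trans (map_zero _).symm)
  rw [decQ_apply, map_zero, map_zero, zero_add] at h
  have h6 : decP t l (0, y) = decP t l 0 := by rw [decP_apply, h, map_zero, map_zero, map_zero, zero_add]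
  exact congrArg (fun z => ((0 : VIdeal p n R ⊗[CalW p n R] T), z.2)) (hP.1 h6)

theorem toCokerIota_eq_zero (x : D.P) (h : D.toCokerIota x = 0) : ∃ y, D.iota y = x := by
  rw [← LinearMap.mem_range, ← Submodule.Quotient.mk_eq_zero]
  refine BC.of_injective (CalW.w0_surjective p n) ?_ (h.trans (map_zero _).symm)
  intro a ha x
  obtain ⟨b, rfl⟩ := (VIdeal.w0_eq_zero_iff p n a).1 ha
  obtain ⟨x, rfl⟩ := Submodule.mkQ_surjective _ x
  rw [← map_smul, Submodule.mkQ_apply, Submodule.Quotient.mk_eq_zero, ← D.iota_eps]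
  exact ⟨_, rfl⟩

/-- The map to `P / κ(I_{n+1}) P` is the extension of scalars along `w_0`. -/
theorem mem_kappaIdeal_smul {M : Type*} [AddCommGroup M] [Module (CalW p n R) M] {N : Type*}
    [AddCommGroup N] [Module R N] {f : M →ₛₗ[CalW.w0 p n R] N} (hf : IsBC f) {x : M}
    (h : f x = 0) : x ∈ VIdeal.kappaIdeal p n R • (⊤ : Submodule (CalW p n R) M) := by
  have h1 := hf.mem_ker_smul (CalW.w0_surjective p n) h
  have h2 : RingHom.ker (CalW.w0 p n R) = VIdeal.kappaIdeal p n R :=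
    Ideal.ext fun a => VIdeal.w0_eq_zero_iff p n a
  rwa [h2] at h1

/-- A normal decomposition exists. -/
theorem IsTruncatedDisplay.exists_isNormal (hp : IsNilpotent (p : R))
    (hD : D.IsTruncatedDisplay) :
    ∃ (T : Type u) (_ : AddCommGroup T) (_ : Module (CalW p n R) T)
      (_ : Module.Finite (CalW p n R) T) (_ : Module.Projective (CalW p n R) T)
      (L : Type u) (_ : AddCommGroup L) (_ : Module (CalW p n R) L)
      (_ : Module.Finite (CalW p n R) L) (_ : Module.Projective (CalW p n R) L)
      (t : T →ₗ[CalW p n R] D.P) (l : L →ₗ[CalW p n R] D.Q), IsNormal t l := by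
  have := hD.finite
  have := hD.projective
  have := hD.finite_coker_iota
  have := hD.projective_coker_iota
  have := hD.finite_coker_eps
  have := hD.projective_coker_eps
  obtain ⟨r, hr⟩ := hD.exists_retraction
  have hnil := CalW.isNilpotent_ker_w0 (n := n) hp
  obtain ⟨T, _, _, _, _, m, hm⟩ := exists_lift_projective (CalW.w0_surjective p n) hnil D.cokerIota
  obtain ⟨L, _, _, _, _, m', hm'⟩ := exists_lift_projective (CalW.w0_surjective p n) hnil D.cokerEps
  -- Modulo κ(I) the module P is an extension of coker ι by coker ε, and the retraction `r` splits
  -- it. Lifting the two summands along w_0 produces T and L; Nakayama then decomposes P.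
  let q : D.P →ₛₗ[CalW.w0 p n R] D.cokerIota × D.cokerEps :=
    { toFun x := (D.toCokerIota x, r x)
      map_add' x y := by simp
      map_smul' a x := by simp }
  have hqs : Function.Surjective q := by
    rintro ⟨a, b⟩
    obtain ⟨x, rfl⟩ := D.toCokerIota_surjective a
    obtain ⟨y, hy⟩ := D.toCokerEps_surjective (b - r x)
    refine ⟨x + D.iota y, Prod.ext ?_ ?_⟩
    · change D.toCokerIota _ = _
      rw [map_add, toCokerIota_iota, add_zero]
    · change r _ = b
      rw [map_add, hr, hy, add_sub_cancel]
  have hq : IsBC q := by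
    refine ⟨?_, fun y => ?_⟩
    · rw [injective_iff_map_eq_zero]
      intro z hz
      obtain ⟨x, rfl⟩ := BC.of_surjective (CalW.w0_surjective p n) z
      rw [BC.lift_of] at hz
      obtain ⟨y, rfl⟩ := toCokerIota_eq_zero x (congrArg Prod.fst hz)
      have h1 : r (D.iota y) = 0 := congrArg Prod.snd hz
      rw [hr] at h1
      obtain ⟨w, rfl⟩ := D.toCokerEps_eq_zero y h1
      clear hz h1
      induction w using TensorProduct.induction_on with
      | zero => simp only [map_zero]
      | add x y hx hy => simp only [map_add, hx, hy, add_zero]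
      | tmul a x => rw [D.iota_eps, LinearMap.map_smulₛₗ, w0_kappa, zero_smul]
    · obtain ⟨x, rfl⟩ := hqs y
      exact ⟨BC.of _ x, BC.lift_of ..⟩
  obtain ⟨t, ht⟩ := exists_lift_semilinear (σ := CalW.w0 p n R) (g := q)
    (LinearMap.inl R D.cokerIota D.cokerEps ∘ₛₗ m) fun x => hqs _
  obtain ⟨l, hl⟩ := exists_lift_semilinear (σ := CalW.w0 p n R) (g := D.toCokerEps) m'
    fun x => D.toCokerEps_surjective _
  refine ⟨T, inferInstance, inferInstance, inferInstance, inferInstance, L, inferInstance,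
    inferInstance, inferInstance, inferInstance, t, l, IsNormal.of_surjective hp hD ?_ ?_⟩
  · refine bijective_of_bijective_mod (CalW.w0_surjective p n) hnil (hm.prod hm') hq
      (f' := LinearMap.id) ?_ Function.bijective_id
    rintro ⟨x, y⟩
    rw [decP_apply, map_add, ht, LinearMap.id_apply, semiProd_apply]
    refine Prod.ext ?_ ?_
    · change m x = m x + D.toCokerIota (D.iota (l y))
      rw [toCokerIota_iota, add_zero]
    · change m' y = 0 + r (D.iota (l y))
      rw [hr, hl, zero_add]
  · intro y
    obtain ⟨x, hx⟩ := hm'.surjective (CalW.w0_surjective p n) (D.toCokerEps y)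
    obtain ⟨w, hw⟩ := D.toCokerEps_eq_zero (y - l x) (by rw [map_sub, hl, hx, sub_self])
    exact ⟨w, x, by rw [hw, sub_add_cancel]⟩

/-! #### Base change of normal decompositions -/

section

variable (φ : R →+* S)

/-- The base change of a map `T → P`. -/
def bcT (t : T →ₗ[CalW p n R] D.P) :
    BC (CalW.map p n φ) T →ₗ[CalW p n S] (D.baseChange φ).P :=
  BC.lift (RingHom.id _) (γ := CalW.map p n φ) (fun _ => rfl) ((D.toBaseChange φ).mapP ∘ₛₗ t)

/-- The base change of a map `L → Q`. -/
def bcL (l : L →ₗ[CalW p n R] D.Q) :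
    BC (CalW.map p n φ) L →ₗ[CalW p n S] (D.baseChange φ).Q :=
  BC.lift (RingHom.id _) (γ := CalW.map p n φ) (fun _ => rfl) ((D.toBaseChange φ).mapQ ∘ₛₗ l)

omit [NeZero n] in
theorem bcT_of (t : T →ₗ[CalW p n R] D.P) (x : T) :
    bcT φ t (BC.of _ x) = (D.toBaseChange φ).mapP (t x) :=
  BC.lift_id_of _ x

omit [NeZero n] in
theorem bcL_of (l : L →ₗ[CalW p n R] D.Q) (x : L) :
    bcL φ l (BC.of _ x) = (D.toBaseChange φ).mapQ (l x) :=
  BC.lift_id_of _ x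

omit [NeZero n] in
theorem decP_bijective_baseChange {t : T →ₗ[CalW p n R] D.P} {l : L →ₗ[CalW p n R] D.Q}
    (h : Function.Bijective (decP t l)) : Function.Bijective (decP (bcT φ t) (bcL φ l)) := by
  refine bijective_of_isBC ((isBC_of (CalW.map p n φ) T).prod (isBC_of (CalW.map p n φ) L))
    (q := (D.toBaseChange φ).mapP) (isBC_of (CalW.map p n φ) D.P) (f := decP t l) ?_ h
  rintro ⟨x, y⟩
  rw [semiProd_apply, decP_apply, bcT_of, bcL_of, (D.toBaseChange φ).iota_comm, decP_apply, map_add]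

omit [NeZero n] in
theorem exists_eps_add_baseChange {l : L →ₗ[CalW p n R] D.Q}
    (h : ∀ y, ∃ w x, y = D.eps w + l x) (y : (D.baseChange φ).Q) :
    ∃ w x, y = (D.baseChange φ).eps w + bcL φ l x := by
  induction y using baseChange_Q_induction with
  | of y =>
    obtain ⟨w, x, rfl⟩ := h y
    rw [map_add, ← bcL_of φ l x]
    suffices h : ∃ w', (D.toBaseChange φ).mapQ (D.eps w) = (D.baseChange φ).eps w' by
      obtain ⟨w', hw'⟩ := h
      exact ⟨w', _, by rw [hw']⟩
    induction w using TensorProduct.induction_on with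
    | zero => exact ⟨0, by simp only [map_zero]⟩
    | tmul a x => exact ⟨_, (D.toBaseChange φ).eps_comm a x⟩
    | add x y hx hy =>
      obtain ⟨x', hx'⟩ := hx
      obtain ⟨y', hy'⟩ := hy
      exact ⟨x' + y', by simp only [map_add, hx', hy']⟩
  | eps b x => exact ⟨b ⊗ₜ x, 0, by rw [map_zero, add_zero]⟩
  | add x y hx hy =>
    obtain ⟨w, x, rfl⟩ := hx
    obtain ⟨w', x', rfl⟩ := hy
    exact ⟨w + w', x + x', by rw [map_add, map_add]; abel⟩
  | smul c x hx =>
    obtain ⟨w, x, rfl⟩ := hx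
    exact ⟨c • w, c • x, by rw [map_smul, map_smul, smul_add]⟩

omit [NeZero n] in
theorem IsNormal.exists_eps_add {t : T →ₗ[CalW p n R] D.P} {l : L →ₗ[CalW p n R] D.Q}
    (h : IsNormal t l) (y : D.Q) : ∃ w x, y = D.eps w + l x := by
  obtain ⟨⟨w, x⟩, rfl⟩ := h.bijective_decQ.2 y
  exact ⟨_, x, decQ_apply ..⟩

/-- Q_S is defined by generators and relations, so only surjectivity of I ⊗ T_S ⊕ L_S → Q_S is
immediate; its injectivity is again `IsNormal.of_surjective`, applied to the display D_S. -/
theorem IsNormal.baseChange (hp : IsNilpotent (p : S)) (hD : D.IsTruncatedDisplay)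
    {t : T →ₗ[CalW p n R] D.P} {l : L →ₗ[CalW p n R] D.Q} (h : IsNormal t l) :
    IsNormal (bcT φ t) (bcL φ l) :=
  IsNormal.of_surjective hp (hD.baseChange φ) (decP_bijective_baseChange φ h.bijective_decP)
    (exists_eps_add_baseChange φ h.exists_eps_add)

end

end Predisplay

end Normal

end
end TruncDisp

namespace TruncDisp


open TensorProduct CategoryTheory

noncomputable section

/-! ### Equalizers of truncated displays -/

/-! ### Linear extensions of semilinear maps -/

section LinExt

variable {A B C : Type*} [CommRing A] [CommRing B] [CommRing C] {M N : Type*} [AddCommGroup M]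
  [Module A M] [AddCommGroup N] [Module B N]

/-- The linear extension of a semilinear map. -/
def linExt {σ : A →+* B} (f : M →ₛₗ[σ] N) : BC σ M →ₗ[B] N :=
  BC.lift (RingHom.id _) (γ := σ) (fun _ => rfl) f

theorem linExt_of {σ : A →+* B} (f : M →ₛₗ[σ] N) (x : M) : linExt f (BC.of _ x) = f x :=
  BC.lift_id_of _ x

/-- The map `B ⊗ M → C ⊗ M` over `B → C`. -/
def bcTrans {σ : A →+* B} {τ : B →+* C} {γ : A →+* C} (h : ∀ a, γ a = τ (σ a)) (M : Type*)
    [AddCommGroup M] [Module A M] : BC σ M →ₛₗ[τ] BC γ M :=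
  BC.lift τ h (BC.of γ)

theorem bcTrans_of {σ : A →+* B} {τ : B →+* C} {γ : A →+* C} (h : ∀ a, γ a = τ (σ a)) (x : M) :
    bcTrans h M (BC.of _ x) = BC.of _ x :=
  BC.lift_of ..

theorem hom_linExt {σ : A →+* B} {τ : B →+* C} {γ : A →+* C} (h : ∀ a, γ a = τ (σ a)) {K : Type*}
    [AddCommGroup K] [Module C K] {f : M →ₛₗ[σ] N} {k : M →ₛₗ[γ] K} {u : N →ₛₗ[τ] K}
    (hu : ∀ x, u (f x) = k x) (z : BC σ M) : u (linExt f z) = linExt k (bcTrans h M z) := by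
  induction z using BC.induction with
  | zero => simp only [map_zero]
  | of x => rw [linExt_of, bcTrans_of, linExt_of, hu]
  | add x y hx hy => simp only [map_add, hx, hy]
  | smul b x hx => rw [map_smul, LinearMap.map_smulₛₗ, LinearMap.map_smulₛₗ, map_smul, hx]

end LinExt

namespace Predisplay

variable {p : ℕ} [Fact p.Prime] {n : ℕ} {R S S' : Type u} [CommRing R] [CommRing S] [CommRing S']

section

variable {D : Predisplay p n R} {T L T' L' : Type u} [AddCommGroup T] [Module (CalW p n R) T]
  [AddCommGroup L] [Module (CalW p n R) L] [AddCommGroup T'] [Module (CalW p n R) T']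
  [AddCommGroup L'] [Module (CalW p n R) L']

theorem IsNormal.comp_equiv {t : T →ₗ[CalW p n R] D.P} {l : L →ₗ[CalW p n R] D.Q}
    (h : IsNormal t l) (e : T' ≃ₗ[CalW p n R] T) (e' : L' ≃ₗ[CalW p n R] L)
    {t' : T' →ₗ[CalW p n R] D.P} {l' : L' →ₗ[CalW p n R] D.Q} (ht : ∀ x, t' x = t (e x))
    (hl : ∀ x, l' x = l (e' x)) : IsNormal t' l' := by
  have ht' : t' = t ∘ₗ e.toLinearMap := LinearMap.ext ht
  constructor
  · convert h.bijective_decP.comp (e.prodCongr e').bijective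
    ext ⟨x, y⟩
    change t' x + D.iota (l' y) = t (e x) + D.iota (l (e' y))
    rw [ht, hl]
  · convert h.bijective_decQ.comp ((e.lTensor (VIdeal p n R)).prodCongr e').bijective
    ext ⟨x, y⟩
    change D.eps (t'.lTensor _ x) + l' y =
      D.eps (t.lTensor _ (e.toLinearMap.lTensor _ x)) + l (e' y)
    rw [hl, ht', LinearMap.lTensor_comp, LinearMap.comp_apply]

end

variable {φ : R →+* S} {D : Predisplay p n S} {T L : Type u} [AddCommGroup T]
  [Module (CalW p n R) T] [AddCommGroup L] [Module (CalW p n R) L]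

/-- The map `I_{n+1}(R) ⊗ T ⊕ L → Q` over `R → S`. -/
def semiDecQ (t : T →ₛₗ[CalW.map p n φ] D.P) (l : L →ₛₗ[CalW.map p n φ] D.Q) :
    (VIdeal p n R ⊗[CalW p n R] T) × L →ₛₗ[CalW.map p n φ] D.Q :=
  (D.eps ∘ₛₗ TensorProduct.map (VIdeal.map p n φ) t) ∘ₛₗ LinearMap.fst (CalW p n R) _ _ +
    l ∘ₛₗ LinearMap.snd (CalW p n R) _ _

theorem semiDecQ_apply (t : T →ₛₗ[CalW.map p n φ] D.P) (l : L →ₛₗ[CalW.map p n φ] D.Q)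
    (w : VIdeal p n R ⊗[CalW p n R] T) (y : L) :
    semiDecQ t l (w, y) = D.eps (TensorProduct.map (VIdeal.map p n φ) t w) + l y := rfl

theorem semiDecQ_eq (t : T →ₛₗ[CalW.map p n φ] D.P) (l : L →ₛₗ[CalW.map p n φ] D.Q)
    (w : VIdeal p n R ⊗[CalW p n R] T) (y : L) :
    semiDecQ t l (w, y) = decQ (linExt t) (linExt l)
      (TensorProduct.map (VIdeal.map p n φ) (BC.of (CalW.map p n φ)) w, BC.of _ y) := by
  rw [semiDecQ_apply, decQ_apply, linExt_of]
  congr 2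
  induction w using TensorProduct.induction_on with
  | zero => simp only [map_zero]
  | add x y hx hy => simp only [map_add, hx, hy]
  | tmul a x => rw [map_tmul, map_tmul, LinearMap.lTensor_tmul, linExt_of]

theorem hom_decQ {χ : R →+* S'} {f : S →+* S'} (h : f.comp φ = χ) {E : Predisplay p n S'}
    (u : HomOver f D E) {t : T →ₛₗ[CalW.map p n φ] D.P} {l : L →ₛₗ[CalW.map p n φ] D.Q}
    {t' : T →ₛₗ[CalW.map p n χ] E.P} {l' : L →ₛₗ[CalW.map p n χ] E.Q}
    (ht : ∀ x, u.mapP (t x) = t' x) (hl : ∀ x, u.mapQ (l x) = l' x)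
    (w : VIdeal p n S ⊗[CalW p n S] BC (CalW.map p n φ) T) (y : BC (CalW.map p n φ) L) :
    u.mapQ (decQ (linExt t) (linExt l) (w, y)) = decQ (linExt t') (linExt l')
      (TensorProduct.map (VIdeal.map p n f) (bcTrans (calWMap_comp' h) T) w,
        bcTrans (calWMap_comp' h) L y) := by
  rw [decQ_apply, decQ_apply, map_add, hom_linExt (calWMap_comp' h) hl]
  congr 1
  induction w using TensorProduct.induction_on with
  | zero => simp only [map_zero]
  | add x y hx hy => simp only [map_add, hx, hy]
  | tmul a x =>
    rw [map_tmul, LinearMap.lTensor_tmul, LinearMap.lTensor_tmul, u.eps_comm,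
      hom_linExt (calWMap_comp' h) ht]

variable [NeZero n]

/-- A normal decomposition over `R` of a predisplay over `S` stays normal under base change. -/
theorem IsNormal.semi_baseChange {χ : R →+* S'} {f : S →+* S'} (h : f.comp φ = χ)
    (hp : IsNilpotent (p : S')) (hD : D.IsTruncatedDisplay) {t : T →ₛₗ[CalW.map p n φ] D.P}
    {l : L →ₛₗ[CalW.map p n φ] D.Q} (hn : IsNormal (linExt t) (linExt l))
    {t' : T →ₛₗ[CalW.map p n χ] (D.baseChange f).P} {l' : L →ₛₗ[CalW.map p n χ] (D.baseChange f).Q}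
    (ht : ∀ x, (D.toBaseChange f).mapP (t x) = t' x)
    (hl : ∀ x, (D.toBaseChange f).mapQ (l x) = l' x) : IsNormal (linExt t') (linExt l') := by
  let e (M : Type u) [AddCommGroup M] [Module (CalW p n R) M] :
      BC (CalW.map p n χ) M ≃ₗ[CalW p n S'] BC (CalW.map p n f) (BC (CalW.map p n φ) M) :=
    ((isBC_of (CalW.map p n φ) M).comp (isBC_of (CalW.map p n f) _) (k := semiComp
      (γ := CalW.map p n χ) (BC.of (CalW.map p n f)) (BC.of (CalW.map p n φ)) (calWMap_comp' h))
      (calWMap_comp' h) fun _ => rfl).equiv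
  have he : ∀ (M : Type u) [AddCommGroup M] [Module (CalW p n R) M] (x : M),
      e M (BC.of _ x) = BC.of _ (BC.of _ x) := fun M _ _ x => IsBC.equiv_of ..
  refine (hn.baseChange f hp hD).comp_equiv (e T) (e L) ?_ ?_
  · refine fun x => LinearMap.congr_fun (g := bcT f (linExt t) ∘ₗ (e T).toLinearMap)
      (BC.ext_of fun x => ?_) x
    rw [linExt_of, ← ht]
    change _ = bcT f (linExt t) (e T (BC.of _ x))
    rw [he, bcT_of, linExt_of]
  · refine fun x => LinearMap.congr_fun (g := bcL f (linExt l) ∘ₗ (e L).toLinearMap)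
      (BC.ext_of fun x => ?_) x
    rw [linExt_of, ← hl]
    change _ = bcL f (linExt l) (e L (BC.of _ x))
    rw [he, bcL_of, linExt_of]

end Predisplay

/-! ### Elements of Q over R as an equalizer over S -/

section Equalizer

variable {p : ℕ} [Fact p.Prime] {n : ℕ} {R S : Type u} [CommRing R] [CommRing S] [Algebra R S]
  [Module.FaithfullyFlat R S]

theorem VIdeal.map_injective : Function.Injective (VIdeal.map p n (algebraMap R S)) := by
  intro a b h
  refine (VIdeal.verInv p n R).injective
    (W.map_injective (φ := algebraMap R S) (FaithfulSMul.algebraMap_injective R S) ?_)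
  rw [← VIdeal.verInv_map, ← VIdeal.verInv_map, h]

theorem VIdeal.exists_of_map_eq {a : VIdeal p n S}
    (h : VIdeal.map p n (p₁ R S : S →+* S ⊗[R] S) a =
      VIdeal.map p n (p₂ R S : S →+* S ⊗[R] S) a) :
    ∃ b, VIdeal.map p n (algebraMap R S) b = a := by
  have h1 := congrArg (VIdeal.verInv p n (S ⊗[R] S)) h
  rw [VIdeal.verInv_map, VIdeal.verInv_map] at h1
  obtain ⟨y, hy⟩ := W.exists_of_map_eq (φ := algebraMap R S) (fun s hs => exists_algebraMap_eq hs) h1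
  refine ⟨(VIdeal.verInv p n R).symm y, (VIdeal.verInv p n S).injective ?_⟩
  rw [VIdeal.verInv_map, AddEquiv.apply_symm_apply, hy]

theorem CalW.exists_of_map_p_eq [NeZero n] {a : CalW p n S}
    (h : CalW.map p n (p₁ R S : S →+* S ⊗[R] S) a =
      CalW.map p n (p₂ R S : S →+* S ⊗[R] S) a) :
    ∃ b, CalW.map p n (algebraMap R S) b = a :=
  CalW.exists_of_map_eq (FaithfulSMul.algebraMap_injective R S)
    (fun _ hs => exists_algebraMap_eq hs)
    (fun r s h => exists_of_algebraMap_eq_mul (p : R) r s (by rw [h, map_natCast])) h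

variable [NeZero n]

theorem bc_equalizer {M : Type u} [AddCommGroup M] [Module (CalW p n R) M]
    [Module.Flat (CalW p n R) M] {N : Type u} [AddCommGroup N] [Module (CalW p n S) N]
    {K : Type u} [AddCommGroup K] [Module (CalW p n (S ⊗[R] S)) K]
    {f : M →ₛₗ[CalW.map p n (algebraMap R S)] N} (hf : IsBC f)
    {f₁ : N →ₛₗ[CalW.map p n (p₁ R S : S →+* S ⊗[R] S)] K}
    {f₂ : N →ₛₗ[CalW.map p n (p₂ R S : S →+* S ⊗[R] S)] K} (h₂ : IsBC f₂)
    (h : ∀ x, f₁ (f x) = f₂ (f x)) :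
    Function.Injective f ∧ ∀ z, f₁ z = f₂ z → ∃ x, f x = z :=
  module_equalizer (γ := CalW.map p n (algebraMap R (S ⊗[R] S)))
    (Predisplay.calWMap_comp' (algHom_comp_algebraMap (p₁ R S)))
    (Predisplay.calWMap_comp' (algHom_comp_algebraMap (p₂ R S)))
    (CalW.map_injective (FaithfulSMul.algebraMap_injective R S)) (fun _ => CalW.exists_of_map_p_eq)
    hf (hf.comp h₂ (k := semiComp f₂ f (Predisplay.calWMap_comp'
      (algHom_comp_algebraMap (p₂ R S)))) (Predisplay.calWMap_comp'
      (algHom_comp_algebraMap (p₂ R S))) fun _ => rfl)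
    (fun x => (h x).symm) fun _ => rfl

namespace Predisplay

variable {D : Predisplay p n S} {T L : Type u} [AddCommGroup T]
  [Module (CalW p n R) T] [AddCommGroup L] [Module (CalW p n R) L] [Module.Flat (CalW p n R) T]
  [Module.Flat (CalW p n R) L]

/-- The equalizer of two maps out of `Q`. -/
theorem IsNormal.equalizer (hp : IsNilpotent (p : R)) (hD : D.IsTruncatedDisplay)
    {t : T →ₛₗ[CalW.map p n (algebraMap R S)] D.P} {l : L →ₛₗ[CalW.map p n (algebraMap R S)] D.Q}
    (h : IsNormal (linExt t) (linExt l))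
    (u : HomOver (p₁ R S : S →+* S ⊗[R] S) D (D.baseChange (p₂ R S : S →+* S ⊗[R] S)))
    (ht : ∀ x, u.mapP (t x) = (D.toBaseChange _).mapP (t x))
    (hl : ∀ x, u.mapQ (l x) = (D.toBaseChange _).mapQ (l x)) :
    Function.Injective (semiDecQ t l) ∧
      ∀ y, u.mapQ y = (D.toBaseChange _).mapQ y → ∃ z, semiDecQ t l z = y := by
  have h₁ := algHom_comp_algebraMap (p₁ R S)
  have h₂ := algHom_comp_algebraMap (p₂ R S)
  have hp' : IsNilpotent (p : S ⊗[R] S) := by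
    simpa using hp.map (algebraMap R (S ⊗[R] S))
  let t' : T →ₛₗ[CalW.map p n (algebraMap R (S ⊗[R] S))] (D.baseChange (p₂ R S : S →+* S ⊗[R] S)).P :=
    semiComp (D.toBaseChange _).mapP t (calWMap_comp' h₂)
  let l' : L →ₛₗ[CalW.map p n (algebraMap R (S ⊗[R] S))] (D.baseChange (p₂ R S : S →+* S ⊗[R] S)).Q :=
    semiComp (D.toBaseChange _).mapQ l (calWMap_comp' h₂)
  -- The decomposition is again normal over S ⊗_R S, so equality of the two images can be tested on
  -- the summands I ⊗ T and L separately.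
  have hn : IsNormal (linExt t') (linExt l') :=
    h.semi_baseChange h₂ hp' hD (fun _ => rfl) fun _ => rfl
  -- I_{n+1} is not a base change of modules from R to S, but through V⁻¹ it is W_n, hence
  -- compatible with equalizers of rings; tensoring with the flat module T preserves this.
  obtain ⟨hT, hT'⟩ := tensor_equalizer (calWMap_comp' h₁) (calWMap_comp' h₂)
    (VIdeal.map_injective (p := p) (n := n) (R := R) (S := S))
    (fun a => by rw [← vIdealMap_comp' h₁, ← vIdealMap_comp' h₂])
    (fun a => VIdeal.exists_of_map_eq) (isBC_of (CalW.map p n (algebraMap R S)) T)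
    (isBC_of (CalW.map p n (algebraMap R (S ⊗[R] S))) T)
    (fun x => (bcTrans_of (calWMap_comp' h₁) x).symm)
    (fun x => (bcTrans_of (calWMap_comp' h₂) x).symm)
  obtain ⟨hL, hL'⟩ := module_equalizer (calWMap_comp' h₁) (calWMap_comp' h₂)
    (CalW.map_injective (FaithfulSMul.algebraMap_injective R S))
    (fun _ => CalW.exists_of_map_p_eq (p := p) (n := n) (R := R) (S := S))
    (isBC_of (CalW.map p n (algebraMap R S)) L)
    (isBC_of (CalW.map p n (algebraMap R (S ⊗[R] S))) L)
    (fun x => (bcTrans_of (calWMap_comp' h₁) x).symm)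
    (fun x => (bcTrans_of (calWMap_comp' h₂) x).symm)
  constructor
  · rintro ⟨w, y⟩ ⟨w', y'⟩ hwy
    rw [semiDecQ_eq, semiDecQ_eq] at hwy
    have := h.bijective_decQ.1 hwy
    exact Prod.ext (hT (congrArg Prod.fst this)) (hL (congrArg Prod.snd this))
  · intro y hy
    obtain ⟨⟨w, z⟩, rfl⟩ := h.bijective_decQ.2 y
    rw [hom_decQ h₁ u (t' := t') (l' := l') ht hl,
      hom_decQ h₂ _ (t' := t') (l' := l') (fun _ => rfl) (fun _ => rfl)] at hy
    have h3 := hn.bijective_decQ.1 hy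
    obtain ⟨w, rfl⟩ := hT' w (congrArg Prod.fst h3)
    obtain ⟨z, rfl⟩ := hL' z (congrArg Prod.snd h3)
    exact ⟨(w, z), semiDecQ_eq t l w z⟩

end Predisplay

end Equalizer

end
end TruncDisp

namespace TruncDisp


open TensorProduct CategoryTheory

noncomputable section

/-! ### Base change is fully faithful -/

section

variable {p : ℕ} [Fact p.Prime] {n : ℕ} {R S : Type u} [CommRing R] [CommRing S]

theorem IsBC.wMap {φ : R →+* S} {M N : Type*} [AddCommGroup M] [Module (CalW p n R) M]
    [AddCommGroup N] [Module (CalW p n S) N] {f : M →ₛₗ[CalW.map p n φ] N} (hf : IsBC f) :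
    IsBC (wMap φ f) :=
  (isBC_of (CalW.res p n R) M).of_comp
    (hf.comp (isBC_of (CalW.res p n S) N)
      (k := semiComp (γ := (CalW.res p n S).comp (CalW.map p n φ)) (BC.of (CalW.res p n S)) f
        fun _ => rfl) (fun _ => rfl) fun _ => rfl)
    (fun a => CalW.res_map p n φ a) fun x => (wMap_of φ f x).symm

namespace Predisplay

/-- Homomorphisms over `φ` factor through injective ones. -/
theorem HomOver.exists_factor {φ : R →+* S} {D E : Predisplay p n R} {G : Predisplay p n S}
    (o : HomOver φ E G) (hP : Function.Injective o.mapP) (hQ : Function.Injective o.mapQ)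
    (hW : Function.Injective (wMap φ o.mapP)) (h : HomOver φ D G)
    (hhP : ∀ x, ∃ y, o.mapP y = h.mapP x) (hhQ : ∀ x, ∃ y, o.mapQ y = h.mapQ x) :
    ∃ g : D ⟶ E, (∀ x, o.mapP (g.mapP x) = h.mapP x) ∧ ∀ y, o.mapQ (g.mapQ y) = h.mapQ y := by
  have hid : ∀ a, CalW.map p n (RingHom.id R) a = a := CalW.map_id p n
  obtain ⟨g, hg⟩ := exists_linear_factor hP h.mapP hhP
  obtain ⟨k, hk⟩ := exists_linear_factor hQ h.mapQ hhQ
  let g' : D.P →ₛₗ[CalW.map p n (RingHom.id R)] E.P :=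
    { toFun := g
      map_add' := map_add g
      map_smul' a x := by rw [hid]; exact map_smul g a x }
  let k' : D.Q →ₛₗ[CalW.map p n (RingHom.id R)] E.Q :=
    { toFun := k
      map_add' := map_add k
      map_smul' a x := by rw [hid]; exact map_smul k a x }
  have hg' : ∀ x, o.mapP (g' x) = h.mapP x := hg
  have hk' : ∀ x, o.mapQ (k' x) = h.mapQ x := hk
  have hw : ∀ z, wMap φ o.mapP (wMap (RingHom.id R) g' z) = wMap φ h.mapP z :=
    wMap_comp (RingHom.comp_id φ) _ _ _ fun x => (hg' x).symm
  refine ⟨{ mapP := g', mapQ := k', iota_comm := fun y => hP ?_, eps_comm := fun a x => hQ ?_,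
            F_comm := fun x => hW ?_, Fdot_comm := fun y => hW ?_ }, hg', hk'⟩
  · rw [← o.iota_comm, hk', hg', h.iota_comm]
  · rw [hk', o.eps_comm, hg', h.eps_comm, VIdeal.map_id]
  · rw [hw, ← o.F_comm, hg', h.F_comm]
  · rw [hw, ← o.Fdot_comm, hk', h.Fdot_comm]

end Predisplay

variable [Algebra R S] [Module.FaithfullyFlat R S]

theorem wMap_injective {M N : Type u} [AddCommGroup M] [Module (CalW p n R) M]
    [Module.Flat (CalW p n R) M] [AddCommGroup N] [Module (CalW p n S) N]
    {f : M →ₛₗ[CalW.map p n (algebraMap R S)] N} (hf : IsBC f) :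
    Function.Injective (wMap (algebraMap R S) f) := by
  have : Module.Flat (W p n R) (BC (CalW.res p n R) M) := by
    let := (CalW.res p n R).toAlgebra
    exact Module.Flat.baseChange (R := CalW p n R) (S := W p n R) (M := M)
  exact hf.wMap.injective_of_flat
    (W.map_injective (φ := algebraMap R S) (FaithfulSMul.algebraMap_injective R S))

theorem wMap_equalizer {M : Type u} [AddCommGroup M] [Module (CalW p n R) M]
    [Module.Flat (CalW p n R) M] {N : Type u} [AddCommGroup N] [Module (CalW p n S) N]
    {K : Type u} [AddCommGroup K] [Module (CalW p n (S ⊗[R] S)) K]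
    {f : M →ₛₗ[CalW.map p n (algebraMap R S)] N} (hf : IsBC f)
    {f₁ : N →ₛₗ[CalW.map p n (p₁ R S : S →+* S ⊗[R] S)] K}
    {f₂ : N →ₛₗ[CalW.map p n (p₂ R S : S →+* S ⊗[R] S)] K} (h₂ : IsBC f₂)
    (h : ∀ x, f₁ (f x) = f₂ (f x)) {z : BC (CalW.res p n S) N}
    (hz : wMap (p₁ R S : S →+* S ⊗[R] S) f₁ z = wMap (p₂ R S : S →+* S ⊗[R] S) f₂ z) :
    ∃ x, wMap (algebraMap R S) f x = z := by
  have : Module.Flat (W p n R) (BC (CalW.res p n R) M) := by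
    let := (CalW.res p n R).toAlgebra
    exact Module.Flat.baseChange (R := CalW p n R) (S := W p n R) (M := M)
  have h₁' := algHom_comp_algebraMap (p₁ R S)
  have h₂' := algHom_comp_algebraMap (p₂ R S)
  let k : M →ₛₗ[CalW.map p n (algebraMap R (S ⊗[R] S))] K :=
    semiComp f₂ f (Predisplay.calWMap_comp' h₂')
  have hk : IsBC k := hf.comp h₂ (Predisplay.calWMap_comp' h₂') fun _ => rfl
  refine (module_equalizer (γ := W.map p n (algebraMap R (S ⊗[R] S)))
    (σ := W.map p n (algebraMap R S)) (α := W.map p n (p₁ R S : S →+* S ⊗[R] S))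
    (β := W.map p n (p₂ R S : S →+* S ⊗[R] S))
    (fun a => by rw [← h₁', W.map_comp]) (fun a => by rw [← h₂', W.map_comp])
    (W.map_injective (φ := algebraMap R S) (FaithfulSMul.algebraMap_injective R S)) (fun _ => W.exists_of_map_eq fun s hs => exists_algebraMap_eq hs)
    hf.wMap hk.wMap (fun x => ?_) (fun x => ?_)).2 z hz
  · exact (wMap_comp h₁' _ _ _ (fun x => (h x).symm) x).symm
  · exact (wMap_comp h₂' _ _ _ (fun x => rfl) x).symm

variable [NeZero n]

namespace Predisplay

variable {D E : Predisplay p n R}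

/-- The first projection of the canonical descent datum. -/
def canonicalFst (E : Predisplay p n R) : HomOver (p₁ R S : S →+* S ⊗[R] S)
    (E.baseChange (algebraMap R S))
    ((E.baseChange (algebraMap R S)).baseChange (p₂ R S : S →+* S ⊗[R] S)) :=
  HomOver.comp (RingHom.id_comp _) ((E.baseChange (algebraMap R S)).toBaseChange _)
    (canonicalHom (algHom_comp_algebraMap (p₁ R S)) (algHom_comp_algebraMap (p₂ R S)) E)

omit [Module.FaithfullyFlat R S] [NeZero n] in
theorem canonicalFst_mapP (x : E.P) :
    (canonicalFst (S := S) E).mapP ((E.toBaseChange (algebraMap R S)).mapP x) =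
      ((E.baseChange (algebraMap R S)).toBaseChange _).mapP ((E.toBaseChange _).mapP x) :=
  canonicalHom_mapP (algHom_comp_algebraMap (p₁ R S)) (algHom_comp_algebraMap (p₂ R S)) E x

omit [Module.FaithfullyFlat R S] [NeZero n] in
theorem canonicalFst_mapQ (x : E.Q) :
    (canonicalFst (S := S) E).mapQ ((E.toBaseChange (algebraMap R S)).mapQ x) =
      ((E.baseChange (algebraMap R S)).toBaseChange _).mapQ ((E.toBaseChange _).mapQ x) :=
  canonicalHom_mapQ (algHom_comp_algebraMap (p₁ R S)) (algHom_comp_algebraMap (p₂ R S)) E x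

theorem IsTruncatedDisplay.equalizerP (hE : E.IsTruncatedDisplay) :
    Function.Injective (E.toBaseChange (algebraMap R S)).mapP ∧
      ∀ x, (canonicalFst E).mapP x = ((E.baseChange (algebraMap R S)).toBaseChange _).mapP x →
        ∃ y, (E.toBaseChange (algebraMap R S)).mapP y = x := by
  have := hE.projective
  exact bc_equalizer (f := (E.toBaseChange (algebraMap R S)).mapP)
    (f₁ := (canonicalFst E).mapP)
    (f₂ := ((E.baseChange (algebraMap R S)).toBaseChange (p₂ R S : S →+* S ⊗[R] S)).mapP)
    (isBC_of (CalW.map p n (algebraMap R S)) E.P)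
    (isBC_of (CalW.map p n (p₂ R S : S →+* S ⊗[R] S)) (E.baseChange (algebraMap R S)).P)
    canonicalFst_mapP

omit [NeZero n] in
theorem semiDecQ_hom {S : Type u} [CommRing S] {φ : R →+* S} {G : Predisplay p n S}
    (o : HomOver φ E G) {T L : Type u}
    [AddCommGroup T] [Module (CalW p n R) T] [AddCommGroup L] [Module (CalW p n R) L]
    (t : T →ₗ[CalW p n R] E.P) (l : L →ₗ[CalW p n R] E.Q)
    (z : (VIdeal p n R ⊗[CalW p n R] T) × L) :
    semiDecQ (o.mapP ∘ₛₗ t) (o.mapQ ∘ₛₗ l) z = o.mapQ (decQ t l z) := by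
  obtain ⟨w, y⟩ := z
  rw [semiDecQ_apply, decQ_apply, map_add, LinearMap.comp_apply]
  congr 1
  induction w using TensorProduct.induction_on with
  | zero => simp only [map_zero]
  | add x y hx hy => simp only [map_add, hx, hy]
  | tmul a x => rw [map_tmul, LinearMap.lTensor_tmul, o.eps_comm, LinearMap.comp_apply]

/-- Since Q need not be flat, the argument for P does not carry over; it is applied to the summands
of a normal decomposition over R. -/
theorem IsTruncatedDisplay.equalizerQ (hp : IsNilpotent (p : R)) (hE : E.IsTruncatedDisplay) :
    Function.Injective (E.toBaseChange (algebraMap R S)).mapQ ∧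
      ∀ x, (canonicalFst E).mapQ x = ((E.baseChange (algebraMap R S)).toBaseChange _).mapQ x →
        ∃ y, (E.toBaseChange (algebraMap R S)).mapQ y = x := by
  obtain ⟨T, _, _, _, _, L, _, _, _, _, t, l, h⟩ := hE.exists_isNormal hp
  have hp' : IsNilpotent (p : S) := by simpa using hp.map (algebraMap R S)
  obtain ⟨h1, h2⟩ := IsNormal.equalizer hp (hE.baseChange (algebraMap R S))
    (t := (E.toBaseChange (algebraMap R S)).mapP ∘ₛₗ t)
    (l := (E.toBaseChange (algebraMap R S)).mapQ ∘ₛₗ l)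
    (h.baseChange (algebraMap R S) hp' hE) (canonicalFst E) (fun x => canonicalFst_mapP _)
    (fun x => canonicalFst_mapQ _)
  constructor
  · intro x y hxy
    obtain ⟨x, rfl⟩ := h.bijective_decQ.2 x
    obtain ⟨y, rfl⟩ := h.bijective_decQ.2 y
    rw [← semiDecQ_hom, ← semiDecQ_hom] at hxy
    rw [h1 hxy]
  · intro x hx
    obtain ⟨z, rfl⟩ := h2 x hx
    exact ⟨_, (semiDecQ_hom _ t l z).symm⟩

theorem IsTruncatedDisplay.baseChangeMap_injective (hp : IsNilpotent (p : R))
    (hE : E.IsTruncatedDisplay) {f g : D ⟶ E}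
    (h : baseChangeMap (algebraMap R S) f = baseChangeMap (algebraMap R S) g) : f = g := by
  refine hom_ext (fun x => hE.equalizerP.1 (a₁ := f.mapP x) (a₂ := g.mapP x) (Eq.trans (baseChangeMap_mapP (algebraMap R S) f x).symm ?_))
    (fun y => (hE.equalizerQ hp).1 (a₁ := f.mapQ y) (a₂ := g.mapQ y) (Eq.trans (baseChangeMap_mapQ (algebraMap R S) f y).symm ?_))
  · rw [h, baseChangeMap_mapP]
  · rw [h, baseChangeMap_mapQ]

/-- Evaluated on elements coming from D, compatibility with the descent data says that f maps them
into the equalizers over S, which are P and Q of E. -/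
theorem IsTruncatedDisplay.exists_baseChangeMap_eq (hp : IsNilpotent (p : R))
    (hE : E.IsTruncatedDisplay)
    (f : D.baseChange (algebraMap R S) ⟶ E.baseChange (algebraMap R S))
    (h : baseChangeMap (p₁ R S : S →+* S ⊗[R] S) f ≫ canonicalHom
      (algHom_comp_algebraMap (p₁ R S)) (algHom_comp_algebraMap (p₂ R S)) E =
      canonicalHom (algHom_comp_algebraMap (p₁ R S)) (algHom_comp_algebraMap (p₂ R S)) D ≫
        baseChangeMap (p₂ R S : S →+* S ⊗[R] S) f) :
    ∃ g : D ⟶ E, baseChangeMap (algebraMap R S) g = f := by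
  have := hE.projective
  have hP : ∀ x, ∃ y, (E.toBaseChange (algebraMap R S)).mapP y =
      (HomOver.comp (RingHom.id_comp _) (D.toBaseChange (algebraMap R S)) f).mapP x := fun x => by
    refine hE.equalizerP.2 _ ?_
    have h1 := LinearMap.congr_fun (congrArg HomOver.mapP h)
      (((D.baseChange (algebraMap R S)).toBaseChange _).mapP ((D.toBaseChange _).mapP x))
    rw [comp_mapP, comp_mapP, baseChangeMap_mapP, canonicalHom_mapP, baseChangeMap_mapP] at h1
    exact h1
  have hQ : ∀ y, ∃ z, (E.toBaseChange (algebraMap R S)).mapQ z =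
      (HomOver.comp (RingHom.id_comp _) (D.toBaseChange (algebraMap R S)) f).mapQ y := fun y => by
    refine (hE.equalizerQ hp).2 _ ?_
    have h1 := LinearMap.congr_fun (congrArg HomOver.mapQ h)
      (((D.baseChange (algebraMap R S)).toBaseChange _).mapQ ((D.toBaseChange _).mapQ y))
    rw [comp_mapQ, comp_mapQ, baseChangeMap_mapQ, canonicalHom_mapQ, baseChangeMap_mapQ] at h1
    exact h1
  obtain ⟨g, hgP, hgQ⟩ := (E.toBaseChange (algebraMap R S)).exists_factor hE.equalizerP.1
    (hE.equalizerQ hp).1 (wMap_injective (isBC_of (CalW.map p n (algebraMap R S)) E.P))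
    (HomOver.comp (RingHom.id_comp _) (D.toBaseChange (algebraMap R S)) f) hP hQ
  refine ⟨g, baseChange_ext (fun x => ?_) fun y => ?_⟩
  · rw [baseChangeMap_mapP, hgP, HomOver.comp_mapP]
  · rw [baseChangeMap_mapQ, hgQ, HomOver.comp_mapQ]

end Predisplay

end

end
end TruncDisp

namespace TruncDisp


open TensorProduct CategoryTheory

noncomputable section

/-! ### Transport along a descent datum of predisplays -/

section Transport

variable {p : ℕ} [Fact p.Prime] {n : ℕ}

namespace Predisplay

section

variable {R S T U : Type u} [CommRing R] [CommRing S] [CommRing T] [CommRing U]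

theorem baseChangeTrans_comp {D : Predisplay p n R} {φ : R →+* S} {χ : R →+* T} {ψ : R →+* U}
    {q : S →+* T} {r : T →+* U} {s : S →+* U} (hq : q.comp φ = χ) (hr : r.comp χ = ψ)
    (hs : s.comp φ = ψ) (h : r.comp q = s) :
    HomOver.comp h (baseChangeTrans hq D) (baseChangeTrans hr D) = baseChangeTrans hs D := by
  refine baseChange_ext (fun x => ?_) (fun y => ?_)
  · rw [HomOver.comp_mapP, baseChangeTrans_mapP, baseChangeTrans_mapP, baseChangeTrans_mapP]
  · rw [HomOver.comp_mapQ, baseChangeTrans_mapQ, baseChangeTrans_mapQ, baseChangeTrans_mapQ]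

theorem baseChangeTrans_id {D : Predisplay p n R} {φ : R →+* S}
    (h : (RingHom.id S).comp φ = φ) : baseChangeTrans h D = HomOver.id (D.baseChange φ) := by
  refine baseChange_ext (fun x => ?_) (fun y => ?_)
  · rw [baseChangeTrans_mapP]; rfl
  · rw [baseChangeTrans_mapQ]; rfl

/-- A left inverse of the ring homomorphism induces a left inverse of the canonical map; no flatness
of Q is involved. -/
theorem baseChangeTrans_mapQ_injective {D : Predisplay p n R} {φ : R →+* S} {χ : R →+* T}
    {q : S →+* T} (hq : q.comp φ = χ) {r : T →+* S} (h : r.comp q = RingHom.id S) :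
    Function.Injective (baseChangeTrans hq D).mapQ := by
  have hr : r.comp χ = φ := by rw [← hq, ← RingHom.comp_assoc, h, RingHom.id_comp]
  have h1 := (baseChangeTrans_comp (D := D) hq hr (RingHom.id_comp φ) h).trans (baseChangeTrans_id _)
  refine Function.LeftInverse.injective (g := (baseChangeTrans hr D).mapQ) fun y => ?_
  exact LinearMap.congr_fun (congrArg HomOver.mapQ h1) y

theorem toBaseChange_mapQ_surjective (D : Predisplay p n R) {φ : R →+* S} {r : S →+* R}
    (h : φ.comp r = RingHom.id S) : Function.Surjective (D.toBaseChange φ).mapQ := by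
  have hP : ∀ x, ∃ y, (D.toBaseChange φ).mapP y = x := by
    refine BC.of_surjective fun a => ⟨CalW.map p n r a, ?_⟩
    rw [← CalW.map_comp, h, CalW.map_id]
  intro y
  induction y using baseChange_Q_induction with
  | of y => exact ⟨y, rfl⟩
  | eps b x =>
    obtain ⟨x, rfl⟩ := hP x
    refine ⟨D.eps (VIdeal.map p n r b ⊗ₜ x), ?_⟩
    rw [(D.toBaseChange φ).eps_comm, ← VIdeal.map_comp, h, VIdeal.map_id]
  | add x y hx hy =>
    obtain ⟨x, rfl⟩ := hx
    obtain ⟨y, rfl⟩ := hy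
    exact ⟨x + y, map_add ..⟩
  | smul c x hx =>
    obtain ⟨x, rfl⟩ := hx
    exact ⟨CalW.map p n r c • x, by rw [LinearMap.map_smulₛₗ, ← CalW.map_comp, h, CalW.map_id]⟩

theorem pull_baseChangeTrans {φ₁ φ₂ : S →+* T} {D : Predisplay p n S}
    (α : D.baseChange φ₁ ⟶ D.baseChange φ₂) (q : T →+* U) {χ₁ χ₂ : S →+* U}
    (h₁ : q.comp φ₁ = χ₁) (h₂ : q.comp φ₂ = χ₂) :
    HomOver.comp (RingHom.id_comp q) (baseChangeTrans h₁ D) (pull α q h₁ h₂) =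
      HomOver.comp (RingHom.comp_id q) α (baseChangeTrans h₂ D) := by
  refine baseChange_ext (fun x => ?_) (fun y => ?_)
  · rw [HomOver.comp_mapP, HomOver.comp_mapP, baseChangeTrans_mapP, pull_mapP]
  · rw [HomOver.comp_mapQ, HomOver.comp_mapQ, baseChangeTrans_mapQ, pull_mapQ]

theorem pull_comp {φ₁ φ₂ φ₃ : S →+* T} {D : Predisplay p n S}
    (α : D.baseChange φ₁ ⟶ D.baseChange φ₂) (β : D.baseChange φ₂ ⟶ D.baseChange φ₃)
    (q : T →+* U) {χ₁ χ₂ χ₃ : S →+* U} (h₁ : q.comp φ₁ = χ₁) (h₂ : q.comp φ₂ = χ₂)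
    (h₃ : q.comp φ₃ = χ₃) : pull α q h₁ h₂ ≫ pull β q h₂ h₃ = pull (α ≫ β) q h₁ h₃ := by
  have h := pull_baseChangeTrans β q h₂ h₃
  refine baseChange_ext (fun x => ?_) (fun y => ?_)
  · rw [comp_mapP, pull_mapP, pull_mapP, comp_mapP]
    exact LinearMap.congr_fun (congrArg HomOver.mapP h) _
  · rw [comp_mapQ, pull_mapQ, pull_mapQ, comp_mapQ]
    exact LinearMap.congr_fun (congrArg HomOver.mapQ h) _

theorem pull_id {φ₁ : S →+* T} {D : Predisplay p n S} (q : T →+* U) {χ₁ : S →+* U}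
    (h₁ : q.comp φ₁ = χ₁) : pull (𝟙 (D.baseChange φ₁)) q h₁ h₁ = 𝟙 (D.baseChange χ₁) := by
  refine baseChange_ext (fun x => ?_) (fun y => ?_)
  · rw [pull_mapP, id_mapP, id_mapP, baseChangeTrans_mapP]
  · rw [pull_mapQ, id_mapQ, id_mapQ, baseChangeTrans_mapQ]

instance {φ₁ φ₂ : S →+* T} {D : Predisplay p n S} (α : D.baseChange φ₁ ⟶ D.baseChange φ₂) [IsIso α]
    (q : T →+* U) {χ₁ χ₂ : S →+* U} (h₁ : q.comp φ₁ = χ₁) (h₂ : q.comp φ₂ = χ₂) :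
    IsIso (pull α q h₁ h₂) :=
  ⟨pull (inv α) q h₂ h₁, by rw [pull_comp, IsIso.hom_inv_id, pull_id],
    by rw [pull_comp, IsIso.inv_hom_id, pull_id]⟩

end

end Predisplay

variable {R S : Type u} [CommRing R] [CommRing S] [Algebra R S]
  {T T' T'' : Type u} [CommRing T] [CommRing T'] [CommRing T''] [Algebra R T] [Algebra R T']
  [Algebra R T'']

theorem algHom_comp_eq {φ : T →ₐ[R] T'} {ℓ : S →ₐ[R] T} {ℓ' : S →ₐ[R] T'} (h : φ.comp ℓ = ℓ') :
    (φ : T →+* T').comp (ℓ : S →+* T) = (ℓ' : S →+* T') :=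
  congrArg (fun ψ : S →ₐ[R] T' => (ψ : S →+* T')) h

open Predisplay

namespace DescentDatum

variable (D : DescentDatum p n R S)

/-- The base change of the descent datum along `s ⊗ s' ↦ f(s) g(s')`. -/
abbrev along (f g : S →ₐ[R] T) :
    D.obj.baseChange (f : S →+* T) ⟶ D.obj.baseChange (g : S →+* T) :=
  pullPair D.iso.hom f g

theorem along_baseChangeTrans {f g : S →ₐ[R] T} {f' g' : S →ₐ[R] T'} (q : T →ₐ[R] T')
    (hf : q.comp f = f') (hg : q.comp g = g') :
    HomOver.comp (RingHom.id_comp _) (baseChangeTrans (algHom_comp_eq hf) D.obj) (D.along f' g') =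
      HomOver.comp (RingHom.comp_id _) (D.along f g) (baseChangeTrans (algHom_comp_eq hg) D.obj) := by
  have hq : (q : T →+* T').comp (pairMap f g : S ⊗[R] S →+* T) =
      (pairMap f' g' : S ⊗[R] S →+* T') := by
    subst hf hg
    refine algHom_comp_eq (Algebra.TensorProduct.ext' fun a b => ?_)
    simp [pairMap]
  have h := baseChangeTrans_comp (D := D.obj) (pairMap_comp_p₂ f g) (algHom_comp_eq hg)
    (pairMap_comp_p₂ f' g') hq
  refine baseChange_ext (fun x => ?_) (fun y => ?_)
  · rw [HomOver.comp_mapP, HomOver.comp_mapP, baseChangeTrans_mapP, along, pullPair, pull_mapP,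
      along, pullPair, pull_mapP, ← h]
    rfl
  · rw [HomOver.comp_mapQ, HomOver.comp_mapQ, baseChangeTrans_mapQ, along, pullPair, pull_mapQ,
      along, pullPair, pull_mapQ, ← h]
    rfl

theorem along_baseChangeTrans_mapP {f g : S →ₐ[R] T} {f' g' : S →ₐ[R] T'} (q : T →ₐ[R] T')
    (hf : q.comp f = f') (hg : q.comp g = g') (x) :
    (D.along f' g').mapP ((baseChangeTrans (algHom_comp_eq hf) D.obj).mapP x) =
      (baseChangeTrans (algHom_comp_eq hg) D.obj).mapP ((D.along f g).mapP x) :=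
  LinearMap.congr_fun (congrArg HomOver.mapP (D.along_baseChangeTrans q hf hg)) x

theorem along_baseChangeTrans_mapQ {f g : S →ₐ[R] T} {f' g' : S →ₐ[R] T'} (q : T →ₐ[R] T')
    (hf : q.comp f = f') (hg : q.comp g = g') (x) :
    (D.along f' g').mapQ ((baseChangeTrans (algHom_comp_eq hf) D.obj).mapQ x) =
      (baseChangeTrans (algHom_comp_eq hg) D.obj).mapQ ((D.along f g).mapQ x) :=
  LinearMap.congr_fun (congrArg HomOver.mapQ (D.along_baseChangeTrans q hf hg)) x

/-- As for modules: a triple of homomorphisms S → T is the image of the universal one, over which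
this is the cocycle condition. -/
theorem along_along (f g h : S →ₐ[R] T) : D.along f g ≫ D.along g h = D.along f h := by
  let t : S ⊗[R] (S ⊗[R] S) →ₐ[R] T := Algebra.TensorProduct.productMap f (pairMap g h)
  have h₁ : t.comp (q₁ R S) = f := AlgHom.ext fun s =>
    Algebra.TensorProduct.productMap_left_apply f (pairMap g h) s
  have h₂ : t.comp (q₂ R S) = g := AlgHom.ext fun s =>
    (Algebra.TensorProduct.productMap_right_apply f (pairMap g h) _).trans
      (Algebra.TensorProduct.productMap_left_apply g h s)
  have h₃ : t.comp (q₃ R S) = h := AlgHom.ext fun s =>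
    (Algebra.TensorProduct.productMap_right_apply f (pairMap g h) _).trans
      (Algebra.TensorProduct.productMap_right_apply g h s)
  refine baseChange_ext (fun x => ?_) (fun y => ?_)
  · rw [comp_mapP, ← baseChangeTrans_mapP (algHom_comp_eq h₁),
      D.along_baseChangeTrans_mapP t h₁ h₂, D.along_baseChangeTrans_mapP t h₂ h₃,
      D.along_baseChangeTrans_mapP t h₁ h₃, along, along, along, D.cocycle, comp_mapP]
  · rw [comp_mapQ, ← baseChangeTrans_mapQ (algHom_comp_eq h₁),
      D.along_baseChangeTrans_mapQ t h₁ h₂, D.along_baseChangeTrans_mapQ t h₂ h₃,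
      D.along_baseChangeTrans_mapQ t h₁ h₃, along, along, along, D.cocycle, comp_mapQ]

/-- It is an isomorphism that equals its own square. -/
theorem along_self (f : S →ₐ[R] T) : D.along f f = 𝟙 _ := by
  have : IsIso (D.along f f) :=
    inferInstanceAs (IsIso (pull D.iso.hom _ (pairMap_comp_p₁ f f) (pairMap_comp_p₂ f f)))
  rw [← cancel_epi (D.along f f), along_along, Category.comp_id]

/-- The homomorphism `ℓ_* D → ℓ'_* D` over `T → T'` given by the descent datum. -/
def transport (φ : T →ₐ[R] T') (ℓ : S →ₐ[R] T) (ℓ' : S →ₐ[R] T') :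
    HomOver (φ : T →+* T') (D.obj.baseChange (ℓ : S →+* T)) (D.obj.baseChange (ℓ' : S →+* T')) :=
  HomOver.comp (RingHom.id_comp _)
    (baseChangeTrans (algHom_comp_eq (rfl : φ.comp ℓ = φ.comp ℓ)) D.obj) (D.along (φ.comp ℓ) ℓ')

theorem transport_mapP_of (φ : T →ₐ[R] T') {ℓ : S →ₐ[R] T} {ℓ' m : S →ₐ[R] T'}
    (h : φ.comp ℓ = m) (x : D.obj.P) :
    (D.transport φ ℓ ℓ').mapP ((D.obj.toBaseChange (ℓ : S →+* T)).mapP x) =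
      (baseChangeTrans (pairMap_comp_p₂ m ℓ') D.obj).mapP
        (D.iso.hom.mapP ((D.obj.toBaseChange _).mapP x)) := by
  subst h
  rw [transport, HomOver.comp_mapP, baseChangeTrans_mapP, along, pullPair, pull_mapP]

theorem transport_mapQ_of (φ : T →ₐ[R] T') {ℓ : S →ₐ[R] T} {ℓ' m : S →ₐ[R] T'}
    (h : φ.comp ℓ = m) (x : D.obj.Q) :
    (D.transport φ ℓ ℓ').mapQ ((D.obj.toBaseChange (ℓ : S →+* T)).mapQ x) =
      (baseChangeTrans (pairMap_comp_p₂ m ℓ') D.obj).mapQ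
        (D.iso.hom.mapQ ((D.obj.toBaseChange _).mapQ x)) := by
  subst h
  rw [transport, HomOver.comp_mapQ, baseChangeTrans_mapQ, along, pullPair, pull_mapQ]

theorem transport_mapQ_of_comp (φ : T →ₐ[R] T') {ℓ : S →ₐ[R] T} {ℓ' : S →ₐ[R] T'}
    (h : φ.comp ℓ = ℓ') (x : D.obj.Q) :
    (D.transport φ ℓ ℓ').mapQ ((D.obj.toBaseChange (ℓ : S →+* T)).mapQ x) =
      (D.obj.toBaseChange (ℓ' : S →+* T')).mapQ x := by
  subst h
  rw [transport, HomOver.comp_mapQ, baseChangeTrans_mapQ, along_self, id_mapQ]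

theorem transport_transport {φ : T →ₐ[R] T'} {φ' : T' →ₐ[R] T''} {φ'' : T →ₐ[R] T''}
    (h : φ'.comp φ = φ'') {ℓ : S →ₐ[R] T} {ℓ' : S →ₐ[R] T'} {ℓ'' : S →ₐ[R] T''} (x) :
    (D.transport φ' ℓ' ℓ'').mapQ ((D.transport φ ℓ ℓ').mapQ x) =
      (D.transport φ'' ℓ ℓ'').mapQ x := by
  subst h
  rw [transport, transport, transport, HomOver.comp_mapQ, HomOver.comp_mapQ, HomOver.comp_mapQ,
    ← D.along_baseChangeTrans_mapQ φ' (f := φ.comp ℓ) rfl rfl, ← comp_mapQ, along_along]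
  exact congrArg (D.along ((φ'.comp φ).comp ℓ) ℓ'').mapQ
    (LinearMap.congr_fun (congrArg HomOver.mapQ (baseChangeTrans_comp (D := D.obj)
      (algHom_comp_eq (rfl : φ.comp ℓ = φ.comp ℓ))
      (algHom_comp_eq (rfl : φ'.comp (φ.comp ℓ) = (φ'.comp φ).comp ℓ))
      (algHom_comp_eq (rfl : (φ'.comp φ).comp ℓ = (φ'.comp φ).comp ℓ)) rfl)) x)

/-- The isomorphism `𝒲_n ⊗_{p₁} P ≅ 𝒲_n ⊗_{p₂} P`. -/
def nabla : BC (CalW.map p n (p₁ R S : S →+* S ⊗[R] S)) D.obj.P ≃ₗ[CalW p n (S ⊗[R] S)]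
    BC (CalW.map p n (p₂ R S : S →+* S ⊗[R] S)) D.obj.P where
  toFun := D.iso.hom.mapP
  invFun := D.iso.inv.mapP
  left_inv x := LinearMap.congr_fun (congrArg HomOver.mapP D.iso.hom_inv_id) x
  right_inv x := LinearMap.congr_fun (congrArg HomOver.mapP D.iso.inv_hom_id) x
  map_add' := map_add D.iso.hom.mapP
  map_smul' a x := by
    refine (LinearMap.map_smulₛₗ D.iso.hom.mapP a x).trans ?_
    rw [CalW.map_id, RingHom.id_apply]
    rfl

theorem nablaAlong_nabla (f g : S →ₐ[R] T) (z : (D.obj.baseChange (f : S →+* T)).P) :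
    nablaAlong D.nabla.toLinearMap f g z = (D.along f g).mapP z := by
  induction z using baseChange_P_induction with
  | of x =>
    refine (nablaAlong_of D.nabla.toLinearMap f g x).trans ?_
    exact (pull_mapP D.iso.hom _ (pairMap_comp_p₁ f g) (pairMap_comp_p₂ f g) x).symm
  | add x y hx hy =>
    refine (map_add (nablaAlong D.nabla.toLinearMap f g) x y).trans ?_
    exact (congrArg₂ (· + ·) hx hy).trans (map_add (D.along f g).mapP x y).symm
  | smul b x hx =>
    refine (map_smul (nablaAlong D.nabla.toLinearMap f g) b x).trans ?_
    refine (congrArg (fun z => b • z) hx).trans ?_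
    refine Eq.trans ?_ (LinearMap.map_smulₛₗ (D.along f g).mapP b x).symm
    rw [CalW.map_id]
    rfl

theorem along_along_mapP (f g h : S →ₐ[R] T) (z : (D.obj.baseChange (f : S →+* T)).P) :
    (D.along g h).mapP ((D.along f g).mapP z) = (D.along f h).mapP z := by
  rw [← comp_mapP, along_along]

theorem nablaAlong_cocycle (z : (D.obj.baseChange (q₁ R S : S →+* S ⊗[R] (S ⊗[R] S))).P) :
    nablaAlong D.nabla.toLinearMap (q₁ R S) (q₃ R S) z =
      nablaAlong D.nabla.toLinearMap (q₂ R S) (q₃ R S)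
        (nablaAlong D.nabla.toLinearMap (q₁ R S) (q₂ R S) z) := by
  have h1 := D.nablaAlong_nabla (q₁ R S) (q₃ R S) z
  have h2 := D.nablaAlong_nabla (q₁ R S) (q₂ R S) z
  have h3 := D.nablaAlong_nabla (q₂ R S) (q₃ R S) ((D.along (q₁ R S) (q₂ R S)).mapP z)
  have h4 := D.along_along_mapP (q₁ R S) (q₂ R S) (q₃ R S) z
  exact ((h1.trans h4.symm).trans h3.symm).trans
    (congrArg (nablaAlong D.nabla.toLinearMap (q₂ R S) (q₃ R S)) h2.symm)

/-- The descent datum on the module `P`. -/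
def toModule : ModuleDescentDatum p n R S D.obj.P where
  nabla := D.nabla
  cocycle := LinearMap.ext fun z => D.nablaAlong_cocycle z

/-- The map `D → p₂_* D` over `p₁` given by the descent datum. -/
def fst : HomOver (p₁ R S : S →+* S ⊗[R] S) D.obj (D.obj.baseChange (p₂ R S : S →+* S ⊗[R] S)) :=
  HomOver.comp (RingHom.id_comp _) (D.obj.toBaseChange _) D.iso.hom

/-- The map `D → p₂_* D` over `p₂`. -/
abbrev snd : HomOver (p₂ R S : S →+* S ⊗[R] S) D.obj
    (D.obj.baseChange (p₂ R S : S →+* S ⊗[R] S)) :=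
  D.obj.toBaseChange _

theorem transport_mapP_of_invariant (φ : T →ₐ[R] T') (ℓ : S →ₐ[R] T) (ℓ' : S →ₐ[R] T')
    {x : D.obj.P} (hx : D.fst.mapP x = D.snd.mapP x) :
    (D.transport φ ℓ ℓ').mapP ((D.obj.toBaseChange (ℓ : S →+* T)).mapP x) =
      (D.obj.toBaseChange (ℓ' : S →+* T')).mapP x := by
  rw [D.transport_mapP_of φ rfl]
  refine (congrArg _ hx).trans ?_
  rw [baseChangeTrans_mapP]

end DescentDatum

end Transport

end
end TruncDisp

namespace TruncDisp


open TensorProduct CategoryTheory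

noncomputable section

/-! ### Lifting invariants along `ι` -/

/-! ### The kernel of ι in terms of a normal decomposition -/

section Kernel

variable {p : ℕ} [Fact p.Prime] {n : ℕ} {R : Type u} [CommRing R]

namespace Predisplay

variable {D : Predisplay p n R} {T L : Type u} [AddCommGroup T] [Module (CalW p n R) T]
  [AddCommGroup L] [Module (CalW p n R) L]

theorem iota_eps_lTensor (t : T →ₗ[CalW p n R] D.P) (w : VIdeal p n R ⊗[CalW p n R] T) :
    D.iota (D.eps (t.lTensor (VIdeal p n R) w)) =
      t (TensorProduct.lid (CalW p n R) T ((VIdeal.kappa p n R).rTensor T w)) := by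
  induction w using TensorProduct.induction_on with
  | zero => simp only [map_zero]
  | add x y hx hy => simp only [map_add, hx, hy]
  | tmul a x =>
    rw [LinearMap.lTensor_tmul, D.iota_eps, LinearMap.rTensor_tmul, lid_tmul, map_smul]

variable [NeZero n]

variable (p n R) in
/-- The map `R[p] → I_{n+1}`. -/
def torI : (LinCoeff.tor.{u} p n).obj R →ₗ[CalW p n R] VIdeal p n R :=
  (Coeff.torVIdeal.{u} p n).app R

theorem torI_injective : Function.Injective (torI p n R) :=
  Coeff.torVIdeal_injective p n

theorem torI_exact : Function.Exact (torI p n R) (VIdeal.kappa p n R) :=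
  Coeff.torVIdeal_exact p n

/-- The map `R[p] ⊗ T → Q`. -/
def torQ (t : T →ₗ[CalW p n R] D.P) :
    (LinCoeff.tor.{u} p n).obj R ⊗[CalW p n R] T →ₗ[CalW p n R] D.Q :=
  D.eps ∘ₗ t.lTensor (VIdeal p n R) ∘ₗ
    (torI p n R).rTensor T

theorem torQ_tmul (t : T →ₗ[CalW p n R] D.P) (a : (LinCoeff.tor.{u} p n).obj R) (x : T) :
    torQ t (a ⊗ₜ x) = D.eps (torI p n R a ⊗ₜ t x) := rfl

theorem iota_torQ (t : T →ₗ[CalW p n R] D.P) (z) : D.iota (torQ t z) = 0 := by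
  induction z using TensorProduct.induction_on with
  | zero => simp only [map_zero]
  | add x y hx hy => simp only [map_add, hx, hy, add_zero]
  | tmul a x =>
    rw [torQ_tmul, D.iota_eps]
    rw [(torI_exact _).2 ⟨a, rfl⟩, zero_smul]

/-- R[p] → I is injective, flatness of T preserves this, and I ⊗ T is a summand of Q. -/
theorem IsNormal.torQ_injective [Module.Flat (CalW p n R) T] {t : T →ₗ[CalW p n R] D.P}
    {l : L →ₗ[CalW p n R] D.Q} (h : IsNormal t l) : Function.Injective (torQ t) := by
  have h1 := Module.Flat.rTensor_preserves_injective_linearMap (M := T)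
    (torI p n R) torI_injective
  intro x y hxy
  refine h1 ?_
  have h2 : decQ t l ((torI p n R).rTensor T x, 0) = decQ t l ((torI p n R).rTensor T y, 0) := (by
    rw [decQ_apply, decQ_apply, map_zero, add_zero, add_zero]
    exact hxy)
  exact congrArg Prod.fst (h.bijective_decQ.1 h2)

/-- In the decompositions, ι is κ ⊗ id on I ⊗ T and the identity on L. Hence its kernel is ker κ ⊗ T
= R[p] ⊗ T by flatness of T. -/
theorem IsNormal.exists_torQ [Module.Flat (CalW p n R) T] {t : T →ₗ[CalW p n R] D.P}
    {l : L →ₗ[CalW p n R] D.Q} (h : IsNormal t l) {y : D.Q} (hy : D.iota y = 0) :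
    ∃ z, torQ t z = y := by
  obtain ⟨⟨w, x⟩, rfl⟩ := h.bijective_decQ.2 y
  rw [decQ_apply, map_add, iota_eps_lTensor, ← decP_apply, ← map_zero (decP t l)] at hy
  have h1 := h.bijective_decP.1 hy
  have hx : x = 0 := congrArg Prod.snd h1
  have hw : (VIdeal.kappa p n R).rTensor T w = 0 := by
    have := congrArg Prod.fst h1
    exact (TensorProduct.lid (CalW p n R) T).injective (this.trans (map_zero _).symm)
  have h2 := Module.Flat.rTensor_exact T (f := torI p n R) (g := VIdeal.kappa p n R) torI_exact
  obtain ⟨z, rfl⟩ := (h2 w).1 hw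
  refine ⟨z, ?_⟩
  rw [decQ_apply, hx, map_zero, add_zero]
  rfl

end Predisplay

end Kernel

/-! ### Removing the obstruction in the p-torsion complex -/

section Lift

variable {p : ℕ} [Fact p.Prime] {n : ℕ} {R S : Type u} [CommRing R] [CommRing S] [Algebra R S]

variable (p n R S) in
/-- The cosimplicial module of a module over `𝒲_n(R)`. -/
def CechModule.const (T : Type u) [AddCommGroup T] [Module (CalW p n R) T] :
    CechModule p n R S where
  obj k := BC (CalW.map p n (algebraMap R (TensorPower R S (k + 1)))) T
  face k i := bcTrans (Predisplay.calWMap_comp' (algHom_comp_algebraMap (coface R S i))) T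
  face_face k i j h x := by
    induction x using BC.induction with
    | zero => simp only [map_zero]
    | of x => simp only [bcTrans_of]
    | add x y hx hy => simp only [map_add, hx, hy]
    | smul b x hx =>
      simp only [LinearMap.map_smulₛₗ, hx]
      congr 1
      rw [← CalW.map_comp, ← CalW.map_comp]
      exact congrArg (fun φ => CalW.map p n φ b) (RingHom.ext (cofaceHom_cofaceHom h))
  merge k := bcTrans (Predisplay.calWMap_comp' (algHom_comp_algebraMap (TensorPower.merge R S k))) T
  merge_face_one k x := by
    induction x using BC.induction with
    | zero => simp only [map_zero]
    | of x => simp only [bcTrans_of]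
    | add x y hx hy => simp only [map_add, hx, hy]
    | smul b x hx =>
      simp only [LinearMap.map_smulₛₗ, hx]
      congr 1
      rw [← CalW.map_comp]
      refine (congrArg (fun φ => CalW.map p n φ b) (RingHom.ext
        (mergeHom_cofaceHom_one k))).trans (CalW.map_id p n b)
  merge_face_succ_succ k i x := by
    induction x using BC.induction with
    | zero => simp only [map_zero]
    | of x => simp only [bcTrans_of]
    | add x y hx hy => simp only [map_add, hx, hy]
    | smul b x hx =>
      simp only [LinearMap.map_smulₛₗ, hx]
      congr 1
      rw [← CalW.map_comp, ← CalW.map_comp]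
      exact congrArg (fun φ => CalW.map p n φ b) (RingHom.ext (mergeHom_cofaceHom_succ_succ k i))

theorem flat_bc {A B M : Type*} [CommRing A] [CommRing B] [AddCommGroup M] [Module A M]
    [Module.Flat A M] (σ : A →+* B) : Module.Flat B (BC σ M) := by
  let := σ.toAlgebra
  exact Module.Flat.baseChange (R := A) (S := B) (M := M)

theorem CechModule.isCartesian_const (T : Type u) [AddCommGroup T] [Module (CalW p n R) T]
    [Module.Flat (CalW p n R) T] : (CechModule.const p n R S T).IsCartesian where
  flat k := flat_bc _
  isBC k := (isBC_of _ T).of_comp (isBC_of _ T)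
    (Predisplay.calWMap_comp' (algHom_comp_algebraMap (coface R S (0 : Fin (k + 2)))))
    fun x => (bcTrans_of (Predisplay.calWMap_comp' (algHom_comp_algebraMap (coface R S
      (0 : Fin (k + 2))))) x).symm

open Predisplay

namespace DescentDatum

variable (D : DescentDatum p n R S)

/-- The base change of a predisplay with descent datum along the last coprojection. -/
abbrev cochain (k : ℕ) : Predisplay p n (TensorPower R S (k + 1)) :=
  D.obj.baseChange (slot R S (Fin.last k) : S →+* TensorPower R S (k + 1))

/-- The face maps. -/
def face (k : ℕ) (i : Fin (k + 2)) : HomOver (cofaceHom R S i) (D.cochain k) (D.cochain (k + 1)) :=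
  D.transport (coface R S i) (slot R S (Fin.last k)) (slot R S (Fin.last (k + 1)))

/-- The face maps on `Q`. -/
def faceQ (k : ℕ) (i : Fin (k + 2)) : (D.cochain k).Q →+ (D.cochain (k + 1)).Q :=
  (D.face k i).mapQ.toAddMonoidHom

theorem faceQ_apply (k : ℕ) (i : Fin (k + 2)) (y) : D.faceQ k i y = (D.face k i).mapQ y := rfl

theorem faceQ_faceQ (k : ℕ) (i j : Fin (k + 2)) (h : i ≤ j) (y) :
    D.faceQ (k + 1) j.succ (D.faceQ k i y) = D.faceQ (k + 1) i.castSucc (D.faceQ k j y) := by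
  have h' : (coface R S j.succ).comp (coface R S i) =
      (coface R S i.castSucc).comp (coface R S j) :=
    AlgHom.ext (TensorPower.coface_coface h)
  rw [faceQ_apply, faceQ_apply, faceQ_apply, faceQ_apply, face, face, face, face,
    D.transport_transport h', D.transport_transport rfl]

/-- The differential on `Q`. -/
def dQ (k : ℕ) : (D.cochain k).Q →+ (D.cochain (k + 1)).Q := altSum D.faceQ k

theorem dQ_dQ (k : ℕ) (y) : D.dQ (k + 1) (D.dQ k y) = 0 := altSum_altSum D.faceQ_faceQ k y

theorem dQ_zero (y) : D.dQ 0 y = (D.face 0 0).mapQ y - (D.face 0 1).mapQ y :=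
  altSum_zero_apply ..

variable {D} {T L : Type u} [AddCommGroup T] [Module (CalW p n R) T] [AddCommGroup L]
  [Module (CalW p n R) L]

/-- The map `T → P` over the last coprojection. -/
def cochainMap (t : T →ₛₗ[CalW.map p n (algebraMap R S)] D.obj.P) (k : ℕ) :
    T →ₛₗ[CalW.map p n (algebraMap R (TensorPower R S (k + 1)))] (D.cochain k).P :=
  semiComp (D.obj.toBaseChange _).mapP t
    (calWMap_comp' (algHom_comp_algebraMap (slot R S (Fin.last k))))

theorem face_linExt {t : T →ₛₗ[CalW.map p n (algebraMap R S)] D.obj.P}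
    (ht : ∀ x, D.fst.mapP (t x) = D.snd.mapP (t x)) (k : ℕ) (i : Fin (k + 2))
    (z : (CechModule.const p n R S T).obj k) :
    (D.face k i).mapP (linExt (cochainMap t k) z) =
      linExt (cochainMap t (k + 1)) ((CechModule.const p n R S T).face k i z) :=
  hom_linExt (calWMap_comp' (algHom_comp_algebraMap (coface R S i)))
    (fun x => D.transport_mapP_of_invariant _ _ _ (ht x)) z

variable [NeZero n]

/-- The map `R[p] ⊗ T → Q` on cochains. -/
def torCochain (t : T →ₛₗ[CalW.map p n (algebraMap R S)] D.obj.P) (k : ℕ) :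
    ((CechModule.const p n R S T).tensor (LinCoeff.tor p n).toCoeff).obj k →+ (D.cochain k).Q :=
  (torQ (linExt (cochainMap t k))).toAddMonoidHom

theorem faceQ_torCochain {t : T →ₛₗ[CalW.map p n (algebraMap R S)] D.obj.P}
    (ht : ∀ x, D.fst.mapP (t x) = D.snd.mapP (t x)) (k : ℕ) (i : Fin (k + 2)) (z) :
    D.faceQ k i (torCochain t k z) = torCochain t (k + 1)
      (((CechModule.const p n R S T).tensor (LinCoeff.tor p n).toCoeff).faceAdd k i z) := by
  induction z using CechModule.tensor_induction with
  | zero => simp only [map_zero]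
  | add x y hx hy => simp only [map_add, hx, hy]
  | tmul a x =>
    refine ((D.face k i).eps_comm _ _).trans ?_
    refine congrArg (D.cochain (k + 1)).eps ?_
    exact congrArg₂ (fun b y => b ⊗ₜ y)
      ((Coeff.torVIdeal p n).naturality (cofaceHom R S i) a).symm (face_linExt ht k i x)

/-- Invariance of `t` makes the p-torsion of the tensor powers, tensored with T, a subsystem of the
complex formed by Q, so that its acyclicity can be used to correct elements of Q. -/
theorem dQ_torCochain {t : T →ₛₗ[CalW.map p n (algebraMap R S)] D.obj.P}
    (ht : ∀ x, D.fst.mapP (t x) = D.snd.mapP (t x)) (k : ℕ) (z) :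
    D.dQ k (torCochain t k z) = torCochain t (k + 1)
      (((CechModule.const p n R S T).tensor (LinCoeff.tor p n).toCoeff).d k z) := by
  rw [dQ, CechModule.d, altSum_apply, altSum_apply, map_sum]
  refine Finset.sum_congr rfl fun i _ => ?_
  rw [faceQ_torCochain ht, map_zsmul]

variable [Module.FaithfullyFlat R S] [Module.Flat (CalW p n R) T]

omit [Module.FaithfullyFlat R S] [Module.Flat (CalW p n R) T] in
theorem IsNormal_cochain (hp : IsNilpotent (p : R)) (hD : D.obj.IsTruncatedDisplay)
    {t : T →ₛₗ[CalW.map p n (algebraMap R S)] D.obj.P}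
    {l : L →ₛₗ[CalW.map p n (algebraMap R S)] D.obj.Q} (h : IsNormal (linExt t) (linExt l))
    (k : ℕ) : ∃ l' : L →ₛₗ[CalW.map p n (algebraMap R (TensorPower R S (k + 1)))] (D.cochain k).Q,
      IsNormal (linExt (cochainMap t k)) (linExt l') := by
  have h₁ := algHom_comp_algebraMap (slot R S (Fin.last k))
  refine ⟨semiComp (D.obj.toBaseChange _).mapQ l (calWMap_comp' h₁),
    h.semi_baseChange h₁ ?_ hD (fun _ => rfl) fun _ => rfl⟩
  simpa using hp.map (algebraMap R (TensorPower R S (k + 1)))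

omit [NeZero n] [Module.FaithfullyFlat R S] [Module.Flat (CalW p n R) T] in
theorem fst_eq_snd_of_dQ_eq_zero {y : D.obj.Q}
    (h : D.dQ 0 ((D.obj.toBaseChange _).mapQ y) = 0) : D.fst.mapQ y = D.snd.mapQ y := by
  have hc0 : (coface R S (0 : Fin 2)).comp (slot R S (Fin.last 0)) = slot R S (Fin.last 1) := by
    ext s
    rw [AlgHom.comp_apply, TensorPower.coface_slot_apply]
    rfl
  have hc1 : (coface R S (1 : Fin 2)).comp (slot R S (Fin.last 0)) = slot R S 0 := by
    ext s
    rw [AlgHom.comp_apply, TensorPower.coface_slot_apply]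
    rfl
  rw [dQ_zero, sub_eq_zero, face, face, D.transport_mapQ_of_comp _ hc0,
    D.transport_mapQ_of _ hc1] at h
  have h1 := TensorPower.pairMap_slot_bijective (R := R) (S := S)
  let e := AlgEquiv.ofBijective _ h1
  refine baseChangeTrans_mapQ_injective (D := D.obj)
    (pairMap_comp_p₂ (slot R S (0 : Fin 2)) (slot R S (Fin.last 1)))
    (r := (e.symm : TensorPower R S 2 →+* S ⊗[R] S))
    (RingHom.ext fun x => e.symm_apply_apply x) (Eq.trans h.symm ?_)
  exact (baseChangeTrans_mapQ _ D.obj y).symm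

/-- Invariant elements of `ι(Q)` come from invariant elements of `Q`. -/
theorem exists_invariant_lift (hp : IsNilpotent (p : R)) (hD : D.obj.IsTruncatedDisplay)
    {t : T →ₛₗ[CalW.map p n (algebraMap R S)] D.obj.P}
    (ht : ∀ x, D.fst.mapP (t x) = D.snd.mapP (t x))
    {l : L →ₛₗ[CalW.map p n (algebraMap R S)] D.obj.Q} (h : IsNormal (linExt t) (linExt l))
    (q : D.obj.Q) (hq : D.fst.mapP (D.obj.iota q) = D.snd.mapP (D.obj.iota q)) :
    ∃ q', D.fst.mapQ q' = D.snd.mapQ q' ∧ D.obj.iota q' = D.obj.iota q := by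
  have hM := CechModule.isCartesian_const (p := p) (n := n) (R := R) (S := S) T
  let o := D.obj.toBaseChange (slot R S (Fin.last 0) : S →+* TensorPower R S 1)
  -- The differential of q measures the failure of q to be invariant. As ι(q) is invariant, it lies
  -- in ker ι, hence comes from an element z of the p-torsion complex in degree 1.
  have h1 : (D.cochain 1).iota (D.dQ 0 (o.mapQ q)) = 0 := by
    rw [dQ_zero, map_sub, (D.face 0 0).iota_comm, (D.face 0 1).iota_comm, o.iota_comm, face, face,
      D.transport_mapP_of_invariant _ _ _ hq, D.transport_mapP_of_invariant _ _ _ hq, sub_self]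
  obtain ⟨l₁, hl₁⟩ := IsNormal_cochain hp hD h 1
  obtain ⟨l₂, hl₂⟩ := IsNormal_cochain hp hD h 2
  have := flat_bc (M := T) (CalW.map p n (algebraMap R (TensorPower R S (1 + 1))))
  have := flat_bc (M := T) (CalW.map p n (algebraMap R (TensorPower R S (2 + 1))))
  obtain ⟨z, hz⟩ : ∃ z : ((CechModule.const p n R S T).tensor (LinCoeff.tor p n).toCoeff).obj 1,
      torCochain t 1 z = D.dQ 0 (o.mapQ q) := hl₁.exists_torQ h1
  have h2 : torCochain t 2
      (((CechModule.const p n R S T).tensor (LinCoeff.tor p n).toCoeff).d 1 z) = 0 := by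
    rw [← dQ_torCochain ht, hz, dQ_dQ]
  -- Since the p-torsion embeds into Q in degree 2, z is a cocycle, and H¹ of the p-torsion complex
  -- vanishes.
  obtain ⟨w, hw⟩ := (hM.exact_tor 0 z).1
    (hl₂.torQ_injective (h2.trans (map_zero (torCochain t 2)).symm))
  have h3 : D.dQ 0 (torCochain t 0 w) = D.dQ 0 (o.mapQ q) := by
    rw [dQ_torCochain ht, hw, hz]
  let e := AlgEquiv.ofBijective _ (TensorPower.slot_zero_bijective (R := R) (S := S))
  -- Subtracting the contribution of w makes the differential zero without changing ι(q), as w maps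
  -- into ker ι. The isomorphism of S with its first tensor power brings the corrected element back
  -- to S.
  obtain ⟨q', hq'⟩ := toBaseChange_mapQ_surjective D.obj
    (φ := (slot R S (Fin.last 0) : S →+* TensorPower R S 1))
    (r := (e.symm : TensorPower R S 1 →+* S)) (RingHom.ext fun x => e.apply_symm_apply x)
    (o.mapQ q - torCochain t 0 w)
  refine ⟨q', fst_eq_snd_of_dQ_eq_zero ?_, ?_⟩
  · rw [hq', map_sub, h3, sub_self]
  · have h4 : o.mapP (D.obj.iota q') = o.mapP (D.obj.iota q) := by
      rw [← o.iota_comm, hq', map_sub, o.iota_comm]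
      have : (D.cochain 0).iota (torCochain t 0 w) = 0 := iota_torQ _ w
      rw [this, sub_zero]
    have h5 : Function.Injective o.mapP :=
      ((isBC_of _ D.obj.P).bijective (CalW.map_bijective (e : S ≃+* TensorPower R S 1))).1
    exact h5 h4

end DescentDatum

end Lift

end
end TruncDisp

namespace TruncDisp


open TensorProduct CategoryTheory

noncomputable section

/-! ### The predisplay of invariants -/

section

theorem exists_semilinear_factor {A A' B M M' N : Type*} [CommRing A] [CommRing A'] [CommRing B]
    [AddCommGroup M] [Module A M] [AddCommGroup M'] [Module A' M'] [AddCommGroup N] [Module B N]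
    {σ : A' →+* B} {τ : A →+* A'} {ρ : A →+* B} (hρ : ∀ a, ρ a = σ (τ a)) {o : M' →ₛₗ[σ] N}
    (ho : Function.Injective o) (g : M →ₛₗ[ρ] N) (h : ∀ x, ∃ y, o y = g x) :
    ∃ f : M →ₛₗ[τ] M', ∀ x, o (f x) = g x := by
  choose f hf using h
  exact ⟨{ toFun := f
           map_add' x y := ho (by rw [map_add o, hf, hf, hf, map_add])
           map_smul' a x := ho (by
            rw [LinearMap.map_smulₛₗ o, hf, hf, LinearMap.map_smulₛₗ, hρ]) }, hf⟩

end

section Invariants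

variable {p : ℕ} [Fact p.Prime] {n : ℕ} {R S : Type u} [CommRing R] [CommRing S] [Algebra R S]

open Predisplay

namespace Predisplay

omit [Algebra R S] in
/-- Restricting a predisplay to submodules over a smaller ring. -/
theorem exists_restrict (D : Predisplay p n S) {φ : R →+* S} {P Q : Type u} [AddCommGroup P]
    [AddCommGroup Q] [Module (CalW p n R) P] [Module (CalW p n R) Q]
    (i : P →ₛₗ[CalW.map p n φ] D.P) (j : Q →ₛₗ[CalW.map p n φ] D.Q)
    (hi : Function.Injective i) (hj : Function.Injective j) (hw : Function.Injective (wMap φ i))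
    (hiota : ∀ y, ∃ x, i x = D.iota (j y))
    (heps : ∀ a x, ∃ y, j y = D.eps (VIdeal.map p n φ a ⊗ₜ i x))
    (hF : ∀ x, ∃ z, wMap φ i z = D.F (i x)) (hFdot : ∀ y, ∃ z, wMap φ i z = D.Fdot (j y)) :
    ∃ (ι : Q →ₗ[CalW p n R] P) (ε : VIdeal p n R ⊗[CalW p n R] P →ₗ[CalW p n R] Q)
      (F : P →ₛₗ[CalW.frob p n R] BC (CalW.res p n R) P)
      (Fdot : Q →ₛₗ[CalW.frob p n R] BC (CalW.res p n R) P),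
      (∀ y, i (ι y) = D.iota (j y)) ∧
      (∀ a x, j (ε (a ⊗ₜ x)) = D.eps (VIdeal.map p n φ a ⊗ₜ i x)) ∧
      (∀ x, wMap φ i (F x) = D.F (i x)) ∧ ∀ y, wMap φ i (Fdot y) = D.Fdot (j y) := by
  obtain ⟨ι, hι⟩ := exists_linear_factor hi (D.iota ∘ₛₗ j) hiota
  obtain ⟨ε, hε⟩ := exists_linear_factor hj (D.eps ∘ₛₗ TensorProduct.map (VIdeal.map p n φ) i)
    fun w => by
      induction w using TensorProduct.induction_on with
      | zero => exact ⟨0, by simp only [map_zero]⟩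
      | tmul a x => exact heps a x
      | add x y hx hy =>
        obtain ⟨x', hx⟩ := hx
        obtain ⟨y', hy⟩ := hy
        exact ⟨x' + y', by simp only [map_add, hx, hy]⟩
  obtain ⟨F, hF'⟩ := exists_semilinear_factor (τ := CalW.frob p n R)
    (ρ := (CalW.frob p n S).comp (CalW.map p n φ)) (fun a => CalW.frob_map p n φ a) hw
    (semiComp D.F i fun _ => rfl) hF
  obtain ⟨Fdot, hFdot'⟩ := exists_semilinear_factor (τ := CalW.frob p n R)
    (ρ := (CalW.frob p n S).comp (CalW.map p n φ)) (fun a => CalW.frob_map p n φ a) hw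
    (semiComp D.Fdot j fun _ => rfl) hFdot
  exact ⟨ι, ε, F, Fdot, hι, fun a x => hε _, hF', hFdot'⟩

end Predisplay

namespace DescentDatum

variable (D : DescentDatum p n R S)

/-- The kernel of the difference of the two maps out of `Q`. -/
def invariantsQ : AddSubgroup D.obj.Q where
  carrier := {y | D.fst.mapQ y = D.snd.mapQ y}
  zero_mem' := by rw [Set.mem_ofPred_eq, map_zero, map_zero]
  add_mem' {x y} hx hy := by
    rw [Set.mem_ofPred_eq] at hx hy ⊢
    rw [map_add, map_add, hx, hy]
  neg_mem' {x} hx := by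
    rw [Set.mem_ofPred_eq] at hx ⊢
    rw [map_neg, map_neg, hx]

theorem smul_mem_invariantsQ (r : CalW p n R) {x : D.obj.Q} (hx : x ∈ D.invariantsQ) :
    CalW.map p n (algebraMap R S) r • x ∈ D.invariantsQ := by
  change D.fst.mapQ _ = D.snd.mapQ _
  rw [LinearMap.map_smulₛₗ, LinearMap.map_smulₛₗ, ← CalW.map_comp, ← CalW.map_comp,
    algHom_comp_algebraMap, algHom_comp_algebraMap]
  exact congrArg _ hx

instance : Module (CalW p n R) D.invariantsQ where
  smul r x := ⟨CalW.map p n (algebraMap R S) r • (x : D.obj.Q), D.smul_mem_invariantsQ r x.2⟩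
  one_smul x := Subtype.ext (by
    change CalW.map p n (algebraMap R S) 1 • (x : D.obj.Q) = x
    rw [map_one, one_smul])
  mul_smul r s x := Subtype.ext (by
    change CalW.map p n (algebraMap R S) (r * s) • (x : D.obj.Q) =
      CalW.map p n (algebraMap R S) r • CalW.map p n (algebraMap R S) s • (x : D.obj.Q)
    rw [map_mul, mul_smul])
  smul_zero r := Subtype.ext (smul_zero (CalW.map p n (algebraMap R S) r))
  smul_add r x y := Subtype.ext (smul_add (CalW.map p n (algebraMap R S) r) (x : D.obj.Q) y)
  add_smul r s x := Subtype.ext (by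
    change CalW.map p n (algebraMap R S) (r + s) • (x : D.obj.Q) =
      CalW.map p n (algebraMap R S) r • (x : D.obj.Q) +
        CalW.map p n (algebraMap R S) s • (x : D.obj.Q)
    rw [map_add, add_smul])
  zero_smul x := Subtype.ext (by
    change CalW.map p n (algebraMap R S) 0 • (x : D.obj.Q) = 0
    rw [map_zero, zero_smul])

/-- A homomorphism onto the invariants of a descent datum. -/
structure IsInvariants {D₀ : Predisplay p n R} (o : HomOver (algebraMap R S) D₀ D.obj) : Prop where
  finite : Module.Finite (CalW p n R) D₀.P
  projective : Module.Projective (CalW p n R) D₀.P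
  isBC : IsBC o.mapP
  injective_mapP : Function.Injective o.mapP
  injective_mapQ : Function.Injective o.mapQ
  fst_mapP x : D.fst.mapP (o.mapP x) = D.snd.mapP (o.mapP x)
  fst_mapQ y : D.fst.mapQ (o.mapQ y) = D.snd.mapQ (o.mapQ y)
  exists_mapP x : D.fst.mapP x = D.snd.mapP x → ∃ z, o.mapP z = x
  exists_mapQ y : D.fst.mapQ y = D.snd.mapQ y → ∃ z, o.mapQ z = y

/-- Because the descent datum is a homomorphism of displays, ι, ε, F and Ḟ preserve equalizers. For
F and Ḟ the target is the equalizer of W_n(S) ⊗ P, which is W_n(R) ⊗ P₀ by flatness of P₀. The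
identities between the maps are checked after the injections into the display over S. -/
theorem exists_isInvariants [NeZero n] [Module.FaithfullyFlat R S] (hp : IsNilpotent (p : R))
    (hD : D.obj.IsTruncatedDisplay) :
    ∃ (D₀ : Predisplay p n R) (o : HomOver (algebraMap R S) D₀ D.obj), D.IsInvariants o := by
  have := hD.finite
  have := hD.projective
  obtain ⟨hfin, hproj, hbij⟩ := D.toModule.descent hp
  let i : D.toModule.invariants →ₛₗ[CalW.map p n (algebraMap R S)] D.obj.P :=
    { toFun x := x
      map_add' _ _ := rfl
      map_smul' _ _ := rfl }
  let j : D.invariantsQ →ₛₗ[CalW.map p n (algebraMap R S)] D.obj.Q :=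
    { toFun x := x
      map_add' _ _ := rfl
      map_smul' _ _ := rfl }
  have hi : IsBC i := hbij
  have hii : ∀ x, D.fst.mapP (i x) = D.snd.mapP (i x) := fun x => x.2
  have hjj : ∀ x, D.fst.mapQ (j x) = D.snd.mapQ (j x) := fun x => x.2
  have hw := wMap_injective hi
  have hw' : ∀ z, wMap _ D.fst.mapP z = wMap _ D.snd.mapP z → ∃ x, wMap (algebraMap R S) i x = z :=
    fun z => wMap_equalizer hi (f₁ := D.fst.mapP) (f₂ := D.snd.mapP)
      (isBC_of (CalW.map p n (p₂ R S : S →+* S ⊗[R] S)) D.obj.P) hii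
  obtain ⟨ι, ε, F, Fdot, hι, hε, hF, hFdot⟩ := D.obj.exists_restrict i j Subtype.val_injective
    Subtype.val_injective hw
    (fun y => ⟨⟨D.obj.iota (j y), (D.fst.iota_comm (j y)).symm.trans
      ((congrArg _ (hjj y)).trans (D.snd.iota_comm (j y)))⟩, rfl⟩)
    (fun a x => by
      refine ⟨⟨D.obj.eps (VIdeal.map p n (algebraMap R S) a ⊗ₜ i x), ?_⟩, rfl⟩
      change D.fst.mapQ _ = D.snd.mapQ _
      rw [D.fst.eps_comm, D.snd.eps_comm, hii, ← VIdeal.map_comp, ← VIdeal.map_comp,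
        algHom_comp_algebraMap, algHom_comp_algebraMap])
    (fun x => hw' _ (by rw [← D.fst.F_comm, ← D.snd.F_comm, hii]))
    (fun x => hw' _ (by rw [← D.fst.Fdot_comm, ← D.snd.Fdot_comm, hjj]))
  have hiinj : Function.Injective i := Subtype.val_injective
  have hjinj : Function.Injective j := Subtype.val_injective
  refine ⟨{ P := D.toModule.invariants, Q := D.invariantsQ, iota := ι, eps := ε, F := F
            Fdot := Fdot, iota_eps := fun a x => hiinj ?_, eps_iota := fun a y => hjinj ?_
            Fdot_eps := fun a x => hw ?_ },
    { mapP := i, mapQ := j, iota_comm := fun y => (hι y).symm, eps_comm := hε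
      F_comm := fun x => (hF x).symm, Fdot_comm := fun y => (hFdot y).symm },
    ⟨hfin, hproj, hi, hiinj, hjinj, hii, hjj, fun x hx => ⟨⟨x, hx⟩, rfl⟩,
      fun y hy => ⟨⟨y, hy⟩, rfl⟩⟩⟩
  · rw [hι, hε, D.obj.iota_eps, LinearMap.map_smulₛₗ, VIdeal.kappa_map]
  · rw [hε, hι, D.obj.eps_iota, LinearMap.map_smulₛₗ, VIdeal.kappa_map]
  · rw [hFdot, hε, D.obj.Fdot_eps, LinearMap.map_smulₛₗ, hF, VIdeal.verInv_map]

end DescentDatum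

end Invariants

end
end TruncDisp

namespace TruncDisp


open TensorProduct CategoryTheory

noncomputable section

/-! ### Descent of normal decompositions -/

/-! ### Lifting a quotient to a direct summand, and descent of an image -/

section Complement

/-- A lift of a quotient of the reduction is a direct summand. -/
theorem exists_complement {A B : Type u} [CommRing A] [CommRing B] {π : A →+* B}
    (hπ : Function.Surjective π) (hker : IsNilpotent (RingHom.ker π)) {M : Type u}
    [AddCommGroup M] [Module A M] [Module.Finite A M] [Module.Projective A M] {X : Type u}
    [AddCommGroup X] [Module B X] [Module.Finite B X] [Module.Projective B X]
    {f : BC π M →ₗ[B] X} (hf : Function.Surjective f) :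
    ∃ (T : Type u) (_ : AddCommGroup T) (_ : Module A T) (_ : Module.Finite A T)
      (_ : Module.Projective A T) (L : Type u) (_ : AddCommGroup L) (_ : Module A L)
      (_ : Module.Finite A L) (_ : Module.Projective A L) (t : T →ₗ[A] M) (l : L →ₗ[A] M)
      (m : T →ₛₗ[π] X), Function.Bijective (t.coprod l) ∧ IsBC m ∧
        (∀ x, f (BC.of π (t x)) = m x) ∧ ∀ y, f (BC.of π (l y)) = 0 := by
  obtain ⟨s, hs⟩ := Module.projective_lifting_property f LinearMap.id hf
  have hs' : ∀ x, f (s x) = x := fun x => LinearMap.congr_fun hs x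
  let r : BC π M →ₗ[B] LinearMap.ker f := LinearMap.codRestrict _ (LinearMap.id - s ∘ₗ f)
    fun z => by
      rw [LinearMap.mem_ker, LinearMap.sub_apply, LinearMap.id_apply, LinearMap.comp_apply, map_sub,
        hs', sub_self]
  have hr' : ∀ z, (r z : BC π M) = z - s (f z) := fun z => rfl
  have hr : ∀ z : LinearMap.ker f, r z = z := fun z => Subtype.ext (by
    rw [hr', LinearMap.mem_ker.1 z.2, map_zero, sub_zero])
  have hrs : Function.Surjective r := fun z => ⟨z, hr z⟩
  have : Module.Finite B (LinearMap.ker f) := Module.Finite.of_surjective r hrs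
  have : Module.Projective B (LinearMap.ker f) :=
    Module.Projective.of_split (LinearMap.ker f).subtype r (LinearMap.ext hr)
  -- The reduction of M is ker f ⊕ X. Both summands are lifted to projective modules over A, mapped
  -- to M, and compared with M by Nakayama.
  obtain ⟨T, _, _, _, _, m, hm⟩ := exists_lift_projective hπ hker X
  obtain ⟨L, _, _, _, _, m', hm'⟩ := exists_lift_projective hπ hker (LinearMap.ker f)
  have hofs := BC.of_surjective (M := M) hπ
  obtain ⟨t, ht⟩ := exists_lift_semilinear (g := BC.of π) (s ∘ₛₗ m) fun x => hofs _
  obtain ⟨l, hl⟩ := exists_lift_semilinear (g := BC.of π) ((LinearMap.ker f).subtype ∘ₛₗ m')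
    fun x => hofs _
  refine ⟨T, inferInstance, inferInstance, inferInstance, inferInstance, L, inferInstance,
    inferInstance, inferInstance, inferInstance, t, l, m, ?_, hm, fun x => ?_, fun y => ?_⟩
  · refine bijective_of_bijective_mod hπ hker (hm.prod hm') (isBC_of π M)
      (f' := s.coprod (LinearMap.ker f).subtype) ?_ ⟨?_, fun z => ⟨(f z, r z), ?_⟩⟩
    · rintro ⟨x, y⟩
      rw [semiProd_apply, LinearMap.coprod_apply, LinearMap.coprod_apply, map_add, ht, hl]
      rfl
    · rw [injective_iff_map_eq_zero]
      rintro ⟨x, y⟩ h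
      rw [LinearMap.coprod_apply] at h
      have h1 := congrArg f h
      rw [map_add, hs', Submodule.subtype_apply, LinearMap.mem_ker.1 y.2, add_zero, map_zero] at h1
      subst h1
      rw [map_zero, zero_add] at h
      exact Prod.ext rfl (Subtype.ext h)
    · rw [LinearMap.coprod_apply, Submodule.subtype_apply, hr']
      exact add_sub_cancel _ _
  · rw [ht]
    exact hs' _
  · rw [hl]
    exact (m' y).2

/-- The image of a map compatible with a descent datum descends. -/
theorem exists_descent_image {R S : Type u} [CommRing R] [CommRing S] [Algebra R S]
    [Module.FaithfullyFlat R S] {M N : Type u} [AddCommGroup M] [Module R M] [AddCommGroup N]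
    [Module S N] (c : M →ₛₗ[algebraMap R S] N) (hc : Submodule.span S (Set.range c) = ⊤)
    (ρ : N →ₛₗ[(p₁ R S : S →+* S ⊗[R] S)] BC (p₂ R S : S →+* S ⊗[R] S) N)
    (hρ : ∀ x, ρ (c x) = BC.of _ (c x)) :
    ∃ (X : Type u) (_ : AddCommGroup X) (_ : Module R X) (j : X →ₛₗ[algebraMap R S] N)
      (f : M →ₗ[R] X), IsBC j ∧ Function.Surjective f ∧ Function.Injective j ∧
        ∀ x, j (f x) = c x := by
  let : Module R N := Module.compHom N (algebraMap R S)
  have : IsScalarTower R S N := ⟨fun r s x => by rw [Algebra.smul_def, mul_smul]; rfl⟩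
  let c' : M →ₗ[R] N :=
    { toFun := c
      map_add' := map_add c
      map_smul' := c.map_smulₛₗ }
  let j : LinearMap.range c' →ₛₗ[algebraMap R S] N :=
    { toFun x := x
      map_add' _ _ := rfl
      map_smul' _ _ := rfl }
  refine ⟨LinearMap.range c', inferInstance, inferInstance, j, c'.rangeRestrict, ?_,
    c'.surjective_rangeRestrict, Subtype.val_injective, fun x => rfl⟩
  rw [isBC_iff_algebraMapLift]
  constructor
  -- Injectivity: since ρ fixes the image of `c`, composing with ρ gives the flat base change of the
  -- inclusion of that image into N, followed by the isomorphism `μ` of S ⊗_R N with the base change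
  -- of N along p₂. Surjectivity is the hypothesis that the image spans N.
  · let μ : S ⊗[R] N →+ BC (p₂ R S : S →+* S ⊗[R] S) N := TensorProduct.liftAddHom
      { toFun s :=
          { toFun x := p₁ R S s • BC.of _ x
            map_zero' := by rw [map_zero, smul_zero]
            map_add' x y := by rw [map_add, smul_add] }
        map_zero' := by
          ext x
          change p₁ R S 0 • BC.of (p₂ R S : S →+* S ⊗[R] S) x = 0
          rw [map_zero, zero_smul]
        map_add' s t := by
          ext x
          exact (congrArg (· • BC.of (p₂ R S : S →+* S ⊗[R] S) x) (map_add (p₁ R S) s t)).trans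
            (add_smul ..) } fun r s x => by
        change p₁ R S (r • s) • BC.of (p₂ R S : S →+* S ⊗[R] S) x =
          p₁ R S s • BC.of (p₂ R S : S →+* S ⊗[R] S) (algebraMap R S r • x)
        rw [LinearMap.map_smulₛₗ, map_smul, Algebra.smul_def, mul_comm, mul_smul]
        congr 2
        exact ((p₂ R S).commutes r).symm
    have hμ : Function.Bijective μ := by
      refine isBC_bijective_tensor (f := p₁ R S) (j := p₂ R S) ?_ (isBC_of _ N) μ fun s x => rfl
      have : Algebra.TensorProduct.productMap (p₁ R S) (p₂ R S) = AlgHom.id R _ :=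
        Algebra.TensorProduct.ext' fun a b => by simp [p₁, p₂]
      rw [this]
      exact Function.bijective_id
    have h1 := Module.Flat.lTensor_preserves_injective_linearMap (M := S)
      (LinearMap.range c').subtype Subtype.val_injective
    have h2 : ∀ z, ρ (algebraMapLift j z) = μ ((LinearMap.range c').subtype.lTensor S z) := by
      intro z
      induction z using TensorProduct.induction_on with
      | zero => simp only [map_zero]
      | add x y hx hy => simp only [map_add, hx, hy]
      | tmul s x =>
        obtain ⟨_, x, rfl⟩ := x
        rw [algebraMapLift_tmul, LinearMap.map_smulₛₗ]
        refine (congrArg _ (hρ x)).trans ?_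
        rfl
    intro x y hxy
    refine h1 (hμ.1 ?_)
    rw [← h2, ← h2, hxy]
  · rw [← LinearMap.range_eq_top, eq_top_iff, ← hc, Submodule.span_le]
    rintro _ ⟨x, rfl⟩
    exact ⟨1 ⊗ₜ ⟨c x, x, rfl⟩, (algebraMapLift_tmul ..).trans (one_smul ..)⟩

end Complement

/-! ### A normal decomposition of the invariants -/

section Decomposition

variable {p : ℕ} [Fact p.Prime] {n : ℕ} [NeZero n] {R S : Type u} [CommRing R] [CommRing S]
  [Algebra R S] [Module.FaithfullyFlat R S]

open Predisplay

namespace DescentDatum.IsInvariants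

variable {D : DescentDatum p n R S} {D₀ : Predisplay p n R}
  {o : HomOver (algebraMap R S) D₀ D.obj}

/-- A decomposition of the invariants whose first summand lifts `P / ι(Q)`. -/
theorem exists_decomposition (ho : D.IsInvariants o) (hp : IsNilpotent (p : R))
    (hD : D.obj.IsTruncatedDisplay) :
    ∃ (T : Type u) (_ : AddCommGroup T) (_ : Module (CalW p n R) T)
      (_ : Module.Finite (CalW p n R) T) (_ : Module.Projective (CalW p n R) T)
      (L : Type u) (_ : AddCommGroup L) (_ : Module (CalW p n R) L)
      (_ : Module.Finite (CalW p n R) L) (_ : Module.Projective (CalW p n R) L)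
      (t : T →ₗ[CalW p n R] D₀.P) (l : L →ₗ[CalW p n R] D₀.P)
      (m : T →ₛₗ[(algebraMap R S).comp (CalW.w0 p n R)] D.obj.cokerIota),
      Function.Bijective (t.coprod l) ∧ IsBC m ∧
        (∀ x, D.obj.toCokerIota (o.mapP (t x)) = m x) ∧
        ∀ y, D.obj.toCokerIota (o.mapP (l y)) = 0 := by
  have := ho.finite
  have := ho.projective
  have := hD.finite_coker_iota
  have := hD.projective_coker_iota
  let c : BC (CalW.w0 p n R) D₀.P →ₛₗ[algebraMap R S] D.obj.cokerIota :=
    BC.lift (algebraMap R S) (γ := (algebraMap R S).comp (CalW.w0 p n R)) (fun _ => rfl)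
      (semiComp D.obj.toCokerIota o.mapP (w0_comp _))
  have hc : ∀ x, c (BC.of _ x) = D.obj.toCokerIota (o.mapP x) := fun x => BC.lift_of ..
  -- The descent datum passes to coker ι and fixes the image of the invariants of P, which spans. So
  -- coker ι descends to an R-quotient X of the reduction of P₀; T will be a lift of X, and L a
  -- complement of T.
  let ρ : D.obj.cokerIota →ₛₗ[(p₁ R S : S →+* S ⊗[R] S)]
      BC (p₂ R S : S →+* S ⊗[R] S) D.obj.cokerIota :=
    cokerIotaLift (γ := (p₁ R S : S →+* S ⊗[R] S).comp (CalW.w0 p n S)) (fun _ => rfl)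
      (semiComp (D.obj.bcPToCoker _) D.fst.mapP (w0_comp _)) fun y => by
        rw [semiComp_apply, ← D.fst.iota_comm, bcPToCoker_iota]
  have hρ : ∀ z, ρ (c z) = BC.of _ (c z) := fun z => by
    obtain ⟨x, rfl⟩ := BC.of_surjective (CalW.w0_surjective p n) z
    rw [hc, cokerIotaLift_apply, semiComp_apply, ho.fst_mapP, bcPToCoker_of]
  have hspan : Submodule.span S (Set.range c) = ⊤ := by
    rw [eq_top_iff]
    rintro z -
    obtain ⟨x, rfl⟩ := D.obj.toCokerIota_surjective z
    induction x using ho.isBC.induction with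
    | of x => exact Submodule.subset_span ⟨_, hc x⟩
    | add x y hx hy => rw [map_add]; exact add_mem hx hy
    | smul a x hx => rw [LinearMap.map_smulₛₗ]; exact Submodule.smul_mem _ _ hx
  obtain ⟨X, _, _, j, f, hj, hf, hji, hjf⟩ := exists_descent_image c hspan ρ hρ
  have := hj.finite_of_faithfullyFlat
  have := hj.projective_of_faithfullyFlat
  obtain ⟨T, _, _, _, _, L, _, _, _, _, t, l, m, hb, hm, ht, hl⟩ := exists_complement
    (CalW.w0_surjective p n) (CalW.isNilpotent_ker_w0 hp) hf
  refine ⟨T, inferInstance, inferInstance, inferInstance, inferInstance, L, inferInstance,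
    inferInstance, inferInstance, inferInstance, t, l, semiComp j m fun _ => rfl, hb,
    hm.comp hj (fun _ => rfl) fun _ => rfl, fun x => ?_, fun y => ?_⟩
  · rw [← hc, ← hjf, ht, semiComp_apply]
  · rw [← hc, ← hjf, hl, map_zero]

variable {T L : Type u} [AddCommGroup T] [Module (CalW p n R) T] [AddCommGroup L]
  [Module (CalW p n R) L]

omit [Module.FaithfullyFlat R S] in
/-- Lifts of the second summand give normal decompositions. -/
theorem isNormal (ho : D.IsInvariants o) (hp : IsNilpotent (p : S))
    (hD : D.obj.IsTruncatedDisplay) {t : T →ₗ[CalW p n R] D₀.P} {l : L →ₗ[CalW p n R] D₀.P}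
    {m : T →ₛₗ[(algebraMap R S).comp (CalW.w0 p n R)] D.obj.cokerIota}
    (hb : Function.Bijective (t.coprod l)) (hm : IsBC m)
    (ht : ∀ x, D.obj.toCokerIota (o.mapP (t x)) = m x)
    {t' : T →ₛₗ[CalW.map p n (algebraMap R S)] D.obj.P} (ht' : ∀ x, t' x = o.mapP (t x))
    {l' : L →ₛₗ[CalW.map p n (algebraMap R S)] D.obj.Q}
    (hl' : ∀ x, D.obj.iota (l' x) = o.mapP (l x)) : IsNormal (linExt t') (linExt l') := by
  have hP : Function.Bijective (decP (linExt t') (linExt l')) := by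
    refine bijective_of_isBC ((isBC_of (CalW.map p n (algebraMap R S)) T).prod
      (isBC_of (CalW.map p n (algebraMap R S)) L)) ho.isBC (f := t.coprod l) ?_ hb
    rintro ⟨x, y⟩
    rw [semiProd_apply, decP_apply, linExt_of, linExt_of, ht', hl', LinearMap.coprod_apply, map_add]
  refine IsNormal.of_surjective hp hD hP fun q => ?_
  obtain ⟨⟨a, b⟩, hab⟩ := hP.2 (D.obj.iota q)
  rw [decP_apply] at hab
  -- Subtracting the L-part moves ι(q) into T. Its class in coker ι is zero, and coker ι is the
  -- reduction of T_S, so the element lies in κ(I)P; the injectivity axiom of the display then puts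
  -- q − l'(b) into the image of ε.
  have h1 : D.obj.iota (q - linExt l' b) = linExt t' a := by rw [map_sub, ← hab, add_sub_cancel_right]
  let f : BC (CalW.map p n (algebraMap R S)) T →ₛₗ[CalW.w0 p n S] D.obj.cokerIota :=
    D.obj.toCokerIota ∘ₛₗ linExt t'
  have hf : IsBC f := (isBC_of (CalW.map p n (algebraMap R S)) T).of_comp hm (w0_comp _) fun x => by
    rw [LinearMap.comp_apply, linExt_of, ht', ht]
  have h2 : f a = 0 := by rw [LinearMap.comp_apply, ← h1, toCokerIota_iota]
  have h3 := Submodule.mem_map_of_mem (f := linExt t') (mem_kappaIdeal_smul hf h2)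
  rw [Submodule.map_smul''] at h3
  obtain ⟨w, hw⟩ := hD.mem_range_eps (q - linExt l' b) (by
    rw [h1]
    exact Submodule.smul_mono le_rfl le_top h3)
  exact ⟨w, b, by rw [hw, sub_add_cancel]⟩

/-- The invariants have a normal decomposition. -/
theorem exists_isNormal (ho : D.IsInvariants o) (hp : IsNilpotent (p : R))
    (hD : D.obj.IsTruncatedDisplay) :
    ∃ (T : Type u) (_ : AddCommGroup T) (_ : Module (CalW p n R) T)
      (_ : Module.Finite (CalW p n R) T) (_ : Module.Projective (CalW p n R) T)
      (L : Type u) (_ : AddCommGroup L) (_ : Module (CalW p n R) L)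
      (_ : Module.Finite (CalW p n R) L) (_ : Module.Projective (CalW p n R) L)
      (t : T →ₗ[CalW p n R] D₀.P) (l : L →ₗ[CalW p n R] D₀.Q), IsNormal t l ∧
        IsNormal (linExt (o.mapP ∘ₛₗ t)) (linExt (o.mapQ ∘ₛₗ l)) := by
  have hp' : IsNilpotent (p : S) := by simpa using hp.map (algebraMap R S)
  obtain ⟨T, _, _, _, _, L, _, _, _, _, t, l, m, hb, hm, ht, hl⟩ := ho.exists_decomposition hp hD
  let t' : T →ₛₗ[CalW.map p n (algebraMap R S)] D.obj.P := o.mapP ∘ₛₗ t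
  have ht' : ∀ x, D.fst.mapP (t' x) = D.snd.mapP (t' x) := fun x => ho.fst_mapP _
  -- An arbitrary lift of L to Q comes first. It already yields a normal decomposition over S, as is
  -- required for lifting invariants along ι, although its values need not be invariant.
  obtain ⟨l₁, hl₁⟩ := exists_lift_semilinear' (o.mapP ∘ₛₗ l) (g := D.obj.iota)
    fun y => toCokerIota_eq_zero _ (hl y)
  have h₁ := ho.isNormal hp' hD hb hm ht (t' := t') (fun _ => rfl) hl₁
  -- Now every value can be corrected to an invariant one, and projectivity of L makes the choice
  -- linear over 𝒲_n(R).
  obtain ⟨l₂, hl₂⟩ := exists_lift_semilinear (o.mapP ∘ₛₗ l)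
    (g := semiComp (γ := CalW.map p n (algebraMap R S)) D.obj.iota o.mapQ fun _ => rfl) fun y => by
      obtain ⟨q, hq, hq'⟩ := exists_invariant_lift hp hD ht' h₁ (l₁ y) (by
        rw [hl₁]
        exact ho.fst_mapP _)
      obtain ⟨z, rfl⟩ := ho.exists_mapQ q hq
      exact ⟨z, hq'.trans (hl₁ y)⟩
  have hl₂' : ∀ y, D.obj.iota (o.mapQ (l₂ y)) = o.mapP (l y) := hl₂
  have h₂ := ho.isNormal hp' hD hb hm ht (t' := t') (fun _ => rfl) (l' := o.mapQ ∘ₛₗ l₂) hl₂'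
  refine ⟨T, inferInstance, inferInstance, inferInstance, inferInstance, L, inferInstance,
    inferInstance, inferInstance, inferInstance, t, l₂, ⟨?_, ?_⟩, h₂⟩
  · have : decP t l₂ = t.coprod l := by
      refine LinearMap.ext fun z => ho.injective_mapP ?_
      rw [LinearMap.coprod_apply, map_add, ← hl₂' z.2, o.iota_comm, ← map_add]
      rfl
    rw [this]
    exact hb
  -- The invariants of Q are an equalizer, which the normal decomposition over S computes as
  -- I_{n+1}(R) ⊗ T ⊕ L.
  · obtain ⟨h3, h4⟩ := h₂.equalizer hp hD D.fst ht' fun y => ho.fst_mapQ _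
    constructor
    · intro x y hxy
      refine h3 ?_
      rw [semiDecQ_hom, semiDecQ_hom, hxy]
    · intro y
      obtain ⟨z, hz⟩ := h4 _ (ho.fst_mapQ y)
      rw [semiDecQ_hom] at hz
      exact ⟨z, ho.injective_mapQ hz⟩

end DescentDatum.IsInvariants

end Decomposition

end
end TruncDisp

namespace TruncDisp


open TensorProduct CategoryTheory

noncomputable section

/-! ### The invariants of a descent datum -/

section Effective

variable {p : ℕ} [Fact p.Prime] {n : ℕ} {R S : Type u} [CommRing R] [CommRing S]

theorem BC.of_algebraMap_injective [Algebra R S] [Module.FaithfullyFlat R S] (M : Type u)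
    [AddCommGroup M] [Module R M] :
    Function.Injective (BC.of (algebraMap R S) : M → BC (algebraMap R S) M) := by
  have h := (isBC_iff_algebraMapLift _).1 (isBC_of (algebraMap R S) M)
  have h1 := h.1.comp (Module.FaithfullyFlat.tensorProduct_mk_injective (A := R) (B := S) M)
  intro x y hxy
  refine h1 ?_
  change algebraMapLift _ ((1 : S) ⊗ₜ[R] x) = algebraMapLift _ ((1 : S) ⊗ₜ[R] y)
  rw [algebraMapLift_tmul, algebraMapLift_tmul, hxy]

namespace Predisplay

variable {D E : Predisplay p n R} [NeZero n]

/-! ### The display axioms for cokernels from a normal decomposition -/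

section Coker

variable {T L : Type u} [AddCommGroup T] [Module (CalW p n R) T]
  [AddCommGroup L] [Module (CalW p n R) L] {t : T →ₗ[CalW p n R] D.P} {l : L →ₗ[CalW p n R] D.Q}

/-- Maps to an extension of scalars along `w_0` that have a left inverse. -/
theorem isBC_of_leftInverse {A B M N : Type*} [CommRing A] [CommRing B] {σ : A →+* B}
    [AddCommGroup M] [Module A M] [AddCommGroup N] [Module B N] {f : M →ₛₗ[σ] N}
    (hσ : Function.Surjective σ) (hf : Function.Surjective f) (g : N →ₗ[B] BC σ M)
    (hg : ∀ x, g (f x) = BC.of σ x) : IsBC f := by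
  constructor
  · intro x y hxy
    obtain ⟨x, rfl⟩ := BC.of_surjective hσ x
    obtain ⟨y, rfl⟩ := BC.of_surjective hσ y
    rw [BC.lift_of, BC.lift_of] at hxy
    rw [← hg, ← hg, hxy]
  · intro y
    obtain ⟨x, rfl⟩ := hf y
    exact ⟨BC.of σ x, BC.lift_of ..⟩

/-- The class of `κ(a) x` in the extension of scalars along `w_0` vanishes. -/
theorem of_kappa_smul {M : Type*} [AddCommGroup M] [Module (CalW p n R) M] (a : VIdeal p n R)
    (x : M) : BC.of (CalW.w0 p n R) (VIdeal.kappa p n R a • x) = 0 := by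
  rw [LinearMap.map_smulₛₗ, w0_kappa, zero_smul]

/-- ι maps I ⊗ T into κ(I)T and L into L. Hence coker ι = T/κ(I)T, the reduction of T along w_0. -/
theorem IsNormal.decP_symm_iota_decQ (h : IsNormal t l)
    (z : (VIdeal p n R ⊗[CalW p n R] T) × L) :
    BC.of (CalW.w0 p n R)
      ((LinearEquiv.ofBijective (decP t l) h.bijective_decP).symm (D.iota (decQ t l z))).1 = 0 := by
  obtain ⟨w, y⟩ := z
  rw [decQ_apply, map_add, map_add, Prod.fst_add, map_add]
  have h1 : (LinearEquiv.ofBijective (decP t l) h.bijective_decP).symm (D.iota (l y)) = (0, y) := by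
    rw [LinearEquiv.symm_apply_eq, LinearEquiv.ofBijective_apply, decP_apply, map_zero, zero_add]
  rw [h1, map_zero, add_zero]
  induction w using TensorProduct.induction_on with
  | zero => simp only [map_zero, Prod.fst_zero]
  | add x y hx hy => simp only [map_add, Prod.fst_add, hx, hy, add_zero]
  | tmul a x => rw [LinearMap.lTensor_tmul, D.iota_eps, map_smul, Prod.smul_fst, of_kappa_smul]

theorem IsNormal.isBC_toCokerIota (h : IsNormal t l) : IsBC (D.toCokerIota ∘ₛₗ t) := by
  let e := LinearEquiv.ofBijective (decP t l) h.bijective_decP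
  refine isBC_of_leftInverse (CalW.w0_surjective p n) (fun z => ?_)
    (cokerIotaLift (γ := CalW.w0 p n R) (fun _ => rfl)
      (BC.of (CalW.w0 p n R) ∘ₛₗ (LinearMap.fst (CalW p n R) T L ∘ₗ e.symm.toLinearMap))
      fun y => ?_) fun x => ?_
  · obtain ⟨x, rfl⟩ := D.toCokerIota_surjective z
    obtain ⟨⟨x, y⟩, rfl⟩ := h.bijective_decP.2 x
    exact ⟨x, by rw [decP_apply, map_add, toCokerIota_iota, add_zero, LinearMap.comp_apply]⟩
  · obtain ⟨z, rfl⟩ := h.bijective_decQ.2 y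
    exact h.decP_symm_iota_decQ z
  · rw [LinearMap.comp_apply, cokerIotaLift_apply]
    have h1 : e.symm (t x) = (x, 0) := by
      rw [LinearEquiv.symm_apply_eq, LinearEquiv.ofBijective_apply, decP_apply, map_zero, map_zero,
        add_zero]
    simp only [LinearMap.comp_apply, LinearEquiv.coe_coe, h1, LinearMap.fst_apply]

/-- From ε(a ⊗ (x + ι(y))) = a ⊗ x + κ(a) y, the image of ε is I ⊗ T ⊕ κ(I)L, so its cokernel is the
reduction of L. -/
theorem IsNormal.isBC_toCokerEps (h : IsNormal t l) : IsBC (D.toCokerEps ∘ₛₗ l) := by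
  let e := LinearEquiv.ofBijective (decQ t l) h.bijective_decQ
  refine isBC_of_leftInverse (CalW.w0_surjective p n) (fun z => ?_)
    (cokerEpsLift (γ := CalW.w0 p n R) (fun _ => rfl)
      (BC.of (CalW.w0 p n R) ∘ₛₗ (LinearMap.snd (CalW p n R) _ L ∘ₗ e.symm.toLinearMap))
      fun w => ?_) fun x => ?_
  · obtain ⟨x, rfl⟩ := D.toCokerEps_surjective z
    obtain ⟨⟨x, y⟩, rfl⟩ := h.bijective_decQ.2 x
    exact ⟨y, by rw [decQ_apply, map_add, toCokerEps_eps, zero_add, LinearMap.comp_apply]⟩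
  · simp only [LinearMap.comp_apply, LinearEquiv.coe_coe, LinearMap.snd_apply]
    induction w using TensorProduct.induction_on with
    | zero => simp only [map_zero, Prod.snd_zero]
    | add x y hx hy => simp only [map_add, Prod.snd_add, hx, hy, add_zero]
    | tmul a x =>
      obtain ⟨⟨x, y⟩, rfl⟩ := h.bijective_decP.2 x
      have h1 : D.eps (a ⊗ₜ decP t l (x, y)) = e (a ⊗ₜ x, VIdeal.kappa p n R a • y) := by
        rw [LinearEquiv.ofBijective_apply, decQ_apply, decP_apply, tmul_add, map_add, D.eps_iota,
          LinearMap.lTensor_tmul, map_smul]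
      rw [h1, LinearEquiv.symm_apply_apply, of_kappa_smul]
  · rw [LinearMap.comp_apply, cokerEpsLift_apply]
    have h1 : e.symm (l x) = (0, x) := by
      rw [LinearEquiv.symm_apply_eq, LinearEquiv.ofBijective_apply, decQ_apply, map_zero, map_zero,
        zero_add]
    simp only [LinearMap.comp_apply, LinearEquiv.coe_coe, h1, LinearMap.snd_apply]

omit [NeZero n] in
-- Modulo Im ε the element comes from L. Projecting P to L shows that it lies in κ(I)L, and κ(a) x =
-- ε(a ⊗ ι(x)).
theorem IsNormal.mem_range_eps (h : IsNormal t l) {y : D.Q}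
    (hy : D.iota y ∈ VIdeal.kappaIdeal p n R • (⊤ : Submodule (CalW p n R) D.P)) :
    y ∈ LinearMap.range D.eps := by
  obtain ⟨w, x, rfl⟩ := h.exists_eps_add y
  refine add_mem ⟨w, rfl⟩ ?_
  let e := LinearEquiv.ofBijective (decP t l) h.bijective_decP
  have h1 : D.iota (D.eps w) ∈ VIdeal.kappaIdeal p n R • (⊤ : Submodule (CalW p n R) D.P) := by
    clear hy
    induction w using TensorProduct.induction_on with
    | zero => simp only [map_zero, zero_mem]
    | add x y hx hy => rw [map_add, map_add]; exact add_mem hx hy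
    | tmul a x =>
      rw [D.iota_eps]
      exact Submodule.smul_mem_smul ⟨a, rfl⟩ trivial
  rw [map_add, Submodule.add_mem_iff_right _ h1] at hy
  have h2 := Submodule.mem_map_of_mem (f := LinearMap.snd (CalW p n R) T L ∘ₗ e.symm.toLinearMap) hy
  rw [Submodule.map_smul''] at h2
  have h3 : e.symm (D.iota (l x)) = (0, x) := by
    rw [LinearEquiv.symm_apply_eq, LinearEquiv.ofBijective_apply, decP_apply, map_zero, zero_add]
  rw [LinearMap.comp_apply, LinearEquiv.coe_coe, h3, LinearMap.snd_apply] at h2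
  have h4 := Submodule.mem_map_of_mem (f := l) (Submodule.smul_mono le_rfl le_top h2)
  rw [Submodule.map_smul''] at h4
  have h5 : VIdeal.kappaIdeal p n R • Submodule.map l ⊤ ≤ LinearMap.range D.eps := by
    rw [Submodule.smul_le]
    rintro _ ⟨a, rfl⟩ _ ⟨x, -, rfl⟩
    exact ⟨a ⊗ₜ D.iota (l x), D.eps_iota a (l x)⟩
  exact h5 h4

end Coker

omit [NeZero n] in
theorem hom_decQ_apply (f : D ⟶ E) {T L : Type u} [AddCommGroup T] [Module (CalW p n R) T]
    [AddCommGroup L] [Module (CalW p n R) L] {t : T →ₗ[CalW p n R] D.P}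
    {l : L →ₗ[CalW p n R] D.Q} {t' : T →ₗ[CalW p n R] E.P} {l' : L →ₗ[CalW p n R] E.Q}
    (ht : ∀ x, f.mapP (t x) = t' x) (hl : ∀ x, f.mapQ (l x) = l' x)
    (z : (VIdeal p n R ⊗[CalW p n R] T) × L) : f.mapQ (decQ t l z) = decQ t' l' z := by
  obtain ⟨w, y⟩ := z
  rw [decQ_apply, decQ_apply, map_add, hl]
  congr 1
  induction w using TensorProduct.induction_on with
  | zero => simp only [map_zero]
  | add x y hx hy => simp only [map_add, hx, hy]
  | tmul a x =>
    rw [LinearMap.lTensor_tmul, LinearMap.lTensor_tmul, f.eps_comm, VIdeal.map_id, ht]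

omit [NeZero n] in
/-- Bijective homomorphisms are isomorphisms. -/
theorem isIso_of_bijective (f : D ⟶ E) (hP : Function.Bijective f.mapP)
    (hQ : Function.Bijective f.mapQ) : IsIso f := by
  have h1 : Function.Bijective (CalW.map p n (RingHom.id R)) :=
    ⟨fun x y h => by rwa [CalW.map_id, CalW.map_id] at h, fun x => ⟨x, CalW.map_id ..⟩⟩
  have h2 : Function.Bijective (W.map p n (RingHom.id R)) :=
    ⟨fun x y h => by rwa [W.map_id, W.map_id] at h, fun x => ⟨x, W.map_id ..⟩⟩
  have hW : Function.Injective (wMap (RingHom.id R) f.mapP) :=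
    ((IsBC.of_bijective h1 hP).wMap.bijective h2).1
  obtain ⟨g, hgP, hgQ⟩ := f.exists_factor hP.1 hQ.1 hW (HomOver.id E) (fun x => hP.2 x)
    fun y => hQ.2 y
  exact ⟨g, hom_ext (fun x => hP.1 (hgP _)) fun y => hQ.1 (hgQ _), hom_ext hgP hgQ⟩

end Predisplay

namespace DescentDatum

variable [Algebra R S]

theorem isIso_of_hom {D E : DescentDatum p n R S} (f : D ⟶ E) [IsIso f.hom] : IsIso f := by
  have h : ∀ φ : S →+* S ⊗[R] S, Predisplay.baseChangeMap φ (inv f.hom) ≫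
      Predisplay.baseChangeMap φ f.hom = 𝟙 _ := fun φ => by
    rw [← Predisplay.baseChangeMap_comp, IsIso.inv_hom_id, Predisplay.baseChangeMap_id]
  have h' : ∀ φ : S →+* S ⊗[R] S, Predisplay.baseChangeMap φ f.hom ≫
      Predisplay.baseChangeMap φ (inv f.hom) = 𝟙 _ := fun φ => by
    rw [← Predisplay.baseChangeMap_comp, IsIso.hom_inv_id, Predisplay.baseChangeMap_id]
  refine ⟨⟨inv f.hom, ?_⟩, Hom.ext (IsIso.hom_inv_id f.hom), Hom.ext (IsIso.inv_hom_id f.hom)⟩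
  rw [← Category.comp_id D.iso.hom, ← h', ← Category.assoc D.iso.hom, ← f.comm, Category.assoc,
    ← Category.assoc, h, Category.id_comp]

variable [Module.FaithfullyFlat R S] [NeZero n]

open Predisplay

namespace IsInvariants

variable {D : DescentDatum p n R S} {D₀ : Predisplay p n R}
  {o : HomOver (algebraMap R S) D₀ D.obj} {T L : Type u} [AddCommGroup T] [Module (CalW p n R) T]
  [AddCommGroup L] [Module (CalW p n R) L] {t : T →ₗ[CalW p n R] D₀.P} {l : L →ₗ[CalW p n R] D₀.Q}

/-- The quotient of W_n(R) ⊗ P₀ by the span vanishes if its reduction along w_0 does, by nilpotency,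
and this may be tested after R → S. There the quotient map extends to W_n(S) ⊗ P and kills Ḟ(Q),
which generates. -/
theorem span_Fdot (ho : D.IsInvariants o) (hp : IsNilpotent (p : R))
    (hD : D.obj.IsTruncatedDisplay)
    (h : IsNormal (linExt (o.mapP ∘ₛₗ t)) (linExt (o.mapQ ∘ₛₗ l))) :
    Submodule.span (W p n R) (Set.range D₀.Fdot) = ⊤ := by
  let U := Submodule.span (W p n R) (Set.range D₀.Fdot)
  let c : BC (CalW.res p n R) D₀.P →ₛₗ[W.w0 p n R] BC (W.w0 p n R) (_ ⧸ U) :=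
    BC.of (W.w0 p n R) ∘ₛₗ U.mkQ
  have hc : ∀ z ∈ U, c z = 0 := fun z hz => by
    change BC.of (W.w0 p n R) (U.mkQ z) = 0
    rw [Submodule.mkQ_apply, (Submodule.Quotient.mk_eq_zero U).2 hz, map_zero]
  let k := semiComp (γ := (algebraMap R S).comp (W.w0 p n R)) (BC.of (algebraMap R S)) c
    fun _ => rfl
  let g := ho.isBC.wMap.lift (W.w0 p n S) (fun a => by
    obtain ⟨a, rfl⟩ := W.exists_trunc p n a
    change algebraMap R S (W.w0 p n R _) = _
    rw [W.map_trunc, W.w0_trunc, W.w0_trunc, WittVector.map_coeff]) k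
  have hg : ∀ z, g (wMap (algebraMap R S) o.mapP z) = BC.of _ (c z) := fun z =>
    IsBC.lift_apply ..
  have hg0 : ∀ z ∈ U, g (wMap (algebraMap R S) o.mapP z) = 0 := fun z hz => by
    rw [hg, hc z hz, map_zero]
  -- F(x) = Ḟ(ε(V(1) ⊗ x)) puts the values of F over R in the span of Ḟ; semilinearity extends the
  -- vanishing to all of P over S.
  have hF : ∀ x, g (D.obj.F x) = 0 := fun x => by
    induction x using ho.isBC.induction with
    | of x =>
      rw [o.F_comm]
      refine hg0 _ ?_
      have h1 := D₀.Fdot_eps ((VIdeal.verInv p n R).symm 1) x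
      rw [AddEquiv.apply_symm_apply, one_smul] at h1
      rw [← h1]
      exact Submodule.subset_span ⟨_, rfl⟩
    | add x y hx hy => rw [map_add, map_add, hx, hy, add_zero]
    | smul a x hx => rw [LinearMap.map_smulₛₗ, LinearMap.map_smulₛₗ, hx, smul_zero]
  -- Q over S is generated by the image of ε, where Ḟ is expressed by F, and by L, whose generators
  -- are invariants.
  have hFdot : ∀ y, g (D.obj.Fdot y) = 0 := fun y => by
    obtain ⟨w, x, rfl⟩ := h.exists_eps_add y
    rw [map_add, map_add]
    have h1 : g (D.obj.Fdot (D.obj.eps w)) = 0 := by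
      induction w using TensorProduct.induction_on with
      | zero => simp only [map_zero]
      | add x y hx hy => simp only [map_add, hx, hy, add_zero]
      | tmul a x => rw [D.obj.Fdot_eps, LinearMap.map_smulₛₗ, hF, smul_zero]
    rw [h1, zero_add]
    induction x using BC.induction with
    | zero => simp only [map_zero]
    | of x =>
      rw [linExt_of, LinearMap.comp_apply, o.Fdot_comm]
      exact hg0 _ (Submodule.subset_span ⟨_, rfl⟩)
    | add x y hx hy => simp only [map_add, hx, hy, add_zero]
    | smul a x hx => simp only [LinearMap.map_smulₛₗ, hx, smul_zero]
  have hg' : ∀ z, g z = 0 := fun z => by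
    have hz : z ∈ Submodule.span (W p n S) (Set.range D.obj.Fdot) := hD.span_Fdot ▸ trivial
    induction hz using Submodule.span_induction with
    | mem z hz =>
      obtain ⟨y, rfl⟩ := hz
      exact hFdot y
    | zero => exact map_zero g
    | add x y _ _ hx hy => rw [map_add, hx, hy, add_zero]
    | smul a x _ hx => rw [LinearMap.map_smulₛₗ, hx, smul_zero]
  have hw : Function.Surjective (W.w0 p n R) := fun r => by
    obtain ⟨a, rfl⟩ := CalW.w0_surjective p n r
    exact ⟨CalW.res p n R a, rfl⟩
  have hq : ∀ z : _ ⧸ U, BC.of (W.w0 p n R) z = 0 := fun z => by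
    obtain ⟨z, rfl⟩ := U.mkQ_surjective z
    refine BC.of_algebraMap_injective (R := R) (S := S) _ ?_
    rw [map_zero]
    exact (hg z).symm.trans (hg' _)
  have hzero : (⊤ : Submodule (W p n R) (_ ⧸ U)) ≤
      RingHom.ker (W.w0 p n R) • (⊤ : Submodule (W p n R) (_ ⧸ U)) := fun z _ =>
    (isBC_of (W.w0 p n R) (_ ⧸ U)).mem_ker_smul hw (hq z)
  have hbot := eq_top_of_sup_smul_eq_top (W.isNilpotent_ker_w0 (n := n) hp) (U := ⊥)
    (hzero.trans le_sup_right)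
  refine eq_top_iff.2 fun z _ => (Submodule.Quotient.mk_eq_zero U).1 ?_
  have h1 : (Submodule.Quotient.mk z : _ ⧸ U) ∈ (⊤ : Submodule (W p n R) _) := trivial
  rw [← hbot] at h1
  exact (Submodule.mem_bot _).1 h1

/-- The predisplay of invariants is a truncated display. -/
theorem isTruncatedDisplay (ho : D.IsInvariants o) (hp : IsNilpotent (p : R))
    (hD : D.obj.IsTruncatedDisplay) : D₀.IsTruncatedDisplay := by
  obtain ⟨T, _, _, _, _, L, _, _, _, _, t, l, h, h'⟩ := ho.exists_isNormal hp hD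
  exact
    { finite := ho.finite
      projective := ho.projective
      finite_coker_iota := h.isBC_toCokerIota.finite
      projective_coker_iota := h.isBC_toCokerIota.projective
      finite_coker_eps := h.isBC_toCokerEps.finite
      projective_coker_eps := h.isBC_toCokerEps.projective
      span_Fdot := ho.span_Fdot hp hD h'
      mem_range_eps := fun _ => h.mem_range_eps }

/-- The homomorphism from the base change of the invariants. -/
def fromBaseChange (o : HomOver (algebraMap R S) D₀ D.obj) :
    D₀.baseChange (algebraMap R S) ⟶ D.obj :=
  desc (algebraMap R S) (RingHom.id_comp _) o

/-- On P this is the descent of modules. On Q, the map I ⊗ T_S ⊕ L_S → Q_{0,S} is surjective and its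
composite to Q is the bijection of the normal decomposition over S, so both are bijective. -/
theorem isIso_fromBaseChange (ho : D.IsInvariants o) (hp : IsNilpotent (p : R))
    (hD : D.obj.IsTruncatedDisplay) : IsIso (fromBaseChange o) := by
  obtain ⟨T, _, _, _, _, L, _, _, _, _, t, l, h, h'⟩ := ho.exists_isNormal hp hD
  have hP : ∀ x, (fromBaseChange o).mapP ((D₀.toBaseChange _).mapP x) = o.mapP x := fun x =>
    desc_mapP _ o x
  have hQ : ∀ y, (fromBaseChange o).mapQ ((D₀.toBaseChange _).mapQ y) = o.mapQ y := fun y =>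
    desc_mapQ _ o y
  have hid : Function.Bijective (CalW.map p n (RingHom.id S)) :=
    ⟨fun x y h => by rwa [CalW.map_id, CalW.map_id] at h, fun x => ⟨x, CalW.map_id ..⟩⟩
  refine isIso_of_bijective _ (IsBC.bijective ?_ hid) ?_
  · exact (isBC_of (CalW.map p n (algebraMap R S)) D₀.P).of_comp ho.isBC
      (fun a => (CalW.map_id p n _).symm) fun x => (hP x).symm
  · have hs : Function.Surjective (decQ (bcT (algebraMap R S) t) (bcL (algebraMap R S) l)) :=
      decQ_surjective (decP_bijective_baseChange (algebraMap R S) h.bijective_decP).2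
        (exists_eps_add_baseChange (algebraMap R S) h.exists_eps_add)
    have hcomp : ∀ z, (fromBaseChange o).mapQ
        (decQ (bcT (algebraMap R S) t) (bcL (algebraMap R S) l) z) =
          decQ (linExt (o.mapP ∘ₛₗ t)) (linExt (o.mapQ ∘ₛₗ l)) z :=
      hom_decQ_apply _ (fun z => by
        induction z using BC.induction with
        | zero => simp only [map_zero]
        | of x => rw [bcT_of, hP, linExt_of, LinearMap.comp_apply]
        | add x y hx hy => simp only [map_add, hx, hy]
        | smul a x hx => rw [map_smul, LinearMap.map_smulₛₗ, CalW.map_id, hx, map_smul]) fun z => by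
        induction z using BC.induction with
        | zero => simp only [map_zero]
        | of x => rw [bcL_of, hQ, linExt_of, LinearMap.comp_apply]
        | add x y hx hy => simp only [map_add, hx, hy]
        | smul a x hx => rw [map_smul, LinearMap.map_smulₛₗ, CalW.map_id, hx, map_smul]
    constructor
    · intro x y hxy
      obtain ⟨x, rfl⟩ := hs x
      obtain ⟨y, rfl⟩ := hs y
      rw [hcomp, hcomp] at hxy
      rw [h'.bijective_decQ.1 hxy]
    · intro y
      obtain ⟨z, rfl⟩ := h'.bijective_decQ.2 y
      exact ⟨_, hcomp z⟩

omit [Module.FaithfullyFlat R S] [NeZero n] in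
theorem fromBaseChange_comm (ho : D.IsInvariants o) :
    baseChangeMap (p₁ R S : S →+* S ⊗[R] S) (fromBaseChange o) ≫ D.iso.hom =
      canonicalHom (algHom_comp_algebraMap (p₁ R S)) (algHom_comp_algebraMap (p₂ R S)) D₀ ≫
        baseChangeMap (p₂ R S : S →+* S ⊗[R] S) (fromBaseChange o) := by
  refine baseChange_baseChange_ext (fun x => ?_) (fun y => ?_)
  · rw [comp_mapP, comp_mapP, baseChangeMap_mapP, canonicalHom_mapP, baseChangeMap_mapP,
      fromBaseChange, desc_mapP]
    exact ho.fst_mapP x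
  · rw [comp_mapQ, comp_mapQ, baseChangeMap_mapQ, canonicalHom_mapQ, baseChangeMap_mapQ,
      fromBaseChange, desc_mapQ]
    exact ho.fst_mapQ y

end IsInvariants

/-- Every descent datum on a truncated display is effective. -/
theorem exists_iso (D : DescentDatum p n R S) (hp : IsNilpotent (p : R))
    (hD : D.obj.IsTruncatedDisplay) :
    ∃ D₀ : Predisplay p n R, D₀.IsTruncatedDisplay ∧
      Nonempty ((baseChangeFunctor p n R S).obj D₀ ≅ D) := by
  obtain ⟨D₀, o, ho⟩ := D.exists_isInvariants hp hD
  let f : (baseChangeFunctor p n R S).obj D₀ ⟶ D :=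
    ⟨IsInvariants.fromBaseChange o, ho.fromBaseChange_comm⟩
  have : IsIso f.hom := ho.isIso_fromBaseChange hp hD
  have := isIso_of_hom f
  exact ⟨D₀, ho.isTruncatedDisplay hp hD, ⟨asIso f⟩⟩

end DescentDatum

variable [Algebra R S] [Module.FaithfullyFlat R S] [NeZero n]

/-- Base change is an equivalence onto the truncated displays with a descent datum. -/
theorem TruncatedDisplay.isEquivalence_baseChangeFunctor (hp : IsNilpotent (p : R)) :
    (TruncatedDisplay.baseChangeFunctor p n R S).IsEquivalence where
  faithful := ⟨fun {D E f g} h => ObjectProperty.hom_ext _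
    (E.property.baseChangeMap_injective (S := S) hp (congrArg (fun k => k.hom.hom) h))⟩
  full := ⟨fun {D E} f => by
    obtain ⟨g, hg⟩ := E.property.exists_baseChangeMap_eq hp f.hom.hom f.hom.comm
    exact ⟨ObjectProperty.homMk g, ObjectProperty.hom_ext _ (DescentDatum.Hom.ext hg)⟩⟩
  essSurj := ⟨fun D => by
    obtain ⟨D₀, h₀, ⟨e⟩⟩ := D.obj.exists_iso hp D.property
    exact ⟨⟨D₀, h₀⟩, ⟨ObjectProperty.isoMk _ e⟩⟩⟩

end Effective

end
end TruncDisp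

theorem mainTheorem11 (p : ℕ) [Fact p.Prime] (n : ℕ) [NeZero n] (R S : Type u) [CommRing R]
    [CommRing S] [Algebra R S] [Module.FaithfullyFlat R S] (hp : IsNilpotent (p : R)) :
    -- the Čech complex of `𝒲_n` is acyclic
    (Function.Injective
        (TruncDisp.CalW.map p n (algebraMap R (TruncDisp.TensorPower R S 1))) ∧
      Function.Exact (TruncDisp.CalW.map p n (algebraMap R (TruncDisp.TensorPower R S 1)))
        (TruncDisp.cechD R S p n 1) ∧
      ∀ k : ℕ, Function.Exact (TruncDisp.cechD R S p n (k + 1))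
        (TruncDisp.cechD R S p n (k + 2))) ∧
    -- descent for finitely generated projective `𝒲_n`-modules is effective
    (∀ (P : Type u) [AddCommGroup P] [Module (TruncDisp.CalW p n S) P]
        [Module.Finite (TruncDisp.CalW p n S) P] [Module.Projective (TruncDisp.CalW p n S) P]
        (D : TruncDisp.ModuleDescentDatum p n R S P),
      (∀ k : ℕ, Function.Exact (D.d k) (D.d (k + 1))) ∧
      Module.Finite (TruncDisp.CalW p n R) D.invariants ∧
      Module.Projective (TruncDisp.CalW p n R) D.invariants ∧
      Function.Bijective D.fromInvariants) ∧
    -- base change is an equivalence onto truncated displays with a descent datum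
    (TruncDisp.TruncatedDisplay.baseChangeFunctor p n R S).IsEquivalence :=
  ⟨⟨TruncDisp.cech_injective R S p n, TruncDisp.cech_exact_zero R S p n,
      TruncDisp.cech_exact R S p n⟩,
    fun _ _ _ _ _ D => ⟨D.d_exact, D.descent hp⟩,
    TruncDisp.TruncatedDisplay.isEquivalence_baseChangeFunctor hp⟩
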